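/- **Setting.** Let $M$ be a smooth (Hausdorff, second countable) manifold of dimension $2m+1$ with a contact metric structure $(\phi,\xi,\lambda,g)$: $g$ is a Riemannian metric, $\lambda(\xi)=1$, $\lambda=g(\cdot,\xi)$, $\omega:=d\lambda=g(\cdot,\phi\,\cdot)$ (where $d\lambda(X,Y)=X\lambda(Y)-Y\lambda(X)-\lambda([X,Y])$), $g(\phi X,\phi Y)=g(X,Y)-\lambda(X)\lambda(Y)$, $\phi^2=-I+\xi\otimes\lambda$, $\phi\xi=0$, $\lambda\circ\phi=0$. Let $\nabla$ be a contact metric connection, i.e. a smooth affine connection with $\nabla\lambda=0$, $\nabla\xi=0$, $\nabla\omega=0$, $\nabla g=0$, $\nabla\phi=0$; write $\nabla_{\partial_i}\partial_j=\Gamma^k_{ji}\partial_k$, $T^n_{ij}=\Gamma^n_{ij}-\Gamma^n_{ji}$, $(\nabla_{\partial_k}\nabla_{\partial_l}-\nabla_{\partial_l}\nabla_{\partial_k})\partial_j=R^i_{jkl}\partial_i$. Put $P^i_j=\delta^i_j-\xi^i\lambda_j$, $\pi^{ij}=g^{ik}\phi^j_k$ and $h^{ij}=g^{ij}+\sqrt{-1}\,\pi^{ij}$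 (the Wick tensor). Let $\mathcal W$ be the space of smooth sections of the bundle whose fibre at $x$ consists of formal power series $a(\nu,y)$ in $\nu$ and $y\in T_xM$ with complex coefficients, with the product $$(a\circ b)(y)=\exp\Big(\frac{\nu}{2}h^{ij}\frac{\partial^2}{\partial y^i\partial z^j}\Big)a(y)b(z)\Big|_{z=y}.$$ Let $\mathcal W^\xi=\{a\in\mathcal W:\ \xi^i\partial a/\partial y^i=0\}$, let $\Lambda_n$ be the differential $n$-forms, $[\cdot,\cdot]$ the graded commutator of $\circ$ on $\mathcal W\otimes\Lambda$, and $F^k$ the filtration in which $y$ has degree $1$ and $\nu$ has degree $2$. Put $$\delta=dx^i\wedge\frac{\partial}{\partial y^i},\qquad \delta^*=y^iP_i^j\,i_{\partial_j},\qquad d_\nabla a=dx^i\wedge\Big(\frac{\partial a}{\partial x^i}-y^j\Gamma^k_{ji}\frac{\partial a}{\partial y^k}\Big).$$ For an $n$-form $a$ of degree $p$ in $y$, let $\delta^{-1}a=\frac{1}{p+n}\delta^*a$ if $i_\xi a=0$ (and $0$ if $p+n=0$), and $\delta^{-1}a=\frac1{p+n-1}\delta^*a$ if $a\in\lambda\wedge(\mathcal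 W^\xi\otimes\Lambda)$ (and $0$ if $p+n=1$), extended linearly. Let $\Pi a=a|_{y=0}$ for $a\in\mathcal W^\xi$ and $\Pi b=\lambda\,(i_\xi b)|_{y=0}$ for $b\in\mathcal W^\xi\otimes\Lambda_1$. For $r\in F^2\,\mathcal W^\xi\otimes\Lambda_1$ put $Da=d_\nabla a-\delta a+\frac i\nu[r,a]$. The connection $D$ is *abelian* if $D^2=0$. Let $\mathcal W_D=\{a\in\mathcal W^\xi: Da=0\}$ be the space of flat sections. The Weyl curvature is $\Omega=\omega-\delta r+T+R+d_\nabla r+\frac i\nu r\circ r$, where $T=\frac12\omega_{kn}T^n_{ij}\,y^k dx^i\wedge dx^j$ and $R=\frac14\omega_{ni}R^n_{jkl}\,y^iy^jdx^k\wedge dx^l$ (so that $d_\nabla^2 a=\frac i\nu[R,a]$ on $\mathcal W^\xi$). **Theorem.** There is exactly one abelian connection $D$ of this form with $\Omega=\omega$, $\delta^{-1}r=0$ and $\Pi r=0$. For this $D$, and more generally for every abelian connection $D$ of the above form, the following holds. 1. For every $a\in\mathcal W^\xi$ the equation $b=a+\delta^{-1}(D+\delta)b$ has exactly one solution $b\in\mathcal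 W^\xi$. For $a\in C^\infty_{\mathbb C}(M)[[\nu]]$ denote it by $Qa$, and put $\Delta a=i_\xi\Pi DQa$ and $a*b=\Pi(Qa\circ Qb)$ for $a,b\in C^\infty_{\mathbb C}(M)[[\nu]]$. 2. Every $a\in\mathcal W_D$ satisfies $\Pi a\in C^\infty_{\mathbb C}(M)[[\nu]]$ and $a=Q\Pi a$. 3. An element $a_0\in C^\infty_{\mathbb C}(M)[[\nu]]$ is the projection $\Pi a$ of some $a\in\mathcal W_D$ if and only if $\Delta a_0=0$. 4. $Q$ is $\mathbb C[[\nu]]$-linear and restricts to a bijection $\ker\Delta\to\mathcal W_D$. The space $\mathcal W_D$ is closed under $\circ$, and $Q(a*b)=Qa\circ Qb$ for $a,b\in\ker\Delta$. Moreover $1\in\ker\Delta$ and $1*a=a*1=a$ for $a\in\ker\Delta$. 5. $(*,\Delta)$ is a Wick deformation quantization of $M$. That is, $$a*b=ab+\frac\nu2\,h\big(da-(\xi a)\lambda,\ db-(\xi b)\lambda\big)+\sum_{k\ge2}\nu^kC_k(a,b),\qquad \Delta a=\xi a+\sum_{k\ge1}\nu^k\Delta_ka,$$ where $h(\alpha,\beta)=h^{ij}\alpha_i\beta_j$,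 the $C_k$ are bidifferential and the $\Delta_k$ differential operators on $C^\infty_{\mathbb C}(M)$, extended $\mathbb C[[\nu]]$-(bi)linearly to $C^\infty_{\mathbb C}(M)[[\nu]]$; and if $\Delta a=\Delta b=\Delta c=0$, then $\Delta(a*b)=0$ and $(a*b)*c=a*(b*c)$. 6. For $a,b\in\ker\Delta$ with $\nu^0$-coefficients $a_0,b_0$, the coefficient of $\nu$ in $a*b-ab$ is $\frac12h(da_0,db_0)$. -/

import Mathlib

open scoped Manifold ContDiff Topology
open Bundle

noncomputable section

namespace WickContact

/-! ### Contact metric geometry -/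

/-- The model space `ℝ^(2m+1)`. -/
abbrev Model (m : ℕ) : Type := EuclideanSpace ℝ (Fin (2 * m + 1))

/-- The `i`-th standard basis vector of the model space. The tangent space `T_x M` is, as a type,
the model space, identified with it through the preferred chart at `x`; so at `x` this vector is
the coordinate vector `∂/∂x^i` of the preferred chart at `x`. -/
abbrev stdVec (m : ℕ) (i : Fin (2 * m + 1)) : Model m := EuclideanSpace.single i 1

/-- The `i`-th coordinate of a vector of the model space. -/
abbrev coord {m : ℕ} (v : Model m) (i : Fin (2 * m + 1)) : ℝ := v i

section Geometry

variable (m : ℕ) (M : Type*) [TopologicalSpace M] [ChartedSpace (Model m) M]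

/-- Vector fields, not necessarily smooth. -/
abbrev VField : Type _ := (x : M) → TangentSpace 𝓘(ℝ, Model m) x

variable {m M}

/-- Smoothness of a vector field. -/
def SmoothVF [IsManifold 𝓘(ℝ, Model m) ∞ M] (X : VField m M) : Prop :=
  ContMDiff 𝓘(ℝ, Model m) (𝓘(ℝ, Model m).prod 𝓘(ℝ, Model m)) ∞
    (fun x => (⟨x, X x⟩ : TangentBundle 𝓘(ℝ, Model m) M))

/-- Smoothness of a real function. -/
def SmoothReal (f : M → ℝ) : Prop := ContMDiff 𝓘(ℝ, Model m) 𝓘(ℝ, ℝ) ∞ f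

/-- The derivative `v f` of a real function along a tangent vector. -/
def dirDeriv (f : M → ℝ) (x : M) (v : TangentSpace 𝓘(ℝ, Model m) x) : ℝ :=
  mfderiv 𝓘(ℝ, Model m) 𝓘(ℝ, ℝ) f x v

variable (m M)

/-- A contact metric structure `(φ, ξ, λ, g)` on a manifold of dimension `2m+1`. The `2`-form
`ω = dλ` enters through `dλ(X, Y) = X λ(Y) - Y λ(X) - λ([X, Y])`. The algebraic relations make
`ω = g(·, φ ·)` nondegenerate on `ker λ`, so that `λ ∧ (dλ)^m` vanishes nowhere. -/
structure ContactMetricStructure [IsManifold 𝓘(ℝ, Model m) ∞ M] where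
  /-- the associated Riemannian metric -/
  g : ContMDiffRiemannianMetric 𝓘(ℝ, Model m) ∞ (Model m)
    (TangentSpace 𝓘(ℝ, Model m) : M → Type _)
  /-- the Reeb vector field -/
  ξ : VField m M
  /-- the contact form -/
  lam : (x : M) → TangentSpace 𝓘(ℝ, Model m) x →L[ℝ] ℝ
  /-- the endomorphism of the tangent bundle -/
  φ : (x : M) → TangentSpace 𝓘(ℝ, Model m) x →L[ℝ] TangentSpace 𝓘(ℝ, Model m) x
  smooth_ξ : SmoothVF ξ
  smooth_lam : ∀ X : VField m M, SmoothVF X → SmoothReal (m := m) (fun x => lam x (X x))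
  smooth_φ : ∀ X : VField m M, SmoothVF X → SmoothVF (fun x => φ x (X x))
  lam_ξ : ∀ x, lam x (ξ x) = 1
  lam_eq : ∀ x v, lam x v = g.inner x v (ξ x)
  dlam_eq : ∀ X Y : VField m M, SmoothVF X → SmoothVF Y → ∀ x,
    dirDeriv (fun z => lam z (Y z)) x (X x) - dirDeriv (fun z => lam z (X z)) x (Y x)
      - lam x (VectorField.mlieBracket 𝓘(ℝ, Model m) X Y x) = g.inner x (X x) (φ x (Y x))
  g_φ_φ : ∀ x v w, g.inner x (φ x v) (φ x w) = g.inner x v w - lam x v * lam x w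
  φ_φ : ∀ x v, φ x (φ x v) = - v + lam x v • ξ x
  φ_ξ : ∀ x, φ x (ξ x) = 0
  lam_φ : ∀ x v, lam x (φ x v) = 0

variable {m M}

/-- Affine connections on `M`. `cov Y x v` is `(∇_v Y)(x)`. -/
abbrev AffineConnection (m : ℕ) (M : Type*) [TopologicalSpace M] [ChartedSpace (Model m) M]
    [IsManifold 𝓘(ℝ, Model m) ∞ M] : Type _ :=
  CovariantDerivative 𝓘(ℝ, Model m) (Model m) (TangentSpace 𝓘(ℝ, Model m) : M → Type _)

variable [IsManifold 𝓘(ℝ, Model m) ∞ M]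

/-- The presymplectic form `ω = dλ`. -/
def ContactMetricStructure.om (S : ContactMetricStructure m M) (x : M)
    (v w : TangentSpace 𝓘(ℝ, Model m) x) : ℝ := S.g.inner x v (S.φ x w)

/-- A contact metric connection: a smooth affine connection with
`∇λ = 0`, `∇ξ = 0`, `∇ω = 0`, `∇g = 0`, `∇φ = 0`. -/
structure IsContactMetricConnection (S : ContactMetricStructure m M)
    (cov : AffineConnection m M) : Prop where
  smooth : CovariantDerivative.ContMDiffCovariantDerivative cov ∞
  lam_parallel : ∀ X : VField m M, SmoothVF X → ∀ x v,
    dirDeriv (fun z => S.lam z (X z)) x v = S.lam x (cov X x v)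
  ξ_parallel : ∀ x v, cov S.ξ x v = 0
  om_parallel : ∀ X Y : VField m M, SmoothVF X → SmoothVF Y → ∀ x v,
    dirDeriv (fun z => S.om z (X z) (Y z)) x v
      = S.om x (cov X x v) (Y x) + S.om x (X x) (cov Y x v)
  g_parallel : ∀ X Y : VField m M, SmoothVF X → SmoothVF Y → ∀ x v,
    dirDeriv (fun z => S.g.inner z (X z) (Y z)) x v
      = S.g.inner x (cov X x v) (Y x) + S.g.inner x (X x) (cov Y x v)
  φ_parallel : ∀ X : VField m M, SmoothVF X → ∀ x v,
    cov (fun z => S.φ z (X z)) x v = S.φ x (cov X x v)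

/-! Components at `x` with respect to the coordinate frame of the preferred chart at `x`. -/

/-- The coordinate vector `∂/∂x^i` at `x`. -/
def frame (x : M) (i : Fin (2 * m + 1)) : TangentSpace 𝓘(ℝ, Model m) x := stdVec m i

/-- The `i`-th component of a tangent vector at `x`. -/
def comp (x : M) (v : TangentSpace 𝓘(ℝ, Model m) x) (i : Fin (2 * m + 1)) : ℝ := coord (m := m) v i

/-- The Jacobian at `x` from the coordinates of the preferred chart at `x₀` to those of the
preferred chart at `x`. -/
def jac (x₀ x : M) : Model m →L[ℝ] Model m := tangentCoordChange 𝓘(ℝ, Model m) x₀ x x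

/-- The coordinate vector field `∂/∂x^i` of the preferred chart at `x`; it is meaningful on the
domain of that chart. -/
def coordField (x : M) (i : Fin (2 * m + 1)) : VField m M := fun z => jac x z (stdVec m i)

/-- The connection coefficients: `∇_{∂_i} ∂_j = Γ^k_{ji} ∂_k`. -/
def christoffel (cov : AffineConnection m M) (x : M) (k j i : Fin (2 * m + 1)) : ℝ :=
  comp x (cov (coordField x j) x (frame x i)) k

/-- The torsion `T^n_{ij} = Γ^n_{ij} - Γ^n_{ji}`, that is, `T(∂_j, ∂_i) = T^n_{ij} ∂_n` for
`T(X, Y) = ∇_X Y - ∇_Y X - [X, Y]`. -/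
def torsionComp (cov : AffineConnection m M) (x : M) (n i j : Fin (2 * m + 1)) : ℝ :=
  comp x (cov (coordField x i) x (frame x j) - cov (coordField x j) x (frame x i)
    - VectorField.mlieBracket 𝓘(ℝ, Model m) (coordField x j) (coordField x i) x) n

/-- The curvature: `(∇_k ∇_l - ∇_l ∇_k) ∂_j = R^i_{jkl} ∂_i`. -/
def curvatureComp (cov : AffineConnection m M) (x : M) (i j k l : Fin (2 * m + 1)) : ℝ :=
  comp x (cov (fun z => cov (coordField x j) z (coordField x l z)) x (frame x k)
    - cov (fun z => cov (coordField x j) z (coordField x k z)) x (frame x l)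
    - cov (coordField x j) x
        (VectorField.mlieBracket 𝓘(ℝ, Model m) (coordField x k) (coordField x l) x)) i

namespace ContactMetricStructure

variable (S : ContactMetricStructure m M)

/-- `λ_i` -/
def lamComp (x : M) (i : Fin (2 * m + 1)) : ℝ := S.lam x (frame x i)

/-- `ξ^i` -/
def ξComp (x : M) (i : Fin (2 * m + 1)) : ℝ := comp x (S.ξ x) i

/-- `ω_{ij}` -/
def omComp (x : M) (i j : Fin (2 * m + 1)) : ℝ := S.om x (frame x i) (frame x j)

/-- `P^i_j = δ^i_j - ξ^i λ_j` -/
def projComp (x : M) (i j : Fin (2 * m + 1)) : ℝ :=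
  (if i = j then 1 else 0) - S.ξComp x i * S.lamComp x j

/-- The inverse metric `g^{ij}`. -/
def invMetric (x : M) : Matrix (Fin (2 * m + 1)) (Fin (2 * m + 1)) ℝ :=
  (Matrix.of fun i j => S.g.inner x (frame x i) (frame x j))⁻¹

/-- The bivector `π^{ij} = g^{ik} φ^j_k` of the Jacobi structure, `π(α, β) = g⁻¹(α, φᵗ β)`. -/
def piComp (x : M) (i j : Fin (2 * m + 1)) : ℝ :=
  ∑ k, S.invMetric x i k * comp x (S.φ x (frame x k)) j

/-- The Wick tensor `h^{ij} = g^{ij} + √-1 π^{ij}`. -/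
def wickTensor (x : M) (i j : Fin (2 * m + 1)) : ℂ :=
  (S.invMetric x i j : ℂ) + Complex.I * (S.piComp x i j : ℂ)

/-- `h(α, β)` for complex-valued covectors. -/
def hForm (x : M) (α β : TangentSpace 𝓘(ℝ, Model m) x →L[ℝ] ℂ) : ℂ :=
  ∑ i, ∑ j, S.wickTensor x i j * α (frame x i) * β (frame x j)

/-- The transverse part `α - α(ξ) λ ∈ C^*` of a complex-valued covector. -/
def transCov (x : M) (α : TangentSpace 𝓘(ℝ, Model m) x →L[ℝ] ℂ) :
    TangentSpace 𝓘(ℝ, Model m) x →L[ℝ] ℂ :=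
  α - (S.lam x).smulRight (α (S.ξ x))

end ContactMetricStructure

end Geometry

/-! ### Functions and formal functions -/

section Functions

variable (m : ℕ) (M : Type*) [TopologicalSpace M] [ChartedSpace (Model m) M]

/-- Smoothness of a complex-valued function. -/
def SmoothC {M : Type*} [TopologicalSpace M] [ChartedSpace (Model m) M] (f : M → ℂ) : Prop :=
  ContMDiff 𝓘(ℝ, Model m) 𝓘(ℝ, ℂ) ∞ f

/-- The algebra `C^∞_ℂ(M)` of smooth complex-valued functions. -/
def SmoothFun : Subalgebra ℂ (M → ℂ) where
  carrier := {f | SmoothC m f}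
  mul_mem' {f g} (hf : ContMDiff _ _ _ _) (hg : ContMDiff _ _ _ _) := by
    have h : ContMDiff 𝓘(ℝ, Model m) 𝓘(ℝ, ℂ) ∞ (fun x => f x * g x) := by
      have := (ContinuousLinearMap.mul ℝ ℂ).isBoundedBilinearMap.contDiff (n := ∞)
      exact (this.contMDiff).comp (hf.prodMk_space hg)
    exact h
  add_mem' {f g} (hf : ContMDiff _ _ _ _) (hg : ContMDiff _ _ _ _) := by
    exact ContMDiff.add hf hg
  algebraMap_mem' c := (contMDiff_const : ContMDiff _ _ _ (fun _ : M => c))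

/-- Formal power series in `ν` whose coefficients are complex functions on `M`. -/
abbrev FormalFun (M : Type*) : Type _ := PowerSeries (M → ℂ)

/-- `C^∞_ℂ(M)[[ν]]` as a subset of all formal functions. -/
def smoothFormal : Set (FormalFun M) := {a | ∀ k, SmoothC m (PowerSeries.coeff k a)}

variable {m M}

/-- A series of bundled smooth functions as a formal function. -/
def toFormal (a : PowerSeries (SmoothFun m M)) : FormalFun M :=
  PowerSeries.map (SmoothFun m M).val.toRingHom a

/-- The differential of a complex function. -/
def dC (f : M → ℂ) (x : M) : TangentSpace 𝓘(ℝ, Model m) x →L[ℝ] ℂ :=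
  mfderiv 𝓘(ℝ, Model m) 𝓘(ℝ, ℂ) f x

/-- Differential operators of order at most `N` on a commutative algebra: all `(N+1)`-fold
commutators with multiplication operators vanish. -/
def IsDiffOp {A : Type*} [CommRing A] [Algebra ℂ A] : ℕ → (A →ₗ[ℂ] A) → Prop
  | 0, L => ∀ f : A, L ∘ₗ LinearMap.mulLeft ℂ f - LinearMap.mulLeft ℂ f ∘ₗ L = 0
  | N + 1, L => ∀ f : A, IsDiffOp N (L ∘ₗ LinearMap.mulLeft ℂ f - LinearMap.mulLeft ℂ f ∘ₗ L)

/-- Bidifferential operators: bilinear operators that are differential operators, of bounded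
order, in each of the two arguments. -/
def IsBiDiffOp {A : Type*} [CommRing A] [Algebra ℂ A] (B : A →ₗ[ℂ] A →ₗ[ℂ] A) : Prop :=
  ∃ N : ℕ, (∀ a, IsDiffOp N (B a)) ∧ ∀ b, IsDiffOp N (B.flip b)

/-- `ker Δ` inside `C^∞_ℂ(M)[[ν]]`. -/
def kerOp (m : ℕ) {M : Type*} [TopologicalSpace M] [ChartedSpace (Model m) M]
    (Dl : FormalFun M → FormalFun M) : Set (FormalFun M) :=
  {a | a ∈ smoothFormal m M ∧ Dl a = 0}

/-- A Wick deformation quantization of a contact metric manifold: a pair `(∗, Δ)` of operators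
`a ∗ b = ab + (ν/2) h(da, db) + ∑_{k ≥ 2} ν^k C_k(a, b)`, `Δ a = ξ a + ∑_{k ≥ 1} ν^k Δ_k a`
on `C^∞_ℂ(M)[[ν]]`, where `h` is evaluated on the transverse parts of the differentials, the
coefficients are (bi)differential operators extended by `ℂ[[ν]]`-linearity, and `ker Δ` is closed
under `∗` and associative. -/
structure IsWickDeformationQuantization [IsManifold 𝓘(ℝ, Model m) ∞ M]
    (S : ContactMetricStructure m M)
    (star : FormalFun M → FormalFun M → FormalFun M) (Dl : FormalFun M → FormalFun M) :
    Prop where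
  star_expansion : ∃ C : ℕ → (SmoothFun m M →ₗ[ℂ] SmoothFun m M →ₗ[ℂ] SmoothFun m M),
    (∀ k, IsBiDiffOp (C k)) ∧
    (∀ a b, C 0 a b = a * b) ∧
    (∀ a b x, (C 1 a b : M → ℂ) x
      = (1 / 2 : ℂ) * S.hForm x (S.transCov x (dC (a : M → ℂ) x))
          (S.transCov x (dC (b : M → ℂ) x))) ∧
    ∀ (a b : PowerSeries (SmoothFun m M)) (n : ℕ),
      PowerSeries.coeff n (star (toFormal a) (toFormal b))
        = ∑ p ∈ Finset.HasAntidiagonal.antidiagonal n, ∑ q ∈ Finset.HasAntidiagonal.antidiagonal p.2,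
            (C p.1 (PowerSeries.coeff q.1 a) (PowerSeries.coeff q.2 b) : M → ℂ)
  delta_expansion : ∃ L : ℕ → (SmoothFun m M →ₗ[ℂ] SmoothFun m M),
    (∀ k, ∃ N, IsDiffOp N (L k)) ∧
    (∀ a x, (L 0 a : M → ℂ) x = dC (a : M → ℂ) x (S.ξ x)) ∧
    ∀ (a : PowerSeries (SmoothFun m M)) (n : ℕ),
      PowerSeries.coeff n (Dl (toFormal a))
        = ∑ p ∈ Finset.HasAntidiagonal.antidiagonal n, (L p.1 (PowerSeries.coeff p.2 a) : M → ℂ)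
  closed : ∀ a ∈ kerOp m Dl, ∀ b ∈ kerOp m Dl, Dl (star a b) = 0
  assoc : ∀ a ∈ kerOp m Dl, ∀ b ∈ kerOp m Dl, ∀ c ∈ kerOp m Dl,
    star (star a b) c = star a (star b c)

end Functions

/-! ### The formal Wick algebra in coordinates -/

/-- Formal power series in the fibre coordinates `y^i` with complex coefficients. -/
abbrev YSeries (m : ℕ) : Type := MvPowerSeries (Fin (2 * m + 1)) ℂ

/-- Formal power series in `ν` and `y^i`: the underlying space of the formal Wick algebra `W_x`,
the `y^i` being the fibre coordinates for the coordinate frame at `x`. -/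
abbrev Wick (m : ℕ) : Type := PowerSeries (YSeries m)

namespace Wick

variable {m : ℕ}

/-- The coefficient of `ν^k y^d`. -/
def cf (k : ℕ) (d : Fin (2 * m + 1) →₀ ℕ) (w : Wick m) : ℂ :=
  MvPowerSeries.coeff d (PowerSeries.coeff k w)

/-- The element with prescribed coefficients. -/
def ofCf (c : ℕ → (Fin (2 * m + 1) →₀ ℕ) → ℂ) : Wick m :=
  PowerSeries.mk fun k => (fun d => c k d : YSeries m)

/-- `∂/∂y^i` -/
def dy (i : Fin (2 * m + 1)) (w : Wick m) : Wick m :=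
  PowerSeries.mk fun k => MvPowerSeries.pderiv ℂ i (PowerSeries.coeff k w)

/-- The variable `y^i`. -/
def y (i : Fin (2 * m + 1)) : Wick m := PowerSeries.C (MvPowerSeries.X i)

/-- Complex constants. -/
def const (z : ℂ) : Wick m := PowerSeries.C (MvPowerSeries.C z)

/-- `∑ h^{i₁j₁} ⋯ h^{i_s j_s} (∂_{i₁} ⋯ ∂_{i_s} a) (∂_{j₁} ⋯ ∂_{j_s} b)`. -/
def contract (h : Fin (2 * m + 1) → Fin (2 * m + 1) → ℂ) :
    ℕ → YSeries m → YSeries m → YSeries m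
  | 0, a, b => a * b
  | s + 1, a, b => ∑ i, ∑ j,
      h i j • contract h s (MvPowerSeries.pderiv ℂ i a) (MvPowerSeries.pderiv ℂ j b)

/-- The product `a ∘ b = exp((ν/2) h^{ij} ∂²/∂y^i∂z^j) a(y) b(z)|_{z = y}`. -/
def circ (h : Fin (2 * m + 1) → Fin (2 * m + 1) → ℂ) (a b : Wick m) : Wick m :=
  PowerSeries.mk fun n => ∑ p ∈ Finset.HasAntidiagonal.antidiagonal n, ∑ q ∈ Finset.HasAntidiagonal.antidiagonal p.2,
    ((1 / 2 : ℂ) ^ p.1 / (p.1.factorial : ℂ)) •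
      contract h p.1 (PowerSeries.coeff q.1 a) (PowerSeries.coeff q.2 b)

/-- Division by `ν` of a series without constant term in `ν`. -/
def divNu (w : Wick m) : Wick m := PowerSeries.mk fun k => PowerSeries.coeff (k + 1) w

/-- Multiply the part of degree `l` in `y` by `c l`. -/
def yScale (c : ℕ → ℂ) (w : Wick m) : Wick m := ofCf fun k d => c d.degree * cf k d w

/-- The linear substitution `y^i ↦ (L y)^i`. -/
def linSubst (L : Model m →L[ℝ] Model m) (w : Wick m) : Wick m :=
  PowerSeries.mk fun k => MvPowerSeries.subst
    (fun i => ∑ j, MvPowerSeries.C ((coord (L (stdVec m j)) i : ℝ) : ℂ) * MvPowerSeries.X j :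
      Fin (2 * m + 1) → YSeries m)
    (PowerSeries.coeff k w)

/-- `w ∈ F^n W` for the filtration in which `y` has degree `1` and `ν` has degree `2`. -/
def InFiltration (n : ℕ) (w : Wick m) : Prop :=
  ∀ k d, 2 * k + d.degree < n → cf k d w = 0

end Wick

/-! ### Sections of the Wick bundle and Wick-algebra-valued forms -/

section Sections

variable (m : ℕ) (M : Type*) [TopologicalSpace M] [ChartedSpace (Model m) M]

/-- Sections of the bundle `W`, not necessarily smooth. The value at `x` is written in the fibre
coordinates of the preferred chart at `x`. -/
abbrev WSec : Type _ := M → Wick m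

/-- `1`-forms `b = b_i dx^i` with values in `W`, through the components `b_i`. -/
abbrev WForm1 : Type _ := M → Fin (2 * m + 1) → Wick m

/-- `2`-forms `b = (1/2) b_{ij} dx^i ∧ dx^j`, `b_{ij} = -b_{ji}`, with values in `W`, through the
components `b_{ij}`. -/
abbrev WForm2 : Type _ := M → Fin (2 * m + 1) → Fin (2 * m + 1) → Wick m

variable {m M}
variable [IsManifold 𝓘(ℝ, Model m) ∞ M]

/-- The value at `x` of a section, expressed in the coordinates of the preferred chart at `x₀`. -/
def inChart (x₀ : M) (a : WSec m M) (x : M) : Wick m := Wick.linSubst (jac x₀ x) (a x)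

/-- The components at `x` of a `1`-form in the coordinates of the preferred chart at `x₀`. -/
def inChart1 (x₀ : M) (b : WForm1 m M) (x : M) (j : Fin (2 * m + 1)) : Wick m :=
  ∑ i, Wick.const ((coord (jac x₀ x (stdVec m j)) i : ℝ) : ℂ) * Wick.linSubst (jac x₀ x) (b x i)

/-- Smoothness of a section: in every preferred chart, all coefficients are smooth functions. -/
def SmoothSec (a : WSec m M) : Prop :=
  ∀ x₀ k d, ContMDiffOn 𝓘(ℝ, Model m) 𝓘(ℝ, ℂ) ∞ (fun x => Wick.cf k d (inChart x₀ a x))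
    (chartAt (Model m) x₀).source

/-- Smoothness of a `W`-valued `1`-form. -/
def SmoothForm1 (b : WForm1 m M) : Prop :=
  ∀ x₀ j k d, ContMDiffOn 𝓘(ℝ, Model m) 𝓘(ℝ, ℂ) ∞ (fun x => Wick.cf k d (inChart1 x₀ b x j))
    (chartAt (Model m) x₀).source

/-- The coefficientwise partial derivative `∂f/∂x^i` at `x` of a `Wick m`-valued function. -/
def dx (x : M) (i : Fin (2 * m + 1)) (f : M → Wick m) : Wick m :=
  Wick.ofCf fun k d => dC (m := m) (fun z => Wick.cf k d (f z)) x (frame x i)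

/-- `y^j Γ^k_{ji} ∂w/∂y^k` at `x`. -/
def gammaAct (cov : AffineConnection m M) (x : M) (i : Fin (2 * m + 1)) (w : Wick m) : Wick m :=
  ∑ j, ∑ k, Wick.const (christoffel cov x k j i : ℂ) * Wick.y j * Wick.dy k w

/-- `d_∇ a = dx^i ∇_i a`, `∇_i a = ∂a/∂x^i - y^j Γ^k_{ji} ∂a/∂y^k`, on sections. -/
def dNabla (cov : AffineConnection m M) (a : WSec m M) : WForm1 m M := fun x i =>
  dx x i (inChart x a) - gammaAct cov x i (a x)

/-- `d_∇ (b_j dx^j) = dx^i ∧ dx^j ∇_i b_j` on `1`-forms. -/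
def dNabla1 (cov : AffineConnection m M) (b : WForm1 m M) : WForm2 m M := fun x i j =>
  (dx x i (fun z => inChart1 x b z j) - gammaAct cov x i (b x j))
    - (dx x j (fun z => inChart1 x b z i) - gammaAct cov x j (b x i))

/-- `δ = dx^i ∧ ∂/∂y^i` on sections. -/
def delta (a : WSec m M) : WForm1 m M := fun x i => Wick.dy i (a x)

/-- `δ = dx^i ∧ ∂/∂y^i` on `1`-forms. -/
def delta1 (b : WForm1 m M) : WForm2 m M := fun x i j =>
  Wick.dy i (b x j) - Wick.dy j (b x i)

/-- The section without dependence on `y` given by a formal function. -/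
def embed (a : FormalFun M) : WSec m M := fun x =>
  PowerSeries.mk fun k => MvPowerSeries.C (PowerSeries.coeff k a x)

/-- `a(x, 0, ν)`, which is the projection `Π a` of a section `a`. -/
def proj (a : WSec m M) : FormalFun M :=
  PowerSeries.mk fun k x => MvPowerSeries.constantCoeff (PowerSeries.coeff k (a x))

/-- `ℂ[[ν]]` acting on sections. -/
def scaleSec (c : PowerSeries ℂ) (a : WSec m M) : WSec m M := fun x =>
  PowerSeries.map MvPowerSeries.C c * a x

/-- `ℂ[[ν]]` acting on formal functions. -/
def scaleFormal (c : PowerSeries ℂ) (a : FormalFun M) : FormalFun M :=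
  PowerSeries.map (algebraMap ℂ (M → ℂ)) c * a

namespace ContactMetricStructure

variable (S : ContactMetricStructure m M)

/-- The fibrewise product of sections. -/
def circ (a b : WSec m M) : WSec m M := fun x => Wick.circ (S.wickTensor x) (a x) (b x)

/-- The fibrewise condition `ξ^i ∂w/∂y^i = 0`. -/
def TransAt (x : M) (w : Wick m) : Prop :=
  ∑ i, Wick.const (S.ξComp x i : ℂ) * Wick.dy i w = 0

/-- The space of smooth `ξ`-transverse sections. -/
def transSec : Set (WSec m M) := {a | SmoothSec a ∧ ∀ x, S.TransAt x (a x)}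

/-- The space of smooth `ξ`-transverse `1`-forms. -/
def transForm1 : Set (WForm1 m M) := {b | SmoothForm1 b ∧ ∀ x i, S.TransAt x (b x i)}

/-- `i_ξ` on `1`-forms. -/
def iξ (b : WForm1 m M) : WSec m M := fun x => ∑ i, Wick.const (S.ξComp x i : ℂ) * b x i

/-- `i_ξ` on `2`-forms. -/
def iξ2 (b : WForm2 m M) : WForm1 m M := fun x j =>
  ∑ i, Wick.const (S.ξComp x i : ℂ) * b x i j

/-- The projection `Π b = λ (i_ξ b)(x, 0, ν)` on `1`-forms. -/
def proj1 (b : WForm1 m M) : WForm1 m M := fun x i =>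
  Wick.const (S.lamComp x i : ℂ) * embed (m := m) (proj (S.iξ b)) x

/-- `y^i P^j_i`, the contraction vector of `δ^*`. -/
def yP (x : M) (j : Fin (2 * m + 1)) : Wick m :=
  ∑ i, Wick.const (S.projComp x j i : ℂ) * Wick.y i

/-- `δ^* = y^i P^j_i i_{∂_j}` on `1`-forms. -/
def deltaStar (b : WForm1 m M) : WSec m M := fun x => ∑ j, S.yP x j * b x j

/-- `δ^* = y^i P^j_i i_{∂_j}` on `2`-forms. -/
def deltaStar2 (b : WForm2 m M) : WForm1 m M := fun x k => ∑ j, S.yP x j * b x j k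

/-- `δ^{-1}` on `1`-forms: if `b` has degree `l - 1` in `y`, then `δ^{-1} b = δ^* b / l`, both for
`b` annihilated by `i_ξ` and for `b` a multiple of `λ`, in which case `δ^* b = 0`. -/
def deltaInv (b : WForm1 m M) : WSec m M := fun x =>
  Wick.yScale (fun l => 1 / (l : ℂ)) (S.deltaStar b x)

/-- The component `λ ∧ i_ξ b` in `Λ^λ` of a `2`-form. -/
def lamPart (b : WForm2 m M) : WForm2 m M := fun x i j =>
  Wick.const (S.lamComp x i : ℂ) * S.iξ2 b x j - Wick.const (S.lamComp x j : ℂ) * S.iξ2 b x i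

/-- `δ^{-1}` on `2`-forms: if `b = b' + b''` has degree `l - 1` in `y`, with `i_ξ b' = 0` and
`b'' = λ ∧ i_ξ b`, then `δ^{-1} b = δ^* b' / (l + 1) + δ^* b'' / l`. -/
def deltaInv2 (b : WForm2 m M) : WForm1 m M := fun x k =>
  Wick.yScale (fun l => 1 / ((l : ℂ) + 1)) (S.deltaStar2 (b - S.lamPart b) x k)
    + Wick.yScale (fun l => 1 / (l : ℂ)) (S.deltaStar2 (S.lamPart b) x k)

/-- `(i/ν) [w, w']` for elements of the fibre at `x`. -/
def ad (x : M) (w w' : Wick m) : Wick m :=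
  Wick.const Complex.I *
    Wick.divNu (Wick.circ (S.wickTensor x) w w' - Wick.circ (S.wickTensor x) w' w)

/-- `(i/ν) [r, a]` for a `1`-form `r` and a section `a`. -/
def adForm (r : WForm1 m M) (a : WSec m M) : WForm1 m M := fun x i => S.ad x (r x i) (a x)

/-- `(i/ν) [r, b] = (i/ν) (r ∘ b + b ∘ r)` for `1`-forms `r` and `b`. -/
def adForm1 (r b : WForm1 m M) : WForm2 m M := fun x i j =>
  S.ad x (r x i) (b x j) - S.ad x (r x j) (b x i)

/-- `(i/ν) r ∘ r` for a `1`-form `r`. -/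
def halfSq (r : WForm1 m M) : WForm2 m M := fun x i j => S.ad x (r x i) (r x j)

/-- `D a = d_∇ a - δ a + (i/ν) [r, a]` on sections. -/
def fedosov (cov : AffineConnection m M) (r : WForm1 m M) (a : WSec m M) : WForm1 m M :=
  dNabla cov a - delta a + S.adForm r a

/-- `D b = d_∇ b - δ b + (i/ν) [r, b]` on `1`-forms. -/
def fedosov1 (cov : AffineConnection m M) (r : WForm1 m M) (b : WForm1 m M) : WForm2 m M :=
  dNabla1 cov b - delta1 b + S.adForm1 r b

/-- `T = (1/2) T_{kij} y^k dx^i ∧ dx^j`, `T_{kij} = ω_{kn} T^n_{ij}`. -/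
def torsionForm (cov : AffineConnection m M) : WForm2 m M := fun x i j =>
  ∑ k, ∑ n, Wick.const ((S.omComp x k n * torsionComp cov x n i j : ℝ) : ℂ) * Wick.y k

/-- The curvature `2`-form `R`, quadratic in `y`, with `d_∇ (d_∇ a) = (i/ν) [R, a]`; its components
are `R_{kl} = (1/2) ω_{ni} R^n_{jkl} y^i y^j`. -/
def curvatureForm (cov : AffineConnection m M) : WForm2 m M := fun x k l =>
  ∑ i, ∑ j, ∑ n, Wick.const ((1 / 2 * S.omComp x n i * curvatureComp cov x n j k l : ℝ) : ℂ)
    * Wick.y i * Wick.y j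

/-- The `2`-form `ω`, as a `W`-valued form. -/
def omForm : WForm2 m M := fun x i j => Wick.const (S.omComp x i j : ℂ)

/-- The Weyl curvature `Ω = ω - δ r + T + R + d_∇ r + (i/ν) r ∘ r`. -/
def weylCurvature (cov : AffineConnection m M) (r : WForm1 m M) : WForm2 m M :=
  S.omForm - delta1 r + S.torsionForm cov + S.curvatureForm cov + dNabla1 cov r + S.halfSq r

/-- `r ∈ F² W^ξ ⊗ Λ_1` defines an abelian connection: `D² = 0`. -/
def IsAbelian (cov : AffineConnection m M) (r : WForm1 m M) : Prop :=
  r ∈ S.transForm1 ∧ (∀ x i, Wick.InFiltration 2 (r x i)) ∧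
    ∀ a ∈ S.transSec, S.fedosov1 cov r (S.fedosov cov r a) = 0

/-- The space `W_D` of flat sections. -/
def flatSec (cov : AffineConnection m M) (r : WForm1 m M) : Set (WSec m M) :=
  {a | a ∈ S.transSec ∧ S.fedosov cov r a = 0}

/-- `b ∈ W^ξ` solves `b = a + δ^{-1} (D + δ) b`. -/
def IsLift (cov : AffineConnection m M) (r : WForm1 m M) (a b : WSec m M) : Prop :=
  b ∈ S.transSec ∧ b = a + S.deltaInv (S.fedosov cov r b + delta b)

open Classical in
/-- The quantum lift `Q`: `Q a` is the solution `b ∈ W^ξ` of `b = a + δ^{-1} (D + δ) b`. -/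
def quantumLift (cov : AffineConnection m M) (r : WForm1 m M) (a : FormalFun M) : WSec m M :=
  if h : ∃ b, S.IsLift cov r (embed a) b then h.choose else 0

/-- `Δ = i_ξ Π D Q`. -/
def Delta (cov : AffineConnection m M) (r : WForm1 m M) (a : FormalFun M) : FormalFun M :=
  proj (S.iξ (S.proj1 (S.fedosov cov r (S.quantumLift cov r a))))

/-- `a ∗ b = Π (Q a ∘ Q b)`. -/
def star (cov : AffineConnection m M) (r : WForm1 m M) (a b : FormalFun M) : FormalFun M :=
  proj (S.circ (S.quantumLift cov r a) (S.quantumLift cov r b))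

end ContactMetricStructure

end Sections

end WickContact

end

namespace WickContact

noncomputable section

/-! ### The formal Wick algebra of a single fibre. -/

namespace Wick

variable {m : ℕ}

/-! ### Coefficients -/

/-! The argument is Fedosov's, carried out on the ξ-transverse part of the Wick bundle. Its starting
point is that δ is inner there. The solder form s_j = ω_{jk} y^k satisfies (i/ν)[s_j, ·] = -∂/∂y^j
on transverse elements (`br_sL_of_dXi`), because π ω is the projection along ξ. Hence D = d_∇ +
(i/ν)[r + s, ·]. Since d_∇ s = T (`torsionForm_eq`) and (i/ν) s∘s = ω (`br_sL_sL`), completing the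
square gives Ω = R + d_∇(r+s) + (i/ν)(r+s)∘(r+s) (`weylCurvature_eq`). So Ω is an ordinary
curvature, with D² = (i/ν)[Ω, ·] (`fedosov1_fedosov`) and the Bianchi identity DΩ = 0
(`DL_bianchi`). These two need that h is parallel (`parallel_hL`), that (i/ν)[R, ·] is the curvature
of ∇ on W (`br_RL`), and the Bianchi identity of R (`bianchi_RL`). All of this is computed in a
fixed chart. The covariance lemmas named `inChart...` carry it to sections and forms, whose value at
a point is stored in the preferred chart of that point.

The second ingredient is a Poincaré lemma in the fibres. On transverse elements, contraction with
y^i P^j_i inverts δ up to weights that depend on the degree and on the presence of a factor λ. In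
filtered form: if δ^* A = 0, then A lies one filtration step deeper than δA
(`inFiltration_of_closed2`); for 1-forms one must also ask that the ξ-component vanish at y = 0
(`inFiltration_of_closed1`).

The third ingredient is contraction. Both d_∇ and (i/ν)[r, ·] with r ∈ F² preserve the filtration,
and δ^{-1} raises it by one. The filtration is complete and separated, so the fixed point equations
below have unique solutions (`exists_fixedPoint`, `unique_fixedPoint`), and smoothness survives
because each coefficient is settled after finitely many iterations.

For the connection one solves r = δ^{-1}(Ω - ω + δr), an equation whose right side involves r only
through d_∇ r and r∘r. The solution satisfies δ^{-1} r = 0 and Π r = 0, hence δ^{-1} δ r = r, hence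
δ^{-1}(Ω - ω) = 0. The Bianchi identity then pushes Ω - ω into every F^n
(`weylCurvature_eq_omForm`). Conversely, every normalised r with Ω = ω solves the equation, which
gives uniqueness (`existsUnique_connection`).

The lift Q is the fixed point of b ↦ a + δ^{-1}(D+δ)b (`existsUnique_isLift`). A flat section
satisfies the equation with a = Πa, so a = QΠa. If Δa = 0, then e = DQa satisfies δ^{-1} e = 0, Π e
= 0 and De = 0, and the fibrewise Poincaré lemma gives e = 0 (`quantumLift_mem_flatSec`). Since D is
a derivation of ∘, flat sections form an algebra, and ∗ on ker Δ is its product transported by Q.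

That the coefficients are differential operators follows from the equation for Q: each use of δ^{-1}
costs one derivative and gains one filtration degree, so Q is of finite order modulo every F^n
(`OrdMod_quantumLift`). The leading terms come from Qf = f + y^i P^j_i ∂_j f modulo terms that do
not affect them (`dy_quantumLift`, `starOp_one`, `Delta_zero`). -/

theorem ext_cf {w w' : Wick m} (h : ∀ k d, cf k d w = cf k d w') : w = w' := by
  refine PowerSeries.ext fun k => MvPowerSeries.ext fun d => h k d

@[simp] theorem cf_ofCf (c : ℕ → (Fin (2 * m + 1) →₀ ℕ) → ℂ) (k d) : cf k d (ofCf c) = c k d := by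
  unfold cf ofCf
  erw [PowerSeries.coeff_mk]
  rfl

@[simp] theorem cf_add (k d) (a b : Wick m) : cf k d (a + b) = cf k d a + cf k d b := by
  simp [cf]

@[simp] theorem cf_sub (k d) (a b : Wick m) : cf k d (a - b) = cf k d a - cf k d b := by
  simp [cf]

@[simp] theorem cf_neg (k d) (a : Wick m) : cf k d (-a) = -cf k d a := by
  simp [cf]

@[simp] theorem cf_zero (k d) : cf k d (0 : Wick m) = 0 := by
  simp [cf]

/-- `cf` as an additive map. -/
def cfHom (k : ℕ) (d : Fin (2 * m + 1) →₀ ℕ) : Wick m →+ ℂ where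
  toFun := cf k d
  map_zero' := cf_zero k d
  map_add' := cf_add k d

@[simp] theorem cf_sum {ι : Type*} (s : Finset ι) (k d) (f : ι → Wick m) :
    cf k d (∑ i ∈ s, f i) = ∑ i ∈ s, cf k d (f i) :=
  map_sum (cfHom k d) f s

@[simp] theorem cf_const_mul (k d) (z : ℂ) (w : Wick m) : cf k d (const z * w) = z * cf k d w := by
  unfold cf const
  rw [PowerSeries.coeff_C_mul, MvPowerSeries.coeff_C_mul]

theorem cf_mul (k d) (a b : Wick m) : cf k d (a * b) =
    ∑ p ∈ Finset.HasAntidiagonal.antidiagonal k, ∑ q ∈ Finset.HasAntidiagonal.antidiagonal d,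
      cf p.1 q.1 a * cf p.2 q.2 b := by
  classical
  unfold cf
  rw [PowerSeries.coeff_mul, map_sum]
  refine Finset.sum_congr rfl fun p _ => ?_
  rw [MvPowerSeries.coeff_mul]

theorem cf_dy (k d) (i : Fin (2 * m + 1)) (w : Wick m) :
    cf k d (dy i w) = cf k (d + Finsupp.single i 1) w * (d i + 1) := by
  unfold cf dy
  rw [PowerSeries.coeff_mk, MvPowerSeries.coeff_pderiv]

theorem sub_add_single {d : Fin (2 * m + 1) →₀ ℕ} {i : Fin (2 * m + 1)} (h : d i ≠ 0) :
    d - Finsupp.single i 1 + Finsupp.single i 1 = d := by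
  refine tsub_add_cancel_of_le fun j => ?_
  by_cases hj : i = j
  · subst hj; simp; omega
  · simp [hj]

theorem cf_y_mul (k d) (i : Fin (2 * m + 1)) (w : Wick m) :
    cf k d (y i * w) = if d i = 0 then 0 else cf k (d - Finsupp.single i 1) w := by
  classical
  unfold cf y
  rw [PowerSeries.coeff_C_mul]
  by_cases h : d i = 0
  · rw [if_pos h, MvPowerSeries.X, MvPowerSeries.coeff_monomial_mul, if_neg]
    intro hle
    have := hle i
    simp [h] at this
  · rw [if_neg h]
    have e := sub_add_single h
    rw [add_comm (d - Finsupp.single i 1)] at e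
    conv_lhs => rw [← e]
    rw [MvPowerSeries.X, MvPowerSeries.coeff_add_monomial_mul, one_mul]

theorem cf_const (k d) (z : ℂ) :
    cf k d (const z : Wick m) = if k = 0 ∧ d = 0 then z else 0 := by
  classical
  unfold cf const
  rw [PowerSeries.coeff_C]
  by_cases hk : k = 0
  · simp [hk, MvPowerSeries.coeff_C]
  · simp [hk]

@[simp] theorem const_zero : (const 0 : Wick m) = 0 := by simp [const]
@[simp] theorem const_one : (const 1 : Wick m) = 1 := by simp [const]
theorem const_add (a b : ℂ) : (const (a + b) : Wick m) = const a + const b := by simp [const]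
theorem const_sub (a b : ℂ) : (const (a - b) : Wick m) = const a - const b := by simp [const]
theorem const_mul (a b : ℂ) : (const (a * b) : Wick m) = const a * const b := by simp [const]
theorem const_neg (a : ℂ) : (const (-a) : Wick m) = -const a := by simp [const]
theorem const_sum {ι : Type*} (s : Finset ι) (f : ι → ℂ) :
    (const (∑ i ∈ s, f i) : Wick m) = ∑ i ∈ s, const (f i) := by simp [const]

/-! ### Fibre derivatives -/

@[simp] theorem dy_one (i) : dy i (1 : Wick m) = 0 := by
  refine ext_cf fun k d => ?_
  rw [cf_dy, ← const_one, cf_const, if_neg, cf_zero, zero_mul]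
  rintro ⟨-, h⟩
  have := DFunLike.congr_fun h i
  simp at this

/-- `∂/∂y^i` as a derivation. -/
def dyD (i : Fin (2 * m + 1)) : Derivation ℤ (Wick m) (Wick m) :=
  Derivation.mk' (AddMonoidHom.mk' (dy i) fun a b => ext_cf fun k d => by
    simp only [cf_dy, cf_add]; ring).toIntLinearMap fun a b => by
    show dy i (a * b) = a * dy i b + b * dy i a
    refine PowerSeries.ext fun k => ?_
    simp only [dy, PowerSeries.coeff_mk, map_add, PowerSeries.coeff_mul, map_sum,
      Derivation.leibniz, smul_eq_mul, Finset.sum_add_distrib]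
    congr 1
    rw [← Finset.Nat.sum_antidiagonal_swap]
    rfl

theorem dyD_apply (i) (w : Wick m) : dyD i w = dy i w := rfl

theorem dy_add (i) (a b : Wick m) : dy i (a + b) = dy i a + dy i b := map_add (dyD i) a b
theorem dy_sub (i) (a b : Wick m) : dy i (a - b) = dy i a - dy i b := map_sub (dyD i) a b
theorem dy_neg (i) (a : Wick m) : dy i (-a) = -dy i a := map_neg (dyD i) a
@[simp] theorem dy_zero (i) : dy i (0 : Wick m) = 0 := map_zero (dyD i)
theorem dy_sum {ι : Type*} (i) (s : Finset ι) (f : ι → Wick m) :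
    dy i (∑ j ∈ s, f j) = ∑ j ∈ s, dy i (f j) := map_sum (dyD i) f s

theorem dy_mul (i) (a b : Wick m) : dy i (a * b) = dy i a * b + a * dy i b := by
  have := (dyD i).leibniz a b
  simp only [dyD_apply, smul_eq_mul] at this
  rw [this]; ring

@[simp] theorem dy_const (i) (z : ℂ) : dy i (const z : Wick m) = 0 := by
  refine ext_cf fun k d => ?_
  rw [cf_dy, cf_const, if_neg, cf_zero, zero_mul]
  rintro ⟨-, h⟩
  have := DFunLike.congr_fun h i
  simp at this

@[simp] theorem dy_const_mul (i) (z : ℂ) (w : Wick m) : dy i (const z * w) = const z * dy i w := by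
  rw [dy_mul, dy_const, zero_mul, zero_add]

theorem dy_comm (i j) (w : Wick m) : dy i (dy j w) = dy j (dy i w) := by
  refine ext_cf fun k d => ?_
  simp only [cf_dy, Finsupp.add_apply, add_right_comm d]
  by_cases h : i = j
  · subst h; ring
  · have h' : ¬ j = i := fun e => h e.symm
    simp [h, h']; ring

theorem dy_y (i j) : dy i (y j : Wick m) = if i = j then 1 else 0 := by
  refine PowerSeries.ext fun k => ?_
  unfold dy y
  rw [PowerSeries.coeff_mk, PowerSeries.coeff_C]
  by_cases hk : k = 0
  · subst hk
    by_cases h : i = j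
    · subst h; simp
    · simp [h, MvPowerSeries.pderiv_X_of_ne (Ne.symm h)]
  · by_cases h : i = j
    · simp [hk, h, PowerSeries.coeff_one]
    · simp [hk, h]

/-- The Euler operator scales by the degree in `y`. -/
theorem euler (w : Wick m) : ∑ i, y i * dy i w = yScale (fun l => (l : ℂ)) w := by
  refine ext_cf fun k d => ?_
  rw [cf_sum]
  simp only [yScale, cf_ofCf]
  have : ∀ i, cf k d (y i * dy i w) = (d i : ℂ) * cf k d w := by
    intro i
    rw [cf_y_mul]
    by_cases h : d i = 0
    · simp [h]
    · rw [if_neg h, cf_dy]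
      have e := sub_add_single h
      rw [e]
      have : (((d - Finsupp.single i 1 : Fin (2 * m + 1) →₀ ℕ) i : ℕ) : ℂ) + 1 = d i := by
        have h1 : (d - Finsupp.single i 1 : Fin (2 * m + 1) →₀ ℕ) i + 1 = d i := by simp; omega
        exact_mod_cast h1
      rw [this]; ring
  simp only [this, ← Finset.sum_mul]
  congr 1
  rw [Finsupp.degree_eq_sum]
  push_cast
  rfl

@[simp] theorem cf_yScale (c : ℕ → ℂ) (k d) (w : Wick m) :
    cf k d (yScale c w) = c d.degree * cf k d w := by simp [yScale]

theorem yScale_add (c) (a b : Wick m) : yScale c (a + b) = yScale c a + yScale c b :=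
  ext_cf fun k d => by simp [mul_add]
theorem yScale_sub (c) (a b : Wick m) : yScale c (a - b) = yScale c a - yScale c b :=
  ext_cf fun k d => by simp [mul_sub]
@[simp] theorem yScale_zero (c) : yScale c (0 : Wick m) = 0 :=
  ext_cf fun k d => by simp
theorem yScale_const_mul (c) (z : ℂ) (a : Wick m) : yScale c (const z * a) = const z * yScale c a :=
  ext_cf fun k d => by simp; ring
theorem yScale_sum {ι : Type*} (c) (s : Finset ι) (f : ι → Wick m) :
    yScale c (∑ j ∈ s, f j) = ∑ j ∈ s, yScale c (f j) :=
  ext_cf fun k d => by simp [Finset.mul_sum]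
theorem yScale_yScale (c c') (a : Wick m) : yScale c (yScale c' a) = yScale (fun l => c l * c' l) a :=
  ext_cf fun k d => by simp; ring

theorem degree_add_single (d : Fin (2 * m + 1) →₀ ℕ) (i) :
    (d + Finsupp.single i 1).degree = d.degree + 1 := by
  simp

theorem dy_yScale (c) (i) (w : Wick m) : dy i (yScale c w) = yScale (fun l => c (l + 1)) (dy i w) :=
  ext_cf fun k d => by simp only [cf_dy, cf_yScale, degree_add_single]; ring

/-- Multiplication by `y i` raises the degree by one, hence the shifted weight. It is what lets the
factors 1/l and 1/(l+1) of δ^{-1} pass a contraction with y. -/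
theorem y_mul_yScale (c : ℕ → ℂ) (i) (w : Wick m) :
    y i * yScale (fun l => c (l + 1)) w = yScale c (y i * w) := by
  refine ext_cf fun k d => ?_
  rw [cf_yScale, cf_y_mul, cf_y_mul]
  by_cases h : d i = 0
  · simp [h]
  · rw [if_neg h, if_neg h, cf_yScale]
    have e := sub_add_single h
    rw [← degree_add_single _ i, e]

/-! ### The filtration -/

theorem InFiltration.add {n} {a b : Wick m} (ha : InFiltration n a) (hb : InFiltration n b) :
    InFiltration n (a + b) := fun k d h => by simp [ha k d h, hb k d h]
theorem InFiltration.sub {n} {a b : Wick m} (ha : InFiltration n a) (hb : InFiltration n b) :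
    InFiltration n (a - b) := fun k d h => by simp [ha k d h, hb k d h]
theorem InFiltration.sum {ι : Type*} {n} {s : Finset ι} {f : ι → Wick m}
    (hf : ∀ i ∈ s, InFiltration n (f i)) : InFiltration n (∑ i ∈ s, f i) := fun k d h => by
  rw [cf_sum]; exact Finset.sum_eq_zero fun i hi => hf i hi k d h
theorem inFiltration_zero (n) : InFiltration n (0 : Wick m) := fun k d _ => by simp
theorem inFiltration_zero_left (a : Wick m) : InFiltration 0 a := fun k d h => by omega
theorem InFiltration.mono {n n'} {a : Wick m} (ha : InFiltration n a) (h : n' ≤ n) :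
    InFiltration n' a := fun k d hk => ha k d (by omega)
theorem InFiltration.const_mul {n} {a : Wick m} (ha : InFiltration n a) (z : ℂ) :
    InFiltration n (const z * a) := fun k d h => by simp [ha k d h]
theorem InFiltration.yScale {n} {a : Wick m} (ha : InFiltration n a) (c) :
    InFiltration n (yScale c a) := fun k d h => by simp [ha k d h]
-- For `n = 0` the truncated `n - 1` is harmless, since the claim is then vacuous.
theorem InFiltration.dy {n} {a : Wick m} (ha : InFiltration n a) (i) :
    InFiltration (n - 1) (dy i a) := fun k d h => by
  rw [cf_dy, ha k _ (by rw [degree_add_single]; omega), zero_mul]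
theorem InFiltration.y_mul {n} {a : Wick m} (ha : InFiltration n a) (i) :
    InFiltration (n + 1) (y i * a) := fun k d h => by
  rw [cf_y_mul]
  split_ifs with h0
  · rfl
  · refine ha _ _ ?_
    have e := sub_add_single h0
    have := degree_add_single (d - Finsupp.single i 1) i
    rw [e] at this
    omega

theorem InFiltration.mul {p q} {a b : Wick m} (ha : InFiltration p a) (hb : InFiltration q b) :
    InFiltration (p + q) (a * b) := fun k d h => by
  rw [cf_mul]
  refine Finset.sum_eq_zero fun u hu => Finset.sum_eq_zero fun v hv => ?_
  have h1 := Finset.HasAntidiagonal.mem_antidiagonal.1 hu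
  have h2 := congrArg Finsupp.degree (Finset.HasAntidiagonal.mem_antidiagonal.1 hv)
  rw [map_add] at h2
  by_cases h3 : 2 * u.1 + v.1.degree < p
  · rw [ha _ _ h3, zero_mul]
  · rw [hb _ _ (by omega), mul_zero]

theorem eq_zero_of_inFiltration {a : Wick m} (h : ∀ n, InFiltration n a) : a = 0 :=
  ext_cf fun k d => by rw [h (2 * k + d.degree + 1) k d (by omega), cf_zero]

/-! ### The product `∘` -/

/-- `h^{i₁j₁} ⋯ h^{i_s j_s} (∂_{i₁} ⋯ ∂_{i_s} a) (∂_{j₁} ⋯ ∂_{j_s} b)` for series in `ν`. -/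
def contr (h : Fin (2 * m + 1) → Fin (2 * m + 1) → ℂ) : ℕ → Wick m → Wick m → Wick m
  | 0, a, b => a * b
  | s + 1, a, b => ∑ i, ∑ j, const (h i j) * contr h s (dy i a) (dy j b)

variable (h : Fin (2 * m + 1) → Fin (2 * m + 1) → ℂ)

/-- Links the contractions of the definition of ∘, which act on single ν-coefficients, with `contr`,
which treats ν as a scalar. From here on ∘ is handled through whole series. -/
theorem coeff_contr (s n) (a b : Wick m) : PowerSeries.coeff n (contr h s a b) =
    ∑ q ∈ Finset.HasAntidiagonal.antidiagonal n,
      contract h s (PowerSeries.coeff q.1 a) (PowerSeries.coeff q.2 b) := by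
  induction s generalizing a b with
  | zero => simp [contr, contract, PowerSeries.coeff_mul]
  | succ s ih =>
    simp only [contr, contract, map_sum]
    rw [Finset.sum_comm' (t' := Finset.univ) (s' := fun _ => Finset.HasAntidiagonal.antidiagonal n)
      (by simp)]
    refine Finset.sum_congr rfl fun i _ => ?_
    rw [Finset.sum_comm' (t' := Finset.univ) (s' := fun _ => Finset.HasAntidiagonal.antidiagonal n)
      (by simp)]
    refine Finset.sum_congr rfl fun j _ => ?_
    unfold const
    rw [PowerSeries.coeff_C_mul, ih, Finset.mul_sum]
    refine Finset.sum_congr rfl fun q _ => ?_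
    simp only [dy, PowerSeries.coeff_mk, MvPowerSeries.smul_eq_C_mul]

/-- The coefficients of the exponential series. -/
def expCf (s : ℕ) : ℂ := (1 / 2 : ℂ) ^ s / (s.factorial : ℂ)

theorem cf_circ (n d) (a b : Wick m) : cf n d (circ h a b) =
    ∑ p ∈ Finset.HasAntidiagonal.antidiagonal n, expCf p.1 * cf p.2 d (contr h p.1 a b) := by
  unfold cf circ
  rw [PowerSeries.coeff_mk, map_sum]
  refine Finset.sum_congr rfl fun p _ => ?_
  rw [coeff_contr, ← Finset.smul_sum]
  simp [expCf]

theorem contr_add_left (s) (a a' b : Wick m) :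
    contr h s (a + a') b = contr h s a b + contr h s a' b := by
  induction s generalizing a a' b with
  | zero => simp [contr, add_mul]
  | succ s ih => simp only [contr, dy_add, ih, mul_add, Finset.sum_add_distrib]

theorem contr_add_right (s) (a b b' : Wick m) :
    contr h s a (b + b') = contr h s a b + contr h s a b' := by
  induction s generalizing a b b' with
  | zero => simp [contr, mul_add]
  | succ s ih => simp only [contr, dy_add, ih, mul_add, Finset.sum_add_distrib]

/-- Elements of `ℂ[[ν]]` are annihilated by all fibre derivatives. -/
def IsScalar (c : Wick m) : Prop := ∀ i, dy i c = 0

theorem contr_mul_left {c : Wick m} (hc : IsScalar c) (s) (a b : Wick m) :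
    contr h s (c * a) b = c * contr h s a b := by
  induction s generalizing a b with
  | zero => simp [contr, mul_assoc]
  | succ s ih =>
    simp only [contr, dy_mul, hc _, zero_mul, zero_add, ih, Finset.mul_sum]
    refine Finset.sum_congr rfl fun i _ => Finset.sum_congr rfl fun j _ => by ring

theorem contr_mul_right {c : Wick m} (hc : IsScalar c) (s) (a b : Wick m) :
    contr h s a (c * b) = c * contr h s a b := by
  induction s generalizing a b with
  | zero => simp only [contr]; ring
  | succ s ih =>
    simp only [contr, dy_mul, hc _, zero_mul, zero_add, ih, Finset.mul_sum]
    refine Finset.sum_congr rfl fun i _ => Finset.sum_congr rfl fun j _ => by ring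

theorem contr_zero (a b : Wick m) : contr h 0 a b = a * b := rfl

theorem expCf_zero : expCf 0 = 1 := by simp [expCf]

/-- `contr` as a biadditive map. -/
def contrHom (s : ℕ) : Wick m →+ Wick m →+ Wick m :=
  AddMonoidHom.mk' (fun a => AddMonoidHom.mk' (fun b => contr h s a b) (contr_add_right h s a))
    (fun a a' => by ext1 b; exact contr_add_left h s a a' b)

theorem contr_sum_left {ι : Type*} (t : Finset ι) (s) (f : ι → Wick m) (b : Wick m) :
    contr h s (∑ i ∈ t, f i) b = ∑ i ∈ t, contr h s (f i) b :=
  map_sum ((contrHom h s).flip b) f t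

theorem contr_sum_right {ι : Type*} (t : Finset ι) (s) (a : Wick m) (f : ι → Wick m) :
    contr h s a (∑ i ∈ t, f i) = ∑ i ∈ t, contr h s a (f i) :=
  map_sum (contrHom h s a) f t

/-- The coefficients of `h` do not depend on y, so every fibre derivative is a derivation of each
contraction, and therefore of ∘. -/
theorem dy_contr (k s) (a b : Wick m) :
    dy k (contr h s a b) = contr h s (dy k a) b + contr h s a (dy k b) := by
  induction s generalizing a b with
  | zero => simp [contr, dy_mul]
  | succ s ih =>
    simp only [contr, dy_sum, dy_const_mul, ih, mul_add, Finset.sum_add_distrib]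
    simp only [dy_comm k]

theorem contr_zero_left (s) (b : Wick m) : contr h s 0 b = 0 := map_zero ((contrHom h s).flip b)
theorem contr_zero_right (s) (a : Wick m) : contr h s a 0 = 0 := map_zero (contrHom h s a)

end Wick

namespace Wick

variable {m : ℕ} (h : Fin (2 * m + 1) → Fin (2 * m + 1) → ℂ)

/-! ### Agreement up to a power of `ν` -/

/-- Agreement of the coefficients of `ν^k` for `k ≤ n`. -/
def EqUpTo (n : ℕ) (w w' : Wick m) : Prop := ∀ k ≤ n, ∀ d, cf k d w = cf k d w'

theorem EqUpTo.refl (n) (w : Wick m) : EqUpTo n w w := fun _ _ _ => rfl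
theorem EqUpTo.symm {n} {w w' : Wick m} (e : EqUpTo n w w') : EqUpTo n w' w :=
  fun k hk d => (e k hk d).symm
theorem EqUpTo.trans {n} {w w' w'' : Wick m} (e : EqUpTo n w w') (e' : EqUpTo n w' w'') :
    EqUpTo n w w'' := fun k hk d => (e k hk d).trans (e' k hk d)
theorem EqUpTo.add {n} {a a' b b' : Wick m} (e : EqUpTo n a a') (e' : EqUpTo n b b') :
    EqUpTo n (a + b) (a' + b') := fun k hk d => by simp [e k hk d, e' k hk d]
theorem EqUpTo.sub {n} {a a' b b' : Wick m} (e : EqUpTo n a a') (e' : EqUpTo n b b') :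
    EqUpTo n (a - b) (a' - b') := fun k hk d => by simp [e k hk d, e' k hk d]
theorem EqUpTo.sum {ι : Type*} {n} {s : Finset ι} {f g : ι → Wick m}
    (e : ∀ i ∈ s, EqUpTo n (f i) (g i)) : EqUpTo n (∑ i ∈ s, f i) (∑ i ∈ s, g i) :=
  fun k hk d => by
    simp only [cf_sum]; exact Finset.sum_congr rfl fun i hi => e i hi k hk d
theorem EqUpTo.mul {n} {a a' b b' : Wick m} (e : EqUpTo n a a') (e' : EqUpTo n b b') :
    EqUpTo n (a * b) (a' * b') := fun k hk d => by
  simp only [cf_mul]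
  refine Finset.sum_congr rfl fun p hp => Finset.sum_congr rfl fun q _ => ?_
  have := Finset.HasAntidiagonal.mem_antidiagonal.1 hp
  rw [e _ (by omega), e' _ (by omega)]
theorem EqUpTo.dy {n} {a a' : Wick m} (e : EqUpTo n a a') (i) : EqUpTo n (dy i a) (dy i a') :=
  fun k hk d => by simp [cf_dy, e k hk]
theorem EqUpTo.contr {n} {a a' b b' : Wick m} (e : EqUpTo n a a') (e' : EqUpTo n b b') (s) :
    EqUpTo n (contr h s a b) (contr h s a' b') := by
  induction s generalizing a a' b b' with
  | zero => exact e.mul e'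
  | succ s ih =>
    exact EqUpTo.sum fun i _ => EqUpTo.sum fun j _ =>
      (EqUpTo.refl n _).mul (ih (e.dy i) (e'.dy j))
theorem eq_of_eqUpTo {w w' : Wick m} (e : ∀ n, EqUpTo n w w') : w = w' :=
  ext_cf fun k d => e k k le_rfl d

/-- The deformation parameter `ν`. -/
def nu : Wick m := PowerSeries.X

theorem cf_nu_pow_mul (k d s) (w : Wick m) :
    cf k d (nu ^ s * w) = if s ≤ k then cf (k - s) d w else 0 := by
  unfold cf nu
  rw [PowerSeries.coeff_X_pow_mul']
  split_ifs <;> simp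

theorem cf_nu_mul (k d) (w : Wick m) :
    cf k d (nu * w) = if 1 ≤ k then cf (k - 1) d w else 0 := by
  simpa using cf_nu_pow_mul k d 1 w

/-- Since ν is not a zero divisor, identities for (i/ν)[·, ·] may be checked after multiplication by
ν, where they become identities for commutators. -/
theorem nu_mul_cancel {w w' : Wick m} (e : nu * w = nu * w') : w = w' := by
  refine ext_cf fun k d => ?_
  have := congrArg (cf (k + 1) d) e
  simpa [cf_nu_mul] using this

theorem isScalar_nu_pow (s : ℕ) : IsScalar (nu ^ s : Wick m) := fun i => by
  refine ext_cf fun k d => ?_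
  have hd : d + Finsupp.single i 1 ≠ 0 := fun e => by
    have := DFunLike.congr_fun e i
    simp at this
  rw [← mul_one (nu ^ s), cf_dy, cf_nu_pow_mul, ← const_one, cf_const]
  simp [hd]

theorem isScalar_nu : IsScalar (nu : Wick m) := by simpa using isScalar_nu_pow (m := m) 1
theorem isScalar_const (z : ℂ) : IsScalar (const z : Wick m) := fun i => dy_const i z
theorem IsScalar.mul {a b : Wick m} (ha : IsScalar a) (hb : IsScalar b) : IsScalar (a * b) :=
  fun i => by rw [dy_mul, ha, hb, zero_mul, mul_zero, add_zero]
theorem isScalar_one : IsScalar (1 : Wick m) := fun i => dy_one i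

/-- A finite truncation of `a ∘ b`. -/
def circN (N : ℕ) (a b : Wick m) : Wick m :=
  ∑ s ∈ Finset.range (N + 1), const (expCf s) * nu ^ s * contr h s a b

theorem cf_term (n d s) (z : ℂ) (w : Wick m) :
    cf n d (const z * nu ^ s * w) = if s ≤ n then z * cf (n - s) d w else 0 := by
  rw [mul_assoc, cf_const_mul, cf_nu_pow_mul]
  split_ifs <;> simp

/-- The s-th term of the exponential carries ν^s, so the terms with s > N do not touch the
coefficients up to ν^N. Identities for ∘ are proved for the finite sums `circN` and transferred with
`eq_of_eqUpTo`. -/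
theorem circ_eqUpTo (N) (a b : Wick m) : EqUpTo N (circ h a b) (circN h N a b) := by
  intro n hn d
  rw [cf_circ, circN, cf_sum, Finset.Nat.sum_antidiagonal_eq_sum_range_succ_mk]
  simp only [cf_term]
  rw [← Finset.sum_filter]
  refine Finset.sum_congr ?_ fun _ _ => rfl
  ext s; simp; omega

theorem circN_add_left (N) (a a' b : Wick m) :
    circN h N (a + a') b = circN h N a b + circN h N a' b := by
  simp [circN, contr_add_left, mul_add, Finset.sum_add_distrib]

theorem circN_add_right (N) (a b b' : Wick m) :
    circN h N a (b + b') = circN h N a b + circN h N a b' := by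
  simp [circN, contr_add_right, mul_add, Finset.sum_add_distrib]

theorem EqUpTo.circN {n N} {a a' b b' : Wick m} (e : EqUpTo n a a') (e' : EqUpTo n b b') :
    EqUpTo n (circN h N a b) (circN h N a' b') :=
  EqUpTo.sum fun _ _ => (EqUpTo.refl n _).mul (e.contr h e' _)

theorem circ_add_left (a a' b : Wick m) : circ h (a + a') b = circ h a b + circ h a' b :=
  eq_of_eqUpTo fun n => (circ_eqUpTo h n _ _).trans <| by
    rw [circN_add_left]; exact ((circ_eqUpTo h n _ _).add (circ_eqUpTo h n _ _)).symm

theorem circ_add_right (a b b' : Wick m) : circ h a (b + b') = circ h a b + circ h a b' :=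
  eq_of_eqUpTo fun n => (circ_eqUpTo h n _ _).trans <| by
    rw [circN_add_right]; exact ((circ_eqUpTo h n _ _).add (circ_eqUpTo h n _ _)).symm

/-- `∘` as a biadditive map. -/
def circHom : Wick m →+ Wick m →+ Wick m :=
  AddMonoidHom.mk' (fun a => AddMonoidHom.mk' (fun b => circ h a b) (circ_add_right h a))
    (fun a a' => by ext1 b; exact circ_add_left h a a' b)

theorem circ_zero_left (b : Wick m) : circ h 0 b = 0 := map_zero ((circHom h).flip b)
theorem circ_zero_right (a : Wick m) : circ h a 0 = 0 := map_zero (circHom h a)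
theorem circ_sub_left (a a' b : Wick m) : circ h (a - a') b = circ h a b - circ h a' b :=
  map_sub ((circHom h).flip b) a a'
theorem circ_sub_right (a b b' : Wick m) : circ h a (b - b') = circ h a b - circ h a b' :=
  map_sub (circHom h a) b b'

theorem circ_mul_left {c : Wick m} (hc : IsScalar c) (a b : Wick m) :
    circ h (c * a) b = c * circ h a b :=
  eq_of_eqUpTo fun n => (circ_eqUpTo h n _ _).trans <| by
    refine EqUpTo.trans ?_ ((EqUpTo.refl n c).mul (circ_eqUpTo h n a b).symm)
    simp only [circN, contr_mul_left h hc, Finset.mul_sum]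
    exact EqUpTo.sum fun s _ => by rw [mul_left_comm]; exact EqUpTo.refl _ _

theorem circ_mul_right {c : Wick m} (hc : IsScalar c) (a b : Wick m) :
    circ h a (c * b) = c * circ h a b :=
  eq_of_eqUpTo fun n => (circ_eqUpTo h n _ _).trans <| by
    refine EqUpTo.trans ?_ ((EqUpTo.refl n c).mul (circ_eqUpTo h n a b).symm)
    simp only [circN, contr_mul_right h hc, Finset.mul_sum]
    exact EqUpTo.sum fun s _ => by rw [mul_left_comm]; exact EqUpTo.refl _ _

theorem contr_one_left (s) (b : Wick m) : contr h (s + 1) 1 b = 0 := by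
  simp [contr, contr_zero_left]

theorem contr_one_right (s) (b : Wick m) : contr h (s + 1) b 1 = 0 := by
  simp [contr, contr_zero_right]

theorem circ_one_left (b : Wick m) : circ h 1 b = b :=
  eq_of_eqUpTo fun n => (circ_eqUpTo h n _ _).trans <| by
    rw [circN, Finset.sum_range_succ']
    simp [contr_one_left, contr_zero, expCf_zero, EqUpTo.refl]

theorem circ_one_right (b : Wick m) : circ h b 1 = b :=
  eq_of_eqUpTo fun n => (circ_eqUpTo h n _ _).trans <| by
    rw [circN, Finset.sum_range_succ']
    simp [contr_one_right, contr_zero, expCf_zero, EqUpTo.refl]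

theorem circ_scalar_left {c : Wick m} (hc : IsScalar c) (b : Wick m) : circ h c b = c * b := by
  conv_lhs => rw [← mul_one c]
  rw [circ_mul_left h hc, circ_one_left]

theorem circ_scalar_right {c : Wick m} (hc : IsScalar c) (b : Wick m) : circ h b c = c * b := by
  conv_lhs => rw [← mul_one c]
  rw [circ_mul_right h hc, circ_one_right]

theorem dy_circ (k) (a b : Wick m) :
    dy k (circ h a b) = circ h (dy k a) b + circ h a (dy k b) :=
  eq_of_eqUpTo fun n => ((circ_eqUpTo h n _ _).dy k).trans <| by
    refine EqUpTo.trans ?_ ((circ_eqUpTo h n _ _).add (circ_eqUpTo h n _ _)).symm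
    simp only [circN, dy_sum, ← Finset.sum_add_distrib, ← mul_add, ← dy_contr]
    refine EqUpTo.sum fun s _ => ?_
    rw [dy_mul, ((isScalar_const _).mul (isScalar_nu_pow s)) k, zero_mul, zero_add]
    exact EqUpTo.refl _ _

/-! ### Associativity -/

/-- The symmetric three-fold contraction. -/
def tri : ℕ → Wick m → Wick m → Wick m → Wick m
  | 0, a, b, c => a * b * c
  | s + 1, a, b, c => ∑ i, ∑ j, const (h i j) * (tri s (dy i a) (dy j b) c
      + tri s (dy i a) b (dy j c) + tri s a (dy i b) (dy j c))

theorem contr_contr_left_succ (s t) (a b c : Wick m) :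
    contr h s (contr h (t + 1) a b) c
      = ∑ i, ∑ j, const (h i j) * contr h s (contr h t (dy i a) (dy j b)) c := by
  conv_lhs => rw [contr]
  simp only [contr_sum_left, contr_mul_left h (isScalar_const _)]

theorem contr_contr_right_succ (s t) (a b c : Wick m) :
    contr h s a (contr h (t + 1) b c)
      = ∑ i, ∑ j, const (h i j) * contr h s a (contr h t (dy i b) (dy j c)) := by
  conv_lhs => rw [contr]
  simp only [contr_sum_right, contr_mul_right h (isScalar_const _)]

theorem contr_succ_contr_left (s t) (a b c : Wick m) :
    contr h (s + 1) (contr h t a b) c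
      = ∑ i, ∑ j, const (h i j) * (contr h s (contr h t (dy i a) b) (dy j c)
        + contr h s (contr h t a (dy i b)) (dy j c)) := by
  simp only [contr, dy_contr, contr_add_left]

theorem contr_succ_contr_right (s t) (a b c : Wick m) :
    contr h (s + 1) a (contr h t b c)
      = ∑ i, ∑ j, const (h i j) * (contr h s (dy i a) (contr h t (dy j b) c)
        + contr h s (dy i a) (contr h t b (dy j c))) := by
  simp only [contr, dy_contr, contr_add_right]

theorem sum_choose_mul_contraction (N) (f : ℕ × ℕ → Fin (2 * m + 1) → Fin (2 * m + 1) → Wick m) :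
    ∑ p ∈ Finset.HasAntidiagonal.antidiagonal N, (N.choose p.1 : Wick m) *
      ∑ i, ∑ j, const (h i j) * f p i j =
    ∑ i, ∑ j, const (h i j) * ∑ p ∈ Finset.HasAntidiagonal.antidiagonal N,
      (N.choose p.1 : Wick m) * f p i j := by
  simp only [Finset.mul_sum]
  rw [Finset.sum_comm]
  refine Finset.sum_congr rfl fun i _ => ?_
  rw [Finset.sum_comm]
  exact Finset.sum_congr rfl fun j _ => Finset.sum_congr rfl fun p _ => by ring

theorem sum_choose_symm_mul_contraction (N)
    (f : ℕ × ℕ → Fin (2 * m + 1) → Fin (2 * m + 1) → Wick m) :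
    ∑ p ∈ Finset.HasAntidiagonal.antidiagonal N, (N.choose p.2 : Wick m) *
      ∑ i, ∑ j, const (h i j) * f p i j =
    ∑ i, ∑ j, const (h i j) * ∑ p ∈ Finset.HasAntidiagonal.antidiagonal N,
      (N.choose p.1 : Wick m) * f p i j := by
  rw [← sum_choose_mul_contraction]
  refine Finset.sum_congr rfl fun p hp => ?_
  rw [Nat.choose_symm_of_eq_add (Finset.HasAntidiagonal.mem_antidiagonal.1 hp).symm]

/-- An elementary contraction of three factors joins a to b, a to c, or b to c. Those joining a to b
form the inner contraction; the other two kinds are, by the Leibniz rule, contractions of the pair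
(a,b) with c. The kinds commute, which produces the binomial coefficients, and Pascal's rule drives
the induction. `tri_eq_right` groups the same contractions the other way. -/
theorem tri_eq_left (N) (a b c : Wick m) : tri h N a b c =
    ∑ p ∈ Finset.HasAntidiagonal.antidiagonal N,
      (N.choose p.1 : Wick m) * contr h p.1 (contr h p.2 a b) c := by
  induction N generalizing a b c with
  | zero => simp [tri, contr]
  | succ N ih =>
    rw [Finset.sum_antidiagonal_choose_succ_mul (fun s t => contr h s (contr h t a b) c)]
    simp only [tri, ih, contr_contr_left_succ, contr_succ_contr_left]
    -- Pascal's rule has split the sum in two; in one half the additional contraction is the inner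
    -- one, in the other the outer one.
    rw [sum_choose_mul_contraction, sum_choose_symm_mul_contraction, ← Finset.sum_add_distrib]
    refine Finset.sum_congr rfl fun i _ => ?_
    rw [← Finset.sum_add_distrib]
    refine Finset.sum_congr rfl fun j _ => ?_
    rw [← mul_add, ← Finset.sum_add_distrib, ← Finset.sum_add_distrib, ← Finset.sum_add_distrib]
    congr 1
    exact Finset.sum_congr rfl fun p _ => by ring

theorem tri_eq_right (N) (a b c : Wick m) : tri h N a b c =
    ∑ p ∈ Finset.HasAntidiagonal.antidiagonal N,
      (N.choose p.1 : Wick m) * contr h p.1 a (contr h p.2 b c) := by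
  induction N generalizing a b c with
  | zero => simp [tri, contr, mul_assoc]
  | succ N ih =>
    rw [Finset.sum_antidiagonal_choose_succ_mul (fun s t => contr h s a (contr h t b c))]
    simp only [tri, ih, contr_contr_right_succ, contr_succ_contr_right]
    rw [sum_choose_mul_contraction, sum_choose_symm_mul_contraction, ← Finset.sum_add_distrib]
    refine Finset.sum_congr rfl fun i _ => ?_
    rw [← Finset.sum_add_distrib]
    refine Finset.sum_congr rfl fun j _ => ?_
    rw [← mul_add, ← Finset.sum_add_distrib, ← Finset.sum_add_distrib, ← Finset.sum_add_distrib]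
    congr 1
    exact Finset.sum_congr rfl fun p _ => by ring

/-- The coefficientwise form of exp(u) exp(v) = exp(u + v) for exp(u/2). -/
theorem expCf_mul (s t : ℕ) : expCf s * expCf t = expCf (s + t) * ((s + t).choose s : ℂ) := by
  unfold expCf
  have h1 := Nat.add_choose_mul_factorial_mul_factorial s t
  have h2 : ((s + t).choose s : ℂ) * s.factorial * t.factorial = (s + t).factorial := by
    have h3 := Nat.choose_symm_add (a := s) (b := t)
    rw [← h3] at h1
    exact_mod_cast h1
  have hs : (s.factorial : ℂ) ≠ 0 := by exact_mod_cast s.factorial_ne_zero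
  have ht : (t.factorial : ℂ) ≠ 0 := by exact_mod_cast t.factorial_ne_zero
  have hst : ((s + t).factorial : ℂ) ≠ 0 := by exact_mod_cast (s + t).factorial_ne_zero
  rw [pow_add]
  field_simp
  rw [← h2]; ring

/-- Summation of a double series in powers of `ν`. -/
theorem eqUpTo_double_sum (n : ℕ) (T : ℕ → Wick m) (G : ℕ → ℕ → Wick m)
    (hT : ∀ N, T N = ∑ p ∈ Finset.HasAntidiagonal.antidiagonal N,
      (N.choose p.1 : Wick m) * G p.1 p.2) :
    EqUpTo n (∑ s ∈ Finset.range (n + 1), ∑ t ∈ Finset.range (n + 1),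
        const (expCf s) * nu ^ s * (const (expCf t) * nu ^ t * G s t))
      (∑ N ∈ Finset.range (n + 1), const (expCf N) * nu ^ N * T N) := by
  have h1 : ∀ N, const (expCf N) * nu ^ N * T N = ∑ s ∈ Finset.range (N + 1),
      const (expCf s) * nu ^ s * (const (expCf (N - s)) * nu ^ (N - s) * G s (N - s)) := by
    intro N
    rw [hT, Finset.mul_sum, Finset.Nat.sum_antidiagonal_eq_sum_range_succ_mk]
    refine Finset.sum_congr rfl fun s hs => ?_
    obtain ⟨t, rfl⟩ := Nat.exists_eq_add_of_le (Nat.lt_succ_iff.1 (Finset.mem_range.1 hs))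
    simp only [Nat.add_sub_cancel_left]
    have e : (const (expCf s) * const (expCf t) : Wick m)
        = const (expCf (s + t)) * ((s + t).choose s : Wick m) := by
      rw [← const_mul, expCf_mul, const_mul]
      congr 1
    rw [pow_add]
    linear_combination (-(nu ^ s * nu ^ t * G s t)) * e
  intro k hk d
  simp only [h1]
  rw [Finset.sum_range_diag_flip (n + 1)
    (fun s t => const (expCf s) * nu ^ s * (const (expCf t) * nu ^ t * G s t)), cf_sum, cf_sum]
  refine Finset.sum_congr rfl fun s hs => ?_
  rw [cf_sum, cf_sum]
  symm
  -- The square contains the triangle s + t ≤ n. The surplus terms carry ν^(s+t) with s + t > n, so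
  -- they vanish in the coefficients considered.
  refine Finset.sum_subset ?_ fun t _ ht => ?_
  · intro t; simp; omega
  · rw [cf_term]
    split_ifs with h2
    · rw [cf_term, if_neg, mul_zero]
      simp at ht hs ⊢
      omega
    · rfl

theorem circN_circN_left (n) (a b c : Wick m) :
    EqUpTo n (circN h n (circN h n a b) c)
      (∑ N ∈ Finset.range (n + 1), const (expCf N) * nu ^ N * tri h N a b c) := by
  refine EqUpTo.trans ?_
    (eqUpTo_double_sum n (fun N => tri h N a b c)
      (fun s t => contr h s (contr h t a b) c) (fun N => tri_eq_left h N a b c))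
  unfold circN
  refine EqUpTo.sum fun s _ => ?_
  rw [contr_sum_left, Finset.mul_sum]
  refine EqUpTo.sum fun t _ => ?_
  rw [contr_mul_left h ((isScalar_const _).mul (isScalar_nu_pow _))]
  exact EqUpTo.refl _ _

theorem circN_circN_right (n) (a b c : Wick m) :
    EqUpTo n (circN h n a (circN h n b c))
      (∑ N ∈ Finset.range (n + 1), const (expCf N) * nu ^ N * tri h N a b c) := by
  refine EqUpTo.trans ?_
    (eqUpTo_double_sum n (fun N => tri h N a b c)
      (fun s t => contr h s a (contr h t b c)) (fun N => tri_eq_right h N a b c))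
  unfold circN
  refine EqUpTo.sum fun s _ => ?_
  rw [contr_sum_right, Finset.mul_sum]
  refine EqUpTo.sum fun t _ => ?_
  rw [contr_mul_right h ((isScalar_const _).mul (isScalar_nu_pow _))]
  exact EqUpTo.refl _ _

/-- Up to any power of ν both bracketings equal the exponential of the three-fold contraction `tri`,
which prefers neither side. -/
theorem circ_assoc (a b c : Wick m) : circ h (circ h a b) c = circ h a (circ h b c) := by
  refine eq_of_eqUpTo fun n => ?_
  have h1 : EqUpTo n (circ h (circ h a b) c) (circN h n (circN h n a b) c) :=
    (circ_eqUpTo h n _ _).trans (EqUpTo.circN h (circ_eqUpTo h n a b) (EqUpTo.refl n c))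
  have h2 : EqUpTo n (circ h a (circ h b c)) (circN h n a (circN h n b c)) :=
    (circ_eqUpTo h n _ _).trans (EqUpTo.circN h (EqUpTo.refl n a) (circ_eqUpTo h n b c))
  exact h1.trans ((circN_circN_left h n a b c).trans
    (h2.trans (circN_circN_right h n a b c)).symm)

/-! ### Filtration degrees of products -/

theorem InFiltration.contr {p q r s : ℕ} {a b : Wick m} (ha : InFiltration p a)
    (hb : InFiltration q b) (hr : r + 2 * s ≤ p + q) : InFiltration r (contr h s a b) := by
  induction s generalizing a b p q with
  | zero => exact (ha.mul hb).mono hr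
  | succ s ih =>
    refine InFiltration.sum fun i _ => InFiltration.sum fun j _ => ?_
    exact (ih (ha.dy i) (hb.dy j) (by omega)).const_mul _

theorem InFiltration.circ {p q : ℕ} {a b : Wick m} (ha : InFiltration p a)
    (hb : InFiltration q b) : InFiltration (p + q) (circ h a b) := fun k d hk => by
  rw [cf_circ]
  refine Finset.sum_eq_zero fun u hu => ?_
  have := Finset.HasAntidiagonal.mem_antidiagonal.1 hu
  by_cases h0 : 2 * u.1 ≤ p + q
  · rw [(ha.contr h hb (r := p + q - 2 * u.1) (by omega)) _ _ (by omega), mul_zero]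
  · omega

/-! ### The bracket `(i/ν) [·, ·]` -/

/-- `(i/ν) [a, b]`. -/
def br (a b : Wick m) : Wick m := const Complex.I * divNu (circ h a b - circ h b a)

theorem cf_divNu (k d) (w : Wick m) : cf k d (divNu w) = cf (k + 1) d w := by
  unfold cf divNu
  rw [PowerSeries.coeff_mk]

theorem cf_circ_zero (d) (a b : Wick m) : cf 0 d (circ h a b) = cf 0 d (a * b) := by
  rw [cf_circ]
  simp [expCf, contr]

theorem nu_mul_divNu {w : Wick m} (hw : ∀ d, cf 0 d w = 0) : nu * divNu w = w := by
  refine ext_cf fun k d => ?_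
  rw [cf_nu_mul]
  split_ifs with hk
  · rw [cf_divNu]; congr 1; omega
  · obtain rfl : k = 0 := by omega
    rw [hw]

/-- At ν = 0 the product ∘ is the commutative one, so a commutator has no ν⁰-term and `divNu`
discards nothing. -/
theorem nu_mul_br (a b : Wick m) : nu * br h a b = const Complex.I * (circ h a b - circ h b a) := by
  unfold br
  rw [mul_left_comm, nu_mul_divNu]
  intro d
  rw [cf_sub, cf_circ_zero, cf_circ_zero, mul_comm, sub_self]

theorem br_add_left (a a' b : Wick m) : br h (a + a') b = br h a b + br h a' b := by
  apply nu_mul_cancel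
  rw [mul_add]; simp only [nu_mul_br, circ_add_left, circ_add_right]; ring

theorem br_add_right (a b b' : Wick m) : br h a (b + b') = br h a b + br h a b' := by
  apply nu_mul_cancel
  rw [mul_add]; simp only [nu_mul_br, circ_add_left, circ_add_right]; ring

theorem br_swap (a b : Wick m) : br h a b = -br h b a := by
  apply nu_mul_cancel
  rw [mul_neg]; simp only [nu_mul_br]; ring

/-- The bracket as a biadditive map. -/
def brHom : Wick m →+ Wick m →+ Wick m :=
  AddMonoidHom.mk' (fun a => AddMonoidHom.mk' (fun b => br h a b) (br_add_right h a))
    (fun a a' => by ext1 b; exact br_add_left h a a' b)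

theorem br_zero_left (b : Wick m) : br h 0 b = 0 := map_zero ((brHom h).flip b)
theorem br_zero_right (a : Wick m) : br h a 0 = 0 := map_zero (brHom h a)
theorem br_sub_left (a a' b : Wick m) : br h (a - a') b = br h a b - br h a' b :=
  map_sub ((brHom h).flip b) a a'
theorem br_sub_right (a b b' : Wick m) : br h a (b - b') = br h a b - br h a b' :=
  map_sub (brHom h a) b b'
theorem br_neg_right (a b : Wick m) : br h a (-b) = -br h a b := map_neg (brHom h a) b
theorem br_sum_left {ι : Type*} (t : Finset ι) (f : ι → Wick m) (b : Wick m) :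
    br h (∑ i ∈ t, f i) b = ∑ i ∈ t, br h (f i) b := map_sum ((brHom h).flip b) f t
theorem br_sum_right {ι : Type*} (t : Finset ι) (a : Wick m) (f : ι → Wick m) :
    br h a (∑ i ∈ t, f i) = ∑ i ∈ t, br h a (f i) := map_sum (brHom h a) f t

theorem br_mul_left {c : Wick m} (hc : IsScalar c) (a b : Wick m) :
    br h (c * a) b = c * br h a b := by
  apply nu_mul_cancel
  rw [mul_left_comm]
  simp only [nu_mul_br, circ_mul_left h hc, circ_mul_right h hc]; ring

theorem br_mul_right {c : Wick m} (hc : IsScalar c) (a b : Wick m) :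
    br h a (c * b) = c * br h a b := by
  apply nu_mul_cancel
  rw [mul_left_comm]
  simp only [nu_mul_br, circ_mul_left h hc, circ_mul_right h hc]; ring

theorem br_scalar_right {c : Wick m} (hc : IsScalar c) (a : Wick m) : br h a c = 0 := by
  apply nu_mul_cancel
  rw [nu_mul_br, circ_scalar_left h hc, circ_scalar_right h hc]; simp

theorem br_scalar_left {c : Wick m} (hc : IsScalar c) (a : Wick m) : br h c a = 0 := by
  rw [br_swap, br_scalar_right h hc, neg_zero]

theorem br_circ (a b c : Wick m) :
    br h a (circ h b c) = circ h (br h a b) c + circ h b (br h a c) := by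
  apply nu_mul_cancel
  rw [mul_add, ← circ_mul_left h isScalar_nu, ← circ_mul_right h isScalar_nu]
  simp only [nu_mul_br, circ_mul_left h (isScalar_const _), circ_mul_right h (isScalar_const _),
    circ_sub_left, circ_sub_right, circ_assoc]
  ring

theorem br_jacobi (a b c : Wick m) : br h a (br h b c) = br h (br h a b) c + br h b (br h a c) := by
  -- A nested bracket contains two divisions by ν, hence two factors ν. What remains is the Jacobi
  -- identity for commutators of an associative product.
  have e : ∀ u v w : Wick m, nu * (nu * br h u (br h v w)) =
      const Complex.I * (const Complex.I * (circ h u (circ h v w) - circ h u (circ h w v)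
        - circ h (circ h v w) u + circ h (circ h w v) u)) := by
    intro u v w
    rw [nu_mul_br, mul_left_comm, mul_sub nu, ← circ_mul_left h isScalar_nu (br h v w) u,
      ← circ_mul_right h isScalar_nu u, nu_mul_br, circ_mul_left h (isScalar_const _),
      circ_mul_right h (isScalar_const _), circ_sub_left, circ_sub_right]
    ring
  apply nu_mul_cancel
  apply nu_mul_cancel
  rw [br_swap h (br h a b) c, mul_add, mul_add, mul_neg, mul_neg, e, e, e]
  simp only [circ_assoc]
  ring

theorem dy_br (k) (a b : Wick m) : dy k (br h a b) = br h (dy k a) b + br h a (dy k b) := by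
  apply nu_mul_cancel
  have e : ∀ w : Wick m, nu * dy k w = dy k (nu * w) := fun w => by
    rw [dy_mul, isScalar_nu, zero_mul, zero_add]
  rw [e, mul_add]
  simp only [nu_mul_br, dy_const_mul, dy_sub, dy_circ]
  ring

/-- The division by ν costs two degrees. Consequently (i/ν)[r, ·] with r ∈ F² does not lower the
filtration, on which both contraction arguments depend. -/
theorem InFiltration.br {p q r : ℕ} {a b : Wick m} (ha : InFiltration p a)
    (hb : InFiltration q b) (hr : r + 2 ≤ p + q) : InFiltration r (br h a b) := by
  refine InFiltration.const_mul (fun k d hk => ?_) _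
  rw [cf_divNu, cf_sub, (ha.circ h hb) _ _ (by omega), (hb.circ h ha) _ _ (by omega), sub_zero]

theorem contr_swap (s) (a b : Wick m) : contr h s b a = contr (fun i j => h j i) s a b := by
  induction s generalizing a b with
  | zero => simp [contr, mul_comm]
  | succ s ih =>
    simp only [contr, ih]
    rw [Finset.sum_comm]

theorem contr_two (a b : Wick m) : contr h 2 a b =
    ∑ i, ∑ j, const (h i j) * ∑ k, ∑ l, const (h k l) * (dy k (dy i a) * dy l (dy j b)) := rfl

theorem contr_eq_zero_of_cubic {a : Wick m} (ha : ∀ i j k, dy i (dy j (dy k a)) = 0)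
    (s : ℕ) (b : Wick m) : contr h (s + 3) a b = 0 := by
  simp [contr, ha, contr_zero_left]

/-- The bracket with a quadratic element. -/
theorem br_of_quadratic {a : Wick m} (ha : ∀ i j k, dy i (dy j (dy k a)) = 0) (b : Wick m) :
    br h a b = const Complex.I * (const (1 / 2) * (contr h 1 a b - contr h 1 b a)
      + const (1 / 8) * nu * (contr h 2 a b - contr h 2 b a)) := by
  have hc : ∀ s b, contr h (s + 3) b a = 0 := fun s b => by
    rw [contr_swap, contr_eq_zero_of_cubic _ ha]
  apply nu_mul_cancel
  rw [nu_mul_br, mul_left_comm]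
  congr 1
  -- Only the contractions of order 0, 1 and 2 survive, with coefficients 1, 1/2 and (1/2)²/2! =
  -- 1/8. Cutting at `n + 2` guarantees that all three are present.
  have e : ∀ n, EqUpTo n (circ h a b) (a * b + nu * (const (1 / 2) * contr h 1 a b
      + const (1 / 8) * nu * contr h 2 a b)) := fun n => by
    intro k hk d
    rw [circ_eqUpTo h (n + 2) a b k (by omega), circN, Finset.sum_range_succ',
      Finset.sum_range_succ', Finset.sum_range_succ']
    simp only [contr_eq_zero_of_cubic h ha, mul_zero, Finset.sum_const_zero]
    congr 1
    simp [expCf, contr]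
    norm_num
    ring
  have e' : ∀ n, EqUpTo n (circ h b a) (a * b + nu * (const (1 / 2) * contr h 1 b a
      + const (1 / 8) * nu * contr h 2 b a)) := fun n => by
    intro k hk d
    rw [circ_eqUpTo h (n + 2) b a k (by omega), circN, Finset.sum_range_succ',
      Finset.sum_range_succ', Finset.sum_range_succ']
    simp only [hc, mul_zero, Finset.sum_const_zero]
    congr 1
    simp [expCf, contr]
    norm_num
    ring
  rw [eq_of_eqUpTo e, eq_of_eqUpTo e']
  ring

end Wick

/-- The matrix entries of an endomorphism of the model space. -/
def ent {m : ℕ} (L : Model m →L[ℝ] Model m) (i j : Fin (2 * m + 1)) : ℝ :=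
  coord (L (stdVec m j)) i

theorem ent_id {m : ℕ} (i j : Fin (2 * m + 1)) :
    ent (ContinuousLinearMap.id ℝ (Model m)) i j = if i = j then 1 else 0 := by
  simp [ent, stdVec, coord]

theorem coord_eq_sum_ent {m : ℕ} (L : Model m →L[ℝ] Model m) (v : Model m) (i) :
    coord (L v) i = ∑ j, ent L i j * coord v j := by
  have hv : v = ∑ j, coord v j • stdVec m j := by
    ext i; simp [stdVec, coord, Finset.sum_apply, Pi.single_apply]
  conv_lhs => rw [hv]
  rw [map_sum]
  simp [ent, coord, mul_comm]

theorem ent_comp {m : ℕ} (A B : Model m →L[ℝ] Model m) (i j : Fin (2 * m + 1)) :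
    ent (A ∘L B) i j = ∑ k, ent A i k * ent B k j := by
  unfold ent
  rw [ContinuousLinearMap.comp_apply, coord_eq_sum_ent]
  rfl

namespace Wick

variable {m : ℕ}

/-! ### Monomials -/

/-- The monomial `y^e`. -/
def mon (e : Fin (2 * m + 1) →₀ ℕ) : Wick m := PowerSeries.C (MvPowerSeries.monomial e 1)

theorem cf_mon (k d) (e : Fin (2 * m + 1) →₀ ℕ) :
    cf k d (mon e) = if k = 0 ∧ d = e then 1 else 0 := by
  classical
  unfold cf mon
  rw [PowerSeries.coeff_C]
  by_cases hk : k = 0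
  · simp [hk, MvPowerSeries.coeff_monomial]
  · simp [hk]

theorem mon_zero : mon (0 : Fin (2 * m + 1) →₀ ℕ) = 1 := by
  simp [mon]

theorem mon_single (i) : mon (Finsupp.single i 1) = (y i : Wick m) := rfl

theorem mon_add (e e' : Fin (2 * m + 1) →₀ ℕ) : mon (e + e') = mon e * mon e' := by
  unfold mon
  rw [← map_mul, MvPowerSeries.monomial_mul_monomial, one_mul]

theorem mon_induction {P : Wick m → Prop} (h1 : P 1)
    (hy : ∀ i w, P w → P (y i * w)) (e : Fin (2 * m + 1) →₀ ℕ) : P (mon e) := by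
  induction e using Finsupp.induction_linear with
  | zero => rw [mon_zero]; exact h1
  | add f g _ _ =>
    have : ∀ (n : ℕ) (e : Fin (2 * m + 1) →₀ ℕ), e.degree = n → P (mon e) := by
      intro n
      induction n with
      | zero =>
        intro e he
        rw [(Finsupp.degree_eq_zero_iff e).1 he, mon_zero]; exact h1
      | succ n ih =>
        intro e he
        obtain ⟨i, hi⟩ : ∃ i, e i ≠ 0 := by
          by_contra hcon
          push Not at hcon
          have : e = 0 := Finsupp.ext hcon
          simp [this] at he
        have hs := sub_add_single hi
        rw [← hs, add_comm, mon_add, mon_single]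
        refine hy _ _ (ih _ ?_)
        have := degree_add_single (e - Finsupp.single i 1) i
        rw [hs] at this; omega
    exact this _ _ rfl
  | single i n =>
    induction n with
    | zero => simpa [mon_zero] using h1
    | succ n ih =>
      rw [Finsupp.single_add, add_comm, mon_add, mon_single]
      exact hy _ _ ih

/-- The multi-indices of a given degree. -/
def multiIdx (m n : ℕ) : Finset (Fin (2 * m + 1) →₀ ℕ) := Finset.finsuppAntidiag Finset.univ n

theorem mem_multiIdx {n} {e : Fin (2 * m + 1) →₀ ℕ} : e ∈ multiIdx m n ↔ e.degree = n := by
  simp [multiIdx, Finset.mem_finsuppAntidiag, Finsupp.degree_eq_sum]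

/-- Functionals which see only the terms `ν^k y^e` with `|e| = n` are determined by their values
on monomials. -/
theorem functional_eq_sum (k n : ℕ) (F : Wick m →+ ℂ)
    (hF : ∀ w, (∀ e : Fin (2 * m + 1) →₀ ℕ, e.degree = n → cf k e w = 0) → F w = 0) (w : Wick m) :
    F w = ∑ e ∈ multiIdx m n, F (const (cf k e w) * nu ^ k * mon e) := by
  rw [← map_sum, ← sub_eq_zero, ← map_sub]
  refine hF _ fun e he => ?_
  simp only [cf_sub, cf_sum]
  rw [Finset.sum_eq_single e]
  · rw [mul_assoc, cf_const_mul, cf_nu_pow_mul, if_pos le_rfl, cf_mon]; simp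
  · intro e' _ hne
    rw [mul_assoc, cf_const_mul, cf_nu_pow_mul, if_pos le_rfl, cf_mon, if_neg, mul_zero]
    exact fun h => hne h.2.symm
  · intro h; exact absurd (mem_multiIdx.2 he) h

theorem functional_ext (k n : ℕ) (F G : Wick m →+ ℂ)
    (hF : ∀ w, (∀ e : Fin (2 * m + 1) →₀ ℕ, e.degree = n → cf k e w = 0) → F w = 0)
    (hG : ∀ w, (∀ e : Fin (2 * m + 1) →₀ ℕ, e.degree = n → cf k e w = 0) → G w = 0)
    (h : ∀ z e, F (const z * nu ^ k * mon e) = G (const z * nu ^ k * mon e)) (w : Wick m) :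
    F w = G w := by
  rw [functional_eq_sum k n F hF, functional_eq_sum k n G hG]
  exact Finset.sum_congr rfl fun e _ => h _ _

/-- Maps which do not mix degrees. -/
def DegreePreserving (f : Wick m → Wick m) : Prop :=
  ∀ k (d : Fin (2 * m + 1) →₀ ℕ) w,
    (∀ e : Fin (2 * m + 1) →₀ ℕ, e.degree = d.degree → cf k e w = 0) → cf k d (f w) = 0

/-- The degree hypotheses replace continuity: on power series a ring homomorphism need not be
determined by its values on constants, ν and the y^i. -/
theorem ringHom_ext {f g : Wick m →+* Wick m} (hf : DegreePreserving f) (hg : DegreePreserving g)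
    (hc : ∀ z, f (const z) = g (const z)) (hn : f nu = g nu) (hy : ∀ i, f (y i) = g (y i)) :
    f = g := by
  ext1 w
  refine ext_cf fun k d => ?_
  refine functional_ext k d.degree ((cfHom k d).comp f.toAddMonoidHom)
    ((cfHom k d).comp g.toAddMonoidHom) (fun w hw => hf k d w hw) (fun w hw => hg k d w hw)
    (fun z e => ?_) w
  have he : f (mon e) = g (mon e) := by
    refine mon_induction (P := fun w => f w = g w) (by simp) (fun i w hw => ?_) e
    rw [map_mul, map_mul, hw, hy]
  show cf k d (f _) = cf k d (g _)
  simp only [map_mul, map_pow, hc, hn, he]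

/-! ### Linear substitutions -/

/-- The linear form `(L y)^i`. -/
def linForm (L : Model m →L[ℝ] Model m) (i : Fin (2 * m + 1)) : YSeries m :=
  ∑ j, MvPowerSeries.C ((coord (L (stdVec m j)) i : ℝ) : ℂ) * MvPowerSeries.X j

theorem hasSubst_linForm (L : Model m →L[ℝ] Model m) : MvPowerSeries.HasSubst (linForm L) := by
  refine MvPowerSeries.hasSubst_of_constantCoeff_zero fun i => ?_
  simp [linForm]

/-- The linear substitution as a ring homomorphism. -/
def linHom (L : Model m →L[ℝ] Model m) : Wick m →+* Wick m :=
  PowerSeries.map (MvPowerSeries.substAlgHom (hasSubst_linForm L) : YSeries m →ₐ[ℂ] YSeries m)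

theorem linHom_apply (L : Model m →L[ℝ] Model m) (w : Wick m) : linHom L w = linSubst L w := by
  refine PowerSeries.ext fun k => ?_
  unfold linSubst linHom
  rw [PowerSeries.coeff_map, PowerSeries.coeff_mk]
  show MvPowerSeries.substAlgHom (hasSubst_linForm L) _ = _
  rw [MvPowerSeries.substAlgHom_apply]
  rfl

variable (L : Model m →L[ℝ] Model m)

theorem linSubst_add (a b : Wick m) : linSubst L (a + b) = linSubst L a + linSubst L b := by
  simp only [← linHom_apply, map_add]
theorem linSubst_sub (a b : Wick m) : linSubst L (a - b) = linSubst L a - linSubst L b := by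
  simp only [← linHom_apply, map_sub]
theorem linSubst_neg (a : Wick m) : linSubst L (-a) = -linSubst L a := by
  simp only [← linHom_apply, map_neg]
theorem linSubst_mul (a b : Wick m) : linSubst L (a * b) = linSubst L a * linSubst L b := by
  simp only [← linHom_apply, map_mul]
@[simp] theorem linSubst_zero : linSubst L (0 : Wick m) = 0 := by
  simp only [← linHom_apply, map_zero]
@[simp] theorem linSubst_one : linSubst L (1 : Wick m) = 1 := by
  simp only [← linHom_apply, map_one]
theorem linSubst_sum {ι : Type*} (s : Finset ι) (f : ι → Wick m) :
    linSubst L (∑ i ∈ s, f i) = ∑ i ∈ s, linSubst L (f i) := by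
  simp only [← linHom_apply, map_sum]
theorem linSubst_pow (a : Wick m) (n : ℕ) : linSubst L (a ^ n) = linSubst L a ^ n := by
  simp only [← linHom_apply, map_pow]

@[simp] theorem linSubst_const (z : ℂ) : linSubst L (const z : Wick m) = const z := by
  rw [← linHom_apply]
  unfold linHom const
  rw [PowerSeries.map_C]
  congr 1
  show MvPowerSeries.substAlgHom (hasSubst_linForm L) _ = _
  exact (MvPowerSeries.substAlgHom (hasSubst_linForm L)).commutes z

@[simp] theorem linSubst_nu : linSubst L (nu : Wick m) = nu := by
  rw [← linHom_apply]
  unfold linHom nu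
  rw [PowerSeries.map_X]

theorem linSubst_y (i) : linSubst L (y i : Wick m) = ∑ j, const (ent L i j : ℂ) * y j := by
  rw [← linHom_apply]
  unfold linHom y
  rw [PowerSeries.map_C]
  show PowerSeries.C (MvPowerSeries.substAlgHom (hasSubst_linForm L) _) = _
  rw [MvPowerSeries.substAlgHom_X]
  simp [linForm, const, ent]

/-- A product of linear forms comes from a homogeneous polynomial whose degree is the number of
factors. -/
theorem linForm_pow_coeff (e d : Fin (2 * m + 1) →₀ ℕ) (hne : e.degree ≠ d.degree) :
    MvPowerSeries.coeff d (e.prod fun i n => linForm L i ^ n) = 0 := by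
  have hp : ∀ i, ∃ p : MvPolynomial (Fin (2 * m + 1)) ℂ, p.IsHomogeneous 1 ∧
      (p : YSeries m) = linForm L i := fun i =>
    ⟨∑ j, MvPolynomial.C ((coord (L (stdVec m j)) i : ℝ) : ℂ) * MvPolynomial.X j,
      MvPolynomial.IsHomogeneous.sum _ _ _ fun j _ => MvPolynomial.isHomogeneous_C_mul_X _ _, by
        simp only [linForm]
        rw [← MvPolynomial.coeToMvPowerSeries.ringHom_apply, map_sum]
        refine Finset.sum_congr rfl fun j _ => ?_
        simp⟩
  choose p hp1 hp2 using hp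
  have h1 : (e.prod fun i n => linForm L i ^ n)
      = ((e.prod fun i n => p i ^ n : MvPolynomial (Fin (2 * m + 1)) ℂ) : YSeries m) := by
    unfold Finsupp.prod
    rw [← MvPolynomial.coeToMvPowerSeries.ringHom_apply, map_prod]
    refine Finset.prod_congr rfl fun i _ => ?_
    rw [map_pow, MvPolynomial.coeToMvPowerSeries.ringHom_apply, hp2]
  rw [h1, MvPolynomial.coeff_coe]
  have h2 : (e.prod fun i n => p i ^ n).IsHomogeneous (∑ i ∈ e.support, 1 * e i) :=
    MvPolynomial.IsHomogeneous.prod _ _ _ fun i _ => (hp1 i).pow _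
  refine h2.coeff_eq_zero ?_
  intro h3
  apply hne
  rw [h3]
  simp [Finsupp.degree_apply]

/-- Substituting linear forms preserves the degree, so only finitely many monomials contribute to a
coefficient. This makes the coefficients of a section in another chart finite sums, to which
smoothness arguments apply. -/
theorem cf_linSubst (k d) (w : Wick m) : cf k d (linSubst L w) =
    ∑ e ∈ multiIdx m d.degree,
      cf k e w * MvPowerSeries.coeff d (e.prod fun i n => linForm L i ^ n) := by
  have h1 : cf k d (linSubst L w) = ∑ᶠ e, cf k e w *
      MvPowerSeries.coeff d (e.prod fun i n => linForm L i ^ n) := by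
    unfold cf linSubst
    rw [PowerSeries.coeff_mk]
    exact MvPowerSeries.coeff_subst (hasSubst_linForm L) _ _
  rw [h1, finsum_eq_sum_of_support_subset]
  intro e he
  simp only [Finset.mem_coe, mem_multiIdx]
  by_contra hne
  exact he (by
    show _ * MvPowerSeries.coeff d (e.prod fun i n => linForm L i ^ n) = 0
    rw [linForm_pow_coeff L e d hne, mul_zero])

theorem degreePreserving_linSubst : DegreePreserving (linSubst L : Wick m → Wick m) := by
  intro k d w hw
  rw [cf_linSubst]
  exact Finset.sum_eq_zero fun e he => by rw [hw e (mem_multiIdx.1 he), zero_mul]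

theorem linSubst_id (w : Wick m) : linSubst (ContinuousLinearMap.id ℝ (Model m)) w = w := by
  rw [← linHom_apply]
  have : linHom (ContinuousLinearMap.id ℝ (Model m)) = RingHom.id (Wick m) := by
    refine ringHom_ext ?_ (fun k d w hw => hw d rfl) (fun z => ?_) ?_ (fun i => ?_)
    · intro k d w hw
      rw [linHom_apply]; exact degreePreserving_linSubst _ k d w hw
    · rw [linHom_apply]; simp
    · rw [linHom_apply]; simp
    · rw [linHom_apply, linSubst_y]
      simp only [ent_id]
      rw [Finset.sum_eq_single i]
      · simp
      · intro j _ hj; simp [Ne.symm hj]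
      · simp
  rw [this]; rfl

theorem linSubst_linSubst (A B : Model m →L[ℝ] Model m) (w : Wick m) :
    linSubst B (linSubst A w) = linSubst (A ∘L B) w := by
  simp only [← linHom_apply]
  have : (linHom B).comp (linHom A) = linHom (A ∘L B) := by
    refine ringHom_ext ?_ ?_ (fun z => ?_) ?_ (fun i => ?_)
    · intro k d w hw
      rw [RingHom.comp_apply, linHom_apply, linHom_apply]
      refine degreePreserving_linSubst _ k d _ fun e he => ?_
      exact degreePreserving_linSubst _ k e _ fun e' he' => hw e' (he'.trans he)
    · intro k d w hw
      rw [linHom_apply]; exact degreePreserving_linSubst _ k d w hw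
    · simp [linHom_apply]
    · simp [linHom_apply]
    · simp only [RingHom.comp_apply, linHom_apply, linSubst_y, linSubst_sum, linSubst_mul,
        linSubst_const, ent_comp, Complex.ofReal_sum, const_sum, Finset.mul_sum, Finset.sum_mul]
      rw [Finset.sum_comm]
      refine Finset.sum_congr rfl fun j _ => Finset.sum_congr rfl fun k _ => ?_
      rw [← mul_assoc, ← const_mul, Complex.ofReal_mul]
  rw [← this]; rfl

theorem linSubst_yScale (c) (w : Wick m) : linSubst L (yScale c w) = yScale c (linSubst L w) := by
  refine ext_cf fun k d => ?_
  rw [cf_yScale, cf_linSubst, cf_linSubst, Finset.mul_sum]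
  refine Finset.sum_congr rfl fun e he => ?_
  rw [cf_yScale, mem_multiIdx.1 he]; ring

theorem InFiltration.linSubst {n} {w : Wick m} (hw : InFiltration n w) :
    InFiltration n (linSubst L w) := fun k d hk => by
  refine degreePreserving_linSubst L k d w fun e he => hw _ _ (by omega)

theorem EqUpTo.linSubst {n} {w w' : Wick m} (e : EqUpTo n w w') :
    EqUpTo n (linSubst L w) (linSubst L w') := fun k hk d => by
  simp only [cf_linSubst, e k hk]

/-- The chain rule. For a given coefficient both sides see only terms of one degree, so
`functional_ext` reduces it to monomials, where it follows by induction from the product rule. -/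
theorem dy_linSubst (i) (w : Wick m) :
    dy i (linSubst L w) = ∑ j, const (ent L j i : ℂ) * linSubst L (dy j w) := by
  refine ext_cf fun k d => ?_
  let F : Wick m →+ ℂ := (cfHom k d).comp ((dyD i).toLinearMap.toAddMonoidHom.comp
    (linHom L).toAddMonoidHom)
  let G : Wick m →+ ℂ := ∑ j, (AddMonoidHom.mulLeft (ent L j i : ℂ)).comp
    ((cfHom k d).comp ((linHom L).toAddMonoidHom.comp (dyD j).toLinearMap.toAddMonoidHom))
  have hF : ∀ w, F w = cf k d (dy i (linSubst L w)) := fun w => by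
    rw [← linHom_apply]; rfl
  have hG : ∀ w, G w = cf k d (∑ j, const (ent L j i : ℂ) * linSubst L (dy j w)) := fun w => by
    simp only [cf_sum, cf_const_mul, ← linHom_apply]
    simp [G]
    rfl
  rw [← hF, ← hG]
  refine functional_ext k (d.degree + 1) F G (fun w hw => ?_) (fun w hw => ?_) (fun z e => ?_) w
  · rw [hF, cf_dy, degreePreserving_linSubst, zero_mul]
    intro e he
    exact hw e (by rw [he, degree_add_single])
  · rw [hG, cf_sum]
    refine Finset.sum_eq_zero fun j _ => ?_
    rw [cf_const_mul, degreePreserving_linSubst, mul_zero]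
    intro e he
    rw [cf_dy, hw _ (by rw [degree_add_single, he]), zero_mul]
  · rw [hF, hG]
    congr 1
    have hsc : IsScalar (const z * nu ^ k : Wick m) := (isScalar_const z).mul (isScalar_nu_pow k)
    have h0 : dy i (linSubst L (mon e)) = ∑ j, const (ent L j i : ℂ) * linSubst L (dy j (mon e)) := by
      refine mon_induction (P := fun w => dy i (linSubst L w) =
        ∑ j, const (ent L j i : ℂ) * linSubst L (dy j w)) (by simp) (fun l w hw => ?_) e
      simp only [linSubst_mul, dy_mul, hw, linSubst_add, mul_add, Finset.sum_add_distrib, dy_y]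
      congr 1
      · rw [linSubst_y, dy_sum, Finset.sum_mul]
        rw [Finset.sum_eq_single i, Finset.sum_eq_single l]
        · simp [dy_y]
        · intro j _ hj; simp [hj]
        · simp
        · intro j _ hj; simp [dy_y, Ne.symm hj]
        · simp
      · rw [Finset.mul_sum]
        exact Finset.sum_congr rfl fun j _ => by ring
    have hL : linSubst L (const z * nu ^ k) = const z * nu ^ k := by
      rw [linSubst_mul, linSubst_pow, linSubst_const, linSubst_nu]
    rw [linSubst_mul, hL, dy_mul, hsc, zero_mul, zero_add, h0, Finset.mul_sum]
    refine Finset.sum_congr rfl fun j _ => ?_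
    rw [dy_mul, hsc, zero_mul, zero_add, linSubst_mul, hL]; ring

theorem IsScalar.linSubst {c : Wick m} (hc : IsScalar c) : IsScalar (linSubst L c) := fun i => by
  rw [dy_linSubst]
  exact Finset.sum_eq_zero fun j _ => by rw [hc, linSubst_zero, mul_zero]

/-- The transformation law of a contravariant two-tensor. -/
def TensorRel (h h' : Fin (2 * m + 1) → Fin (2 * m + 1) → ℂ) : Prop :=
  ∀ i j, h i j = ∑ k, ∑ l, (ent L i k : ℂ) * h' k l * (ent L j l : ℂ)

variable {L} {h h' : Fin (2 * m + 1) → Fin (2 * m + 1) → ℂ}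

/-- The chain rule produces one Jacobian factor for each index of the tensor; the transformation law
of `h` absorbs them. Hence ∘ and its bracket do not depend on the coordinates. -/
theorem linSubst_contr (hr : TensorRel L h h') (s) (a b : Wick m) :
    linSubst L (contr h s a b) = contr h' s (linSubst L a) (linSubst L b) := by
  induction s generalizing a b with
  | zero => simp [contr, linSubst_mul]
  | succ s ih =>
    simp only [contr, linSubst_sum, linSubst_mul, linSubst_const, ih, dy_linSubst, contr_sum_left,
      contr_sum_right, contr_mul_left h' (isScalar_const _), contr_mul_right h' (isScalar_const _)]
    have e : ∀ i j, (const (h i j) : Wick m)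
        = ∑ k, ∑ l, const (h' k l) * (const (ent L i k : ℂ) * const (ent L j l : ℂ)) := by
      intro i j
      rw [hr i j, const_sum]
      refine Finset.sum_congr rfl fun k _ => ?_
      rw [const_sum]
      refine Finset.sum_congr rfl fun l _ => ?_
      rw [const_mul, const_mul]; ring
    simp only [e, Finset.sum_mul, Finset.mul_sum]
    have e1 : ∀ f : Fin (2 * m + 1) → Fin (2 * m + 1) → Fin (2 * m + 1) → Fin (2 * m + 1) → Wick m,
        ∑ i, ∑ j, ∑ k, ∑ l, f i j k l = ∑ k, ∑ l, ∑ j, ∑ i, f i j k l := by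
      intro f
      calc ∑ i, ∑ j, ∑ k, ∑ l, f i j k l = ∑ i, ∑ k, ∑ j, ∑ l, f i j k l :=
            Finset.sum_congr rfl fun i _ => Finset.sum_comm
        _ = ∑ k, ∑ i, ∑ j, ∑ l, f i j k l := Finset.sum_comm
        _ = ∑ k, ∑ i, ∑ l, ∑ j, f i j k l :=
            Finset.sum_congr rfl fun k _ => Finset.sum_congr rfl fun i _ => Finset.sum_comm
        _ = ∑ k, ∑ l, ∑ i, ∑ j, f i j k l :=
            Finset.sum_congr rfl fun k _ => Finset.sum_comm
        _ = _ := Finset.sum_congr rfl fun k _ => Finset.sum_congr rfl fun l _ => Finset.sum_comm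
    rw [e1]
    refine Finset.sum_congr rfl fun k _ => Finset.sum_congr rfl fun l _ =>
      Finset.sum_congr rfl fun j _ => Finset.sum_congr rfl fun i _ => by ring

theorem linSubst_circ (hr : TensorRel L h h') (a b : Wick m) :
    linSubst L (circ h a b) = circ h' (linSubst L a) (linSubst L b) := by
  refine eq_of_eqUpTo fun n => ((circ_eqUpTo h n a b).linSubst L).trans
    (EqUpTo.trans ?_ (circ_eqUpTo h' n _ _).symm)
  simp only [circN, linSubst_sum, linSubst_mul, linSubst_const, linSubst_pow, linSubst_nu,
    linSubst_contr hr]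
  exact EqUpTo.refl _ _

theorem linSubst_br (hr : TensorRel L h h') (a b : Wick m) :
    linSubst L (br h a b) = br h' (linSubst L a) (linSubst L b) := by
  apply nu_mul_cancel
  rw [nu_mul_br, ← linSubst_circ hr, ← linSubst_circ hr, ← linSubst_sub]
  conv_lhs => rw [← linSubst_nu L]
  rw [← linSubst_mul, nu_mul_br, linSubst_mul, linSubst_const]

end Wick

end

end WickContact

/-! ### Calculus of coefficient functions on the manifold. -/

namespace WickContact

set_option linter.unusedSectionVars false

noncomputable section

variable {m : ℕ} {M : Type*} [TopologicalSpace M] [ChartedSpace (Model m) M]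

/-! ### Derivatives of scalar functions -/

/-- Smoothness of a complex function near a point. -/
def SmC (z : M) (f : M → ℂ) : Prop := ContMDiffAt 𝓘(ℝ, Model m) 𝓘(ℝ, ℂ) ∞ f z

/-- Smoothness of a real function near a point. -/
def SmR (z : M) (f : M → ℝ) : Prop := ContMDiffAt 𝓘(ℝ, Model m) 𝓘(ℝ, ℝ) ∞ f z

theorem SmC.mdiff {z : M} {f : M → ℂ} (hf : SmC (m := m) z f) :
    MDifferentiableAt 𝓘(ℝ, Model m) 𝓘(ℝ, ℂ) f z :=
  ContMDiffAt.mdifferentiableAt hf (by simp)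

theorem SmR.mdiff {z : M} {f : M → ℝ} (hf : SmR (m := m) z f) :
    MDifferentiableAt 𝓘(ℝ, Model m) 𝓘(ℝ, ℝ) f z :=
  ContMDiffAt.mdifferentiableAt hf (by simp)

theorem smC_const (z : M) (c : ℂ) : SmC (m := m) z (fun _ => c) := contMDiffAt_const
theorem SmC.add {z : M} {f g : M → ℂ} (hf : SmC (m := m) z f) (hg : SmC (m := m) z g) :
    SmC (m := m) z (fun p => f p + g p) := ContMDiffAt.add hf hg
theorem SmC.sub {z : M} {f g : M → ℂ} (hf : SmC (m := m) z f) (hg : SmC (m := m) z g) :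
    SmC (m := m) z (fun p => f p - g p) := ContMDiffAt.sub hf hg
theorem SmC.mul {z : M} {f g : M → ℂ} (hf : SmC (m := m) z f) (hg : SmC (m := m) z g) :
    SmC (m := m) z (fun p => f p * g p) := by
  have := (ContinuousLinearMap.mul ℝ ℂ).isBoundedBilinearMap.contDiff (n := ∞)
  exact (this.contMDiff (x := (f z, g z))).comp z (ContMDiffAt.prodMk_space hf hg)
theorem SmC.sum {z : M} {ι : Type*} {s : Finset ι} {f : ι → M → ℂ}
    (hf : ∀ i ∈ s, SmC (m := m) z (f i)) : SmC (m := m) z (fun p => ∑ i ∈ s, f i p) := by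
  classical
  induction s using Finset.induction_on with
  | empty => simpa using smC_const z 0
  | insert i s hi ih =>
    simp only [Finset.sum_insert hi]
    exact (hf i (by simp)).add (ih fun j hj => hf j (by simp [hj]))
theorem SmC.congr {z : M} {f g : M → ℂ} (hf : SmC (m := m) z f) (h : g =ᶠ[𝓝 z] f) :
    SmC (m := m) z g := ContMDiffAt.congr_of_eventuallyEq hf h
theorem SmR.ofReal {z : M} {f : M → ℝ} (hf : SmR (m := m) z f) :
    SmC (m := m) z (fun p => (f p : ℂ)) :=
  (Complex.ofRealCLM.contDiff (n := ∞)).contMDiff.contMDiffAt.comp z hf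

theorem smR_const (z : M) (c : ℝ) : SmR (m := m) z (fun _ => c) := contMDiffAt_const
theorem SmR.add {z : M} {f g : M → ℝ} (hf : SmR (m := m) z f) (hg : SmR (m := m) z g) :
    SmR (m := m) z (fun p => f p + g p) := ContMDiffAt.add hf hg
theorem SmR.sub {z : M} {f g : M → ℝ} (hf : SmR (m := m) z f) (hg : SmR (m := m) z g) :
    SmR (m := m) z (fun p => f p - g p) := ContMDiffAt.sub hf hg
theorem SmR.mul {z : M} {f g : M → ℝ} (hf : SmR (m := m) z f) (hg : SmR (m := m) z g) :
    SmR (m := m) z (fun p => f p * g p) := ContMDiffAt.mul hf hg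
theorem SmR.sum {z : M} {ι : Type*} {s : Finset ι} {f : ι → M → ℝ}
    (hf : ∀ i ∈ s, SmR (m := m) z (f i)) : SmR (m := m) z (fun p => ∑ i ∈ s, f i p) := by
  classical
  induction s using Finset.induction_on with
  | empty => simpa using smR_const z 0
  | insert i s hi ih =>
    simp only [Finset.sum_insert hi]
    exact (hf i (by simp)).add (ih fun j hj => hf j (by simp [hj]))
theorem SmR.congr {z : M} {f g : M → ℝ} (hf : SmR (m := m) z f) (h : g =ᶠ[𝓝 z] f) :
    SmR (m := m) z g := ContMDiffAt.congr_of_eventuallyEq hf h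

variable (z : M) (v : TangentSpace 𝓘(ℝ, Model m) z)

theorem dC_const (c : ℂ) : dC (m := m) (fun _ : M => c) z v = 0 := by
  unfold dC; rw [mfderiv_const]; rfl

theorem dC_add {f g : M → ℂ} (hf : SmC (m := m) z f) (hg : SmC (m := m) z g) :
    dC (fun p => f p + g p) z v = dC f z v + dC g z v := by
  have := (hf.mdiff.hasMFDerivAt.add hg.mdiff.hasMFDerivAt).mfderiv
  unfold dC
  exact congrArg (fun L => L v) this

theorem dC_mul {f g : M → ℂ} (hf : SmC (m := m) z f) (hg : SmC (m := m) z g) :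
    dC (fun p => f p * g p) z v = dC f z v * g z + f z * dC g z v := by
  have := (hf.mdiff.hasMFDerivAt.mul hg.mdiff.hasMFDerivAt).mfderiv
  unfold dC
  refine (congrArg (fun L => L v) this).trans ?_
  simp [mul_comm]
  exact add_comm _ _

theorem dC_const_mul (c : ℂ) {f : M → ℂ} (hf : SmC (m := m) z f) :
    dC (fun p => c * f p) z v = c * dC f z v := by
  rw [dC_mul z v (smC_const z c) hf, dC_const, zero_mul, zero_add]

theorem dC_sub {f g : M → ℂ} (hf : SmC (m := m) z f) (hg : SmC (m := m) z g) :
    dC (fun p => f p - g p) z v = dC f z v - dC g z v := by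
  have h := dC_add z v hf ((smC_const z (-1)).mul hg)
  have h2 := dC_const_mul z v (-1) hg
  rw [h2] at h
  rw [show (fun p => f p - g p) = fun p => f p + -1 * g p by funext p; ring, h]; ring

theorem dC_sum {ι : Type*} {s : Finset ι} {f : ι → M → ℂ} (hf : ∀ i ∈ s, SmC (m := m) z (f i)) :
    dC (fun p => ∑ i ∈ s, f i p) z v = ∑ i ∈ s, dC (f i) z v := by
  classical
  induction s using Finset.induction_on with
  | empty => simpa using dC_const z v 0
  | insert i s hi ih =>
    simp only [Finset.sum_insert hi]
    rw [dC_add z v (hf i (by simp)) (SmC.sum fun j hj => hf j (by simp [hj])),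
      ih fun j hj => hf j (by simp [hj])]

theorem dC_congr {f g : M → ℂ} (h : f =ᶠ[𝓝 z] g) : dC (m := m) f z v = dC g z v := by
  unfold dC
  rw [h.mfderiv_eq]

theorem dC_ofReal {f : M → ℝ} (hf : SmR (m := m) z f) :
    dC (fun p => (f p : ℂ)) z v = (dirDeriv f z v : ℂ) := by
  have h1 : HasMFDerivAt 𝓘(ℝ, ℝ) 𝓘(ℝ, ℂ) Complex.ofRealCLM (f z) Complex.ofRealCLM :=
    Complex.ofRealCLM.hasFDerivAt.hasMFDerivAt
  have := (h1.comp z hf.mdiff.hasMFDerivAt).mfderiv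
  unfold dC dirDeriv
  exact congrArg (fun L => L v) this

/-! ### Partial derivatives in a chart -/

variable [IsManifold 𝓘(ℝ, Model m) ∞ M]

/-- The partial derivative along the `i`-th coordinate of the preferred chart at `x₀`. -/
def pd (x₀ : M) (i : Fin (2 * m + 1)) (f : M → ℂ) (z : M) : ℂ := dC f z (coordField x₀ i z)

theorem hasFDerivAt_coordChange {x₀ z : M} (hz : z ∈ (chartAt (Model m) x₀).source) :
    HasFDerivAt (extChartAt 𝓘(ℝ, Model m) z ∘ (extChartAt 𝓘(ℝ, Model m) x₀).symm)
      (jac x₀ z) (extChartAt 𝓘(ℝ, Model m) x₀ z) := by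
  have h := hasFDerivWithinAt_tangentCoordChange (I := 𝓘(ℝ, Model m)) (x := x₀) (y := z) (z := z)
    ⟨by simpa using hz, by simp⟩
  simpa [jac] using h

theorem dC_eq_fderiv {z : M} {f : M → ℂ} (hf : MDifferentiableAt 𝓘(ℝ, Model m) 𝓘(ℝ, ℂ) f z)
    (v : Model m) : dC f z v = fderiv ℝ (f ∘ (extChartAt 𝓘(ℝ, Model m) z).symm)
      (extChartAt 𝓘(ℝ, Model m) z z) v := by
  have h0 : (mfderiv 𝓘(ℝ, Model m) 𝓘(ℝ, ℂ) f z : Model m →L[ℝ] ℂ) =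
      fderiv ℝ (f ∘ (extChartAt 𝓘(ℝ, Model m) z).symm) (extChartAt 𝓘(ℝ, Model m) z z) := by
    rw [← fderivWithin_univ]
    refine hf.mfderiv.trans ?_
    simp [writtenInExtChartAt]
    rfl
  exact congrArg (fun L : Model m →L[ℝ] ℂ => L v) h0

/-- The manifold derivative at z is taken in the preferred chart at z, whereas the chart at x₀ is
held fixed here. The Jacobian built into `coordField` is exactly the chain rule between the two. -/
theorem pd_eq_fderiv {x₀ z : M} (hz : z ∈ (chartAt (Model m) x₀).source) {f : M → ℂ}
    (hf : MDifferentiableAt 𝓘(ℝ, Model m) 𝓘(ℝ, ℂ) f z) (i : Fin (2 * m + 1)) :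
    pd x₀ i f z = fderiv ℝ (f ∘ (extChartAt 𝓘(ℝ, Model m) x₀).symm)
      (extChartAt 𝓘(ℝ, Model m) x₀ z) (stdVec m i) := by
  have hz' : z ∈ (extChartAt 𝓘(ℝ, Model m) x₀).source := by simpa using hz
  have hl := (extChartAt 𝓘(ℝ, Model m) x₀).left_inv hz'
  have hd : DifferentiableAt ℝ (f ∘ (extChartAt 𝓘(ℝ, Model m) z).symm)
      (extChartAt 𝓘(ℝ, Model m) z z) := by
    have := hf.differentiableWithinAt_writtenInExtChartAt
    rw [← differentiableWithinAt_univ]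
    simp [writtenInExtChartAt] at this
    exact this
  have hd' : DifferentiableAt ℝ (f ∘ (extChartAt 𝓘(ℝ, Model m) z).symm)
      ((extChartAt 𝓘(ℝ, Model m) z ∘ (extChartAt 𝓘(ℝ, Model m) x₀).symm)
        (extChartAt 𝓘(ℝ, Model m) x₀ z)) := by
    rw [Function.comp_apply (f := extChartAt 𝓘(ℝ, Model m) z), hl]; exact hd
  have h1 := hd'.hasFDerivAt.comp _ (hasFDerivAt_coordChange hz)
  have h2 : f ∘ (extChartAt 𝓘(ℝ, Model m) x₀).symm =ᶠ[𝓝 (extChartAt 𝓘(ℝ, Model m) x₀ z)]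
      (f ∘ (extChartAt 𝓘(ℝ, Model m) z).symm) ∘
        (extChartAt 𝓘(ℝ, Model m) z ∘ (extChartAt 𝓘(ℝ, Model m) x₀).symm) := by
    have hc := (continuousAt_extChartAt_symm' (I := 𝓘(ℝ, Model m)) hz').tendsto
    rw [hl] at hc
    filter_upwards [hc (extChartAt_source_mem_nhds (I := 𝓘(ℝ, Model m)) z)] with q hq
    simp only [Function.comp_apply]
    rw [(extChartAt 𝓘(ℝ, Model m) z).left_inv hq]
  rw [h2.fderiv_eq, h1.fderiv, Function.comp_apply (f := extChartAt 𝓘(ℝ, Model m) z), hl]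
  exact dC_eq_fderiv hf _

theorem smC_iff {x₀ z : M} (hz : z ∈ (chartAt (Model m) x₀).source) {f : M → ℂ} :
    SmC (m := m) z f ↔ ContDiffAt ℝ ∞ (f ∘ (extChartAt 𝓘(ℝ, Model m) x₀).symm)
      (extChartAt 𝓘(ℝ, Model m) x₀ z) := by
  unfold SmC
  rw [contMDiffAt_iff_source_of_mem_source hz]
  simp only [modelWithCornersSelf_coe, Set.range_id]
  rw [contMDiffWithinAt_univ, contMDiffAt_iff_contDiffAt]

theorem SmC.eventually {z : M} {f : M → ℂ} (hf : SmC (m := m) z f) :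
    ∀ᶠ p in 𝓝 z, MDifferentiableAt 𝓘(ℝ, Model m) 𝓘(ℝ, ℂ) f p := by
  have h1 : ContMDiffAt 𝓘(ℝ, Model m) 𝓘(ℝ, ℂ) 1 f z := ContMDiffAt.of_le hf (by simp)
  filter_upwards [(contMDiffAt_iff_contMDiffAt_nhds (by simp)).1 h1] with p hp
  exact ContMDiffAt.mdifferentiableAt hp (by simp)

theorem source_mem_nhds {x₀ z : M} (hz : z ∈ (chartAt (Model m) x₀).source) :
    (chartAt (Model m) x₀).source ∈ 𝓝 z := (chartAt (Model m) x₀).open_source.mem_nhds hz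

theorem SmC.pd_eventuallyEq {x₀ z : M} (hz : z ∈ (chartAt (Model m) x₀).source) {f : M → ℂ}
    (hf : SmC (m := m) z f) (i : Fin (2 * m + 1)) :
    ∀ᶠ p in 𝓝 z, pd x₀ i f p = fderiv ℝ (f ∘ (extChartAt 𝓘(ℝ, Model m) x₀).symm)
      (extChartAt 𝓘(ℝ, Model m) x₀ p) (stdVec m i) := by
  filter_upwards [hf.eventually, source_mem_nhds hz] with p hp hp'
  exact pd_eq_fderiv hp' hp i

theorem SmC.contDiffAt_fderiv {x₀ z : M} (hz : z ∈ (chartAt (Model m) x₀).source) {f : M → ℂ}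
    (hf : SmC (m := m) z f) (i : Fin (2 * m + 1)) :
    ContDiffAt ℝ ∞ (fun q => fderiv ℝ (f ∘ (extChartAt 𝓘(ℝ, Model m) x₀).symm) q (stdVec m i))
      (extChartAt 𝓘(ℝ, Model m) x₀ z) :=
  (ContDiffAt.fderiv_right ((smC_iff hz).1 hf) (m := ∞) (by simp)).clm_apply contDiffAt_const

theorem SmC.pd {x₀ z : M} (hz : z ∈ (chartAt (Model m) x₀).source) {f : M → ℂ}
    (hf : SmC (m := m) z f) (i : Fin (2 * m + 1)) : SmC (m := m) z (pd x₀ i f) := by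
  refine SmC.congr (f := fun p => fderiv ℝ (f ∘ (extChartAt 𝓘(ℝ, Model m) x₀).symm)
      (extChartAt 𝓘(ℝ, Model m) x₀ p) (stdVec m i)) ?_ (hf.pd_eventuallyEq hz i)
  exact (hf.contDiffAt_fderiv hz i).contMDiffAt.comp z (contMDiffAt_extChartAt' hz)

/-- Read in the chart at x₀, both sides are the second Fréchet derivative of a smooth function,
which is symmetric. The curvature formula, the symmetry of the derivatives of transition Jacobians
and dω = 0 all rest on it. -/
theorem pd_comm {x₀ z : M} (hz : z ∈ (chartAt (Model m) x₀).source) {f : M → ℂ}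
    (hf : SmC (m := m) z f) (i j : Fin (2 * m + 1)) : pd x₀ i (pd x₀ j f) z = pd x₀ j (pd x₀ i f) z := by
  have hz' : z ∈ (extChartAt 𝓘(ℝ, Model m) x₀).source := by simpa using hz
  have key : ∀ i j, WickContact.pd x₀ i (WickContact.pd x₀ j f) z =
      fderiv ℝ (fderiv ℝ (f ∘ (extChartAt 𝓘(ℝ, Model m) x₀).symm))
        (extChartAt 𝓘(ℝ, Model m) x₀ z) (stdVec m i) (stdVec m j) := by
    intro i j
    rw [pd_eq_fderiv hz (hf.pd hz j).mdiff]
    have h1 : WickContact.pd x₀ j f ∘ (extChartAt 𝓘(ℝ, Model m) x₀).symm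
        =ᶠ[𝓝 (extChartAt 𝓘(ℝ, Model m) x₀ z)]
        fun q => fderiv ℝ (f ∘ (extChartAt 𝓘(ℝ, Model m) x₀).symm) q (stdVec m j) := by
      have hc := (continuousAt_extChartAt_symm' (I := 𝓘(ℝ, Model m)) hz').tendsto
      rw [(extChartAt 𝓘(ℝ, Model m) x₀).left_inv hz'] at hc
      filter_upwards [hc.eventually (hf.pd_eventuallyEq hz j),
        extChartAt_target_mem_nhds' ((extChartAt 𝓘(ℝ, Model m) x₀).map_source hz')] with q hq hq'
      rw [Function.comp_apply, hq, (extChartAt 𝓘(ℝ, Model m) x₀).right_inv hq']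
    rw [h1.fderiv_eq]
    have h2 : DifferentiableAt ℝ (fderiv ℝ (f ∘ (extChartAt 𝓘(ℝ, Model m) x₀).symm))
        (extChartAt 𝓘(ℝ, Model m) x₀ z) :=
      (ContDiffAt.fderiv_right ((smC_iff hz).1 hf) (m := ∞) (by simp)).differentiableAt (by simp)
    rw [fderiv_clm_apply h2 (differentiableAt_const _)]
    simp
  rw [key, key]
  have hs : ContDiffAt ℝ ∞ (f ∘ (extChartAt 𝓘(ℝ, Model m) x₀).symm)
      (extChartAt 𝓘(ℝ, Model m) x₀ z) := (smC_iff hz).1 hf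
  exact hs.isSymmSndFDerivAt (by simp only [minSmoothness_of_isRCLikeNormedField]; exact WithTop.coe_le_coe.2 le_top) _ _

end

end WickContact

namespace WickContact

set_option linter.unusedSectionVars false

noncomputable section

open Wick

variable {m : ℕ} {M : Type*} [TopologicalSpace M] [ChartedSpace (Model m) M]

/-! ### Smooth functions with values in the Wick algebra -/

/-- Coefficientwise smoothness at a point. -/
def SmW (z : M) (F : M → Wick m) : Prop := ∀ k d, SmC (m := m) z fun p => cf k d (F p)

/-- The coefficientwise derivative along a tangent vector. -/
def dv (z : M) (v : TangentSpace 𝓘(ℝ, Model m) z) (F : M → Wick m) : Wick m :=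
  ofCf fun k d => dC (m := m) (fun p => cf k d (F p)) z v

@[simp] theorem cf_dv (z : M) (v : TangentSpace 𝓘(ℝ, Model m) z) (F : M → Wick m) (k d) :
    cf k d (dv z v F) = dC (m := m) (fun p => cf k d (F p)) z v := cf_ofCf _ _ _

section Smooth

variable {z : M} {F G : M → Wick m}

theorem smW_of_forall_eq (w : Wick m) : SmW z (fun _ => w) := fun _ _ => smC_const _ _
theorem SmW.add (hF : SmW z F) (hG : SmW z G) : SmW z (fun p => F p + G p) := fun k d => by
  simpa using (hF k d).add (hG k d)
theorem SmW.sub (hF : SmW z F) (hG : SmW z G) : SmW z (fun p => F p - G p) := fun k d => by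
  simpa using (hF k d).sub (hG k d)
theorem SmW.sum {ι : Type*} {s : Finset ι} {F : ι → M → Wick m} (hF : ∀ i ∈ s, SmW z (F i)) :
    SmW z (fun p => ∑ i ∈ s, F i p) := fun k d => by
  simpa using SmC.sum fun i hi => hF i hi k d
theorem SmW.congr (hF : SmW z F) (h : G =ᶠ[𝓝 z] F) : SmW z G := fun k d =>
  (hF k d).congr (h.mono fun p hp => by simp only [hp])
theorem SmC.const {f : M → ℂ} (hf : SmC (m := m) z f) : SmW z (fun p => (const (f p) : Wick m)) :=
  fun k d => by
    simp only [cf_const]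
    split_ifs
    · exact hf
    · exact smC_const _ _
theorem SmW.mul (hF : SmW z F) (hG : SmW z G) : SmW z (fun p => F p * G p) := fun k d => by
  simp only [cf_mul]
  exact SmC.sum fun i _ => SmC.sum fun j _ => (hF _ _).mul (hG _ _)
theorem SmW.dy (hF : SmW z F) (i) : SmW z (fun p => dy i (F p)) := fun k d => by
  simp only [cf_dy]
  exact (hF _ _).mul (smC_const _ _)
theorem SmW.yScale (hF : SmW z F) (c) : SmW z (fun p => yScale c (F p)) := fun k d => by
  simp only [cf_yScale]
  exact (smC_const _ _).mul (hF _ _)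
theorem SmW.divNu (hF : SmW z F) : SmW z (fun p => divNu (F p)) := fun k d => by
  simp only [cf_divNu]
  exact hF _ _
theorem SmW.const_mul (hF : SmW z F) (c : ℂ) : SmW z (fun p => Wick.const c * F p) :=
  (smW_of_forall_eq _).mul hF

variable {h : M → Fin (2 * m + 1) → Fin (2 * m + 1) → ℂ}

theorem SmW.contr (hh : ∀ i j, SmC (m := m) z fun p => h p i j) (hF : SmW z F) (hG : SmW z G) (s) :
    SmW z (fun p => contr (h p) s (F p) (G p)) := by
  induction s generalizing F G with
  | zero => exact hF.mul hG
  | succ s ih =>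
    exact SmW.sum fun i _ => SmW.sum fun j _ => (hh i j).const.mul (ih (hF.dy i) (hG.dy j))

theorem SmW.circ (hh : ∀ i j, SmC (m := m) z fun p => h p i j) (hF : SmW z F) (hG : SmW z G) :
    SmW z (fun p => circ (h p) (F p) (G p)) := fun k d => by
  simp only [cf_circ]
  exact SmC.sum fun i _ => (smC_const _ _).mul (SmW.contr hh hF hG _ _ _)

theorem SmW.br (hh : ∀ i j, SmC (m := m) z fun p => h p i j) (hF : SmW z F) (hG : SmW z G) :
    SmW z (fun p => br (h p) (F p) (G p)) :=
  (((SmW.circ hh hF hG).sub (SmW.circ hh hG hF)).divNu).const_mul _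

/-- Separates the coefficients of `w` from the dependence on `L`, which enters only through images
of monomials. Smoothness and derivatives in both variables then follow from the product rule on a
finite sum. -/
theorem cf_linSubst_eq_sum_mon (L : Model m →L[ℝ] Model m) (k) (d : Fin (2 * m + 1) →₀ ℕ) (w : Wick m) :
    cf k d (linSubst L w) = ∑ e ∈ multiIdx m d.degree, cf k e w * cf 0 d (linSubst L (mon e)) := by
  have h1 := functional_eq_sum k d.degree ((cfHom k d).comp (linHom L).toAddMonoidHom)
    (fun w hw => by
      show cf k d (linHom L w) = 0
      rw [linHom_apply]; exact degreePreserving_linSubst L k d w hw) w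
  have h2 : ∀ w, ((cfHom k d).comp (linHom L).toAddMonoidHom) w = cf k d (linSubst L w) := fun w => by
    show cf k d (linHom L w) = _
    rw [linHom_apply]
  simp only [h2] at h1
  rw [h1]
  refine Finset.sum_congr rfl fun e _ => ?_
  simp [linSubst_mul, linSubst_pow, mul_assoc, cf_nu_pow_mul]

variable {L : M → Model m →L[ℝ] Model m}

theorem smW_linSubst_mon (hL : ∀ i j, SmC (m := m) z fun p => (ent (L p) i j : ℂ)) (e) :
    SmW z (fun p => linSubst (L p) (mon e)) := by
  refine mon_induction (P := fun w => SmW z (fun p => linSubst (L p) w)) ?_ ?_ e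
  · simpa using smW_of_forall_eq _
  · intro i w hw
    simp only [linSubst_mul, linSubst_y]
    exact (SmW.sum fun j _ => (hL i j).const.mul (smW_of_forall_eq _)).mul hw

theorem SmW.linSubst (hL : ∀ i j, SmC (m := m) z fun p => (ent (L p) i j : ℂ)) (hF : SmW z F) :
    SmW z (fun p => linSubst (L p) (F p)) := fun k d => by
  simp only [cf_linSubst_eq_sum_mon _ k d]
  exact SmC.sum fun e _ => (hF _ _).mul (smW_linSubst_mon hL e _ _)

end Smooth

section Derivative

variable {z : M} (v : TangentSpace 𝓘(ℝ, Model m) z) {F G : M → Wick m}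

theorem dv_fixed (w : Wick m) : dv z v (fun _ => w) = 0 := ext_cf fun k d => by
  simp [dC_const]
theorem dv_add (hF : SmW z F) (hG : SmW z G) :
    dv z v (fun p => F p + G p) = dv z v F + dv z v G := ext_cf fun k d => by
  simp [dC_add z v (hF k d) (hG k d)]
theorem dv_sub (hF : SmW z F) (hG : SmW z G) :
    dv z v (fun p => F p - G p) = dv z v F - dv z v G := ext_cf fun k d => by
  simp [dC_sub z v (hF k d) (hG k d)]
theorem dv_sum {ι : Type*} {s : Finset ι} {F : ι → M → Wick m} (hF : ∀ i ∈ s, SmW z (F i)) :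
    dv z v (fun p => ∑ i ∈ s, F i p) = ∑ i ∈ s, dv z v (F i) := ext_cf fun k d => by
  simp [dC_sum z v fun i hi => hF i hi k d]
theorem dv_congr (h : F =ᶠ[𝓝 z] G) : dv z v F = dv z v G := ext_cf fun k d => by
  simp only [cf_dv]
  exact dC_congr z v (h.mono fun p hp => by simp only [hp])
theorem dv_const (f : M → ℂ) : dv z v (fun p => (const (f p) : Wick m)) = const (dC f z v) :=
  ext_cf fun k d => by
    simp only [cf_dv, cf_const]
    split_ifs
    · rfl
    · exact dC_const z v 0
theorem dv_mul (hF : SmW z F) (hG : SmW z G) :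
    dv z v (fun p => F p * G p) = dv z v F * G z + F z * dv z v G := ext_cf fun k d => by
  simp only [cf_dv, cf_mul, cf_add]
  rw [dC_sum z v fun i _ => SmC.sum fun j _ => (hF _ _).mul (hG _ _), ← Finset.sum_add_distrib]
  refine Finset.sum_congr rfl fun i _ => ?_
  rw [dC_sum z v fun j _ => (hF _ _).mul (hG _ _), ← Finset.sum_add_distrib]
  refine Finset.sum_congr rfl fun j _ => ?_
  rw [dC_mul z v (hF _ _) (hG _ _)]
theorem dv_fixed_mul (w : Wick m) (hF : SmW z F) : dv z v (fun p => w * F p) = w * dv z v F := by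
  rw [dv_mul v (smW_of_forall_eq w) hF, dv_fixed, zero_mul, zero_add]
theorem dv_const_mul {f : M → ℂ} (hf : SmC (m := m) z f) (hF : SmW z F) :
    dv z v (fun p => const (f p) * F p) = const (dC f z v) * F z + const (f z) * dv z v F := by
  rw [dv_mul v hf.const hF, dv_const]
theorem dv_dy (hF : SmW z F) (i) : dv z v (fun p => dy i (F p)) = dy i (dv z v F) :=
  ext_cf fun k d => by
    simp only [cf_dv, cf_dy]
    rw [dC_mul z v (hF _ _) (smC_const _ _), dC_const, mul_zero, add_zero]
theorem dv_yScale (hF : SmW z F) (c) : dv z v (fun p => yScale c (F p)) = yScale c (dv z v F) :=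
  ext_cf fun k d => by
    simp only [cf_dv, cf_yScale]
    rw [dC_const_mul z v _ (hF _ _)]
theorem dv_eqUpTo {n} (h : ∀ p, EqUpTo n (F p) (G p)) : EqUpTo n (dv z v F) (dv z v G) :=
  fun k hk d => by simp only [cf_dv, fun p => h p k hk d]

theorem Wick.InFiltration.dv {n} (h : ∀ᶠ p in 𝓝 z, InFiltration n (F p)) :
    InFiltration n (dv z v F) := fun k d hk => by
  rw [cf_dv, dC_congr z v (g := fun _ => 0) (h.mono fun p hp => hp k d hk), dC_const]

theorem dv_sum_vec {ι : Type*} (s : Finset ι) (c : ι → ℝ) (u : ι → TangentSpace 𝓘(ℝ, Model m) z) :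
    dv z (∑ i ∈ s, c i • u i) F = ∑ i ∈ s, const (c i : ℂ) * dv z (u i) F :=
  ext_cf fun k d => by simp

variable {L : M → Model m →L[ℝ] Model m}

/-- The derivative of a substitution with respect to the substituted matrix. -/
def dSubst (A : Model m →L[ℝ] Model m) (B : Fin (2 * m + 1) → Fin (2 * m + 1) → ℂ) (w : Wick m) :
    Wick m := ∑ i, ∑ j, const (B i j) * (y j * linSubst A (dy i w))

theorem dSubst_mul (A : Model m →L[ℝ] Model m) (B) (w w' : Wick m) :
    dSubst A B (w * w') = dSubst A B w * linSubst A w' + linSubst A w * dSubst A B w' := by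
  simp only [dSubst, dy_mul, linSubst_add, linSubst_mul, Finset.sum_mul, Finset.mul_sum,
    ← Finset.sum_add_distrib]
  refine Finset.sum_congr rfl fun i _ => Finset.sum_congr rfl fun j _ => ?_
  ring

theorem dSubst_add (A : Model m →L[ℝ] Model m) (B) (w w' : Wick m) :
    dSubst A B (w + w') = dSubst A B w + dSubst A B w' := by
  simp only [dSubst, dy_add, linSubst_add, mul_add, Finset.sum_add_distrib]

theorem dSubst_y (A : Model m →L[ℝ] Model m) (B) (i) :
    dSubst A B (y i) = ∑ j, const (B i j) * y j := by
  unfold dSubst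
  rw [Finset.sum_eq_single i]
  · simp [dy_y]
  · intro k _ hk
    simp [dy_y, hk]
  · simp

theorem dSubst_of_isScalar (A : Model m →L[ℝ] Model m) (B) {c : Wick m} (hc : IsScalar c) :
    dSubst A B c = 0 := by
  unfold dSubst
  exact Finset.sum_eq_zero fun i _ => Finset.sum_eq_zero fun j _ => by
    rw [hc]; simp

theorem dv_linSubst_mon (hL : ∀ i j, SmC (m := m) z fun p => (ent (L p) i j : ℂ)) (e) :
    dv z v (fun p => linSubst (L p) (mon e)) =
      dSubst (L z) (fun i j => dC (m := m) (fun p => (ent (L p) i j : ℂ)) z v) (mon e) := by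
  have := mon_induction (P := fun w => SmW z (fun p => linSubst (L p) w) ∧
    dv z v (fun p => linSubst (L p) w) =
      dSubst (L z) (fun i j => dC (m := m) (fun p => (ent (L p) i j : ℂ)) z v) w) ?_ ?_ e
  · exact this.2
  · constructor
    · simpa using smW_of_forall_eq _
    · simp [dSubst_of_isScalar _ _ isScalar_one, dv_fixed]
  · rintro i w ⟨hw, hw'⟩
    have hs : SmW z (fun p => ∑ j, const (ent (L p) i j : ℂ) * (y j : Wick m)) :=
      SmW.sum fun j _ => (hL i j).const.mul (smW_of_forall_eq _)
    simp only [linSubst_mul, linSubst_y]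
    refine ⟨hs.mul hw, ?_⟩
    rw [dv_mul v hs hw, hw', dSubst_mul, linSubst_y, dSubst_y,
      dv_sum v fun j _ => (hL i j).const.mul (smW_of_forall_eq _)]
    congr 2
    refine Finset.sum_congr rfl fun j _ => ?_
    rw [dv_const_mul v (hL i j) (smW_of_forall_eq _), dv_fixed, mul_zero, add_zero]

theorem cf_dSubst (A : Model m →L[ℝ] Model m) (B) (k) (d : Fin (2 * m + 1) →₀ ℕ) (w : Wick m) :
    cf k d (dSubst A B w) = ∑ e ∈ multiIdx m d.degree, cf k e w * cf 0 d (dSubst A B (mon e)) := by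
  have h1 := functional_eq_sum k d.degree
    ((cfHom k d).comp (AddMonoidHom.mk' (dSubst A B) (dSubst_add A B)))
    (fun w hw => by
      show cf k d (dSubst A B w) = 0
      simp only [dSubst, cf_sum, cf_const_mul, cf_y_mul]
      refine Finset.sum_eq_zero fun i _ => Finset.sum_eq_zero fun j _ => ?_
      split_ifs with hj
      · simp
      · rw [degreePreserving_linSubst A k _ _ (fun e he => ?_), mul_zero]
        rw [cf_dy, hw, zero_mul]
        rw [degree_add_single, he, ← degree_add_single _ j, sub_add_single hj]) w
  have h2 : ∀ w, ((cfHom k d).comp (AddMonoidHom.mk' (dSubst A B) (dSubst_add A B))) w =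
    cf k d (dSubst A B w) := fun w => rfl
  simp only [h2] at h1
  rw [h1]
  refine Finset.sum_congr rfl fun e _ => ?_
  rw [dSubst_mul, dSubst_of_isScalar A B ((isScalar_const _).mul (isScalar_nu_pow k))]
  simp [linSubst_mul, linSubst_pow, mul_assoc, cf_nu_pow_mul]

theorem dv_linSubst (hL : ∀ i j, SmC (m := m) z fun p => (ent (L p) i j : ℂ)) (hF : SmW z F) :
    dv z v (fun p => linSubst (L p) (F p)) = linSubst (L z) (dv z v F) +
      dSubst (L z) (fun i j => dC (m := m) (fun p => (ent (L p) i j : ℂ)) z v) (F z) :=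
  ext_cf fun k d => by
    simp only [cf_dv, cf_add]
    rw [cf_linSubst_eq_sum_mon _ k d, cf_dSubst]
    simp only [cf_linSubst_eq_sum_mon _ k d]
    rw [dC_sum z v fun e _ => (hF _ _).mul (smW_linSubst_mon hL e _ _), ← Finset.sum_add_distrib]
    refine Finset.sum_congr rfl fun e _ => ?_
    rw [dC_mul z v (hF _ _) (smW_linSubst_mon hL e _ _), ← dv_linSubst_mon v hL, cf_dv, cf_dv]

end Derivative

/-! ### Linear connections acting on functions with values in the Wick algebra -/

section Gamma

variable (C : Fin (2 * m + 1) → Fin (2 * m + 1) → ℂ)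

/-- The derivation `C^k_j y^j ∂/∂y^k`. -/
def gam (w : Wick m) : Wick m := ∑ j, ∑ k, const (C k j) * y j * dy k w

theorem gam_add (w w' : Wick m) : gam C (w + w') = gam C w + gam C w' := by
  simp only [gam, dy_add, mul_add, Finset.sum_add_distrib]
theorem gam_sub (w w' : Wick m) : gam C (w - w') = gam C w - gam C w' := by
  simp only [gam, dy_sub, mul_sub, Finset.sum_sub_distrib]
theorem gam_mul (w w' : Wick m) : gam C (w * w') = gam C w * w' + w * gam C w' := by
  simp only [gam, dy_mul, Finset.sum_mul, Finset.mul_sum, ← Finset.sum_add_distrib]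
  refine Finset.sum_congr rfl fun i _ => Finset.sum_congr rfl fun j _ => ?_
  ring
theorem gam_of_isScalar {c : Wick m} (hc : IsScalar c) : gam C c = 0 :=
  Finset.sum_eq_zero fun i _ => Finset.sum_eq_zero fun j _ => by rw [hc, mul_zero]
theorem gam_sum {ι : Type*} (s : Finset ι) (f : ι → Wick m) :
    gam C (∑ i ∈ s, f i) = ∑ i ∈ s, gam C (f i) :=
  map_sum (AddMonoidHom.mk' (gam C) (gam_add C)) f s
theorem gam_y (i) : gam C (y i) = ∑ j, const (C i j) * y j := by
  unfold gam
  refine Finset.sum_congr rfl fun j _ => ?_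
  rw [Finset.sum_eq_single i]
  · simp [dy_y]
  · intro k _ hk; simp [dy_y, hk]
  · simp
theorem dy_gam (i) (w : Wick m) : dy i (gam C w) = gam C (dy i w) + ∑ k, const (C k i) * dy k w := by
  simp only [gam, dy_sum, dy_mul, dy_const, dy_y, zero_mul, zero_add, Finset.sum_add_distrib,
    dy_comm i]
  rw [add_comm]
  congr 1
  rw [Finset.sum_eq_single i]
  · simp
  · intro j _ hj; simp [Ne.symm hj]
  · simp
theorem Wick.InFiltration.gam {n} {w : Wick m} (hw : InFiltration n w) : InFiltration n (gam C w) := by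
  refine InFiltration.sum fun j _ => InFiltration.sum fun k _ => ?_
  rw [mul_assoc]
  refine InFiltration.const_mul ?_ _
  rcases n with _ | n
  · exact inFiltration_zero_left _
  · exact (hw.dy k).y_mul j
theorem Wick.EqUpTo.gam {n} {w w' : Wick m} (e : EqUpTo n w w') : EqUpTo n (gam C w) (gam C w') :=
  EqUpTo.sum fun j _ => EqUpTo.sum fun k _ => EqUpTo.mul (EqUpTo.refl _ _) (e.dy k)
theorem gam_yScale (c) (w : Wick m) : gam C (yScale c w) = yScale c (gam C w) := by
  simp only [gam, yScale_sum, mul_assoc, yScale_const_mul]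
  refine Finset.sum_congr rfl fun j _ => Finset.sum_congr rfl fun k _ => ?_
  refine ext_cf fun k' d => ?_
  simp only [cf_const_mul, cf_y_mul, cf_yScale, cf_dy]
  split_ifs with h
  · simp
  · have h1 := degree_add_single (d - Finsupp.single j 1) j
    have h2 := degree_add_single (d - Finsupp.single j 1) k
    rw [sub_add_single h] at h1
    rw [h2, ← h1]; ring

end Gamma

/-- The covariant derivative along `v` for the connection with coefficients `C`. -/
def covAt (z : M) (v : TangentSpace 𝓘(ℝ, Model m) z) (C : Fin (2 * m + 1) → Fin (2 * m + 1) → ℂ)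
    (F : M → Wick m) : Wick m := dv z v F - gam C (F z)

section CovAt

variable {z : M} (v : TangentSpace 𝓘(ℝ, Model m) z) (C : Fin (2 * m + 1) → Fin (2 * m + 1) → ℂ)
  {F G : M → Wick m}

theorem covAt_add (hF : SmW z F) (hG : SmW z G) :
    covAt z v C (fun p => F p + G p) = covAt z v C F + covAt z v C G := by
  simp only [covAt, dv_add v hF hG, gam_add]; ring
theorem covAt_sub (hF : SmW z F) (hG : SmW z G) :
    covAt z v C (fun p => F p - G p) = covAt z v C F - covAt z v C G := by
  simp only [covAt, dv_sub v hF hG, gam_sub]; ring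
theorem covAt_sum {ι : Type*} {s : Finset ι} {F : ι → M → Wick m} (hF : ∀ i ∈ s, SmW z (F i)) :
    covAt z v C (fun p => ∑ i ∈ s, F i p) = ∑ i ∈ s, covAt z v C (F i) := by
  simp only [covAt, dv_sum v hF, gam_sum, Finset.sum_sub_distrib]
theorem covAt_mul (hF : SmW z F) (hG : SmW z G) :
    covAt z v C (fun p => F p * G p) = covAt z v C F * G z + F z * covAt z v C G := by
  simp only [covAt, dv_mul v hF hG, gam_mul]; ring
theorem covAt_const_mul {f : M → ℂ} (hf : SmC (m := m) z f) (hF : SmW z F) :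
    covAt z v C (fun p => const (f p) * F p) =
      const (dC f z v) * F z + const (f z) * covAt z v C F := by
  rw [covAt_mul v C hf.const hF]
  simp only [covAt, dv_const, gam_of_isScalar C (isScalar_const _), sub_zero]
theorem covAt_const (f : M → ℂ) : covAt z v C (fun p => (const (f p) : Wick m)) = const (dC f z v) := by
  simp only [covAt, dv_const, gam_of_isScalar C (isScalar_const _), sub_zero]
theorem covAt_fixed_mul {w : Wick m} (hw : IsScalar w) (hF : SmW z F) :
    covAt z v C (fun p => w * F p) = w * covAt z v C F := by
  simp only [covAt, dv_fixed_mul v w hF, gam_mul, gam_of_isScalar C hw]; ring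
theorem covAt_congr (h : F =ᶠ[𝓝 z] G) : covAt z v C F = covAt z v C G := by
  simp only [covAt, dv_congr v h, h.self_of_nhds]
theorem covAt_y (i) : covAt z v C (fun _ => (y i : Wick m)) = -∑ j, const (C i j) * y j := by
  simp only [covAt, dv_fixed, gam_y, zero_sub]
theorem covAt_dy (hF : SmW z F) (i) : covAt z v C (fun p => dy i (F p)) =
    dy i (covAt z v C F) + ∑ k, const (C k i) * dy k (F z) := by
  simp only [covAt, dv_dy v hF, dy_sub, dy_gam]; ring
theorem covAt_yScale (hF : SmW z F) (c) :
    covAt z v C (fun p => yScale c (F p)) = yScale c (covAt z v C F) := by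
  simp only [covAt, dv_yScale v hF, yScale_sub, gam_yScale]
theorem covAt_eqUpTo {n} (h : ∀ p, EqUpTo n (F p) (G p)) :
    EqUpTo n (covAt z v C F) (covAt z v C G) := (dv_eqUpTo v h).sub ((h z).gam C)
theorem Wick.InFiltration.covAt {n} (h : ∀ᶠ p in 𝓝 z, InFiltration n (F p)) :
    InFiltration n (covAt z v C F) := (Wick.InFiltration.dv v h).sub (h.self_of_nhds.gam C)

variable {h : M → Fin (2 * m + 1) → Fin (2 * m + 1) → ℂ}

/-- The tensor `h` is parallel along `v`. -/
def ParallelAt (z : M) (v : TangentSpace 𝓘(ℝ, Model m) z)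
    (C : Fin (2 * m + 1) → Fin (2 * m + 1) → ℂ)
    (h : M → Fin (2 * m + 1) → Fin (2 * m + 1) → ℂ) : Prop :=
  ∀ p q, dC (m := m) (fun x => h x p q) z v + ∑ i, h z i q * C p i + ∑ j, h z p j * C q j = 0

variable (hh : ∀ i j, SmC (m := m) z fun p => h p i j) (hp : ParallelAt z v C h)
include hh hp

/-- Moving ∇ past a fibre derivative creates connection terms (`covAt_dy`), one for each index of
`h`. They cancel against the derivative of `h` because `h` is parallel, so that ∇ is a derivation of
every contraction and hence of ∘. -/
theorem covAt_contr (hF : SmW z F) (hG : SmW z G) (s) :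
    covAt z v C (fun p => contr (h p) s (F p) (G p)) =
      contr (h z) s (covAt z v C F) (G z) + contr (h z) s (F z) (covAt z v C G) := by
  induction s generalizing F G with
  | zero => exact covAt_mul v C hF hG
  | succ s ih =>
    have h0 : ∀ i j, SmW z fun p => contr (h p) s (dy i (F p)) (dy j (G p)) := fun i j =>
      SmW.contr hh (hF.dy i) (hG.dy j) s
    simp only [contr]
    rw [covAt_sum v C fun i _ => SmW.sum fun j _ => (hh i j).const.mul (h0 i j)]
    have e1 : ∀ i j, covAt z v C (fun p => const (h p i j) * contr (h p) s (dy i (F p)) (dy j (G p)))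
        = const (dC (m := m) (fun x => h x i j) z v) * contr (h z) s (dy i (F z)) (dy j (G z))
          + ((∑ k, const (h z i j * C k i) * contr (h z) s (dy k (F z)) (dy j (G z)))
          + (∑ k, const (h z i j * C k j) * contr (h z) s (dy i (F z)) (dy k (G z))))
          + (const (h z i j) * contr (h z) s (dy i (covAt z v C F)) (dy j (G z))
          + const (h z i j) * contr (h z) s (dy i (F z)) (dy j (covAt z v C G))) := by
      intro i j
      rw [covAt_const_mul v C (hh i j) (h0 i j), ih (hF.dy i) (hG.dy j), covAt_dy v C hF,
        covAt_dy v C hG, contr_add_left, contr_add_right, contr_sum_left, contr_sum_right]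
      simp only [contr_mul_left _ (isScalar_const _), contr_mul_right _ (isScalar_const _),
        const_mul, Finset.mul_sum, mul_add, mul_assoc]
      ring
    -- The derivative of `h` together with the two connection terms, after renaming summation
    -- indices: this is the parallelism of `h`.
    have e2 : ∑ i, ∑ j, (const (dC (m := m) (fun x => h x i j) z v)
            * contr (h z) s (dy i (F z)) (dy j (G z))
          + ((∑ k, const (h z i j * C k i) * contr (h z) s (dy k (F z)) (dy j (G z)))
          + (∑ k, const (h z i j * C k j) * contr (h z) s (dy i (F z)) (dy k (G z))))) = 0 := by
      have e3 : ∀ i j, (const (dC (m := m) (fun x => h x i j) z v) : Wick m) =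
          -(∑ k, const (h z k j * C i k)) - ∑ k, const (h z i k * C j k) := by
        intro i j
        rw [← const_sum, ← const_sum, ← const_neg, ← const_sub]
        congr 1
        linear_combination hp i j
      simp only [e3, sub_mul, neg_mul, Finset.sum_mul, Finset.sum_add_distrib,
        Finset.sum_sub_distrib, Finset.sum_neg_distrib]
      have e4 : ∑ i, ∑ j, ∑ k, const (h z i j * C k i) * contr (h z) s (dy k (F z)) (dy j (G z))
          = ∑ i, ∑ j, ∑ k, const (h z k j * C i k) * contr (h z) s (dy i (F z)) (dy j (G z)) := by
        rw [Finset.sum_comm]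
        conv_rhs => rw [Finset.sum_comm]
        refine Finset.sum_congr rfl fun j _ => ?_
        rw [Finset.sum_comm]
      have e5 : ∑ i, ∑ j, ∑ k, const (h z i j * C k j) * contr (h z) s (dy i (F z)) (dy k (G z))
          = ∑ i, ∑ j, ∑ k, const (h z i k * C j k) * contr (h z) s (dy i (F z)) (dy j (G z)) := by
        refine Finset.sum_congr rfl fun i _ => ?_
        rw [Finset.sum_comm]
      rw [e4, e5]; ring
    have e6 : ∀ i, covAt z v C (fun p => ∑ j, const (h p i j) *
        contr (h p) s (dy i (F p)) (dy j (G p))) = ∑ j, covAt z v C (fun p => const (h p i j) *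
        contr (h p) s (dy i (F p)) (dy j (G p))) := fun i =>
      covAt_sum v C fun j _ => (hh i j).const.mul (h0 i j)
    simp only [e6, e1]
    simp only [Finset.sum_add_distrib] at e2 ⊢
    rw [e2, zero_add]

theorem covAt_circ (hF : SmW z F) (hG : SmW z G) :
    covAt z v C (fun p => circ (h p) (F p) (G p)) =
      circ (h z) (covAt z v C F) (G z) + circ (h z) (F z) (covAt z v C G) := by
  refine eq_of_eqUpTo fun n => ?_
  refine (covAt_eqUpTo v C (fun p => circ_eqUpTo (h p) n (F p) (G p))).trans ?_
  have e : covAt z v C (fun p => circN (h p) n (F p) (G p)) =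
      circN (h z) n (covAt z v C F) (G z) + circN (h z) n (F z) (covAt z v C G) := by
    unfold circN
    rw [covAt_sum v C fun s _ => (smW_of_forall_eq _).mul (SmW.contr hh hF hG s),
      ← Finset.sum_add_distrib]
    refine Finset.sum_congr rfl fun s _ => ?_
    rw [covAt_fixed_mul v C ((isScalar_const _).mul (isScalar_nu_pow s)) (SmW.contr hh hF hG s),
      covAt_contr v C hh hp hF hG, mul_add]
  rw [e]
  exact ((circ_eqUpTo _ _ _ _).add (circ_eqUpTo _ _ _ _)).symm

theorem covAt_br (hF : SmW z F) (hG : SmW z G) :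
    covAt z v C (fun p => br (h p) (F p) (G p)) =
      br (h z) (covAt z v C F) (G z) + br (h z) (F z) (covAt z v C G) := by
  apply nu_mul_cancel
  rw [← covAt_fixed_mul v C isScalar_nu (SmW.br hh hF hG)]
  simp only [mul_add, nu_mul_br]
  rw [covAt_fixed_mul v C (isScalar_const _) ((SmW.circ hh hF hG).sub (SmW.circ hh hG hF)),
    covAt_sub v C (SmW.circ hh hF hG) (SmW.circ hh hG hF), covAt_circ v C hh hp hF hG,
    covAt_circ v C hh hp hG hF]
  ring

end CovAt

end

end WickContact

/-! ### Coordinate frames, the contact metric structure and the connection coefficients in a chart.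
-/

namespace WickContact

set_option linter.unusedSectionVars false

noncomputable section

variable {m : ℕ} {M : Type*} [TopologicalSpace M] [ChartedSpace (Model m) M]
  [IsManifold 𝓘(ℝ, Model m) ∞ M]

/-! ### Coordinate frames -/

/-- Smoothness of a vector field at a point. -/
def SmV (z : M) (X : VField m M) : Prop :=
  ContMDiffAt 𝓘(ℝ, Model m) (𝓘(ℝ, Model m).prod 𝓘(ℝ, Model m)) ∞
    (fun x => (⟨x, X x⟩ : TangentBundle 𝓘(ℝ, Model m) M)) z

/-- The Jacobian at `z` from the coordinates at `z` to those at `x₀`. -/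
def jacInv (x₀ z : M) : Model m →L[ℝ] Model m := tangentCoordChange 𝓘(ℝ, Model m) z x₀ z

/-- The components of a tangent vector in the coordinates at `x₀`. -/
def icomp (x₀ z : M) (v : TangentSpace 𝓘(ℝ, Model m) z) (k : Fin (2 * m + 1)) : ℝ :=
  coord (jacInv x₀ z (show Model m from v)) k

theorem jac_self (x : M) : jac (m := m) x x = ContinuousLinearMap.id ℝ (Model m) := by
  ext1 v
  exact tangentCoordChange_self (mem_extChartAt_source x)

theorem jacInv_jac {x₀ z : M} (hz : z ∈ (chartAt (Model m) x₀).source) (v : Model m) :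
    jacInv x₀ z (jac x₀ z v) = v := by
  unfold jacInv jac
  have h1 : z ∈ (extChartAt 𝓘(ℝ, Model m) x₀).source := by simpa using hz
  rw [tangentCoordChange_comp ⟨⟨h1, mem_extChartAt_source z⟩, h1⟩]
  exact tangentCoordChange_self h1

theorem jac_jacInv {x₀ z : M} (hz : z ∈ (chartAt (Model m) x₀).source) (v : Model m) :
    jac x₀ z (jacInv x₀ z v) = v := by
  unfold jacInv jac
  have h1 : z ∈ (extChartAt 𝓘(ℝ, Model m) x₀).source := by simpa using hz
  rw [tangentCoordChange_comp ⟨⟨mem_extChartAt_source z, h1⟩, mem_extChartAt_source z⟩]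
  exact tangentCoordChange_self (mem_extChartAt_source z)

theorem icomp_add (x₀ z : M) (v w : TangentSpace 𝓘(ℝ, Model m) z) (k) :
    icomp x₀ z (v + w) k = icomp x₀ z v k + icomp x₀ z w k := by
  unfold icomp
  exact congrArg (fun u : Model m => u k) (map_add (jacInv x₀ z) _ _)

theorem icomp_smul (x₀ z : M) (c : ℝ) (v : TangentSpace 𝓘(ℝ, Model m) z) (k) :
    icomp x₀ z (c • v) k = c * icomp x₀ z v k := by
  unfold icomp
  exact congrArg (fun u : Model m => u k) (map_smul (jacInv x₀ z) c _)

theorem icomp_sum {ι : Type*} (x₀ z : M) (s : Finset ι) (v : ι → TangentSpace 𝓘(ℝ, Model m) z) (k) :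
    icomp x₀ z (∑ i ∈ s, v i) k = ∑ i ∈ s, icomp x₀ z (v i) k :=
  map_sum (AddMonoidHom.mk' (fun v => icomp x₀ z v k) fun a b => icomp_add x₀ z a b k) v s

theorem icomp_coordField {x₀ z : M} (hz : z ∈ (chartAt (Model m) x₀).source)
    (j k : Fin (2 * m + 1)) : icomp x₀ z (coordField x₀ j z) k = if k = j then 1 else 0 := by
  unfold icomp coordField
  have := jacInv_jac hz (stdVec m j)
  refine (congrArg (fun u : Model m => u k) this).trans ?_
  simp [stdVec]

theorem sum_icomp {x₀ z : M} (hz : z ∈ (chartAt (Model m) x₀).source)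
    (v : TangentSpace 𝓘(ℝ, Model m) z) : v = ∑ k, icomp x₀ z v k • coordField x₀ k z := by
  have h1 : (jacInv x₀ z v : Model m) = ∑ k, icomp x₀ z v k • stdVec m k := by
    ext i
    have : ∀ k, (icomp x₀ z v k • stdVec m k) i = if i = k then icomp x₀ z v k else 0 := fun k => by
      simp [stdVec]
    have h3 := map_sum (EuclideanSpace.proj i : Model m →L[ℝ] ℝ)
      (fun k => icomp x₀ z v k • stdVec m k) Finset.univ
    refine Eq.trans ?_ h3.symm
    show _ = ∑ k, (icomp x₀ z v k • stdVec m k) i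
    simp only [this]
    simp
    rfl
  have h2 := congrArg (jac x₀ z) h1
  rw [map_sum] at h2
  refine (jac_jacInv hz v).symm.trans (h2.trans ?_)
  refine Finset.sum_congr rfl fun k _ => ?_
  exact map_smul _ _ _

theorem icomp_self (x : M) (v : TangentSpace 𝓘(ℝ, Model m) x) (k) : icomp x x v k = comp x v k := by
  unfold icomp comp
  exact congrArg (fun u : Model m => u k) (tangentCoordChange_self (mem_extChartAt_source x))

theorem coordField_self (x : M) (i : Fin (2 * m + 1)) : coordField x i x = frame x i := by
  unfold coordField frame
  rw [jac_self]; rfl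

theorem mem_source (x : M) : x ∈ (chartAt (Model m) x).source := mem_chart_source _ _

section Frame

variable (m) in
/-- The standard basis of the model space. -/
def stdBasis : Module.Basis (Fin (2 * m + 1)) ℝ (Model m) :=
  (EuclideanSpace.basisFun (Fin (2 * m + 1)) ℝ).toBasis

/-- The tangent trivialization at a point. -/
abbrev tTriv (x₀ : M) : Trivialization (Model m) (TotalSpace.proj : TangentBundle 𝓘(ℝ, Model m) M → M) :=
  trivializationAt (Model m) (TangentSpace 𝓘(ℝ, Model m)) x₀

theorem mem_baseSet {x₀ z : M} (hz : z ∈ (chartAt (Model m) x₀).source) :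
    z ∈ (tTriv (m := m) x₀).baseSet := by simpa using hz

theorem coordField_eq_localFrame {x₀ z : M} (hz : z ∈ (chartAt (Model m) x₀).source)
    (i : Fin (2 * m + 1)) : coordField x₀ i z = (tTriv x₀).localFrame (stdBasis m) i z := by
  have h := mem_baseSet hz
  rw [Trivialization.localFrame_apply_of_mem_baseSet _ _ h]
  have h1 : (tTriv x₀).basisAt (stdBasis m) h i = (tTriv x₀).symmL ℝ z (stdBasis m i) := by
    simp [Trivialization.basisAt, Trivialization.linearEquivAt_symm_apply]
    exact (Trivialization.symmL_apply _ (mem_baseSet hz) _).symm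
  have h2 := TangentBundle.symmL_trivializationAt_eq_core (I := 𝓘(ℝ, Model m)) hz
  rw [h1, h2]
  simp [stdBasis, coordField, jac]
  rfl

theorem smV_coordField {x₀ z : M} (hz : z ∈ (chartAt (Model m) x₀).source)
    (i : Fin (2 * m + 1)) : SmV z (coordField (m := m) x₀ i) := by
  have h := contMDiffAt_localFrame_of_mem (I := 𝓘(ℝ, Model m)) ∞ (tTriv (m := m) x₀) (stdBasis m) i
    (mem_baseSet hz)
  refine h.congr_of_eventuallyEq ?_
  filter_upwards [source_mem_nhds hz] with p hp
  rw [coordField_eq_localFrame hp]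

theorem localFrameCoeff_eq_icomp {x₀ z : M} (hz : z ∈ (chartAt (Model m) x₀).source)
    (X : VField m M) (i) :
    (tTriv x₀).localFrameCoeff 𝓘(ℝ, Model m) (stdBasis m) i z (X z) = icomp x₀ z (X z) i := by
  rw [Trivialization.localFrameCoeff_apply_of_mem_baseSet (I := 𝓘(ℝ, Model m)) (tTriv x₀)
    (stdBasis m) (mem_baseSet hz)]
  have h3 : ∀ j, (tTriv x₀).basisAt (stdBasis m) (mem_baseSet hz) j = coordField x₀ j z := fun j => by
    rw [coordField_eq_localFrame hz, Trivialization.localFrame_apply_of_mem_baseSet]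
  conv_lhs => rw [sum_icomp hz (X z)]
  simp only [← h3, map_sum, map_smul, Module.Basis.repr_self, Finsupp.coe_finsetSum,
    Finset.sum_apply, Finsupp.smul_apply, Finsupp.single_apply]
  simp

theorem SmV.icomp {x₀ z : M} (hz : z ∈ (chartAt (Model m) x₀).source) {X : VField m M}
    (hX : SmV z X) (k) : SmR (m := m) z (fun p => icomp x₀ p (X p) k) := by
  have h := contMDiffAt_localFrameCoeff (I := 𝓘(ℝ, Model m)) (stdBasis m) (mem_baseSet hz) hX k
  refine ContMDiffAt.congr_of_eventuallyEq h ?_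
  filter_upwards [source_mem_nhds hz] with p hp
  exact (localFrameCoeff_eq_icomp hp _ _).symm

end Frame

/-- The axioms for the structure and the connection speak of globally smooth fields, while
coordinate fields are meaningful only on a chart domain. A bump function, available because M is
Hausdorff, bridges the gap, and all quantities concerned are local. -/
theorem exists_smooth_extension [T2Space M] {x₀ z : M} (hz : z ∈ (chartAt (Model m) x₀).source)
    (i : Fin (2 * m + 1)) : ∃ X : VField m M, SmoothVF X ∧ X =ᶠ[𝓝 z] coordField x₀ i := by
  obtain ⟨f, hf⟩ := (SmoothBumpFunction.nhds_basis_tsupport (I := 𝓘(ℝ, Model m)) z).mem_iff.1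
    (source_mem_nhds hz)
  refine ⟨fun p => f p • coordField x₀ i p, ?_, ?_⟩
  · refine ContMDiffOn.smul_section_of_tsupport (s := coordField x₀ i) (ψ := f)
      (u := (chartAt (Model m) x₀).source) f.contMDiff.contMDiffOn
      (chartAt (Model m) x₀).open_source (hf.2) fun p hp => (smV_coordField hp i).contMDiffWithinAt
  · filter_upwards [f.eventuallyEq_one] with p hp
    rw [hp]; exact one_smul ℝ _

/-! ### The structure in a fixed chart -/

theorem dirDeriv_congr {z : M} (v : TangentSpace 𝓘(ℝ, Model m) z) {f g : M → ℝ}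
    (h : f =ᶠ[𝓝 z] g) : dirDeriv (m := m) f z v = dirDeriv g z v := by
  exact congrArg (fun L : Model m →L[ℝ] ℝ => L v) h.mfderiv_eq

theorem SmV.congr {z : M} {X Y : VField m M} (hX : SmV z X) (h : Y =ᶠ[𝓝 z] X) : SmV z Y :=
  ContMDiffAt.congr_of_eventuallyEq hX (h.mono fun p hp => by
    show (⟨p, Y p⟩ : TangentBundle 𝓘(ℝ, Model m) M) = ⟨p, X p⟩
    rw [hp])

theorem SmV.mdiff {z : M} {X : VField m M} (hX : SmV z X) :
    MDifferentiableAt 𝓘(ℝ, Model m) (𝓘(ℝ, Model m).prod 𝓘(ℝ, Model m))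
      (fun x => (⟨x, X x⟩ : TangentBundle 𝓘(ℝ, Model m) M)) z :=
  ContMDiffAt.mdifferentiableAt hX (by simp)

theorem SmoothVF.smV {X : VField m M} (hX : SmoothVF X) (z : M) : SmV z X := hX.contMDiffAt

section Cov

variable (cov : AffineConnection m M)

theorem cov_congr {z : M} {X Y : VField m M} (hX : SmV z X) (h : X =ᶠ[𝓝 z] Y) :
    cov X z = cov Y z :=
  cov.isCovariantDerivativeOnUniv.congr_of_eventuallyEq hX.mdiff (hX.congr h.symm).mdiff
    Filter.univ_mem h

theorem cov_add {z : M} {X Y : VField m M} (hX : SmV z X) (hY : SmV z Y) :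
    cov (X + Y) z = cov X z + cov Y z :=
  cov.isCovariantDerivativeOnUniv.add hX.mdiff hY.mdiff

theorem cov_smul {z : M} {X : VField m M} {f : M → ℝ} (hf : SmR (m := m) z f) (hX : SmV z X)
    (v : TangentSpace 𝓘(ℝ, Model m) z) :
    cov (fun p => f p • X p) z v = f z • cov X z v + dirDeriv f z v • X z := by
  have h := cov.isCovariantDerivativeOnUniv.leibniz hX.mdiff hf.mdiff
  exact congrArg (fun L => L v) h

theorem SmV.smul {z : M} {X : VField m M} {f : M → ℝ} (hf : SmR (m := m) z f) (hX : SmV z X) :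
    SmV z (fun p => f p • X p) := ContMDiffAt.smul_section hf hX

theorem SmV.sum {z : M} {ι : Type*} {s : Finset ι} {X : ι → VField m M}
    (hX : ∀ i ∈ s, SmV z (X i)) : SmV z (fun p => ∑ i ∈ s, X i p) := ContMDiffAt.sum_section hX

theorem cov_sum {z : M} {ι : Type*} {s : Finset ι} {X : ι → VField m M}
    (hX : ∀ i ∈ s, SmV z (X i)) : cov (fun p => ∑ i ∈ s, X i p) z = ∑ i ∈ s, cov (X i) z := by
  classical
  induction s using Finset.induction_on with
  | empty =>
    simp only [Finset.sum_empty]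
    exact congrFun cov.zero z
  | insert i s hi ih =>
    simp only [Finset.sum_insert hi]
    rw [← ih fun j hj => hX j (by simp [hj])]
    exact cov_add cov (hX i (by simp)) (SmV.sum fun j hj => hX j (by simp [hj]))

/-- The connection coefficients in the chart at `x₀`. -/
def chr (x₀ : M) (k j i : Fin (2 * m + 1)) (z : M) : ℝ :=
  icomp x₀ z (cov (coordField x₀ j) z (coordField x₀ i z)) k

theorem chr_self (x : M) (k j i : Fin (2 * m + 1)) : chr cov x k j i x = christoffel cov x k j i := by
  unfold chr christoffel
  rw [icomp_self, coordField_self]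

variable {cov} {x₀ z : M} (hz : z ∈ (chartAt (Model m) x₀).source)
include hz

theorem cov_coordField (j i : Fin (2 * m + 1)) : cov (coordField x₀ j) z (coordField x₀ i z) =
    ∑ k, chr cov x₀ k j i z • coordField x₀ k z := sum_icomp hz _

theorem smR_chr [T2Space M] (hc : CovariantDerivative.ContMDiffCovariantDerivative cov ∞)
    (k j i : Fin (2 * m + 1)) : SmR (m := m) z (chr cov x₀ k j i) := by
  obtain ⟨X, hX, hXe⟩ := exists_smooth_extension (m := m) hz j
  have h1 := hc.contMDiff.contMDiff (σ := X) (hX.contMDiffOn)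
  have h2 := (h1.contMDiffAt Filter.univ_mem (x := z)).clm_bundle_apply (smV_coordField (m := m) hz i)
  have h3 : SmV z (fun p => cov X p (coordField x₀ i p)) := h2
  refine SmR.congr (h3.icomp hz k) ?_
  filter_upwards [hXe.eventuallyEq_nhds] with p hp
  unfold chr
  rw [cov_congr cov (hX.smV p) hp]

theorem cov_expand [T2Space M] {X : VField m M} (hX : SmV z X) (l : Fin (2 * m + 1)) (k) :
    icomp x₀ z (cov X z (coordField x₀ l z)) k =
      dirDeriv (fun p => icomp x₀ p (X p) k) z (coordField x₀ l z)
        + ∑ n, icomp x₀ z (X z) n * chr cov x₀ k n l z := by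
  have h1 : X =ᶠ[𝓝 z] (fun p => ∑ n, icomp x₀ p (X p) n • coordField x₀ n p : VField m M) := by
    filter_upwards [source_mem_nhds hz] with p hp
    exact sum_icomp hp (X p)
  have hs : ∀ n ∈ Finset.univ, SmV z (fun p => icomp x₀ p (X p) n • coordField (m := m) x₀ n p) :=
    fun n _ => SmV.smul (hX.icomp hz n) (smV_coordField hz n)
  rw [cov_congr cov hX h1, cov_sum cov hs]
  have h2 : (∑ n, cov (fun p => icomp x₀ p (X p) n • coordField x₀ n p) z) (coordField x₀ l z)
      = ∑ n, (icomp x₀ z (X z) n • cov (coordField x₀ n) z (coordField x₀ l z)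
        + dirDeriv (fun p => icomp x₀ p (X p) n) z (coordField x₀ l z) • coordField x₀ n z) := by
    rw [sum_apply]
    exact Finset.sum_congr rfl fun n _ => cov_smul cov (hX.icomp hz n) (smV_coordField hz n) _
  rw [h2, icomp_sum]
  simp only [icomp_add, icomp_smul, icomp_coordField hz, Finset.sum_add_distrib]
  rw [add_comm]
  congr 1
  simp

end Cov

section Bracket

variable {x₀ z : M} (hz : z ∈ (chartAt (Model m) x₀).source)
include hz

variable (m) in
/-- A constant vector field on the model space. -/
def constField (i : Fin (2 * m + 1)) : VField m (Model m) := fun _ => stdVec m i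

theorem coordField_eq_mpullback (i : Fin (2 * m + 1)) :
    coordField x₀ i z = VectorField.mpullback 𝓘(ℝ, Model m) 𝓘(ℝ, Model m)
      (extChartAt 𝓘(ℝ, Model m) x₀) (constField m i) z := by
  rw [VectorField.mpullback_apply]
  have h0 : MDifferentiableAt 𝓘(ℝ, Model m) 𝓘(ℝ, Model m) (extChartAt 𝓘(ℝ, Model m) x₀) z :=
    (contMDiffAt_extChartAt' (n := ∞) hz).mdifferentiableAt (by simp)
  have h1 : (mfderiv 𝓘(ℝ, Model m) 𝓘(ℝ, Model m) (extChartAt 𝓘(ℝ, Model m) x₀) z :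
      Model m →L[ℝ] Model m) = jacInv x₀ z := by
    refine h0.mfderiv.trans ?_
    rfl
  have h2 : (mfderiv 𝓘(ℝ, Model m) 𝓘(ℝ, Model m) (extChartAt 𝓘(ℝ, Model m) x₀) z :
      Model m →L[ℝ] Model m).inverse = jac x₀ z := by
    rw [h1]
    refine ContinuousLinearMap.inverse_eq ?_ ?_
    · ext1 v; exact jacInv_jac hz v
    · ext1 v; exact jac_jacInv hz v
  exact (congrArg (fun L : Model m →L[ℝ] Model m => L (stdVec m i)) h2).symm

/-- Coordinate fields are pullbacks of constant fields under the chart. Pullback respects brackets,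
and constant fields commute. -/
theorem mlieBracket_coordField (i j : Fin (2 * m + 1)) :
    VectorField.mlieBracket 𝓘(ℝ, Model m) (coordField x₀ i) (coordField x₀ j) z = 0 := by
  have he : ∀ i : Fin (2 * m + 1), coordField x₀ i =ᶠ[𝓝 z]
      VectorField.mpullback 𝓘(ℝ, Model m) 𝓘(ℝ, Model m)
      (extChartAt 𝓘(ℝ, Model m) x₀) (constField m i) := fun i => by
    filter_upwards [source_mem_nhds hz] with p hp
    exact coordField_eq_mpullback hp i
  rw [Filter.EventuallyEq.mlieBracket_vectorField_eq (he i) (he j)]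
  have hs : ∀ i : Fin (2 * m + 1), MDifferentiableAt 𝓘(ℝ, Model m) (𝓘(ℝ, Model m).prod 𝓘(ℝ, Model m))
      (fun q : Model m => (⟨q, constField m i q⟩ : TangentBundle 𝓘(ℝ, Model m) (Model m)))
      (extChartAt 𝓘(ℝ, Model m) x₀ z) := fun i => by
    have h : ContMDiffAt 𝓘(ℝ, Model m) (𝓘(ℝ, Model m).prod 𝓘(ℝ, Model m)) ∞
      (fun q : Model m => (⟨q, constField m i q⟩ : TangentBundle 𝓘(ℝ, Model m) (Model m)))
      (extChartAt 𝓘(ℝ, Model m) x₀ z) :=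
      contMDiffAt_vectorSpace_iff_contDiffAt.2 contDiffAt_const
    exact h.mdifferentiableAt (by simp)
  have : IsManifold 𝓘(ℝ, Model m) (minSmoothness ℝ 2) M :=
    IsManifold.of_le (n := ∞) (by
      simp only [minSmoothness_of_isRCLikeNormedField]; exact WithTop.coe_le_coe.2 le_top)
  rw [← VectorField.mpullback_mlieBracket (n := ∞) (hs i) (hs j) (contMDiffAt_extChartAt' hz)
    (by simp only [minSmoothness_of_isRCLikeNormedField]; exact WithTop.coe_le_coe.2 le_top)]
  rw [VectorField.mpullback_apply]
  have : VectorField.mlieBracket 𝓘(ℝ, Model m) (constField m i) (constField m j)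
      (extChartAt 𝓘(ℝ, Model m) x₀ z) = 0 := by
    rw [← VectorField.mlieBracketWithin_univ, VectorField.mlieBracketWithin_eq_lieBracketWithin]
    show VectorField.lieBracketWithin ℝ (fun _ : Model m => stdVec m i) (fun _ => stdVec m j)
      Set.univ _ = 0
    rw [VectorField.lieBracketWithin_univ]
    simp [VectorField.lieBracket]
  rw [this]
  exact map_zero _

end Bracket

namespace ContactMetricStructure

variable (S : ContactMetricStructure m M)

/-- The metric in the chart at `x₀`. -/
def gL (x₀ : M) (i j : Fin (2 * m + 1)) (z : M) : ℝ :=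
  S.g.inner z (coordField x₀ i z) (coordField x₀ j z)
/-- The endomorphism `φ` in the chart at `x₀`. -/
def phL (x₀ : M) (k j : Fin (2 * m + 1)) (z : M) : ℝ := icomp x₀ z (S.φ z (coordField x₀ j z)) k
/-- The contact form in the chart at `x₀`. -/
def lamL (x₀ : M) (i : Fin (2 * m + 1)) (z : M) : ℝ := S.lam z (coordField x₀ i z)
/-- The Reeb field in the chart at `x₀`. -/
def xiL (x₀ : M) (k : Fin (2 * m + 1)) (z : M) : ℝ := icomp x₀ z (S.ξ z) k
/-- The form `ω` in the chart at `x₀`. -/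
def omL (x₀ : M) (i j : Fin (2 * m + 1)) (z : M) : ℝ :=
  S.om z (coordField x₀ i z) (coordField x₀ j z)

section Algebra

variable {S} {x₀ z : M} (hz : z ∈ (chartAt (Model m) x₀).source)

theorem g_sum_left {ι : Type*} (s : Finset ι) (c : ι → ℝ) (u : ι → TangentSpace 𝓘(ℝ, Model m) z)
    (w : TangentSpace 𝓘(ℝ, Model m) z) :
    S.g.inner z (∑ i ∈ s, c i • u i) w = ∑ i ∈ s, c i * S.g.inner z (u i) w := by
  rw [map_sum, sum_apply]
  refine Finset.sum_congr rfl fun i _ => ?_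
  rw [map_smul]; rfl

theorem g_sum_right {ι : Type*} (s : Finset ι) (c : ι → ℝ) (u : ι → TangentSpace 𝓘(ℝ, Model m) z)
    (w : TangentSpace 𝓘(ℝ, Model m) z) :
    S.g.inner z w (∑ i ∈ s, c i • u i) = ∑ i ∈ s, c i * S.g.inner z w (u i) := by
  rw [map_sum]
  refine Finset.sum_congr rfl fun i _ => ?_
  rw [map_smul]; rfl

theorem lam_sum {ι : Type*} (s : Finset ι) (c : ι → ℝ) (u : ι → TangentSpace 𝓘(ℝ, Model m) z) :
    S.lam z (∑ i ∈ s, c i • u i) = ∑ i ∈ s, c i * S.lam z (u i) := by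
  rw [map_sum]
  refine Finset.sum_congr rfl fun i _ => ?_
  rw [map_smul]; rfl

theorem φ_sum {ι : Type*} (s : Finset ι) (c : ι → ℝ) (u : ι → TangentSpace 𝓘(ℝ, Model m) z) :
    S.φ z (∑ i ∈ s, c i • u i) = ∑ i ∈ s, c i • S.φ z (u i) := by
  rw [map_sum]
  refine Finset.sum_congr rfl fun i _ => ?_
  rw [map_smul]

theorem gL_symm (i j) : S.gL x₀ i j z = S.gL x₀ j i z := S.g.symm _ _ _

include hz

theorem φ_coordField (j : Fin (2 * m + 1)) :
    S.φ z (coordField x₀ j z) = ∑ k, S.phL x₀ k j z • coordField x₀ k z := sum_icomp hz _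

theorem ξ_eq_sum : S.ξ z = ∑ k, S.xiL x₀ k z • coordField x₀ k z := sum_icomp hz _

theorem lamL_eq (i) : S.lamL x₀ i z = ∑ k, S.gL x₀ i k z * S.xiL x₀ k z := by
  unfold lamL
  rw [S.lam_eq, ξ_eq_sum hz, g_sum_right]
  exact Finset.sum_congr rfl fun k _ => mul_comm _ _

theorem lamL_xiL : ∑ k, S.lamL x₀ k z * S.xiL x₀ k z = 1 := by
  have := S.lam_ξ z
  rw [ξ_eq_sum hz, lam_sum] at this
  rw [← this]
  exact Finset.sum_congr rfl fun k _ => mul_comm _ _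

theorem omL_eq (i j) : S.omL x₀ i j z = ∑ k, S.gL x₀ i k z * S.phL x₀ k j z := by
  unfold omL om
  rw [φ_coordField hz, g_sum_right]
  exact Finset.sum_congr rfl fun k _ => mul_comm _ _

theorem phL_xiL (k) : ∑ j, S.phL x₀ k j z * S.xiL x₀ j z = 0 := by
  have h := congrArg (fun v => icomp x₀ z v k) (S.φ_ξ z)
  rw [ξ_eq_sum hz, φ_sum] at h
  simp only [icomp_sum, icomp_smul] at h
  have h0 : icomp x₀ z 0 k = 0 := by
    have := icomp_smul x₀ z 0 0 k
    simpa using this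
  rw [h0] at h
  rw [← h]
  exact Finset.sum_congr rfl fun n _ => mul_comm _ _

theorem phL_gL_phL (i j) : ∑ a, ∑ b, S.phL x₀ a i z * S.gL x₀ a b z * S.phL x₀ b j z =
    S.gL x₀ i j z - S.lamL x₀ i z * S.lamL x₀ j z := by
  have h := S.g_φ_φ z (coordField x₀ i z) (coordField x₀ j z)
  rw [φ_coordField hz, φ_coordField hz, g_sum_left] at h
  simp only [g_sum_right, Finset.mul_sum] at h
  refine Eq.trans ?_ h
  exact Finset.sum_congr rfl fun a _ => Finset.sum_congr rfl fun b _ => by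
    rw [gL]; ring

/-- A null vector of the Gram matrix gives a tangent vector orthogonal to itself. -/
theorem gL_nondegenerate (c : Fin (2 * m + 1) → ℝ) (h : ∀ j, ∑ i, c i * S.gL x₀ i j z = 0) : c = 0 := by
  set v : TangentSpace 𝓘(ℝ, Model m) z := ∑ i, c i • coordField x₀ i z with hv
  have h1 : S.g.inner z v v = 0 := by
    refine (g_sum_left (S := S) Finset.univ c (fun i => coordField x₀ i z) v).trans ?_
    have h2 : ∀ i, S.g.inner z (coordField x₀ i z) v = ∑ j, c j * S.gL x₀ i j z := fun i => by
      rw [hv, g_sum_right]; rfl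
    simp only [h2, Finset.mul_sum]
    rw [Finset.sum_comm]
    refine Finset.sum_eq_zero fun j _ => ?_
    have := h j
    calc ∑ i, c i * (c j * S.gL x₀ i j z) = c j * ∑ i, c i * S.gL x₀ i j z := by
          rw [Finset.mul_sum]; exact Finset.sum_congr rfl fun i _ => by ring
      _ = 0 := by rw [this, mul_zero]
  have h3 : v = 0 := by
    by_contra hne
    exact (S.g.pos z v hne).ne' h1
  funext k
  have h4 : icomp x₀ z v k = icomp x₀ z 0 k := by rw [h3]
  rw [hv, icomp_sum] at h4
  simp only [icomp_smul, icomp_coordField hz] at h4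
  have h0 : icomp x₀ z 0 k = 0 := by
    have := icomp_smul x₀ z 0 0 k
    simpa using this
  rw [h0] at h4
  simpa using h4

end Algebra

section Smooth

variable [T2Space M] {S} {x₀ z : M} (hz : z ∈ (chartAt (Model m) x₀).source)
include hz

theorem smR_lamL (i) : SmR (m := m) z (S.lamL x₀ i) := by
  obtain ⟨X, hX, hXe⟩ := exists_smooth_extension (m := m) hz i
  exact SmR.congr (S.smooth_lam X hX).contMDiffAt (hXe.mono fun p hp => congrArg (S.lam p) hp.symm)

theorem smV_φ_coordField (i) : SmV z (fun p => S.φ p (coordField x₀ i p)) := by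
  obtain ⟨X, hX, hXe⟩ := exists_smooth_extension (m := m) hz i
  exact SmV.congr ((S.smooth_φ X hX).smV z) (hXe.mono fun p hp => congrArg (S.φ p) hp.symm)

theorem smR_phL (k i) : SmR (m := m) z (S.phL x₀ k i) := (smV_φ_coordField hz i).icomp hz k

theorem smR_xiL (k) : SmR (m := m) z (S.xiL x₀ k) := (S.smooth_ξ.smV z).icomp hz k

theorem smR_gL (i j) : SmR (m := m) z (S.gL x₀ i j) := by
  have h := ContMDiffAt.clm_bundle_apply₂ (F₃ := ℝ) (E₃ := fun _ : M => ℝ) S.g.contMDiff.contMDiffAt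
    (smV_coordField (m := m) hz i) (smV_coordField (m := m) hz j)
  have h2 := (Bundle.contMDiffAt_totalSpace.1 h).2
  exact h2

theorem smR_omL (i j) : SmR (m := m) z (S.omL x₀ i j) := by
  refine SmR.congr (SmR.sum fun k (_ : k ∈ Finset.univ) =>
    (smR_gL (S := S) hz i k).mul (smR_phL (S := S) hz k j)) ?_
  filter_upwards [source_mem_nhds hz] with p hp
  exact omL_eq hp i j

end Smooth

section Parallel

variable [T2Space M] {S} {cov : AffineConnection m M} (hcov : IsContactMetricConnection S cov)
  {x₀ z : M} (hz : z ∈ (chartAt (Model m) x₀).source)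
include hcov hz

/-- With its companions for g, ω, φ and ξ, this turns the parallelism of the structure tensors into
equations with Christoffel symbols, the form in which it is used from here on. -/
theorem dirDeriv_lamL (i l) : dirDeriv (S.lamL x₀ i) z (coordField x₀ l z) =
    ∑ k, chr cov x₀ k i l z * S.lamL x₀ k z := by
  obtain ⟨X, hX, hXe⟩ := exists_smooth_extension (m := m) hz i
  have h := hcov.lam_parallel X hX z (coordField x₀ l z)
  rw [cov_congr cov (hX.smV z) hXe, cov_coordField hz, lam_sum] at h
  refine Eq.trans (dirDeriv_congr _ (hXe.mono fun p hp => ?_)) h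
  rw [lamL, hp]

theorem dirDeriv_gL (i j l) : dirDeriv (S.gL x₀ i j) z (coordField x₀ l z) =
    ∑ k, chr cov x₀ k i l z * S.gL x₀ k j z + ∑ k, chr cov x₀ k j l z * S.gL x₀ i k z := by
  obtain ⟨X, hX, hXe⟩ := exists_smooth_extension (m := m) hz i
  obtain ⟨Y, hY, hYe⟩ := exists_smooth_extension (m := m) hz j
  have h := hcov.g_parallel X Y hX hY z (coordField x₀ l z)
  rw [cov_congr cov (hX.smV z) hXe, cov_congr cov (hY.smV z) hYe, cov_coordField hz,
    cov_coordField hz, g_sum_left, g_sum_right, hXe.self_of_nhds, hYe.self_of_nhds] at h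
  refine Eq.trans (dirDeriv_congr _ ?_) h
  filter_upwards [hXe, hYe] with p hp hp'
  rw [gL, hp, hp']

theorem dirDeriv_omL (i j l) : dirDeriv (S.omL x₀ i j) z (coordField x₀ l z) =
    ∑ k, chr cov x₀ k i l z * S.omL x₀ k j z + ∑ k, chr cov x₀ k j l z * S.omL x₀ i k z := by
  obtain ⟨X, hX, hXe⟩ := exists_smooth_extension (m := m) hz i
  obtain ⟨Y, hY, hYe⟩ := exists_smooth_extension (m := m) hz j
  have h := hcov.om_parallel X Y hX hY z (coordField x₀ l z)
  rw [cov_congr cov (hX.smV z) hXe, cov_congr cov (hY.smV z) hYe, cov_coordField hz,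
    cov_coordField hz, hXe.self_of_nhds, hYe.self_of_nhds] at h
  simp only [om] at h
  rw [g_sum_left, φ_sum, g_sum_right] at h
  refine Eq.trans (dirDeriv_congr _ ?_) h
  filter_upwards [hXe, hYe] with p hp hp'
  rw [omL, om, hp, hp']

theorem dirDeriv_phL (k j l) : dirDeriv (S.phL x₀ k j) z (coordField x₀ l z) =
    ∑ n, chr cov x₀ n j l z * S.phL x₀ k n z - ∑ n, S.phL x₀ n j z * chr cov x₀ k n l z := by
  obtain ⟨X, hX, hXe⟩ := exists_smooth_extension (m := m) hz j
  have h := hcov.φ_parallel X hX z (coordField x₀ l z)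
  have hXe' : (fun p => S.φ p (X p)) =ᶠ[𝓝 z] (fun p => S.φ p (coordField x₀ j p) : VField m M) :=
    hXe.mono fun p hp => congrArg (S.φ p) hp
  rw [cov_congr cov ((S.smooth_φ X hX).smV z) hXe', cov_congr cov (hX.smV z) hXe,
    cov_coordField hz, φ_sum] at h
  have h2 := congrArg (fun v => icomp x₀ z v k) h
  simp only [icomp_sum, icomp_smul] at h2
  rw [cov_expand hz (smV_φ_coordField hz j)] at h2
  exact eq_sub_of_add_eq h2

theorem dirDeriv_xiL (k l) : dirDeriv (S.xiL x₀ k) z (coordField x₀ l z) =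
    -∑ n, S.xiL x₀ n z * chr cov x₀ k n l z := by
  have h : icomp x₀ z (cov S.ξ z (coordField x₀ l z)) k = icomp x₀ z 0 k := by
    rw [hcov.ξ_parallel z (coordField x₀ l z)]
  rw [cov_expand hz (S.smooth_ξ.smV z)] at h
  have h0 : icomp x₀ z 0 k = 0 := by
    have := icomp_smul x₀ z 0 0 k
    simpa using this
  rw [h0] at h
  exact eq_neg_of_add_eq_zero_left h

-- Coordinate fields commute, so the bracket term of dλ drops out. This is where ω = dλ enters: it
-- makes ω antisymmetric and, through `pd_omL_cyclic`, closed.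
omit hcov in
theorem omL_eq_dlam (i j) : S.omL x₀ i j z = dirDeriv (S.lamL x₀ j) z (coordField x₀ i z) -
    dirDeriv (S.lamL x₀ i) z (coordField x₀ j z) := by
  obtain ⟨X, hX, hXe⟩ := exists_smooth_extension (m := m) hz i
  obtain ⟨Y, hY, hYe⟩ := exists_smooth_extension (m := m) hz j
  have h := S.dlam_eq X Y hX hY z
  rw [Filter.EventuallyEq.mlieBracket_vectorField_eq hXe hYe, mlieBracket_coordField hz, map_zero,
    sub_zero, hXe.self_of_nhds, hYe.self_of_nhds] at h
  rw [omL, om, ← h]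
  congr 1
  · exact dirDeriv_congr _ (hYe.mono fun p hp => congrArg (S.lam p) hp)
  · exact dirDeriv_congr _ (hXe.mono fun p hp => congrArg (S.lam p) hp)

end Parallel

end ContactMetricStructure

end

end WickContact

/-! ### The Wick tensor, covariant derivatives and fibrewise operators in charts. -/

namespace WickContact

set_option linter.unusedSectionVars false

noncomputable section

open Wick

variable {m : ℕ} {M : Type*} [TopologicalSpace M] [ChartedSpace (Model m) M]
  [IsManifold 𝓘(ℝ, Model m) ∞ M]

/-! ### The Wick tensor in a fixed chart -/

theorem SmR.prod {z : M} {ι : Type*} {s : Finset ι} {f : ι → M → ℝ}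
    (hf : ∀ i ∈ s, SmR (m := m) z (f i)) : SmR (m := m) z (fun p => ∏ i ∈ s, f i p) := by
  classical
  induction s using Finset.induction_on with
  | empty => simpa using smR_const z 1
  | insert i s hi ih =>
    simp only [Finset.prod_insert hi]
    exact (hf i (by simp)).mul (ih fun j hj => hf j (by simp [hj]))

theorem SmR.inv {z : M} {f : M → ℝ} (hf : SmR (m := m) z f) (h0 : f z ≠ 0) :
    SmR (m := m) z (fun p => (f p)⁻¹) :=
  (contDiffAt_inv ℝ h0).contMDiffAt.comp z hf

theorem SmR.det {z : M} {ι : Type*} [Fintype ι] [DecidableEq ι] {A : M → Matrix ι ι ℝ}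
    (hA : ∀ i j, SmR (m := m) z (fun p => A p i j)) : SmR (m := m) z (fun p => (A p).det) := by
  simp only [Matrix.det_apply']
  exact SmR.sum fun σ _ => (smR_const z _).mul (SmR.prod fun i _ => hA _ _)

theorem SmR.matrix_inv {z : M} {ι : Type*} [Fintype ι] [DecidableEq ι] {A : M → Matrix ι ι ℝ}
    (hA : ∀ i j, SmR (m := m) z (fun p => A p i j)) (h0 : (A z).det ≠ 0) (i j) :
    SmR (m := m) z (fun p => (A p)⁻¹ i j) := by
  simp only [Matrix.inv_def, Matrix.smul_apply, Ring.inverse_eq_inv', Matrix.adjugate_apply]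
  refine ((SmR.det hA).inv h0).mul (SmR.det fun k l => ?_)
  simp only [Matrix.updateRow_apply]
  split_ifs
  · exact smR_const _ _
  · exact hA _ _

namespace ContactMetricStructure

variable (S : ContactMetricStructure m M)

/-- The matrix of the metric in the chart at `x₀`. -/
def gMat (x₀ z : M) : Matrix (Fin (2 * m + 1)) (Fin (2 * m + 1)) ℝ :=
  Matrix.of fun i j => S.gL x₀ i j z
/-- The matrix of `φ` in the chart at `x₀`. -/
def phMat (x₀ z : M) : Matrix (Fin (2 * m + 1)) (Fin (2 * m + 1)) ℝ :=
  Matrix.of fun i j => S.phL x₀ i j z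
/-- The matrix of `ω` in the chart at `x₀`. -/
def omMat (x₀ z : M) : Matrix (Fin (2 * m + 1)) (Fin (2 * m + 1)) ℝ :=
  Matrix.of fun i j => S.omL x₀ i j z
/-- The bivector `π` in the chart at `x₀`. -/
def piMat (x₀ z : M) : Matrix (Fin (2 * m + 1)) (Fin (2 * m + 1)) ℝ :=
  (S.gMat x₀ z)⁻¹ * (S.phMat x₀ z).transpose
/-- The Wick tensor in the chart at `x₀`. -/
def hL (x₀ z : M) (i j : Fin (2 * m + 1)) : ℂ :=
  ((S.gMat x₀ z)⁻¹ i j : ℂ) + Complex.I * (S.piMat x₀ z i j : ℂ)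

theorem hL_self (x : M) : S.hL x x = S.wickTensor x := by
  funext i j
  unfold hL wickTensor piMat piComp invMetric gMat phMat
  simp only [Matrix.mul_apply, Matrix.transpose_apply, Matrix.of_apply, gL, phL, coordField_self,
    icomp_self]

variable {S} {x₀ z : M} (hz : z ∈ (chartAt (Model m) x₀).source)

theorem gMat_symm : (S.gMat x₀ z).transpose = S.gMat x₀ z := by
  ext i j; exact gL_symm _ _
theorem gMat_inv_symm : ((S.gMat x₀ z)⁻¹).transpose = (S.gMat x₀ z)⁻¹ := by
  rw [Matrix.transpose_nonsing_inv, gMat_symm]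

include hz

theorem det_gMat : (S.gMat x₀ z).det ≠ 0 := by
  intro h
  obtain ⟨c, hc, h0⟩ := Matrix.exists_vecMul_eq_zero_iff.2 h
  exact hc (gL_nondegenerate hz c fun j => by
    have := congrFun h0 j
    simpa [Matrix.vecMul, dotProduct, gMat] using this)

theorem gMat_inv_mul : (S.gMat x₀ z)⁻¹ * S.gMat x₀ z = 1 :=
  Matrix.nonsing_inv_mul _ (isUnit_iff_ne_zero.2 (det_gMat hz))
theorem gMat_mul_inv : S.gMat x₀ z * (S.gMat x₀ z)⁻¹ = 1 :=
  Matrix.mul_nonsing_inv _ (isUnit_iff_ne_zero.2 (det_gMat hz))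

theorem smR_gMat_inv [T2Space M] (i j) : SmR (m := m) z (fun p => (S.gMat x₀ p)⁻¹ i j) :=
  SmR.matrix_inv (A := fun p => S.gMat x₀ p) (fun i j => smR_gL (S := S) hz i j) (det_gMat hz) i j

theorem smR_piMat [T2Space M] (i j) : SmR (m := m) z (fun p => S.piMat x₀ p i j) := by
  simp only [piMat, Matrix.mul_apply]
  exact SmR.sum fun k _ => (smR_gMat_inv hz i k).mul (smR_phL hz j k)

theorem smC_hL [T2Space M] (i j) : SmC (m := m) z (fun p => S.hL x₀ p i j) :=
  (smR_gMat_inv hz i j).ofReal.add ((smC_const z _).mul (smR_piMat hz i j).ofReal)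

theorem omMat_eq : S.omMat x₀ z = S.gMat x₀ z * S.phMat x₀ z := by
  ext i j
  exact omL_eq hz i j

theorem omMat_transpose [T2Space M] : (S.omMat x₀ z).transpose = -S.omMat x₀ z := by
  ext i j
  simp only [omMat, Matrix.transpose_apply, Matrix.of_apply, Matrix.neg_apply]
  rw [omL_eq_dlam hz, omL_eq_dlam hz]; ring

/-- Antisymmetry of ω = gφ reads φᵀ g = -ω, so that π = g⁻¹φᵀ is, up to sign, ω with both indices
raised. In particular π is antisymmetric. -/
theorem piMat_eq [T2Space M] :
    S.piMat x₀ z = -((S.gMat x₀ z)⁻¹ * S.omMat x₀ z * (S.gMat x₀ z)⁻¹) := by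
  have h := omMat_transpose (S := S) hz
  rw [omMat_eq hz] at h
  rw [← Matrix.neg_mul, ← Matrix.mul_neg, omMat_eq hz, ← h, Matrix.transpose_mul, gMat_symm, piMat,
    Matrix.mul_assoc, Matrix.mul_assoc, gMat_mul_inv hz, Matrix.mul_one]

theorem piMat_transpose [T2Space M] : (S.piMat x₀ z).transpose = -S.piMat x₀ z := by
  rw [piMat_eq hz]
  simp only [Matrix.transpose_neg, Matrix.transpose_mul, gMat_inv_symm, omMat_transpose hz,
    Matrix.neg_mul, Matrix.mul_neg, neg_neg, Matrix.mul_assoc]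

theorem gMat_inv_lamL (i) : ∑ k, (S.gMat x₀ z)⁻¹ i k * S.lamL x₀ k z = S.xiL x₀ i z := by
  have h : Matrix.mulVec (S.gMat x₀ z) (fun k => S.xiL x₀ k z) = fun k => S.lamL x₀ k z := by
    funext k
    rw [lamL_eq hz]; rfl
  have h2 := congrArg (Matrix.mulVec (S.gMat x₀ z)⁻¹) h
  rw [Matrix.mulVec_mulVec, gMat_inv_mul hz, Matrix.one_mulVec] at h2
  exact (congrFun h2 i).symm

/-- The projection `P` in the chart at `x₀`. -/
theorem piMat_mul_omMat : S.piMat x₀ z * S.omMat x₀ z =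
    1 - Matrix.of fun i j => S.xiL x₀ i z * S.lamL x₀ j z := by
  have h1 : (S.phMat x₀ z).transpose * S.gMat x₀ z * S.phMat x₀ z =
      S.gMat x₀ z - Matrix.of fun i j => S.lamL x₀ i z * S.lamL x₀ j z := by
    ext i j
    rw [Matrix.sub_apply, Matrix.of_apply, gMat, Matrix.of_apply, ← phL_gL_phL hz]
    simp only [Matrix.mul_apply, Finset.sum_mul]
    rw [Finset.sum_comm]
    rfl
  rw [piMat, omMat_eq hz, Matrix.mul_assoc, ← Matrix.mul_assoc _ _ (S.phMat x₀ z), h1,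
    Matrix.mul_sub, gMat_inv_mul hz]
  congr 1
  ext i j
  rw [Matrix.mul_apply, Matrix.of_apply, ← gMat_inv_lamL hz, Finset.sum_mul]
  exact Finset.sum_congr rfl fun k _ => by rw [Matrix.of_apply]; ring

/-- Lowering an index of h leaves only the identity and φ, whose derivatives are known without
differentiating an inverse matrix. -/
theorem hL_mul_gL (q r) : ∑ p, S.hL x₀ z p q * (S.gL x₀ p r z : ℂ) =
    (if q = r then 1 else 0) + Complex.I * (S.phL x₀ q r z : ℂ) := by
  have h1 : ∑ p, (S.gMat x₀ z)⁻¹ p q * S.gL x₀ p r z = if q = r then 1 else 0 := by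
    have := congrFun (congrFun (gMat_inv_mul (S := S) hz) q) r
    rw [Matrix.mul_apply, Matrix.one_apply] at this
    rw [← this]
    refine Finset.sum_congr rfl fun p _ => ?_
    rw [← gMat_inv_symm, Matrix.transpose_apply, gMat_inv_symm]; rfl
  have h2 : ∑ p, S.piMat x₀ z p q * S.gL x₀ p r z = S.phL x₀ q r z := by
    have : (S.piMat x₀ z).transpose * S.gMat x₀ z = S.phMat x₀ z := by
      rw [piMat, Matrix.transpose_mul, Matrix.transpose_transpose, gMat_inv_symm, Matrix.mul_assoc,
        gMat_inv_mul hz, Matrix.mul_one]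
    exact congrFun (congrFun this q) r
  simp only [hL, add_mul, Finset.sum_add_distrib, mul_assoc, ← Finset.mul_sum]
  rw [← h2]
  push_cast
  congr 1
  have := congrArg (fun t : ℝ => (t : ℂ)) h1
  simp only [Complex.ofReal_sum, Complex.ofReal_mul] at this
  rw [this]
  split_ifs <;> simp

theorem eq_zero_of_gL {c : Fin (2 * m + 1) → ℂ} (h : ∀ r, ∑ p, c p * (S.gL x₀ p r z : ℂ) = 0) (p) :
    c p = 0 := by
  have h1 : ∑ r, (∑ q, c q * (S.gL x₀ q r z : ℂ)) * ((S.gMat x₀ z)⁻¹ r p : ℂ) = 0 :=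
    Finset.sum_eq_zero fun r _ => by rw [h, zero_mul]
  simp only [Finset.sum_mul] at h1
  rw [Finset.sum_comm] at h1
  have h2 : ∀ q, ∑ r, c q * (S.gL x₀ q r z : ℂ) * ((S.gMat x₀ z)⁻¹ r p : ℂ) =
      if q = p then c q else 0 := fun q => by
    have := congrFun (congrFun (gMat_mul_inv (S := S) hz) q) p
    rw [Matrix.mul_apply, Matrix.one_apply] at this
    have h3 := congrArg (fun t : ℝ => (t : ℂ)) this
    simp only [Complex.ofReal_sum, Complex.ofReal_mul] at h3
    simp only [mul_assoc, ← Finset.mul_sum]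
    refine (congrArg (c q * ·) h3).trans ?_
    split_ifs <;> simp
  simp only [h2] at h1
  simpa using h1

/-- Differentiate h·g = 1 + iφ (`hL_mul_gL`), insert ∇g = 0 and ∇φ = 0, and cancel g by
nondegeneracy. -/
theorem parallel_hL [T2Space M] {cov : AffineConnection m M} (hcov : IsContactMetricConnection S cov)
    (l : Fin (2 * m + 1)) :
    ParallelAt z (coordField x₀ l z) (fun k j => (chr cov x₀ k j l z : ℂ)) (S.hL x₀) := by
  intro p q
  refine eq_zero_of_gL (S := S) hz (c := fun p => dC (m := m) (fun x => S.hL x₀ x p q) z (coordField x₀ l z)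
    + ∑ i, S.hL x₀ z i q * (chr cov x₀ p i l z : ℂ) + ∑ j, S.hL x₀ z p j * (chr cov x₀ q j l z : ℂ))
    (fun r => ?_) p
  have h1 : dC (m := m) (fun x => ∑ p, S.hL x₀ x p q * (S.gL x₀ p r x : ℂ)) z (coordField x₀ l z) =
      ∑ p, (dC (m := m) (fun x => S.hL x₀ x p q) z (coordField x₀ l z) * (S.gL x₀ p r z : ℂ)
        + S.hL x₀ z p q * (dirDeriv (S.gL x₀ p r) z (coordField x₀ l z) : ℂ)) := by
    rw [dC_sum _ _ fun p _ => (smC_hL hz p q).mul (smR_gL hz p r).ofReal]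
    refine Finset.sum_congr rfl fun p _ => ?_
    rw [dC_mul _ _ (smC_hL hz p q) (smR_gL hz p r).ofReal, dC_ofReal _ _ (smR_gL hz p r)]
  have h2 : dC (m := m) (fun x => ∑ p, S.hL x₀ x p q * (S.gL x₀ p r x : ℂ)) z (coordField x₀ l z) =
      Complex.I * (dirDeriv (S.phL x₀ q r) z (coordField x₀ l z) : ℂ) := by
    have he : (fun x => ∑ p, S.hL x₀ x p q * (S.gL x₀ p r x : ℂ)) =ᶠ[𝓝 z]
        fun x => (if q = r then 1 else 0) + Complex.I * (S.phL x₀ q r x : ℂ) := by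
      filter_upwards [source_mem_nhds hz] with x hx
      exact hL_mul_gL hx q r
    rw [dC_congr _ _ he, dC_add _ _ (smC_const _ _) ((smC_const _ _).mul (smR_phL hz q r).ofReal),
      dC_const_mul _ _ _ (smR_phL hz q r).ofReal, dC_const, zero_add, dC_ofReal _ _ (smR_phL hz q r)]
  rw [h2] at h1
  simp only [dirDeriv_gL hcov hz, dirDeriv_phL hcov hz, Finset.sum_add_distrib] at h1
  push_cast at h1
  simp only [mul_add, Finset.sum_add_distrib, Finset.mul_sum] at h1
  simp only [add_mul, Finset.sum_add_distrib, Finset.sum_mul]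
  have e1 : ∑ p, ∑ k, S.hL x₀ z p q * ((chr cov x₀ k p l z : ℂ) * (S.gL x₀ k r z : ℂ)) =
      ∑ p, ∑ i, S.hL x₀ z i q * (chr cov x₀ p i l z : ℂ) * (S.gL x₀ p r z : ℂ) := by
    rw [Finset.sum_comm]
    exact Finset.sum_congr rfl fun _ _ => Finset.sum_congr rfl fun _ _ => by ring
  have e2 : ∑ p, ∑ k, S.hL x₀ z p q * ((chr cov x₀ k r l z : ℂ) * (S.gL x₀ p k z : ℂ)) =
      ∑ k, (chr cov x₀ k r l z : ℂ) * ((if q = k then 1 else 0) + Complex.I * (S.phL x₀ q k z : ℂ)) := by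
    rw [Finset.sum_comm]
    refine Finset.sum_congr rfl fun k _ => ?_
    rw [← hL_mul_gL hz, Finset.mul_sum]
    exact Finset.sum_congr rfl fun _ _ => by ring
  have e3 : ∑ p, ∑ j, S.hL x₀ z p j * (chr cov x₀ q j l z : ℂ) * (S.gL x₀ p r z : ℂ) =
      ∑ j, (chr cov x₀ q j l z : ℂ) * ((if j = r then 1 else 0) + Complex.I * (S.phL x₀ j r z : ℂ)) := by
    rw [Finset.sum_comm]
    refine Finset.sum_congr rfl fun k _ => ?_
    rw [← hL_mul_gL hz, Finset.mul_sum]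
    exact Finset.sum_congr rfl fun _ _ => by ring
  rw [e1, e2] at h1
  rw [e3]
  simp only [mul_add, Finset.sum_add_distrib, mul_ite, mul_one, mul_zero, Finset.sum_ite_eq,
    Finset.sum_ite_eq', Finset.mem_univ, if_true] at h1 ⊢
  have e4 : ∑ k, (chr cov x₀ k r l z : ℂ) * (Complex.I * (S.phL x₀ q k z : ℂ)) =
    Complex.I * ∑ k, (chr cov x₀ k r l z : ℂ) * (S.phL x₀ q k z : ℂ) := by
    rw [Finset.mul_sum]; exact Finset.sum_congr rfl fun _ _ => by ring
  have e5 : ∑ k, (chr cov x₀ q k l z : ℂ) * (Complex.I * (S.phL x₀ k r z : ℂ)) =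
    Complex.I * ∑ k, (S.phL x₀ k r z : ℂ) * (chr cov x₀ q k l z : ℂ) := by
    rw [Finset.mul_sum]; exact Finset.sum_congr rfl fun _ _ => by ring
  rw [e4] at h1
  rw [e5]
  linear_combination -h1

end ContactMetricStructure

section Transform

variable {x₀ z : M} (hz : z ∈ (chartAt (Model m) x₀).source)

theorem coordField_eq_sum_frame (k : Fin (2 * m + 1)) :
    coordField x₀ k z = ∑ i, ent (jac x₀ z) i k • frame z i := by
  have := sum_icomp (mem_source z) (coordField (m := m) x₀ k z)
  simp only [icomp_self, coordField_self] at this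
  exact this

include hz

theorem comp_eq_sum_icomp (v : TangentSpace 𝓘(ℝ, Model m) z) (i : Fin (2 * m + 1)) :
    comp z v i = ∑ k, ent (jac x₀ z) i k * icomp x₀ z v k := by
  conv_lhs => rw [← icomp_self, sum_icomp hz v, icomp_sum]
  refine Finset.sum_congr rfl fun k _ => ?_
  rw [icomp_smul, icomp_self, mul_comm]
  rfl

theorem jacMat_mul_inv : (Matrix.of fun i j => ent (jac x₀ z) i j) *
    (Matrix.of fun i j => ent (jacInv x₀ z) i j) = (1 : Matrix (Fin (2 * m + 1)) _ ℝ) := by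
  ext i j
  simp only [Matrix.mul_apply, Matrix.of_apply]
  rw [← ent_comp, show jac x₀ z ∘L jacInv x₀ z = ContinuousLinearMap.id ℝ (Model m) by
    ext1 v; exact jac_jacInv hz v, ent_id, Matrix.one_apply]

variable (S : ContactMetricStructure m M)

/-- With J the Jacobian, the metrics are related by Jᵀ g J and the endomorphisms by φ J = J φ.
Inverting the first shows that g⁻¹ and π = g⁻¹φᵀ transform contravariantly. This makes ∘ well
defined on the bundle. -/
theorem tensorRel_jac : TensorRel (jac x₀ z) (S.wickTensor z) (S.hL x₀ z) := by
  set J : Matrix (Fin (2 * m + 1)) (Fin (2 * m + 1)) ℝ := Matrix.of fun i j => ent (jac x₀ z) i j with hJ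
  have hJ' := jacMat_mul_inv (m := m) hz
  have hg : J.transpose * S.gMat z z * J = S.gMat x₀ z := by
    ext k l
    simp only [ContactMetricStructure.gMat, Matrix.of_apply, ContactMetricStructure.gL]
    rw [coordField_eq_sum_frame, coordField_eq_sum_frame, ContactMetricStructure.g_sum_left]
    simp only [ContactMetricStructure.g_sum_right, Matrix.mul_apply, Matrix.transpose_apply,
      Matrix.of_apply, coordField_self, Finset.sum_mul, Finset.mul_sum, hJ]
    rw [Finset.sum_comm]
    exact Finset.sum_congr rfl fun _ _ => Finset.sum_congr rfl fun _ _ => by ring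
  have hp : S.phMat z z * J = J * S.phMat x₀ z := by
    ext k l
    have h1 := comp_eq_sum_icomp hz (S.φ z (coordField x₀ l z)) k
    have h2 : icomp z z (S.φ z (coordField x₀ l z)) k =
        ∑ i, ent (jac x₀ z) i l * icomp z z (S.φ z (frame z i)) k := by
      rw [coordField_eq_sum_frame, ContactMetricStructure.φ_sum, icomp_sum]
      simp only [icomp_smul]
    rw [← icomp_self, h2] at h1
    simp only [Matrix.mul_apply, ContactMetricStructure.phMat, Matrix.of_apply,
      ContactMetricStructure.phL, hJ, coordField_self]
    rw [← h1]
    exact Finset.sum_congr rfl fun _ _ => mul_comm _ _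
  have hG : (S.gMat z z)⁻¹ = J * (S.gMat x₀ z)⁻¹ * J.transpose := by
    refine Matrix.inv_eq_right_inv ?_
    have h1 : J.transpose * (S.gMat z z * (J * (S.gMat x₀ z)⁻¹ * J.transpose)) = J.transpose := by
      calc J.transpose * (S.gMat z z * (J * (S.gMat x₀ z)⁻¹ * J.transpose))
          = (J.transpose * S.gMat z z * J) * (S.gMat x₀ z)⁻¹ * J.transpose := by
            simp only [Matrix.mul_assoc]
        _ = J.transpose := by rw [hg, ContactMetricStructure.gMat_mul_inv hz, Matrix.one_mul]
    have h2 := congrArg ((Matrix.of fun i j => ent (jacInv x₀ z) i j).transpose * ·) h1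
    rw [← Matrix.mul_assoc, ← Matrix.transpose_mul, hJ', Matrix.transpose_one, Matrix.one_mul] at h2
    exact h2
  have hP : S.piMat z z = J * S.piMat x₀ z * J.transpose := by
    rw [ContactMetricStructure.piMat, ContactMetricStructure.piMat, hG]
    calc J * (S.gMat x₀ z)⁻¹ * J.transpose * (S.phMat z z).transpose
        = J * (S.gMat x₀ z)⁻¹ * (S.phMat z z * J).transpose := by
          rw [Matrix.transpose_mul, ← Matrix.mul_assoc]
      _ = _ := by rw [hp, Matrix.transpose_mul]; simp only [Matrix.mul_assoc]
  intro i j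
  rw [← S.hL_self z]
  unfold ContactMetricStructure.hL
  rw [hG, hP]
  have e : ∀ A : Matrix (Fin (2 * m + 1)) (Fin (2 * m + 1)) ℝ, (((J * A * J.transpose) i j : ℝ) : ℂ) =
      ∑ k, ∑ l, (ent (jac x₀ z) i k : ℂ) * (A k l : ℂ) * (ent (jac x₀ z) j l : ℂ) := fun A => by
    simp only [Matrix.mul_apply, Matrix.transpose_apply, Finset.sum_mul, hJ, Matrix.of_apply]
    rw [Finset.sum_comm]
    push_cast
    rfl
  rw [e, e]
  simp only [Finset.mul_sum, ← Finset.sum_add_distrib]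
  exact Finset.sum_congr rfl fun _ _ => Finset.sum_congr rfl fun _ _ => by ring

end Transform

/-! ### The connection on Wick-valued functions in a fixed chart -/

/-- For linear vector fields the second-order terms of the commutator cancel. The matrices occur in
reversed order because the action is on the coordinate functions y. -/
theorem gam_comm (C D : Fin (2 * m + 1) → Fin (2 * m + 1) → ℂ) (w : Wick m) :
    gam C (gam D w) - gam D (gam C w) =
      gam (fun k a => ∑ j, (D k j * C j a - C k j * D j a)) w := by
  have h1 : gam C (gam D w) = gam D (gam C w) + (∑ j, ∑ k, const (D k j) * gam C (y j) * dy k w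
      - ∑ j, ∑ k, const (D k j) * y j * ∑ b, const (C b k) * dy b w) := by
    conv_lhs => rw [gam.eq_def D, gam_sum]
    rw [gam.eq_def D, ← Finset.sum_sub_distrib, ← Finset.sum_add_distrib]
    refine Finset.sum_congr rfl fun j _ => ?_
    rw [gam_sum, ← Finset.sum_sub_distrib, ← Finset.sum_add_distrib]
    refine Finset.sum_congr rfl fun k _ => ?_
    rw [gam_mul, gam_mul, gam_of_isScalar C (isScalar_const _), dy_gam]
    ring
  rw [h1, add_sub_cancel_left]
  simp only [gam_y]
  simp only [gam, Finset.sum_sub_distrib, const_sub, sub_mul, const_sum, const_mul, Finset.mul_sum,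
    Finset.sum_mul]
  have e1 : ∑ j, ∑ k, ∑ a, const (D k j) * (const (C j a) * y a) * dy k w =
      ∑ a, ∑ k, ∑ j, const (D k j) * const (C j a) * y a * dy k w := by
    rw [Finset.sum_congr rfl fun j _ => Finset.sum_comm, Finset.sum_comm]
    refine Finset.sum_congr rfl fun a _ => ?_
    rw [Finset.sum_comm]
    exact Finset.sum_congr rfl fun k _ => Finset.sum_congr rfl fun j _ => by ring
  have e2 : ∑ j, ∑ k, ∑ b, const (D k j) * y j * (const (C b k) * dy b w) =
      ∑ a, ∑ k, ∑ j, const (C k j) * const (D j a) * y a * dy k w := by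
    refine Finset.sum_congr rfl fun a _ => ?_
    rw [Finset.sum_comm]
    exact Finset.sum_congr rfl fun k _ => Finset.sum_congr rfl fun j _ => by ring
  exact congrArg₂ (· - ·) e1 e2

/-- The covariant derivative along the `i`-th coordinate of the chart at `x₀`. -/
def nab (cov : AffineConnection m M) (x₀ : M) (i : Fin (2 * m + 1)) (F : M → Wick m) (z : M) :
    Wick m := covAt z (coordField x₀ i z) (fun k j => (chr cov x₀ k j i z : ℂ)) F

/-- The curvature in the chart at `x₀`. -/
def curvL (cov : AffineConnection m M) (x₀ : M) (b a k l : Fin (2 * m + 1)) (z : M) : ℝ :=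
  dirDeriv (chr cov x₀ b a l) z (coordField x₀ k z) - dirDeriv (chr cov x₀ b a k) z (coordField x₀ l z)
    + ∑ n, (chr cov x₀ n a l z * chr cov x₀ b n k z - chr cov x₀ n a k z * chr cov x₀ b n l z)

section Nab

variable {cov : AffineConnection m M} {x₀ z : M} {F G : M → Wick m}

variable (hz : z ∈ (chartAt (Model m) x₀).source)
include hz

theorem SmW.dv_coordField (hF : SmW z F) (i) : SmW z (fun p => dv p (coordField x₀ i p) F) :=
  fun k d => by
    simp only [cf_dv]
    exact (hF k d).pd hz i

theorem SmW.gam_chr [T2Space M] (hc : CovariantDerivative.ContMDiffCovariantDerivative cov ∞)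
    (hF : SmW z F) (i) : SmW z (fun p => gam (fun k j => (chr cov x₀ k j i p : ℂ)) (F p)) :=
  SmW.sum fun j _ => SmW.sum fun k _ =>
    ((smR_chr hz hc k j i).ofReal.const.mul (smW_of_forall_eq _)).mul (hF.dy k)

theorem SmW.nab [T2Space M] (hc : CovariantDerivative.ContMDiffCovariantDerivative cov ∞)
    (hF : SmW z F) (i) : SmW z (nab cov x₀ i F) := (hF.dv_coordField hz i).sub (hF.gam_chr hz hc i)

theorem dv_gam_chr [T2Space M] (hc : CovariantDerivative.ContMDiffCovariantDerivative cov ∞)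
    (hF : SmW z F) (k l) :
    dv z (coordField x₀ k z) (fun p => gam (fun b a => (chr cov x₀ b a l p : ℂ)) (F p)) =
      gam (fun b a => (dirDeriv (chr cov x₀ b a l) z (coordField x₀ k z) : ℂ)) (F z) +
      gam (fun b a => (chr cov x₀ b a l z : ℂ)) (dv z (coordField x₀ k z) F) := by
  unfold gam
  have hs : ∀ b a, SmW z (fun p => (const (chr cov x₀ b a l p : ℂ) : Wick m)) := fun b a =>
    (smR_chr hz hc b a l).ofReal.const
  have hy : ∀ a, SmW z (fun _ : M => (y a : Wick m)) := fun a => smW_of_forall_eq _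
  rw [dv_sum _ fun a _ => SmW.sum fun b _ => ((hs b a).mul (hy a)).mul (hF.dy b),
    ← Finset.sum_add_distrib]
  refine Finset.sum_congr rfl fun a _ => ?_
  rw [dv_sum _ fun b _ => ((hs b a).mul (hy a)).mul (hF.dy b), ← Finset.sum_add_distrib]
  refine Finset.sum_congr rfl fun b _ => ?_
  rw [dv_mul _ ((hs b a).mul (hy a)) (hF.dy b), dv_mul _ (hs b a) (hy a), dv_fixed, dv_const,
    dC_ofReal _ _ (smR_chr hz hc b a l), dv_dy _ hF, mul_zero, add_zero]

/-- Partial derivatives commute, so only terms of order zero in x remain: the derivatives of Γ and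
the commutator of the two linear vector fields, which together form the curvature. The minus sign is
that of the dual action on the y^i. -/
theorem nab_comm [T2Space M] (hc : CovariantDerivative.ContMDiffCovariantDerivative cov ∞)
    (hF : SmW z F) (k l) : WickContact.nab cov x₀ k (WickContact.nab cov x₀ l F) z
      - WickContact.nab cov x₀ l (WickContact.nab cov x₀ k F) z
      = -gam (fun b a => (curvL cov x₀ b a k l z : ℂ)) (F z) := by
  have h1 : ∀ k l, WickContact.nab cov x₀ k (WickContact.nab cov x₀ l F) z =
      dv z (coordField x₀ k z) (fun p => dv p (coordField x₀ l p) F)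
      - gam (fun b a => (dirDeriv (chr cov x₀ b a l) z (coordField x₀ k z) : ℂ)) (F z)
      - gam (fun b a => (chr cov x₀ b a l z : ℂ)) (dv z (coordField x₀ k z) F)
      - gam (fun b a => (chr cov x₀ b a k z : ℂ)) (dv z (coordField x₀ l z) F)
      + gam (fun b a => (chr cov x₀ b a k z : ℂ)) (gam (fun b a => (chr cov x₀ b a l z : ℂ)) (F z)) := by
    intro k l
    have e : dv z (coordField x₀ k z) (WickContact.nab cov x₀ l F) =
        dv z (coordField x₀ k z) (fun p => dv p (coordField x₀ l p) F)
        - dv z (coordField x₀ k z) (fun p => gam (fun b a => (chr cov x₀ b a l p : ℂ)) (F p)) :=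
      dv_sub _ (hF.dv_coordField hz l) (hF.gam_chr hz hc l)
    unfold WickContact.nab covAt at e ⊢
    rw [e, dv_gam_chr hz hc hF, gam_sub]
    ring
  have h2 : dv z (coordField x₀ k z) (fun p => dv p (coordField x₀ l p) F) =
      dv z (coordField x₀ l z) (fun p => dv p (coordField x₀ k p) F) := by
    refine ext_cf fun s d => ?_
    simp only [cf_dv]
    exact pd_comm hz (hF s d) k l
  rw [h1, h1, h2]
  have h3 := gam_comm (fun b a => (chr cov x₀ b a k z : ℂ)) (fun b a => (chr cov x₀ b a l z : ℂ)) (F z)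
  have h4 : gam (fun b a => (curvL cov x₀ b a k l z : ℂ)) (F z) =
      gam (fun b a => (dirDeriv (chr cov x₀ b a l) z (coordField x₀ k z) : ℂ)) (F z)
      - gam (fun b a => (dirDeriv (chr cov x₀ b a k) z (coordField x₀ l z) : ℂ)) (F z)
      - gam (fun b a => ∑ j, ((chr cov x₀ b j l z : ℂ) * (chr cov x₀ j a k z : ℂ)
          - (chr cov x₀ b j k z : ℂ) * (chr cov x₀ j a l z : ℂ))) (F z) := by
    unfold gam curvL
    rw [← Finset.sum_sub_distrib, ← Finset.sum_sub_distrib]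
    refine Finset.sum_congr rfl fun a _ => ?_
    rw [← Finset.sum_sub_distrib, ← Finset.sum_sub_distrib]
    refine Finset.sum_congr rfl fun b _ => ?_
    rw [← sub_mul, ← sub_mul, ← sub_mul, ← sub_mul, ← const_sub, ← const_sub]
    congr 3
    push_cast
    simp only [Finset.sum_sub_distrib]
    rw [Finset.sum_congr rfl fun n _ => mul_comm (chr cov x₀ n a l z : ℂ) _,
      Finset.sum_congr rfl fun n _ => mul_comm (chr cov x₀ n a k z : ℂ) _]
    ring
  rw [h4, ← h3]
  ring

end Nab

/-! ### Change of chart -/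

/-- The Jacobian at `p` from the coordinates at `x₀` to those at `z`. -/
def trans (x₀ z p : M) : Model m →L[ℝ] Model m := tangentCoordChange 𝓘(ℝ, Model m) x₀ z p

section Trans

variable {x₀ z p : M} (hp : p ∈ (chartAt (Model m) x₀).source) (hp' : p ∈ (chartAt (Model m) z).source)

theorem trans_self (x₀ z : M) : (trans x₀ z z : Model m →L[ℝ] Model m) = (jac x₀ z : Model m →L[ℝ] Model m) := rfl

include hp hp'

theorem jac_eq_comp : (jac x₀ p : Model m →L[ℝ] Model m) = jac z p ∘L trans x₀ z p := by
  ext1 v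
  have h1 : p ∈ (extChartAt 𝓘(ℝ, Model m) x₀).source := by simpa using hp
  have h2 : p ∈ (extChartAt 𝓘(ℝ, Model m) z).source := by simpa using hp'
  exact (tangentCoordChange_comp ⟨⟨h1, h2⟩, mem_extChartAt_source p⟩).symm

theorem ent_trans (i j : Fin (2 * m + 1)) :
    ent (trans x₀ z p) i j = icomp z p (coordField x₀ j p) i := by
  have h1 : p ∈ (extChartAt 𝓘(ℝ, Model m) x₀).source := by simpa using hp
  have h2 : p ∈ (extChartAt 𝓘(ℝ, Model m) z).source := by simpa using hp'
  exact congrArg (fun u : Model m => u i)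
    (tangentCoordChange_comp (I := 𝓘(ℝ, Model m)) (w := x₀) (x := p) (y := z) (z := p) (v := stdVec m j)
      ⟨⟨h1, mem_extChartAt_source p⟩, h2⟩).symm

theorem ent_trans_eq_pd (i j : Fin (2 * m + 1)) :
    (ent (trans x₀ z p) i j : ℂ) = pd x₀ j (fun q => ((extChartAt 𝓘(ℝ, Model m) z q i : ℝ) : ℂ)) p := by
  have h1 : p ∈ (extChartAt 𝓘(ℝ, Model m) x₀).source := by simpa using hp
  have h2 : p ∈ (extChartAt 𝓘(ℝ, Model m) z).source := by simpa using hp'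
  have hs : ContMDiffAt 𝓘(ℝ, Model m) 𝓘(ℝ, ℂ) ∞
      (fun q => ((extChartAt 𝓘(ℝ, Model m) z q i : ℝ) : ℂ)) p := by
    have h3 : ContMDiffAt 𝓘(ℝ, Model m) 𝓘(ℝ, Model m) ∞ (extChartAt 𝓘(ℝ, Model m) z) p :=
      contMDiffAt_extChartAt' hp'
    exact ((Complex.ofRealCLM ∘L (EuclideanSpace.proj i : Model m →L[ℝ] ℝ)).contDiff
      (n := ∞)).contMDiff.contMDiffAt.comp p h3
  rw [pd_eq_fderiv hp (hs.mdifferentiableAt (by simp))]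
  have h4 := hasFDerivWithinAt_tangentCoordChange (I := 𝓘(ℝ, Model m)) (x := x₀) (y := z) (z := p)
    ⟨h1, h2⟩
  have h5 : HasFDerivAt (extChartAt 𝓘(ℝ, Model m) z ∘ (extChartAt 𝓘(ℝ, Model m) x₀).symm)
      (trans x₀ z p) (extChartAt 𝓘(ℝ, Model m) x₀ p) := by simpa [trans] using h4
  have h6 := (Complex.ofRealCLM ∘L (EuclideanSpace.proj i : Model m →L[ℝ] ℝ)).hasFDerivAt.comp _ h5
  have h7 := h6.fderiv
  exact (congrArg (fun L : Model m →L[ℝ] ℂ => L (stdVec m j)) h7).symm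

end Trans

section TransDeriv

variable {x₀ z : M} (hz : z ∈ (chartAt (Model m) x₀).source)
include hz

theorem eventually_mem_source : ∀ᶠ p in 𝓝 z, p ∈ (chartAt (Model m) x₀).source ∧
    p ∈ (chartAt (Model m) z).source :=
  Filter.inter_mem (source_mem_nhds hz) (source_mem_nhds (mem_source z))

theorem smR_ent_trans (i j : Fin (2 * m + 1)) : SmR (m := m) z (fun p => ent (trans x₀ z p) i j) := by
  refine SmR.congr ((smV_coordField hz j).icomp (mem_source z) i) ?_
  filter_upwards [eventually_mem_source hz] with p hp
  exact ent_trans hp.1 hp.2 i j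

theorem smC_ent_trans (i j : Fin (2 * m + 1)) :
    SmC (m := m) z (fun p => (ent (trans x₀ z p) i j : ℂ)) := (smR_ent_trans hz i j).ofReal

/-- The entries of the transition Jacobian are first partial derivatives of the coordinates of the
chart at z, so this is the symmetry of second derivatives. -/
theorem dC_ent_trans_symm (i j k : Fin (2 * m + 1)) :
    dC (m := m) (fun p => (ent (trans x₀ z p) i j : ℂ)) z (coordField x₀ k z) =
      dC (m := m) (fun p => (ent (trans x₀ z p) i k : ℂ)) z (coordField x₀ j z) := by
  have hs : SmC (m := m) z (fun q => ((extChartAt 𝓘(ℝ, Model m) z q i : ℝ) : ℂ)) := by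
    have h3 : ContMDiffAt 𝓘(ℝ, Model m) 𝓘(ℝ, Model m) ∞ (extChartAt 𝓘(ℝ, Model m) z) z :=
      contMDiffAt_extChartAt' (mem_source z)
    exact ((Complex.ofRealCLM ∘L (EuclideanSpace.proj i : Model m →L[ℝ] ℝ)).contDiff
      (n := ∞)).contMDiff.contMDiffAt.comp z h3
  have h : ∀ j, (fun p => (ent (trans x₀ z p) i j : ℂ)) =ᶠ[𝓝 z]
      pd x₀ j (fun q => ((extChartAt 𝓘(ℝ, Model m) z q i : ℝ) : ℂ)) := fun j => by
    filter_upwards [eventually_mem_source hz] with p hp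
    exact ent_trans_eq_pd hp.1 hp.2 i j
  rw [dC_congr _ _ (h j), dC_congr _ _ (h k)]
  exact pd_comm hz hs k j

/-- The inhomogeneous transformation law of Christoffel symbols, obtained by computing one component
of ∇_i ∂_j in both frames. -/
theorem christoffel_transform [T2Space M] {cov : AffineConnection m M} (b j i : Fin (2 * m + 1)) :
    ∑ k, ent (jac x₀ z) b k * chr cov x₀ k j i z =
      dirDeriv (fun p => ent (trans x₀ z p) b j) z (coordField x₀ i z) +
      ∑ l, ∑ n, ent (jac x₀ z) l i * ent (jac x₀ z) n j * chr cov z b n l z := by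
  have h1 := comp_eq_sum_icomp hz (cov (coordField x₀ j) z (coordField x₀ i z)) b
  refine h1.symm.trans ?_
  rw [← icomp_self]
  have hd : dirDeriv (fun p => ent (trans x₀ z p) b j) z (coordField x₀ i z) =
      ∑ l, ent (jac x₀ z) l i *
        dirDeriv (fun p => icomp z p (coordField x₀ j p) b) z (coordField z l z) := by
    rw [dirDeriv_congr (g := fun p => icomp z p (coordField x₀ j p) b) _ (by
      filter_upwards [eventually_mem_source hz] with p hp
      exact ent_trans hp.1 hp.2 b j), coordField_eq_sum_frame]
    unfold dirDeriv
    rw [map_sum]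
    refine Finset.sum_congr rfl fun l _ => ?_
    rw [map_smul, coordField_self]; rfl
  have hl : icomp z z (cov (coordField x₀ j) z (coordField x₀ i z)) b =
      ∑ l, ent (jac x₀ z) l i * icomp z z (cov (coordField x₀ j) z (coordField z l z)) b := by
    rw [coordField_eq_sum_frame (x₀ := x₀) i, map_sum, icomp_sum]
    refine Finset.sum_congr rfl fun l _ => ?_
    rw [map_smul, icomp_smul, coordField_self]
  rw [hl, hd, ← Finset.sum_add_distrib]
  refine Finset.sum_congr rfl fun l _ => ?_
  rw [cov_expand (mem_source z) (smV_coordField hz j), mul_add, Finset.mul_sum]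
  congr 1
  refine Finset.sum_congr rfl fun n _ => ?_
  rw [show icomp z z (coordField x₀ j z) n = ent (jac x₀ z) n j from
    (ent_trans hz (mem_source z) n j).symm]
  ring

/-- The connection commutes with changes of chart. -/
theorem nab_linSubst_trans [T2Space M] {cov : AffineConnection m M} {F : M → Wick m} (hF : SmW z F)
    (i : Fin (2 * m + 1)) :
    nab cov x₀ i (fun p => linSubst (trans x₀ z p) (F p)) z =
      ∑ l, const (ent (jac x₀ z) l i : ℂ) * linSubst (jac x₀ z) (nab cov z l F z) := by
  unfold nab covAt
  rw [dv_linSubst _ (fun i j => smC_ent_trans hz i j) hF]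
  simp only [trans_self]
  have h1 : dv z (coordField x₀ i z) F = ∑ l, const (ent (jac x₀ z) l i : ℂ) *
      dv z (coordField z l z) F := by
    rw [coordField_eq_sum_frame, dv_sum_vec]
    exact Finset.sum_congr rfl fun l _ => by rw [coordField_self]
  rw [h1, linSubst_sum]
  simp only [linSubst_mul, linSubst_const, linSubst_sub, mul_sub, Finset.sum_sub_distrib]
  rw [add_sub_assoc, sub_eq_add_neg (∑ l, _)]
  congr 1
  rw [sub_eq_iff_eq_add, ← sub_eq_neg_add, eq_sub_iff_add_eq]
  -- The inhomogeneous term of the Christoffel law is exactly the derivative of the substituted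
  -- matrix that `dv_linSubst` produces.
  have hT : ∀ b c, (∑ k, (ent (jac x₀ z) b k : ℂ) * (chr cov x₀ k c i z : ℂ)) =
      dC (m := m) (fun p => (ent (trans x₀ z p) b c : ℂ)) z (coordField x₀ i z) +
      ∑ l, ∑ n, (ent (jac x₀ z) l i : ℂ) * (ent (jac x₀ z) n c : ℂ) * (chr cov z b n l z : ℂ) := by
    intro b c
    rw [dC_ofReal _ _ (smR_ent_trans hz b c)]
    have := congrArg (fun t : ℝ => (t : ℂ)) (christoffel_transform (cov := cov) hz b c i)
    push_cast at this
    exact this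
  have e1 : gam (fun k j => (chr cov x₀ k j i z : ℂ)) (linSubst (jac x₀ z) (F z)) =
      ∑ b, ∑ c, const (∑ k, (ent (jac x₀ z) b k : ℂ) * (chr cov x₀ k c i z : ℂ)) *
        (y c * linSubst (jac x₀ z) (dy b (F z))) := by
    unfold gam
    simp only [dy_linSubst, Finset.mul_sum, const_sum, Finset.sum_mul, const_mul]
    rw [Finset.sum_congr rfl fun c _ => Finset.sum_comm, Finset.sum_comm]
    exact Finset.sum_congr rfl fun b _ => Finset.sum_congr rfl fun c _ =>
      Finset.sum_congr rfl fun k _ => by ring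
  have e2 : ∑ l, const (ent (jac x₀ z) l i : ℂ) *
      linSubst (jac x₀ z) (gam (fun k j => (chr cov z k j l z : ℂ)) (F z)) =
      ∑ b, ∑ c, const (∑ l, ∑ n, (ent (jac x₀ z) l i : ℂ) * (ent (jac x₀ z) n c : ℂ) *
        (chr cov z b n l z : ℂ)) * (y c * linSubst (jac x₀ z) (dy b (F z))) := by
    unfold gam
    simp only [linSubst_sum, linSubst_mul, linSubst_const, linSubst_y, Finset.mul_sum, const_sum,
      Finset.sum_mul, const_mul]
    rw [Finset.sum_congr rfl fun l _ => Finset.sum_comm, Finset.sum_comm]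
    refine Finset.sum_congr rfl fun b _ => ?_
    rw [Finset.sum_congr rfl fun l _ => Finset.sum_comm, Finset.sum_comm]
    refine Finset.sum_congr rfl fun c _ => Finset.sum_congr rfl fun l _ =>
      Finset.sum_congr rfl fun n _ => by ring
  rw [e1, e2]
  unfold dSubst
  simp only [hT, const_add, add_mul, Finset.sum_add_distrib]

end TransDeriv

/-! ### Sections and forms in charts -/

/-- The components at `x` of a `2`-form in the coordinates of the preferred chart at `x₀`. -/
def inChart2 (x₀ : M) (B : WForm2 m M) (x : M) (k l : Fin (2 * m + 1)) : Wick m :=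
  ∑ i, ∑ j, const (ent (jac x₀ x) i k * ent (jac x₀ x) j l : ℂ) * linSubst (jac x₀ x) (B x i j)

/-- Smoothness of a section at a point. -/
def SmAt (z : M) (a : WSec m M) : Prop := SmW z (inChart z a)

/-- Smoothness of a `1`-form at a point. -/
def SmAt1 (z : M) (b : WForm1 m M) : Prop := ∀ j, SmW z (fun p => inChart1 z b p j)

/-- Smoothness of a `2`-form at a point. -/
def SmAt2 (z : M) (B : WForm2 m M) : Prop := ∀ k l, SmW z (fun p => inChart2 z B p k l)

theorem ent_jac_self (x : M) (i j : Fin (2 * m + 1)) :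
    ent (jac (m := m) x x : Model m →L[ℝ] Model m) i j = if i = j then 1 else 0 := by
  rw [jac_self]; exact ent_id i j

theorem linSubst_jac_self (x : M) (w : Wick m) : linSubst (jac (m := m) x x) w = w := by
  rw [jac_self]; exact linSubst_id w

theorem inChart_self (x : M) (a : WSec m M) : inChart x a x = a x := linSubst_jac_self x _

theorem inChart1_self (x : M) (b : WForm1 m M) (j) : inChart1 x b x j = b x j := by
  change ∑ i, const ((ent (jac (m := m) x x) i j : ℝ) : ℂ) * linSubst (jac x x) (b x i) = _
  simp only [ent_jac_self, linSubst_jac_self]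
  rw [Finset.sum_eq_single j]
  · simp
  · intro i _ hi; simp [hi]
  · simp

theorem inChart2_self (x : M) (B : WForm2 m M) (k l) : inChart2 x B x k l = B x k l := by
  unfold inChart2
  simp only [ent_jac_self, linSubst_jac_self]
  rw [Finset.sum_eq_single k]
  · rw [Finset.sum_eq_single l]
    · simp
    · intro i _ hi; simp [hi]
    · simp
  · intro i _ hi; simp [hi]
  · simp

section Trans

variable {x₀ z : M} (hz : z ∈ (chartAt (Model m) x₀).source)
include hz

theorem inChart_eventuallyEq (a : WSec m M) :
    inChart x₀ a =ᶠ[𝓝 z] fun p => linSubst (trans x₀ z p) (inChart z a p) := by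
  filter_upwards [eventually_mem_source hz] with p hp
  exact (congrArg (fun L : Model m →L[ℝ] Model m => linSubst L (a p)) (jac_eq_comp hp.1 hp.2)).trans
    (linSubst_linSubst _ _ _).symm

theorem inChart1_eventuallyEq (b : WForm1 m M) (j) :
    (fun p => inChart1 x₀ b p j) =ᶠ[𝓝 z] fun p => ∑ i, const (ent (trans x₀ z p) i j : ℂ) *
      linSubst (trans x₀ z p) (inChart1 z b p i) := by
  filter_upwards [eventually_mem_source hz] with p hp
  have e := jac_eq_comp hp.1 hp.2
  have e1 : ∀ n, ent (jac x₀ p : Model m →L[ℝ] Model m) n j =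
      ∑ i, ent (jac z p) n i * ent (trans x₀ z p) i j := fun n => by rw [e, ent_comp]
  have e2 : ∀ w, linSubst (jac x₀ p : Model m →L[ℝ] Model m) w =
      linSubst (trans x₀ z p) (linSubst (jac z p) w) := fun w => by rw [e, linSubst_linSubst]
  change ∑ n, const ((ent (jac x₀ p) n j : ℝ) : ℂ) * linSubst (jac x₀ p) (b p n) =
    ∑ i, const (ent (trans x₀ z p) i j : ℂ) *
      linSubst (trans x₀ z p) (∑ n, const ((ent (jac z p) n i : ℝ) : ℂ) * linSubst (jac z p) (b p n))
  simp only [e1, e2, linSubst_sum, linSubst_mul, linSubst_const, Finset.mul_sum]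
  push_cast
  simp only [const_sum, const_mul, Finset.sum_mul]
  rw [Finset.sum_comm]
  exact Finset.sum_congr rfl fun i _ => Finset.sum_congr rfl fun n _ => by ring

variable {a : WSec m M} {b : WForm1 m M} {B : WForm2 m M}

theorem SmAt.inChart (ha : SmAt z a) : SmW z (inChart x₀ a) :=
  (SmW.linSubst (fun i j => smC_ent_trans hz i j) ha).congr (inChart_eventuallyEq hz a)

theorem SmAt1.inChart1 (hb : SmAt1 z b) (j) : SmW z (fun p => inChart1 x₀ b p j) :=
  SmW.congr (SmW.sum fun i _ => (SmC.const (smC_ent_trans hz i j)).mul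
    (SmW.linSubst (fun i j => smC_ent_trans hz i j) (hb i))) (inChart1_eventuallyEq hz b j)

end Trans

theorem smoothSec_iff {a : WSec m M} : SmoothSec a ↔ ∀ z, SmAt z a := by
  constructor
  · intro h z k d
    exact (h z k d).contMDiffAt (source_mem_nhds (mem_source z))
  · intro h x₀ k d z hz
    exact ((h z).inChart hz k d).contMDiffWithinAt

theorem smoothForm1_iff {b : WForm1 m M} : SmoothForm1 b ↔ ∀ z, SmAt1 z b := by
  constructor
  · intro h z j k d
    exact (h z j k d).contMDiffAt (source_mem_nhds (mem_source z))
  · intro h x₀ j k d z hz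
    exact ((h z).inChart1 hz j k d).contMDiffWithinAt

/-! ### Covariance of the differential operators -/

theorem dNabla_apply (cov : AffineConnection m M) (a : WSec m M) (x : M) (i) :
    dNabla cov a x i = nab cov x i (inChart x a) x := by
  unfold nab covAt
  rw [coordField_self, inChart_self]
  simp only [chr_self]
  rfl

theorem dNabla1_apply (cov : AffineConnection m M) (b : WForm1 m M) (x : M) (i j) :
    dNabla1 cov b x i j = nab cov x i (fun p => inChart1 x b p j) x
      - nab cov x j (fun p => inChart1 x b p i) x := by
  unfold nab covAt
  rw [coordField_self, coordField_self]
  simp only [chr_self, inChart1_self]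
  rfl

section Cov

variable {cov : AffineConnection m M} {x₀ z : M} (hz : z ∈ (chartAt (Model m) x₀).source)
variable {a : WSec m M} {b : WForm1 m M} {B : WForm2 m M}
include hz

theorem inChart_dNabla [T2Space M] (ha : SmAt z a) (j) :
    inChart1 x₀ (dNabla cov a) z j = nab cov x₀ j (inChart x₀ a) z := by
  have h1 : nab cov x₀ j (inChart x₀ a) z = _ :=
    (covAt_congr _ _ (inChart_eventuallyEq hz a)).trans
      (nab_linSubst_trans (cov := cov) hz (F := inChart z a) ha j)
  rw [h1]
  refine Finset.sum_congr rfl fun i _ => ?_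
  rw [dNabla_apply]
  rfl

/-- Changing the chart differentiates the Jacobian carried by the form index. That derivative is
symmetric in the two form indices (`dC_ent_trans_symm`) and disappears under antisymmetrisation, so
no torsion correction is needed. -/
theorem inChart_dNabla1 [T2Space M] (hb : SmAt1 z b) (k l) :
    inChart2 x₀ (dNabla1 cov b) z k l = nab cov x₀ k (fun p => inChart1 x₀ b p l) z
      - nab cov x₀ l (fun p => inChart1 x₀ b p k) z := by
  have h1 : ∀ k l, nab cov x₀ k (fun p => inChart1 x₀ b p l) z =
      ∑ i, (const (dC (m := m) (fun p => (ent (trans x₀ z p) i l : ℂ)) z (coordField x₀ k z)) *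
        linSubst (jac x₀ z) (inChart1 z b z i)) +
      ∑ i, ∑ n, const (ent (jac x₀ z) i l * ent (jac x₀ z) n k : ℂ) *
        linSubst (jac x₀ z) (nab cov z n (fun p => inChart1 z b p i) z) := by
    intro k l
    refine (covAt_congr _ _ (inChart1_eventuallyEq hz b l)).trans ?_
    have hs : ∀ i, SmW z (fun p => linSubst (trans x₀ z p) (inChart1 z b p i)) := fun i =>
      SmW.linSubst (fun i j => smC_ent_trans hz i j) (hb i)
    have hc : ∀ i, SmW z (fun p => (const (ent (trans x₀ z p) i l : ℂ) : Wick m)) := fun i =>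
      SmC.const (smC_ent_trans hz i l)
    rw [covAt_sum _ _ fun i _ => (hc i).mul (hs i), ← Finset.sum_add_distrib]
    refine Finset.sum_congr rfl fun i _ => ?_
    rw [covAt_mul _ _ (hc i) (hs i), covAt_const]
    have e := nab_linSubst_trans (cov := cov) hz (F := fun p => inChart1 z b p i) (hb i) k
    refine congrArg₂ (· + ·) rfl ?_
    refine (congrArg (const (ent (trans x₀ z z) i l : ℂ) * ·) e).trans ?_
    rw [Finset.mul_sum]
    refine Finset.sum_congr rfl fun n _ => ?_
    rw [const_mul, mul_assoc]
    rfl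
  rw [h1 k l, h1 l k, Finset.sum_congr rfl fun i _ => by rw [dC_ent_trans_symm hz i l k],
    add_sub_add_left_eq_sub]
  unfold inChart2
  simp only [dNabla1_apply, linSubst_sub, mul_sub, Finset.sum_sub_distrib]
  refine congrArg₂ (· - ·) ?_ ?_
  · rw [Finset.sum_comm]
    exact Finset.sum_congr rfl fun i _ => Finset.sum_congr rfl fun j _ => by rw [mul_comm (_ : ℂ)]
  · exact Finset.sum_congr rfl fun i _ => Finset.sum_congr rfl fun j _ => rfl

end Cov

/-! ### Covariance of the fibrewise operators -/

theorem linSubst_zero (L : Model m →L[ℝ] Model m) : linSubst L (0 : Wick m) = 0 :=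
  (linHom_apply L 0).symm.trans (map_zero _)

theorem inChart1_eq (x₀ : M) (b : WForm1 m M) (x : M) (j) :
    inChart1 x₀ b x j = ∑ i, const (ent (jac x₀ x) i j : ℂ) * linSubst (jac x₀ x) (b x i) := rfl

theorem inChart_add (x₀ : M) (a b : WSec m M) (z) :
    inChart x₀ (a + b) z = inChart x₀ a z + inChart x₀ b z := linSubst_add _ _ _

theorem inChart_sub (x₀ : M) (a b : WSec m M) (z) :
    inChart x₀ (a - b) z = inChart x₀ a z - inChart x₀ b z := linSubst_sub _ _ _

theorem inChart1_add (x₀ : M) (a b : WForm1 m M) (z j) :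
    inChart1 x₀ (a + b) z j = inChart1 x₀ a z j + inChart1 x₀ b z j := by
  simp only [inChart1_eq, Pi.add_apply, linSubst_add, mul_add, Finset.sum_add_distrib]

theorem inChart1_sub (x₀ : M) (a b : WForm1 m M) (z j) :
    inChart1 x₀ (a - b) z j = inChart1 x₀ a z j - inChart1 x₀ b z j := by
  simp only [inChart1_eq, Pi.sub_apply, linSubst_sub, mul_sub, Finset.sum_sub_distrib]

theorem inChart2_add (x₀ : M) (a b : WForm2 m M) (z k l) :
    inChart2 x₀ (a + b) z k l = inChart2 x₀ a z k l + inChart2 x₀ b z k l := by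
  simp only [inChart2, Pi.add_apply, linSubst_add, mul_add, Finset.sum_add_distrib]

theorem inChart2_sub (x₀ : M) (a b : WForm2 m M) (z k l) :
    inChart2 x₀ (a - b) z k l = inChart2 x₀ a z k l - inChart2 x₀ b z k l := by
  simp only [inChart2, Pi.sub_apply, linSubst_sub, mul_sub, Finset.sum_sub_distrib]

theorem inChart_yScale (x₀ : M) (c) (a : WSec m M) (z) :
    inChart x₀ (fun x => yScale c (a x)) z = yScale c (inChart x₀ a z) := linSubst_yScale _ _ _

theorem inChart1_yScale (x₀ : M) (c) (b : WForm1 m M) (z j) :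
    inChart1 x₀ (fun x k => yScale c (b x k)) z j = yScale c (inChart1 x₀ b z j) := by
  simp only [inChart1_eq, linSubst_yScale, yScale_sum, yScale_const_mul]

theorem inChart_delta (x₀ : M) (a : WSec m M) (z j) :
    inChart1 x₀ (delta a) z j = dy j (inChart x₀ a z) := (dy_linSubst _ _ _).symm

theorem inChart_delta1 (x₀ : M) (b : WForm1 m M) (z k l) :
    inChart2 x₀ (delta1 b) z k l = dy k (inChart1 x₀ b z l) - dy l (inChart1 x₀ b z k) := by
  simp only [inChart2, delta1, inChart1_eq, linSubst_sub, dy_sum, dy_mul, dy_const, zero_mul,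
    zero_add, dy_linSubst, Finset.mul_sum, mul_sub, Finset.sum_sub_distrib, const_mul]
  refine congrArg₂ (· - ·) ?_ ?_
  · rw [Finset.sum_comm]
    exact Finset.sum_congr rfl fun i _ => Finset.sum_congr rfl fun j _ => by ring
  · exact Finset.sum_congr rfl fun i _ => Finset.sum_congr rfl fun j _ => by ring

namespace ContactMetricStructure

variable (S : ContactMetricStructure m M)

/-- `P^k_i` in the chart at `x₀`. -/
def projL (x₀ z : M) (k i : Fin (2 * m + 1)) : ℝ :=
  (if k = i then 1 else 0) - S.xiL x₀ k z * S.lamL x₀ i z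

/-- `y^i P^j_i` in the chart at `x₀`. -/
def yPL (x₀ z : M) (j : Fin (2 * m + 1)) : Wick m := ∑ i, const (S.projL x₀ z j i : ℂ) * y i

/-- `∑ ω_{jk} y^k` -/
def sL (x₀ : M) (j : Fin (2 * m + 1)) (z : M) : Wick m := ∑ k, const (S.omL x₀ j k z : ℂ) * y k

/-- The derivative along `ξ` in the fibre. -/
def dXi (x₀ z : M) (w : Wick m) : Wick m := ∑ k, const (S.xiL x₀ k z : ℂ) * dy k w

/-- The `1`-form `s` with `(i/ν) [s, ·] = -δ` on transverse elements. -/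
def solder : WForm1 m M := fun x j => ∑ k, const (S.omComp x j k : ℂ) * y k

variable {S} {x₀ z : M}

theorem lamL_eq_sum_jac (j) : S.lamL x₀ j z = ∑ i, ent (jac x₀ z) i j * S.lamComp z i := by
  unfold lamL lamComp
  rw [coordField_eq_sum_frame, lam_sum]

theorem omL_eq_sum_jac (k l) : S.omL x₀ k l z =
    ∑ i, ∑ j, ent (jac x₀ z) i k * ent (jac x₀ z) j l * S.omComp z i j := by
  unfold omL omComp om
  rw [coordField_eq_sum_frame, g_sum_left]
  refine Finset.sum_congr rfl fun i _ => ?_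
  rw [coordField_eq_sum_frame, φ_sum, g_sum_right, Finset.mul_sum]
  exact Finset.sum_congr rfl fun j _ => by ring

theorem lamL_self (x : M) (i) : S.lamL x i x = S.lamComp x i := by
  unfold lamL lamComp; rw [coordField_self]

theorem omL_self (x : M) (i j) : S.omL x i j x = S.omComp x i j := by
  unfold omL omComp om; rw [coordField_self, coordField_self]

theorem xiL_self (x : M) (k) : S.xiL x k x = S.ξComp x k := icomp_self x (S.ξ x) k

theorem projL_self (x : M) (j i) : S.projL x x j i = S.projComp x j i := by
  unfold projL projComp; rw [xiL_self, lamL_self]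

theorem yPL_self (x : M) (j) : S.yPL x x j = S.yP x j := by
  unfold yPL yP; simp only [projL_self]

theorem solder_apply (x : M) (j) : S.solder x j = S.sL x j x := by
  unfold solder sL; simp only [omL_self]

theorem inChart2_omForm (k l) : inChart2 x₀ S.omForm z k l = const (S.omL x₀ k l z : ℂ) := by
  rw [omL_eq_sum_jac]
  unfold inChart2 omForm
  push_cast
  simp only [linSubst_const, const_sum, const_mul]

theorem inChart1_solder (j) : inChart1 x₀ S.solder z j = S.sL x₀ j z := by
  rw [inChart1_eq]
  unfold solder sL
  simp only [linSubst_sum, linSubst_mul, linSubst_const, linSubst_y, omL_eq_sum_jac]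
  push_cast
  simp only [const_sum, const_mul, Finset.mul_sum, Finset.sum_mul]
  conv_rhs => rw [Finset.sum_comm]
  refine Finset.sum_congr rfl fun i _ => ?_
  rw [Finset.sum_comm]
  exact Finset.sum_congr rfl fun i _ => Finset.sum_congr rfl fun j _ => by ring

theorem inChart1_lam_mul (c : WSec m M) (j) :
    inChart1 x₀ (fun x k => const (S.lamComp x k : ℂ) * c x) z j =
      const (S.lamL x₀ j z : ℂ) * inChart x₀ c z := by
  rw [inChart1_eq, lamL_eq_sum_jac]
  push_cast
  simp only [linSubst_mul, linSubst_const, const_sum, const_mul, Finset.sum_mul]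
  exact Finset.sum_congr rfl fun j _ => mul_assoc _ _ _ |>.symm

section

variable (hz : z ∈ (chartAt (Model m) x₀).source)
include hz

theorem ξComp_eq_sum_jac (i) : S.ξComp z i = ∑ k, ent (jac x₀ z) i k * S.xiL x₀ k z :=
  comp_eq_sum_icomp hz (S.ξ z) i

theorem sum_ent_projL (j i) : ∑ k, ent (jac x₀ z) j k * S.projL x₀ z k i =
    ∑ n, S.projComp z j n * ent (jac x₀ z) n i := by
  unfold projL projComp
  simp only [mul_sub, sub_mul, Finset.sum_sub_distrib]
  refine congrArg₂ (· - ·) (by simp) ?_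
  rw [ξComp_eq_sum_jac hz, lamL_eq_sum_jac]
  simp only [Finset.mul_sum, Finset.sum_mul]
  rw [Finset.sum_comm]
  exact Finset.sum_congr rfl fun i _ => Finset.sum_congr rfl fun j _ => by ring

theorem linSubst_yP (j) : linSubst (jac x₀ z) (S.yP z j) =
    ∑ k, const (ent (jac x₀ z) j k : ℂ) * S.yPL x₀ z k := by
  unfold yP yPL
  simp only [linSubst_sum, linSubst_mul, linSubst_const, linSubst_y, Finset.mul_sum]
  rw [Finset.sum_comm]
  conv_rhs => rw [Finset.sum_comm]
  refine Finset.sum_congr rfl fun i _ => ?_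
  simp only [← mul_assoc, ← const_mul, ← Finset.sum_mul, ← const_sum]
  refine congrArg (fun t : ℂ => (const t : Wick m) * y i) ?_
  have := congrArg (fun t : ℝ => (t : ℂ)) (sum_ent_projL (S := S) hz j i)
  push_cast at this
  exact this.symm

theorem inChart_deltaStar (b : WForm1 m M) :
    inChart x₀ (S.deltaStar b) z = ∑ k, S.yPL x₀ z k * inChart1 x₀ b z k := by
  refine (linSubst_sum _ _ _).trans ?_
  simp only [linSubst_mul, linSubst_yP hz, inChart1_eq, Finset.mul_sum, Finset.sum_mul]
  rw [Finset.sum_comm]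
  exact Finset.sum_congr rfl fun i _ => Finset.sum_congr rfl fun j _ => by ring

theorem inChart_iξ (b : WForm1 m M) :
    inChart x₀ (S.iξ b) z = ∑ k, const (S.xiL x₀ k z : ℂ) * inChart1 x₀ b z k := by
  refine (linSubst_sum _ _ _).trans ?_
  simp only [linSubst_mul, linSubst_const, ξComp_eq_sum_jac hz, inChart1_eq, Finset.mul_sum]
  push_cast
  simp only [const_sum, const_mul, Finset.sum_mul]
  rw [Finset.sum_comm]
  exact Finset.sum_congr rfl fun i _ => Finset.sum_congr rfl fun j _ => by ring

theorem inChart1_deltaStar2 (B : WForm2 m M) (l) :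
    inChart1 x₀ (S.deltaStar2 B) z l = ∑ k, S.yPL x₀ z k * inChart2 x₀ B z k l := by
  rw [inChart1_eq]
  simp only [deltaStar2, inChart2, linSubst_sum, linSubst_mul, linSubst_yP hz, Finset.mul_sum,
    Finset.sum_mul, const_mul]
  rw [Finset.sum_congr rfl fun j _ => Finset.sum_comm, Finset.sum_comm]
  refine Finset.sum_congr rfl fun k _ => ?_
  rw [Finset.sum_comm]
  exact Finset.sum_congr rfl fun i _ => Finset.sum_congr rfl fun j _ => by ring

theorem linSubst_dXi (w : Wick m) :
    S.dXi x₀ z (linSubst (jac x₀ z) w) =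
      linSubst (jac x₀ z) (∑ i, const (S.ξComp z i : ℂ) * dy i w) := by
  unfold dXi
  simp only [dy_linSubst, linSubst_sum, linSubst_mul, linSubst_const, ξComp_eq_sum_jac hz,
    Finset.mul_sum]
  push_cast
  simp only [const_sum, const_mul, Finset.sum_mul]
  rw [Finset.sum_comm]
  exact Finset.sum_congr rfl fun i _ => Finset.sum_congr rfl fun j _ => by ring

theorem inChart_circ (a b : WSec m M) :
    inChart x₀ (S.circ a b) z = Wick.circ (S.hL x₀ z) (inChart x₀ a z) (inChart x₀ b z) :=
  linSubst_circ (tensorRel_jac hz S) _ _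

theorem inChart_adForm (r : WForm1 m M) (a : WSec m M) (j) :
    inChart1 x₀ (S.adForm r a) z j = br (S.hL x₀ z) (inChart1 x₀ r z j) (inChart x₀ a z) := by
  simp only [inChart1_eq, br_sum_left, br_mul_left _ (isScalar_const _)]
  refine Finset.sum_congr rfl fun i _ => congrArg _ ?_
  exact linSubst_br (tensorRel_jac hz S) _ _

theorem inChart2_br (r b : WForm1 m M) (k l) :
    inChart2 x₀ (fun x i j => S.ad x (r x i) (b x j)) z k l =
      br (S.hL x₀ z) (inChart1 x₀ r z k) (inChart1 x₀ b z l) := by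
  simp only [inChart1_eq, br_sum_left, br_sum_right, br_mul_left _ (isScalar_const _),
    br_mul_right _ (isScalar_const _), inChart2, Finset.mul_sum, const_mul]
  conv_rhs => rw [Finset.sum_comm]
  refine Finset.sum_congr rfl fun i _ => Finset.sum_congr rfl fun j _ => ?_
  rw [← linSubst_br (tensorRel_jac hz S), mul_assoc]
  exact mul_left_comm _ _ _

theorem inChart_halfSq (r : WForm1 m M) (k l) :
    inChart2 x₀ (S.halfSq r) z k l =
      br (S.hL x₀ z) (inChart1 x₀ r z k) (inChart1 x₀ r z l) := inChart2_br hz r r k l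

theorem inChart_adForm1 (r b : WForm1 m M) (k l) :
    inChart2 x₀ (S.adForm1 r b) z k l =
      br (S.hL x₀ z) (inChart1 x₀ r z k) (inChart1 x₀ b z l)
        - br (S.hL x₀ z) (inChart1 x₀ r z l) (inChart1 x₀ b z k) := by
  rw [← inChart2_br hz, ← inChart2_br hz]
  simp only [inChart2, adForm1, linSubst_sub, mul_sub, Finset.sum_sub_distrib]
  refine congrArg₂ (· - ·) rfl ?_
  rw [Finset.sum_comm]
  exact Finset.sum_congr rfl fun i _ => Finset.sum_congr rfl fun j _ => by rw [mul_comm (_ : ℂ)]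

theorem dXi_inChart_of_transAt {a : WSec m M} (ha : S.TransAt z (a z)) :
    S.dXi x₀ z (inChart x₀ a z) = 0 := by
  refine (linSubst_dXi hz _).trans ?_
  rw [ha]
  exact linSubst_zero _

end

theorem dXi_add (w w' : Wick m) : S.dXi x₀ z (w + w') = S.dXi x₀ z w + S.dXi x₀ z w' := by
  simp only [dXi, dy_add, mul_add, Finset.sum_add_distrib]

theorem dXi_sub (w w' : Wick m) : S.dXi x₀ z (w - w') = S.dXi x₀ z w - S.dXi x₀ z w' := by
  simp only [dXi, dy_sub, mul_sub, Finset.sum_sub_distrib]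

theorem dXi_sum {ι : Type*} (s : Finset ι) (f : ι → Wick m) :
    S.dXi x₀ z (∑ i ∈ s, f i) = ∑ i ∈ s, S.dXi x₀ z (f i) :=
  map_sum (AddMonoidHom.mk' (S.dXi x₀ z) dXi_add) f s

theorem dXi_mul (w w' : Wick m) :
    S.dXi x₀ z (w * w') = S.dXi x₀ z w * w' + w * S.dXi x₀ z w' := by
  simp only [dXi, dy_mul, mul_add, Finset.sum_add_distrib, Finset.sum_mul, Finset.mul_sum]
  exact congrArg₂ (· + ·) (Finset.sum_congr rfl fun i _ => by ring)
    (Finset.sum_congr rfl fun i _ => by ring)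

theorem dXi_of_isScalar {c : Wick m} (hc : IsScalar c) : S.dXi x₀ z c = 0 :=
  Finset.sum_eq_zero fun i _ => by rw [hc, mul_zero]

theorem dXi_y (i) : S.dXi x₀ z (y i) = const (S.xiL x₀ i z : ℂ) := by
  unfold dXi
  rw [Finset.sum_eq_single i]
  · simp [dy_y]
  · intro j _ hj; simp [dy_y, hj]
  · simp

theorem dXi_dy (i) (w : Wick m) : S.dXi x₀ z (dy i w) = dy i (S.dXi x₀ z w) := by
  simp only [dXi, dy_sum, dy_mul, dy_const, zero_mul, zero_add, dy_comm i]

theorem dXi_yScale_of_eq_zero (c) {w : Wick m} (h : S.dXi x₀ z w = 0) :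
    S.dXi x₀ z (yScale c w) = 0 := by
  unfold dXi at h ⊢
  simp only [dy_yScale, ← yScale_const_mul, ← yScale_sum]
  rw [h]
  simp

theorem dXi_br (h) (a b : Wick m) :
    S.dXi x₀ z (br h a b) = br h (S.dXi x₀ z a) b + br h a (S.dXi x₀ z b) := by
  simp only [dXi, dy_br, br_sum_left, br_sum_right, br_mul_left _ (isScalar_const _),
    br_mul_right _ (isScalar_const _), mul_add, Finset.sum_add_distrib]

theorem dXi_circ (h : Fin (2 * m + 1) → Fin (2 * m + 1) → ℂ) (a b : Wick m) :
    S.dXi x₀ z (Wick.circ h a b) = Wick.circ h (S.dXi x₀ z a) b + Wick.circ h a (S.dXi x₀ z b) := by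
  have e1 : Wick.circ h (S.dXi x₀ z a) b = ∑ k, const (S.xiL x₀ k z : ℂ) * Wick.circ h (dy k a) b := by
    have := map_sum ((circHom h).flip b) (fun k => const (S.xiL x₀ k z : ℂ) * dy k a) Finset.univ
    exact this.trans (Finset.sum_congr rfl fun k _ => circ_mul_left h (isScalar_const _) _ _)
  have e2 : Wick.circ h a (S.dXi x₀ z b) = ∑ k, const (S.xiL x₀ k z : ℂ) * Wick.circ h a (dy k b) := by
    have := map_sum (circHom h a) (fun k => const (S.xiL x₀ k z : ℂ) * dy k b) Finset.univ
    exact this.trans (Finset.sum_congr rfl fun k _ => circ_mul_right h (isScalar_const _) _ _)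
  rw [e1, e2, ← Finset.sum_add_distrib]
  simp only [dXi, dy_circ, mul_add]

theorem transAt_iff (w : Wick m) : S.TransAt z w ↔ S.dXi z z w = 0 := by
  unfold TransAt dXi; simp only [xiL_self]

theorem dXi_inChart1_of_transAt (hz : z ∈ (chartAt (Model m) x₀).source) {b : WForm1 m M}
    (hb : ∀ i, S.TransAt z (b z i)) (j) : S.dXi x₀ z (inChart1 x₀ b z j) = 0 := by
  have e : ∀ i, S.dXi x₀ z (linSubst (jac x₀ z) (b z i)) = 0 := fun i =>
    (linSubst_dXi hz _).trans ((congrArg _ (hb i)).trans (linSubst_zero _))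
  rw [inChart1_eq, dXi_sum]
  exact Finset.sum_eq_zero fun i _ => by
    rw [dXi_mul, dXi_of_isScalar (isScalar_const _), e, zero_mul, mul_zero, add_zero]

end ContactMetricStructure

/-! ### The curvature in charts -/

theorem const_injective {a b : ℂ} (h : (const a : Wick m) = const b) : a = b := by
  simpa [cf_const] using congrArg (cf 0 0) h

section Curv

variable {cov : AffineConnection m M} {x₀ z : M} (hz : z ∈ (chartAt (Model m) x₀).source)
include hz

theorem smV_cov_coordField [T2Space M] (hc : CovariantDerivative.ContMDiffCovariantDerivative cov ∞)
    (j l : Fin (2 * m + 1)) :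
    SmV z (fun p => cov (coordField x₀ j) p (coordField x₀ l p)) := by
  refine SmV.congr (SmV.sum (s := Finset.univ) (X := fun k p => chr cov x₀ k j l p • coordField x₀ k p)
    fun k _ => SmV.smul (smR_chr hz hc k j l) (smV_coordField hz k)) ?_
  filter_upwards [source_mem_nhds hz] with p hp
  exact cov_coordField hp j l

theorem smC_curvL [T2Space M] (hc : CovariantDerivative.ContMDiffCovariantDerivative cov ∞)
    (b a k l : Fin (2 * m + 1)) : SmC (m := m) z (fun p => (curvL cov x₀ b a k l p : ℂ)) := by
  have hd : ∀ l k : Fin (2 * m + 1), SmC (m := m) z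
      (fun p => (dirDeriv (chr cov x₀ b a l) p (coordField x₀ k p) : ℂ)) := by
    intro l k
    refine SmC.congr ((smR_chr hz hc b a l).ofReal.pd hz k) ?_
    filter_upwards [source_mem_nhds hz] with p hp
    exact (dC_ofReal _ _ (smR_chr hp hc b a l)).symm
  have hch := fun b a l => smR_chr hz hc b a l
  refine SmC.congr (((hd l k).sub (hd k l)).add (SmR.sum (s := Finset.univ) fun n _ =>
    ((hch n a l).mul (hch b n k)).sub ((hch n a k).mul (hch b n l))).ofReal) ?_
  refine Filter.Eventually.of_forall fun p => ?_
  simp only [curvL]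
  push_cast
  rfl

end Curv

theorem comp_sub (x : M) (u v : TangentSpace 𝓘(ℝ, Model m) x) (i) :
    comp x (u - v) i = comp x u i - comp x v i := rfl

theorem curvatureComp_eq [T2Space M] {cov : AffineConnection m M}
    (hc : CovariantDerivative.ContMDiffCovariantDerivative cov ∞) (x : M)
    (i j k l : Fin (2 * m + 1)) : curvatureComp cov x i j k l = curvL cov x i j k l x := by
  unfold curvatureComp
  rw [mlieBracket_coordField (mem_source x), comp_sub, comp_sub]
  have h0 : comp x (cov (coordField x j) x 0) i = 0 := by
    rw [map_zero]; rfl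
  have h1 : ∀ k l, comp x (cov (fun z => cov (coordField x j) z (coordField x l z)) x (frame x k)) i =
      dirDeriv (chr cov x i j l) x (coordField x k x) +
        ∑ n, chr cov x n j l x * chr cov x i n k x := by
    intro k l
    rw [← icomp_self, ← coordField_self]
    exact cov_expand (mem_source x) (smV_cov_coordField (mem_source x) hc j l) k i
  rw [h0, h1, h1, sub_zero]
  unfold curvL
  rw [Finset.sum_sub_distrib]
  ring

/-- The action of the curvature on a fibre. -/
def gamK (cov : AffineConnection m M) (x₀ : M) (k l : Fin (2 * m + 1)) (z : M) (w : Wick m) : Wick m :=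
  gam (fun b a => (curvL cov x₀ b a k l z : ℂ)) w

section Smoothness

variable {x₀ z p : M} (hp : p ∈ (chartAt (Model m) x₀).source)
  (hp' : p ∈ (chartAt (Model m) z).source) {a : WSec m M}
include hp hp'

theorem smC_ent_trans' (i j : Fin (2 * m + 1)) :
    SmC (m := m) p (fun q => (ent (trans x₀ z q) i j : ℂ)) := by
  refine SmR.ofReal (SmR.congr ((smV_coordField hp j).icomp hp' i) ?_)
  filter_upwards [source_mem_nhds hp, source_mem_nhds hp'] with q hq hq'
  exact ent_trans hq hq' i j

theorem SmW.inChart_change (h : SmW p (inChart z a)) : SmW p (inChart x₀ a) := by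
  refine (SmW.linSubst (fun i j => smC_ent_trans' hp hp' i j) h).congr ?_
  filter_upwards [source_mem_nhds hp, source_mem_nhds hp'] with q hq hq'
  exact (congrArg (fun L : Model m →L[ℝ] Model m => Wick.linSubst L (a q)) (jac_eq_comp hq hq')).trans
    (linSubst_linSubst _ _ _).symm

end Smoothness

section SecondDerivative

variable [T2Space M] {cov : AffineConnection m M}
  (hc : CovariantDerivative.ContMDiffCovariantDerivative cov ∞) {z : M} {a : WSec m M}
  (ha : ∀ᶠ p in 𝓝 z, SmAt p a)
include hc ha

theorem inChart_dNabla_eventuallyEq {x₀ : M} (hz : z ∈ (chartAt (Model m) x₀).source) (j) :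
    (fun p => inChart1 x₀ (dNabla cov a) p j) =ᶠ[𝓝 z] nab cov x₀ j (inChart x₀ a) := by
  filter_upwards [ha, source_mem_nhds hz] with p h1 h2
  exact inChart_dNabla h2 h1 j

theorem smAt1_dNabla : SmAt1 z (dNabla cov a) := fun j =>
  (SmW.nab (mem_source z) hc (ha.self_of_nhds) j).congr
    (inChart_dNabla_eventuallyEq hc ha (mem_source z) j)

theorem inChart2_dNabla1_dNabla {x₀ : M} (hz : z ∈ (chartAt (Model m) x₀).source) (k l) :
    inChart2 x₀ (dNabla1 cov (dNabla cov a)) z k l = -gamK cov x₀ k l z (inChart x₀ a z) := by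
  rw [inChart_dNabla1 hz (smAt1_dNabla hc ha)]
  refine Eq.trans (congrArg₂ (· - ·) ?_ ?_)
    (nab_comm hz hc (ha.self_of_nhds.inChart hz) k l)
  · exact covAt_congr _ _ (inChart_dNabla_eventuallyEq hc ha hz l)
  · exact covAt_congr _ _ (inChart_dNabla_eventuallyEq hc ha hz k)

end SecondDerivative

/-- Take the section that is constant in the chart at z. It allows identities in a single fibre to
be read off from identities for sections. -/
theorem exists_section_eq [T2Space M] (z : M) (w : Wick m) :
    ∃ a : WSec m M, a z = w ∧ ∀ᶠ p in 𝓝 z, SmAt p a := by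
  have h1 : ∀ p ∈ (chartAt (Model m) z).source,
      inChart z (fun q => linSubst (jacInv z q) w : WSec m M) p = w := by
    intro p hp
    refine (linSubst_linSubst _ _ _).trans ?_
    have : (jacInv z p : Model m →L[ℝ] Model m) ∘L jac z p = ContinuousLinearMap.id ℝ (Model m) := by
      ext1 v
      exact jacInv_jac hp v
    rw [this, linSubst_id]
  refine ⟨fun q => linSubst (jacInv z q) w, ?_, ?_⟩
  · exact (inChart_self z _).symm.trans (h1 z (mem_source z))
  · filter_upwards [source_mem_nhds (mem_source (m := m) z)] with p hp
    refine SmW.inChart_change (mem_source p) hp ((smW_of_forall_eq w).congr ?_)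
    filter_upwards [source_mem_nhds hp] with q hq
    exact h1 q hq

/-- The curvature acts covariantly. -/
theorem gamK_transform [T2Space M] {cov : AffineConnection m M}
    (hc : CovariantDerivative.ContMDiffCovariantDerivative cov ∞) {x₀ z : M}
    (hz : z ∈ (chartAt (Model m) x₀).source) (k l) (w : Wick m) :
    gamK cov x₀ k l z (linSubst (jac x₀ z) w) =
      ∑ i, ∑ j, const (ent (jac x₀ z) i k * ent (jac x₀ z) j l : ℂ) *
        linSubst (jac x₀ z) (gamK cov z i j z w) := by
  -- d_∇² of a section depends only on its value at the point. Computing it in the two charts and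
  -- comparing gives the transformation law of the curvature without transforming ∂Γ by hand.
  obtain ⟨a, rfl, ha⟩ := exists_section_eq z w
  have h1 := inChart2_dNabla1_dNabla hc ha hz k l
  have h2 : ∀ i j, dNabla1 cov (dNabla cov a) z i j = -gamK cov z i j z (a z) := fun i j => by
    refine (inChart2_self z _ i j).symm.trans ?_
    rw [inChart2_dNabla1_dNabla hc ha (mem_source z), inChart_self]
  have h3 := neg_eq_iff_eq_neg.mpr h1
  refine (neg_injective (h1.symm.trans ?_))
  unfold inChart2
  simp only [h2, linSubst_neg, mul_neg, Finset.sum_neg_distrib]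

namespace ContactMetricStructure

variable (S : ContactMetricStructure m M)

/-- The curvature element `R_{kl}` in the chart at `x₀`. -/
def RL (cov : AffineConnection m M) (x₀ : M) (k l : Fin (2 * m + 1)) (z : M) : Wick m :=
  const (1 / 2) * ∑ n, S.sL x₀ n z * gamK cov x₀ k l z (y n)

variable {S} {cov : AffineConnection m M} {x₀ z : M}

theorem curvatureForm_apply [T2Space M]
    (hc : CovariantDerivative.ContMDiffCovariantDerivative cov ∞) (x : M) (k l) :
    S.curvatureForm cov x k l = S.RL cov x k l x := by
  unfold curvatureForm RL gamK sL
  simp only [gam_y, curvatureComp_eq hc, omL_self, Finset.mul_sum, Finset.sum_mul]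
  rw [Finset.sum_congr rfl fun i _ => Finset.sum_comm, Finset.sum_comm]
  refine Finset.sum_congr rfl fun n _ => ?_
  rw [Finset.sum_comm]
  refine Finset.sum_congr rfl fun j _ => Finset.sum_congr rfl fun i _ => ?_
  push_cast
  simp only [const_mul]
  ring

/-- R = ½ ∑ s_n · (K y^n), where K is the curvature action; both the solder elements and K transform
covariantly. -/
theorem inChart2_curvatureForm [T2Space M]
    (hc : CovariantDerivative.ContMDiffCovariantDerivative cov ∞)
    (hz : z ∈ (chartAt (Model m) x₀).source) (k l) :
    inChart2 x₀ (S.curvatureForm cov) z k l = S.RL cov x₀ k l z := by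
  have h1 : ∀ b, S.sL x₀ b z = ∑ n, const (ent (jac x₀ z) n b : ℂ) *
      linSubst (jac x₀ z) (S.sL z n z) := fun b => by
    rw [← inChart1_solder, inChart1_eq]; simp only [solder_apply]
  unfold inChart2
  simp only [curvatureForm_apply hc, RL, linSubst_mul, linSubst_const, linSubst_sum, Finset.mul_sum]
  rw [Finset.sum_congr rfl fun i _ => Finset.sum_comm, Finset.sum_comm]
  have h2 : ∀ n, ∑ i, ∑ j, const (ent (jac x₀ z) i k * ent (jac x₀ z) j l : ℂ) *
      (const (1 / 2) * (linSubst (jac x₀ z) (S.sL z n z) *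
        linSubst (jac x₀ z) (gamK cov z i j z (y n)))) =
      const (1 / 2) * (linSubst (jac x₀ z) (S.sL z n z) *
        ∑ b, const (ent (jac x₀ z) n b : ℂ) * gamK cov x₀ k l z (y b)) := by
    intro n
    have e : ∑ b, const (ent (jac x₀ z) n b : ℂ) * gamK cov x₀ k l z (y b) =
        gamK cov x₀ k l z (linSubst (jac x₀ z) (y n)) := by
      rw [linSubst_y]
      unfold gamK
      rw [gam_sum]
      exact Finset.sum_congr rfl fun b _ => by
        rw [gam_mul, gam_of_isScalar _ (isScalar_const _), zero_mul, zero_add]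
    rw [e, gamK_transform hc hz]
    simp only [Finset.mul_sum]
    exact Finset.sum_congr rfl fun i _ => Finset.sum_congr rfl fun j _ => by ring
  refine (Finset.sum_congr rfl fun n _ => h2 n).trans ?_
  simp only [h1, Finset.mul_sum, Finset.sum_mul]
  rw [Finset.sum_comm]
  exact Finset.sum_congr rfl fun i _ => Finset.sum_congr rfl fun j _ => by ring

theorem smW_sL [T2Space M] (hz : z ∈ (chartAt (Model m) x₀).source) (j) : SmW z (S.sL x₀ j) :=
  SmW.sum fun k _ => (SmC.const (smR_omL hz j k).ofReal).mul (smW_of_forall_eq _)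

theorem smW_RL [T2Space M] (hc : CovariantDerivative.ContMDiffCovariantDerivative cov ∞)
    (hz : z ∈ (chartAt (Model m) x₀).source) (k l) : SmW z (S.RL cov x₀ k l) := by
  unfold RL gamK gam
  refine SmW.const_mul (SmW.sum fun n _ => (smW_sL hz n).mul (SmW.sum fun a _ => SmW.sum fun b _ =>
    ((SmC.const (smC_curvL hz hc b a k l)).mul (smW_of_forall_eq _)).mul (smW_of_forall_eq _))) _

/-! ### Algebraic identities for the curvature -/

variable (hcov : IsContactMetricConnection S cov) (hz : z ∈ (chartAt (Model m) x₀).source)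
include hcov hz

/-- The function λ_n y^n is parallel, so the commutator of covariant derivatives annihilates it. Its
coefficient at y^a is the claim. -/
theorem lamL_curvL [T2Space M] (k l a) : ∑ n, S.lamL x₀ n z * curvL cov x₀ n a k l z = 0 := by
  -- The derivative of λ from ∇λ = 0 cancels the connection term of y; it must vanish on a
  -- neighbourhood since it is differentiated again.
  have h0 : ∀ p ∈ (chartAt (Model m) x₀).source, ∀ i,
      nab cov x₀ i (fun q => ∑ n, const (S.lamL x₀ n q : ℂ) * y n) p = 0 := by
    intro p hp i
    unfold nab
    have hs : ∀ n, SmW p (fun q => (const (S.lamL x₀ n q : ℂ) : Wick m)) := fun n =>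
      SmC.const (smR_lamL hp n).ofReal
    rw [covAt_sum _ _ fun n _ => (hs n).mul (smW_of_forall_eq _)]
    have : ∀ n, covAt p (coordField x₀ i p) (fun k j => (chr cov x₀ k j i p : ℂ))
        (fun q => const (S.lamL x₀ n q : ℂ) * (y n : Wick m)) =
        (∑ k, const (chr cov x₀ k n i p : ℂ) * const (S.lamL x₀ k p : ℂ) * y n) -
        ∑ j, const (chr cov x₀ n j i p : ℂ) * const (S.lamL x₀ n p : ℂ) * y j := by
      intro n
      rw [covAt_mul _ _ (hs n) (smW_of_forall_eq _), covAt_const, covAt_y,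
        dC_ofReal _ _ (smR_lamL hp n), dirDeriv_lamL hcov hp]
      push_cast
      simp only [const_sum, const_mul, Finset.sum_mul, mul_neg, Finset.mul_sum]
      rw [sub_eq_add_neg]
      refine congrArg₂ (· + ·) rfl (congrArg Neg.neg ?_)
      exact Finset.sum_congr rfl fun j _ => by ring
    simp only [this, Finset.sum_sub_distrib]
    rw [sub_eq_zero, Finset.sum_comm]
  have hs : SmW z (fun q => ∑ n, const (S.lamL x₀ n q : ℂ) * (y n : Wick m)) :=
    SmW.sum fun n _ => (SmC.const (smR_lamL hz n).ofReal).mul (smW_of_forall_eq _)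
  have h1 := nab_comm hz hcov.smooth hs k l
  have h2 : ∀ k l, nab cov x₀ k (nab cov x₀ l
      (fun q => ∑ n, const (S.lamL x₀ n q : ℂ) * (y n : Wick m))) z = 0 := by
    intro k l
    refine (covAt_congr (G := fun _ => (0 : Wick m)) _ _ ?_).trans ?_
    · filter_upwards [source_mem_nhds hz] with p hp using h0 p hp l
    · have := covAt_const (m := m) (coordField x₀ k z) (fun k_1 j => (chr cov x₀ k_1 j k z : ℂ)) (fun _ : M => (0 : ℂ))
      rw [dC_const] at this
      simpa using this
  rw [h2, h2, sub_zero, eq_comm, neg_eq_zero, gam_sum] at h1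
  have h3 := congrArg (dy a) h1
  simp only [gam_mul, gam_of_isScalar _ (isScalar_const _), gam_y, zero_mul, zero_add, dy_sum, dy_mul,
    dy_const, dy_y, mul_ite, mul_one, mul_zero, Finset.sum_ite_eq, Finset.mem_univ, if_true] at h3
  have h4 : (const (∑ n, (S.lamL x₀ n z : ℂ) * (curvL cov x₀ n a k l z : ℂ)) : Wick m) = const 0 := by
    rw [const_sum]; simpa [const_mul] using h3
  exact_mod_cast const_injective h4

end ContactMetricStructure

namespace ContactMetricStructure

variable {S : ContactMetricStructure m M} {cov : AffineConnection m M} {x₀ z : M}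

/-- The matrix of the curvature in the chart at `x₀`. -/
def curvMat (cov : AffineConnection m M) (x₀ : M) (k l : Fin (2 * m + 1)) (z : M) :
    Matrix (Fin (2 * m + 1)) (Fin (2 * m + 1)) ℝ := Matrix.of fun b a => curvL cov x₀ b a k l z

theorem omMat_mul_piMat [T2Space M] (hz : z ∈ (chartAt (Model m) x₀).source) : S.omMat x₀ z * S.piMat x₀ z =
    1 - Matrix.of fun i j => S.lamL x₀ i z * S.xiL x₀ j z := by
  have h := congrArg Matrix.transpose (piMat_mul_omMat (S := S) hz)
  rw [Matrix.transpose_mul, omMat_transpose hz, piMat_transpose hz, Matrix.neg_mul, Matrix.mul_neg,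
    neg_neg, Matrix.transpose_sub, Matrix.transpose_one] at h
  rw [h]
  congr 1
  ext i j
  simp [mul_comm]

variable [T2Space M] (hcov : IsContactMetricConnection S cov)
  (hz : z ∈ (chartAt (Model m) x₀).source)
include hcov hz

/-- Apply [∇_k, ∇_l] to h^{pq}, written as the first contraction of y^p and y^q. The curvature kills
functions without y, while the Leibniz rule distributes it over the two factors with cancelling
cross terms. The real and imaginary parts give K g⁻¹ + g⁻¹Kᵀ = 0 and K π + π Kᵀ = 0. -/
theorem sum_hL_curvL (k l p q : Fin (2 * m + 1)) :
    ∑ a, (curvL cov x₀ p a k l z : ℂ) * S.hL x₀ z a q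
      + ∑ a, (curvL cov x₀ q a k l z : ℂ) * S.hL x₀ z p a = 0 := by
  have hy : ∀ (w : M) (i : Fin (2 * m + 1)), SmW w (fun _ : M => (y i : Wick m)) :=
    fun w i => smW_of_forall_eq _
  have hn : ∀ {w : M} (_ : w ∈ (chartAt (Model m) x₀).source) (i j : Fin (2 * m + 1)),
      SmW w (nab cov x₀ j (fun _ : M => (y i : Wick m))) :=
    fun hw i j => SmW.nab hw hcov.smooth (hy _ i) j
  have h1 : ∀ {w : M} (_ : w ∈ (chartAt (Model m) x₀).source) (j : Fin (2 * m + 1))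
      {F G : M → Wick m} (_ : SmW w F) (_ : SmW w G),
      nab cov x₀ j (fun r => contr (S.hL x₀ r) 1 (F r) (G r)) w =
      contr (S.hL x₀ w) 1 (nab cov x₀ j F w) (G w) + contr (S.hL x₀ w) 1 (F w) (nab cov x₀ j G w) :=
    fun hw j _ _ hF hG => covAt_contr _ _ (fun a b => smC_hL hw a b) (parallel_hL hw hcov j) hF hG 1
  have h2 : ∀ (k l : Fin (2 * m + 1)), nab cov x₀ k (nab cov x₀ l
      (fun r => contr (S.hL x₀ r) 1 (y p) (y q))) z =
      contr (S.hL x₀ z) 1 (nab cov x₀ k (nab cov x₀ l (fun _ => y p)) z) (y q) +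
      contr (S.hL x₀ z) 1 (nab cov x₀ l (fun _ => y p) z) (nab cov x₀ k (fun _ => y q) z) +
      (contr (S.hL x₀ z) 1 (nab cov x₀ k (fun _ => y p) z) (nab cov x₀ l (fun _ => y q) z) +
      contr (S.hL x₀ z) 1 (y p) (nab cov x₀ k (nab cov x₀ l (fun _ => y q)) z)) := by
    intro k l
    rw [← h1 hz k (hn hz p l) (hy z q), ← h1 hz k (hy z p) (hn hz q l)]
    refine Eq.trans (covAt_congr _ _ ?_) (covAt_add _ _
      (SmW.contr (fun a b => smC_hL hz a b) (hn hz p l) (hy z q) 1)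
      (SmW.contr (fun a b => smC_hL hz a b) (hy z p) (hn hz q l) 1))
    filter_upwards [source_mem_nhds hz] with w hw
    exact h1 hw l (hy w p) (hy w q)
  have h3 : ∀ r, contr (S.hL x₀ r) 1 (y p : Wick m) (y q) = const (S.hL x₀ r p q) := by
    intro r
    simp [contr, dy_y]
  have h4 := nab_comm hz hcov.smooth (F := fun r => contr (S.hL x₀ r) 1 (y p) (y q))
    (SmW.contr (fun a b => smC_hL hz a b) (hy z p) (hy z q) 1) k l
  rw [h2, h2, h3, gam_of_isScalar _ (isScalar_const _)] at h4
  have h5 := nab_comm hz hcov.smooth (hy z p) k l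
  have h6 := nab_comm hz hcov.smooth (hy z q) k l
  rw [sub_eq_iff_eq_add] at h5 h6
  rw [h5, h6, contr_add_left, contr_add_right] at h4
  have h7 : contr (S.hL x₀ z) 1 (-gam (fun b a => (curvL cov x₀ b a k l z : ℂ)) (y p)) (y q) +
      contr (S.hL x₀ z) 1 (y p) (-gam (fun b a => (curvL cov x₀ b a k l z : ℂ)) (y q)) = 0 := by
    linear_combination h4
  simp only [gam_y, contr, dy_neg, dy_sum, dy_mul, dy_const, dy_y, zero_mul, zero_add] at h7
  have h8 : (const (∑ a, (curvL cov x₀ p a k l z : ℂ) * S.hL x₀ z a q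
      + ∑ a, (curvL cov x₀ q a k l z : ℂ) * S.hL x₀ z p a) : Wick m) = const 0 := by
    have e1 : ∑ i, ∑ j, const (S.hL x₀ z i j) * ((-∑ a, const (curvL cov x₀ p a k l z : ℂ) *
        if i = a then 1 else 0) * if j = q then 1 else 0) =
        -∑ a, (const (curvL cov x₀ p a k l z : ℂ) * const (S.hL x₀ z a q) : Wick m) := by
      simp [mul_comm]
    have e2 : ∑ i, ∑ j, const (S.hL x₀ z i j) * ((if i = p then 1 else 0) *
        -∑ a, const (curvL cov x₀ q a k l z : ℂ) * if j = a then 1 else 0) =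
        -∑ a, (const (curvL cov x₀ q a k l z : ℂ) * const (S.hL x₀ z p a) : Wick m) := by
      rw [Finset.sum_comm]
      simp [mul_comm]
    rw [e1, e2, ← neg_add, neg_eq_zero] at h7
    simp only [const_add, const_sum, const_mul]
    rw [h7]
    simp [const]
  exact const_injective h8

theorem curvMat_mul_gMat_inv (k l) : curvMat cov x₀ k l z * (S.gMat x₀ z)⁻¹ +
    (S.gMat x₀ z)⁻¹ * (curvMat cov x₀ k l z).transpose = 0 := by
  ext p q
  have h := congrArg Complex.re (sum_hL_curvL hcov hz k l p q)
  simp only [hL, Complex.add_re, Complex.re_sum, Complex.mul_re, Complex.ofReal_re,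
    Complex.ofReal_im, Complex.I_re, Complex.I_im, zero_mul, mul_zero, sub_zero, add_zero,
    Complex.zero_re] at h
  simp only [Matrix.add_apply, Matrix.mul_apply, Matrix.transpose_apply, curvMat, Matrix.of_apply,
    Matrix.zero_apply]
  rw [← h]
  refine congrArg₂ (· + ·) (Finset.sum_congr rfl fun a _ => by ring)
    (Finset.sum_congr rfl fun a _ => by ring)

theorem curvMat_mul_piMat (k l) : curvMat cov x₀ k l z * S.piMat x₀ z +
    S.piMat x₀ z * (curvMat cov x₀ k l z).transpose = 0 := by
  ext p q
  have h := congrArg Complex.im (sum_hL_curvL hcov hz k l p q)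
  simp only [hL, Complex.add_im, Complex.im_sum, Complex.mul_im, Complex.ofReal_re,
    Complex.ofReal_im, Complex.I_re, Complex.I_im, zero_mul, mul_zero, add_zero, zero_add, one_mul,
    Complex.zero_im, Complex.add_re, Complex.mul_re, sub_zero] at h
  simp only [Matrix.add_apply, Matrix.mul_apply, Matrix.transpose_apply, curvMat, Matrix.of_apply,
    Matrix.zero_apply]
  rw [← h]
  refine congrArg₂ (· + ·) (Finset.sum_congr rfl fun a _ => by ring)
    (Finset.sum_congr rfl fun a _ => by ring)

/-- `λ` as a vector. -/
theorem vecMul_curvMat (k l) :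
    Matrix.vecMul (fun n => S.lamL x₀ n z) (curvMat cov x₀ k l z) = 0 := by
  funext a
  exact lamL_curvL hcov hz k l a

/-- Since ξ = g⁻¹λ and K g⁻¹ = -g⁻¹Kᵀ, this is dual to Kᵀλ = 0. -/
theorem curvMat_mulVec (k l) :
    Matrix.mulVec (curvMat cov x₀ k l z) (fun n => S.xiL x₀ n z) = 0 := by
  have h1 : (fun n => S.xiL x₀ n z) = Matrix.mulVec (S.gMat x₀ z)⁻¹ (fun n => S.lamL x₀ n z) := by
    funext n
    exact (gMat_inv_lamL hz n).symm
  have h2 := congrArg (fun A => Matrix.mulVec A (fun n => S.lamL x₀ n z))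
    (curvMat_mul_gMat_inv hcov hz k l)
  simp only [Matrix.add_mulVec, ← Matrix.mulVec_mulVec, Matrix.mulVec_transpose,
    vecMul_curvMat hcov hz, Matrix.mulVec_zero, add_zero, Matrix.zero_mulVec] at h2
  rw [h1, h2]

theorem xi_mul_curvMat (k l) : (Matrix.of fun i j => S.xiL x₀ i z * S.lamL x₀ j z) *
    curvMat cov x₀ k l z = 0 := by
  ext i j
  have := congrFun (vecMul_curvMat hcov hz k l) j
  simp only [Matrix.mul_apply, Matrix.of_apply, mul_assoc, ← Finset.mul_sum]
  simp only [Matrix.vecMul, dotProduct] at this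
  rw [this]; simp

theorem curvMat_mul_xi (k l) : curvMat cov x₀ k l z *
    (Matrix.of fun i j => S.xiL x₀ i z * S.lamL x₀ j z) = 0 := by
  ext i j
  have := congrFun (curvMat_mulVec hcov hz k l) i
  simp only [Matrix.mul_apply, Matrix.of_apply, ← mul_assoc, ← Finset.sum_mul]
  simp only [Matrix.mulVec, dotProduct] at this
  rw [this]; simp

/-- Multiply K π + π Kᵀ = 0 by ω from both sides. The products π ω and ω π are the identity up to
rank-one terms in ξ and λ, which K does not see because Kξ = 0. Symmetry is what makes R a faithful
quadratic generator of K. -/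
theorem omMat_mul_curvMat_symm (k l) : (S.omMat x₀ z * curvMat cov x₀ k l z).transpose =
    S.omMat x₀ z * curvMat cov x₀ k l z := by
  have h1 : S.omMat x₀ z * (curvMat cov x₀ k l z * S.piMat x₀ z +
      S.piMat x₀ z * (curvMat cov x₀ k l z).transpose) * S.omMat x₀ z = 0 := by
    rw [curvMat_mul_piMat hcov hz]; simp
  have e1 : S.omMat x₀ z * (curvMat cov x₀ k l z * S.piMat x₀ z) * S.omMat x₀ z =
      S.omMat x₀ z * curvMat cov x₀ k l z := by
    rw [Matrix.mul_assoc, Matrix.mul_assoc, piMat_mul_omMat hz, Matrix.mul_sub, Matrix.mul_one,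
      curvMat_mul_xi hcov hz, sub_zero]
  have e2 : S.omMat x₀ z * (S.piMat x₀ z * (curvMat cov x₀ k l z).transpose) * S.omMat x₀ z =
      (curvMat cov x₀ k l z).transpose * S.omMat x₀ z := by
    have e3 : (Matrix.of fun i j => S.lamL x₀ i z * S.xiL x₀ j z) *
        (curvMat cov x₀ k l z).transpose = 0 := by
      have := congrArg Matrix.transpose (curvMat_mul_xi (S := S) hcov hz k l)
      rw [Matrix.transpose_mul, Matrix.transpose_zero] at this
      rw [← this]
      congr 1
      ext i j
      simp [mul_comm]
    rw [← Matrix.mul_assoc, omMat_mul_piMat hz, Matrix.sub_mul, Matrix.one_mul, e3, sub_zero]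
  rw [Matrix.mul_add, Matrix.add_mul, e1, e2] at h1
  rw [Matrix.transpose_mul, omMat_transpose hz, Matrix.mul_neg]
  exact (eq_neg_of_add_eq_zero_left h1).symm

theorem piMat_mul_omMat_mul_curvMat (k l) : S.piMat x₀ z * (S.omMat x₀ z * curvMat cov x₀ k l z) =
    curvMat cov x₀ k l z := by
  rw [← Matrix.mul_assoc, piMat_mul_omMat hz, Matrix.sub_mul, Matrix.one_mul,
    xi_mul_curvMat hcov hz, sub_zero]

theorem omMat_mul_curvMat_mul_piMat (k l) : S.omMat x₀ z * curvMat cov x₀ k l z * S.piMat x₀ z =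
    -(curvMat cov x₀ k l z).transpose := by
  have h := congrArg Matrix.transpose (piMat_mul_omMat_mul_curvMat hcov hz k l)
  rw [Matrix.transpose_mul, omMat_mul_curvMat_symm hcov hz, piMat_transpose hz, Matrix.mul_neg] at h
  rw [← h, neg_neg]

/-- The second-order contraction of the curvature is symmetric. -/
theorem hL_curvMat_hL (k l p q) :
    ∑ i, ∑ j, S.hL x₀ z i p * ((S.omMat x₀ z * curvMat cov x₀ k l z) i j : ℂ) * S.hL x₀ z j q =
    ∑ i, ∑ j, S.hL x₀ z p i * ((S.omMat x₀ z * curvMat cov x₀ k l z) i j : ℂ) * S.hL x₀ z q j := by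
  set A := S.omMat x₀ z * curvMat cov x₀ k l z with hA
  -- With g⁻¹ symmetric and π antisymmetric, the two sides of the claim differ by 2i(g⁻¹Aπ - πAg⁻¹).
  -- By AπT-type relations, Aπ = -Kᵀ and πA = K, this reduces to K g⁻¹ + g⁻¹Kᵀ = 0.
  have hs : (S.gMat x₀ z)⁻¹ * A * S.piMat x₀ z = S.piMat x₀ z * A * (S.gMat x₀ z)⁻¹ := by
    rw [Matrix.mul_assoc, hA, omMat_mul_curvMat_mul_piMat hcov hz,
      piMat_mul_omMat_mul_curvMat hcov hz, Matrix.mul_neg]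
    exact (eq_neg_of_add_eq_zero_left (curvMat_mul_gMat_inv hcov hz k l)).symm
  have hg : ∀ i j, (S.gMat x₀ z)⁻¹ i j = (S.gMat x₀ z)⁻¹ j i := fun i j =>
    congrFun (congrFun (gMat_inv_symm (S := S)) j) i
  have hpi : ∀ i j, S.piMat x₀ z i j = -S.piMat x₀ z j i := fun i j =>
    congrFun (congrFun (piMat_transpose (S := S) hz) j) i
  have hs' := congrArg (fun t : ℝ => (t : ℂ)) (congrFun (congrFun hs p) q)
  simp only [Matrix.mul_apply, Finset.sum_mul] at hs'
  push_cast at hs'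
  rw [Finset.sum_comm] at hs'
  conv_rhs at hs' => rw [Finset.sum_comm]
  rw [← sub_eq_zero] at hs' ⊢
  rw [← Finset.sum_sub_distrib] at hs' ⊢
  have hs'' := congrArg (2 * Complex.I * ·) hs'
  simp only [mul_zero] at hs''
  rw [← hs'', Finset.mul_sum]
  refine Finset.sum_congr rfl fun i _ => ?_
  rw [← Finset.sum_sub_distrib, ← Finset.sum_sub_distrib, Finset.mul_sum]
  refine Finset.sum_congr rfl fun j _ => ?_
  simp only [hL]
  rw [hg i p, hg j q, hpi i p, hpi q j]
  push_cast
  ring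

end ContactMetricStructure

/-! ### Quadratic elements -/

theorem const_one : (const 1 : Wick m) = 1 := by simp [const]

theorem const_two : (const 2 : Wick m) = 2 := by
  rw [show (2 : ℂ) = 1 + 1 by norm_num, const_add, const_one, one_add_one_eq_two]

/-- Homogeneous of degree two in `y`. -/
def IsQuadratic (w : Wick m) : Prop := yScale (fun l => if l = 2 then 1 else 0) w = w

theorem isQuadratic_y_mul_y (i j : Fin (2 * m + 1)) : IsQuadratic (y i * y j : Wick m) := by
  unfold IsQuadratic
  refine ext_cf fun k d => ?_
  rw [cf_yScale, cf_y_mul]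
  split_ifs with h2 h1 h1
  · simp
  · simp
  · simp
  · have h3 : cf k (d - Finsupp.single i 1) (y j : Wick m) = 0 := by
      rw [← mul_one (y j), cf_y_mul]
      split_ifs with h4
      · rfl
      · rw [show (1 : Wick m) = const 1 by simp [const], cf_const, if_neg]
        rintro ⟨-, h5⟩
        apply h2
        rw [← sub_add_single h1, ← sub_add_single h4, h5, degree_add_single, degree_add_single]
        simp
    rw [h3]; simp

theorem IsQuadratic.sum {ι : Type*} {s : Finset ι} {f : ι → Wick m} (h : ∀ i ∈ s, IsQuadratic (f i)) :
    IsQuadratic (∑ i ∈ s, f i) := by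
  unfold IsQuadratic
  rw [yScale_sum]
  exact Finset.sum_congr rfl h

theorem IsQuadratic.const_mul {w : Wick m} (h : IsQuadratic w) (c : ℂ) : IsQuadratic (const c * w) := by
  unfold IsQuadratic
  rw [yScale_const_mul, h]

theorem IsQuadratic.add {w w' : Wick m} (h : IsQuadratic w) (h' : IsQuadratic w') :
    IsQuadratic (w + w') := by
  unfold IsQuadratic
  rw [yScale_add, h, h']

theorem IsQuadratic.eq_zero {w : Wick m} (h : IsQuadratic w) (h' : IsScalar w) : w = 0 := by
  refine ext_cf fun k d => ?_
  rw [← h, cf_yScale]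
  split_ifs with h1
  · obtain ⟨i, hi⟩ : ∃ i, d i ≠ 0 := by
      by_contra! hc
      have : d = 0 := Finsupp.ext hc
      simp [this] at h1
    have h2 := congrArg (cf k (d - Finsupp.single i 1)) (h' i)
    rw [cf_dy, sub_add_single hi] at h2
    have h3 : (((d - Finsupp.single i 1 : Fin (2 * m + 1) →₀ ℕ) i : ℂ) + 1) ≠ 0 := Nat.cast_add_one_ne_zero _
    have h4 := (mul_eq_zero.mp (h2.trans (by simp))).resolve_right h3
    rw [h4]; simp
  · simp

theorem IsQuadratic.inFiltration {w : Wick m} (h : IsQuadratic w) : InFiltration 2 w := by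
  intro k d hd
  rw [← h, cf_yScale, if_neg (by omega), zero_mul]

namespace ContactMetricStructure

variable {S : ContactMetricStructure m M} {cov : AffineConnection m M} {x₀ z : M}

/-- The coefficients of the curvature element. -/
def omCurv (S : ContactMetricStructure m M) (cov : AffineConnection m M) (x₀ : M)
    (k l : Fin (2 * m + 1)) (z : M) (i j : Fin (2 * m + 1)) : ℂ :=
  ((S.omMat x₀ z * curvMat cov x₀ k l z) i j : ℂ)

theorem isQuadratic_RL (k l) : IsQuadratic (S.RL cov x₀ k l z) := by
  refine IsQuadratic.const_mul (IsQuadratic.sum fun n _ => ?_) _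
  unfold sL gamK
  rw [gam_y, Finset.sum_mul_sum]
  refine IsQuadratic.sum fun i _ => IsQuadratic.sum fun j _ => ?_
  have : const (S.omL x₀ n i z : ℂ) * y i * (const (curvL cov x₀ n j k l z : ℂ) * y j) =
      const (S.omL x₀ n i z : ℂ) * (const (curvL cov x₀ n j k l z : ℂ) * (y i * y j : Wick m)) := by
    ring
  rw [this]
  exact ((isQuadratic_y_mul_y i j).const_mul _).const_mul _

variable [T2Space M]

theorem omL_swap (hz : z ∈ (chartAt (Model m) x₀).source) (i j) :
    S.omL x₀ i j z = -S.omL x₀ j i z :=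
  congrFun (congrFun (omMat_transpose (S := S) hz) j) i

theorem RL_eq (hz : z ∈ (chartAt (Model m) x₀).source) (k l) : S.RL cov x₀ k l z =
    const (-(1 / 2)) * ∑ i, ∑ j, const (S.omCurv cov x₀ k l z i j) * (y i * y j) := by
  unfold RL sL gamK omCurv
  simp only [gam_y, omMat, curvMat, Matrix.mul_apply, Matrix.of_apply, const_neg]
  rw [neg_mul, ← mul_neg]
  refine congrArg _ ?_
  push_cast
  simp only [const_mul, const_sum, Finset.mul_sum, Finset.sum_mul]
  rw [← Finset.sum_neg_distrib]
  rw [Finset.sum_congr rfl fun n _ => Finset.sum_comm, Finset.sum_comm]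
  refine Finset.sum_congr rfl fun i _ => ?_
  rw [Finset.sum_comm, ← Finset.sum_neg_distrib]
  refine Finset.sum_congr rfl fun j _ => ?_
  rw [← Finset.sum_neg_distrib]
  refine Finset.sum_congr rfl fun n _ => ?_
  rw [omL_swap hz n i]
  push_cast
  rw [const_neg]
  ring

variable (hcov : IsContactMetricConnection S cov) (hz : z ∈ (chartAt (Model m) x₀).source)
include hcov hz

theorem omCurv_symm (k l i j) : S.omCurv cov x₀ k l z i j = S.omCurv cov x₀ k l z j i := by
  unfold omCurv
  exact congrArg _ (congrFun (congrFun (omMat_mul_curvMat_symm hcov hz k l) j) i)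

theorem dy_RL (k l a) : dy a (S.RL cov x₀ k l z) =
    -∑ j, const (S.omCurv cov x₀ k l z a j) * y j := by
  rw [RL_eq hz]
  simp only [dy_mul, dy_sum, dy_const, dy_y, zero_mul, zero_add, ite_mul, mul_ite, mul_one, one_mul,
    mul_zero, mul_add, Finset.sum_add_distrib]
  have e1 : ∑ i, ∑ j, (if a = i then const (S.omCurv cov x₀ k l z i j) * y j else 0 : Wick m) =
      ∑ j, const (S.omCurv cov x₀ k l z a j) * y j := by
    rw [Finset.sum_comm]; simp
  have e2 : ∑ i, ∑ j, (if a = j then const (S.omCurv cov x₀ k l z i j) * y i else 0 : Wick m) =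
      ∑ j, const (S.omCurv cov x₀ k l z a j) * y j := by
    simp only [Finset.sum_ite_eq, Finset.mem_univ, if_true]
    exact Finset.sum_congr rfl fun j _ => by rw [omCurv_symm hcov hz]
  rw [e1, e2, ← mul_add, ← two_mul, ← mul_assoc,
    show (2 : Wick m) = const 2 from const_two.symm, ← const_mul]
  norm_num [const_neg]

theorem dy_dy_RL (k l a b) : dy b (dy a (S.RL cov x₀ k l z)) =
    -const (S.omCurv cov x₀ k l z a b) := by
  rw [dy_RL hcov hz]
  simp [dy_neg, dy_sum, dy_mul, dy_y]

theorem sum_piMat_omCurv (k l j a) : ∑ i, (S.piMat x₀ z j i : ℂ) * S.omCurv cov x₀ k l z i a =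
    (curvL cov x₀ j a k l z : ℂ) := by
  have h := congrFun (congrFun (piMat_mul_omMat_mul_curvMat hcov hz k l) j) a
  rw [Matrix.mul_apply] at h
  unfold omCurv
  exact_mod_cast h

/-- The bracket with a quadratic element has a first-order and a second-order part. The second-order
part is the difference of two contractions of ωK with h, which agree by `hL_curvMat_hL`. The
first-order part sees only the antisymmetric part iπ of h, and π(ωK) = K turns it into the curvature
action. -/
theorem br_RL (k l) (w : Wick m) : br (S.hL x₀ z) (S.RL cov x₀ k l z) w = -gamK cov x₀ k l z w := by
  rw [br_of_quadratic]
  swap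
  · intro i j k'
    rw [dy_dy_RL hcov hz, dy_neg, dy_const, neg_zero]
  have h2 : contr (S.hL x₀ z) 2 (S.RL cov x₀ k l z) w - contr (S.hL x₀ z) 2 w (S.RL cov x₀ k l z) = 0 := by
    rw [contr_two, contr_two, sub_eq_zero]
    simp only [dy_dy_RL hcov hz]
    have e1 : ∑ i, ∑ j, const (S.hL x₀ z i j) * ∑ i', ∑ j', const (S.hL x₀ z i' j') *
        (-const (S.omCurv cov x₀ k l z i i') * dy j' (dy j w)) =
        -∑ p, ∑ q, const (∑ i, ∑ j, S.hL x₀ z i p * S.omCurv cov x₀ k l z i j * S.hL x₀ z j q) *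
          dy q (dy p w) := by
      simp only [const_sum, const_mul, Finset.sum_mul, Finset.mul_sum]
      rw [Finset.sum_comm, ← Finset.sum_neg_distrib]
      refine Finset.sum_congr rfl fun p _ => ?_
      rw [Finset.sum_congr rfl fun i _ => Finset.sum_comm, Finset.sum_comm, ← Finset.sum_neg_distrib]
      refine Finset.sum_congr rfl fun q _ => ?_
      rw [← Finset.sum_neg_distrib]
      refine Finset.sum_congr rfl fun i _ => ?_
      rw [← Finset.sum_neg_distrib]
      refine Finset.sum_congr rfl fun j _ => by ring
    have e2 : ∑ i, ∑ j, const (S.hL x₀ z i j) * ∑ i', ∑ j', const (S.hL x₀ z i' j') *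
        (dy i' (dy i w) * -const (S.omCurv cov x₀ k l z j j')) =
        -∑ p, ∑ q, const (∑ i, ∑ j, S.hL x₀ z p i * S.omCurv cov x₀ k l z i j * S.hL x₀ z q j) *
          dy q (dy p w) := by
      simp only [const_sum, const_mul, Finset.sum_mul, Finset.mul_sum]
      rw [← Finset.sum_neg_distrib]
      refine Finset.sum_congr rfl fun p _ => ?_
      rw [Finset.sum_comm, ← Finset.sum_neg_distrib]
      refine Finset.sum_congr rfl fun q _ => ?_
      rw [← Finset.sum_neg_distrib]
      refine Finset.sum_congr rfl fun i _ => ?_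
      rw [← Finset.sum_neg_distrib]
      refine Finset.sum_congr rfl fun j _ => by ring
    rw [e1, e2]
    simp only [omCurv, hL_curvMat_hL hcov hz]
  have h1 : contr (S.hL x₀ z) 1 (S.RL cov x₀ k l z) w - contr (S.hL x₀ z) 1 w (S.RL cov x₀ k l z) =
      const (2 * Complex.I) * ∑ i, ∑ j, const (S.piMat x₀ z i j : ℂ) *
        (dy i (S.RL cov x₀ k l z) * dy j w) := by
    have e : contr (S.hL x₀ z) 1 w (S.RL cov x₀ k l z) = ∑ i, ∑ j, const (S.hL x₀ z j i) *
        (dy i (S.RL cov x₀ k l z) * dy j w) := by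
      simp only [contr]
      rw [Finset.sum_comm]
      exact Finset.sum_congr rfl fun i _ => Finset.sum_congr rfl fun j _ => by ring
    rw [e]
    simp only [contr]
    rw [← Finset.sum_sub_distrib, Finset.mul_sum]
    refine Finset.sum_congr rfl fun i _ => ?_
    rw [← Finset.sum_sub_distrib, Finset.mul_sum]
    refine Finset.sum_congr rfl fun j _ => ?_
    have hg : (S.gMat x₀ z)⁻¹ i j = (S.gMat x₀ z)⁻¹ j i :=
      congrFun (congrFun (gMat_inv_symm (S := S)) j) i
    have hpi : S.piMat x₀ z j i = -S.piMat x₀ z i j :=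
      congrFun (congrFun (piMat_transpose (S := S) hz) i) j
    have hh : S.hL x₀ z i j - S.hL x₀ z j i = 2 * Complex.I * (S.piMat x₀ z i j : ℂ) := by
      simp only [hL, hg, hpi]
      push_cast
      ring
    rw [← sub_mul, ← const_sub, hh, const_mul, mul_assoc]
  rw [h1, h2, mul_zero, add_zero, ← mul_assoc, ← mul_assoc, ← const_mul, ← const_mul]
  rw [show Complex.I * (1 / 2) * (2 * Complex.I) = -1 by linear_combination Complex.I_mul_I]
  rw [show (const (-1) : Wick m) = -1 by simp [const], neg_one_mul]
  refine congrArg Neg.neg ?_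
  unfold gamK gam
  rw [Finset.sum_comm]
  conv_rhs => rw [Finset.sum_comm]
  refine Finset.sum_congr rfl fun b _ => ?_
  simp only [dy_RL hcov hz, neg_mul, mul_neg, Finset.sum_mul, Finset.mul_sum,
    Finset.sum_neg_distrib]
  rw [Finset.sum_comm, ← Finset.sum_neg_distrib]
  refine Finset.sum_congr rfl fun a _ => ?_
  rw [← sum_piMat_omCurv hcov hz, const_sum, Finset.sum_mul, Finset.sum_mul, ← Finset.sum_neg_distrib]
  refine Finset.sum_congr rfl fun i _ => ?_
  have hpi : S.piMat x₀ z i b = -S.piMat x₀ z b i :=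
    congrFun (congrFun (piMat_transpose (S := S) hz) b) i
  rw [hpi]
  push_cast
  simp only [const_mul, const_neg]
  ring

/-- By symmetry of ωK the ξ-derivative of R contracts ξ with K, and Kξ = 0. -/
theorem dXi_RL (k l) : S.dXi x₀ z (S.RL cov x₀ k l z) = 0 := by
  unfold dXi
  simp only [dy_RL hcov hz, mul_neg, Finset.sum_neg_distrib, neg_eq_zero, Finset.mul_sum]
  rw [Finset.sum_comm]
  refine Finset.sum_eq_zero fun j _ => ?_
  have h : ∑ i, (S.xiL x₀ i z : ℂ) * S.omCurv cov x₀ k l z i j = 0 := by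
    have h1 := congrFun (curvMat_mulVec hcov hz k l)
    have h2 : Matrix.mulVec (S.omMat x₀ z * curvMat cov x₀ k l z) (fun n => S.xiL x₀ n z) = 0 := by
      rw [← Matrix.mulVec_mulVec, curvMat_mulVec hcov hz, Matrix.mulVec_zero]
    have h3 := congrArg (fun t : ℝ => (t : ℂ)) (congrFun h2 j)
    simp only [Matrix.mulVec, dotProduct, Pi.zero_apply] at h3
    push_cast at h3
    rw [← h3]
    refine Finset.sum_congr rfl fun i _ => ?_
    rw [omCurv_symm hcov hz, mul_comm]; rfl
  simp only [← mul_assoc, ← const_mul, ← Finset.sum_mul, ← const_sum]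
  rw [h]; simp [const]

/-- `[∇_k, ∇_l] = (i/ν) [R_{kl}, ·]`. -/
theorem nab_comm_eq_br {F : M → Wick m} (hF : SmW z F) (k l) :
    nab cov x₀ k (nab cov x₀ l F) z - nab cov x₀ l (nab cov x₀ k F) z =
      br (S.hL x₀ z) (S.RL cov x₀ k l z) (F z) := by
  rw [nab_comm hz hcov.smooth hF, br_RL hcov hz]
  rfl

end ContactMetricStructure

/-! ### Brackets with linear elements, and the Bianchi identity of R. -/

namespace ContactMetricStructure

variable {S : ContactMetricStructure m M} {cov : AffineConnection m M} {x₀ z : M}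
variable [T2Space M]

section

variable (hz : z ∈ (chartAt (Model m) x₀).source)
include hz

theorem hL_sub_swap (i j) :
    S.hL x₀ z i j - S.hL x₀ z j i = 2 * Complex.I * (S.piMat x₀ z i j : ℂ) := by
  have hg : (S.gMat x₀ z)⁻¹ i j = (S.gMat x₀ z)⁻¹ j i :=
    congrFun (congrFun (gMat_inv_symm (S := S)) j) i
  have hpi : S.piMat x₀ z j i = -S.piMat x₀ z i j :=
    congrFun (congrFun (piMat_transpose (S := S) hz) i) j
  simp only [hL, hg, hpi]
  push_cast
  ring

/-- For a linear element only the first contraction survives, and the commutator keeps only the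
antisymmetric part iπ of h. -/
theorem br_y (a) (w : Wick m) : br (S.hL x₀ z) (y a) w =
    ∑ i, const (S.piMat x₀ z i a : ℂ) * dy i w := by
  rw [br_of_quadratic (S.hL x₀ z) (a := y a) (fun i j k => by simp [dy_y, apply_ite])]
  have h2 : contr (S.hL x₀ z) 2 (y a) w - contr (S.hL x₀ z) 2 w (y a) = 0 := by
    rw [contr_two, contr_two]
    have : ∀ i j, dy i (dy j (y a : Wick m)) = 0 := fun i j => by simp [dy_y, apply_ite]
    simp [this]
  have e1 : contr (S.hL x₀ z) 1 (y a) w = ∑ i, const (S.hL x₀ z a i) * dy i w := by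
    simp [contr, dy_y]
  have e2 : contr (S.hL x₀ z) 1 w (y a) = ∑ i, const (S.hL x₀ z i a) * dy i w := by
    simp [contr, dy_y]
  rw [h2, e1, e2, mul_zero, add_zero, ← Finset.sum_sub_distrib, Finset.mul_sum, Finset.mul_sum]
  refine Finset.sum_congr rfl fun i _ => ?_
  rw [← sub_mul, ← const_sub, ← neg_sub, hL_sub_swap hz, ← mul_assoc, ← mul_assoc, ← const_mul,
    ← const_mul]
  congr 2
  linear_combination -(S.piMat x₀ z i a : ℂ) * Complex.I_mul_I

theorem sum_piMat_omL (i b) : ∑ a, (S.piMat x₀ z i a : ℂ) * (S.omL x₀ a b z : ℂ) =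
    (if i = b then 1 else 0) - (S.xiL x₀ i z : ℂ) * (S.lamL x₀ b z : ℂ) := by
  have h := congrArg (fun t : ℝ => (t : ℂ)) (congrFun (congrFun (piMat_mul_omMat (S := S) hz) i) b)
  simp only [Matrix.mul_apply, Matrix.sub_apply, Matrix.one_apply, Matrix.of_apply, omMat] at h
  push_cast at h
  rw [h]
  split_ifs <;> simp

/-- By `br_y`, the bracket with s_j is the derivation with coefficients ω_{jk}π^{ik}. This matrix is
minus the projection along ξ, hence the correction by the fibre derivative along ξ. On transverse
elements the correction is absent and δ has become inner. -/
theorem br_sL (j) (w : Wick m) : br (S.hL x₀ z) (S.sL x₀ j z) w =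
    -dy j w + const (S.lamL x₀ j z : ℂ) * S.dXi x₀ z w := by
  unfold sL
  simp only [br_sum_left, br_mul_left _ (isScalar_const _), br_y hz, Finset.mul_sum, ← mul_assoc,
    ← const_mul]
  rw [Finset.sum_comm]
  simp only [← Finset.sum_mul, ← const_sum]
  have h : ∀ i, ∑ k, (S.omL x₀ j k z : ℂ) * (S.piMat x₀ z i k : ℂ) =
      -(if i = j then 1 else 0) + (S.lamL x₀ j z : ℂ) * (S.xiL x₀ i z : ℂ) := by
    intro i
    have h1 : ∀ k, (S.omL x₀ j k z : ℂ) * (S.piMat x₀ z i k : ℂ) =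
        -((S.piMat x₀ z i k : ℂ) * (S.omL x₀ k j z : ℂ)) := fun k => by
      rw [omL_swap hz]; push_cast; ring
    simp only [h1, Finset.sum_neg_distrib, sum_piMat_omL hz]
    ring
  simp only [h, const_add, add_mul, Finset.sum_add_distrib, dXi, Finset.mul_sum, ← mul_assoc,
    ← const_mul]
  refine congrArg (· + _) ?_
  rw [Finset.sum_eq_single j]
  · rw [if_pos rfl, const_neg, const_one, neg_one_mul]
  · intro i _ hi; rw [if_neg hi]; simp [const]
  · simp

theorem br_sL_of_dXi (j) {w : Wick m} (hw : S.dXi x₀ z w = 0) :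
    br (S.hL x₀ z) (S.sL x₀ j z) w = -dy j w := by
  rw [br_sL hz, hw, mul_zero, add_zero]

theorem omL_xiL (j) : ∑ k, S.omL x₀ j k z * S.xiL x₀ k z = 0 := by
  simp only [omL_eq hz, Finset.sum_mul, mul_assoc]
  rw [Finset.sum_comm]
  refine Finset.sum_eq_zero fun k _ => ?_
  rw [← Finset.mul_sum, phL_xiL hz, mul_zero]

theorem dXi_sL (j) : S.dXi x₀ z (S.sL x₀ j z) = 0 := by
  unfold sL
  rw [dXi_sum]
  simp only [dXi_mul, dXi_of_isScalar (isScalar_const _), zero_mul, zero_add, dXi_y, ← const_mul,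
    ← const_sum]
  have := congrArg (fun t : ℝ => (t : ℂ)) (omL_xiL (S := S) hz j)
  push_cast at this
  rw [this]; simp [const]

theorem dy_sL (i j) : dy i (S.sL x₀ j z) = const (S.omL x₀ j i z : ℂ) := by
  unfold sL
  simp [dy_sum, dy_mul, dy_y]

/-- The source of the summand ω in the Weyl curvature. -/
theorem br_sL_sL (i j) : br (S.hL x₀ z) (S.sL x₀ i z) (S.sL x₀ j z) =
    const (S.omL x₀ i j z : ℂ) := by
  rw [br_sL_of_dXi hz i (dXi_sL hz j), dy_sL hz, omL_swap hz]
  push_cast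
  rw [const_neg, neg_neg]

end

variable (hcov : IsContactMetricConnection S cov) (hz : z ∈ (chartAt (Model m) x₀).source)
include hcov hz

/-- Because ξ is parallel, the derivative of its components cancels the connection term from moving
∇ past a fibre derivative. Hence ∇ preserves transversality. -/
theorem dXi_nab {F : M → Wick m} (hF : SmW z F) (i) :
    S.dXi x₀ z (nab cov x₀ i F z) = nab cov x₀ i (fun p => S.dXi x₀ p (F p)) z := by
  unfold nab dXi
  have hs : ∀ k, SmW z (fun p => (const (S.xiL x₀ k p : ℂ) : Wick m)) := fun k =>
    SmC.const (smR_xiL hz k).ofReal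
  rw [covAt_sum _ _ fun k _ => (hs k).mul (hF.dy k)]
  have h : ∀ k, covAt z (coordField x₀ i z) (fun k j => (chr cov x₀ k j i z : ℂ))
      (fun p => const (S.xiL x₀ k p : ℂ) * dy k (F p)) =
      const (S.xiL x₀ k z : ℂ) * dy k (covAt z (coordField x₀ i z)
        (fun k j => (chr cov x₀ k j i z : ℂ)) F) +
      ((∑ n, const (S.xiL x₀ k z : ℂ) * const (chr cov x₀ n k i z : ℂ) * dy n (F z)) -
        ∑ n, const (S.xiL x₀ n z : ℂ) * const (chr cov x₀ k n i z : ℂ) * dy k (F z)) := by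
    intro k
    rw [covAt_mul _ _ (hs k) (hF.dy k), covAt_const, covAt_dy _ _ hF, dC_ofReal _ _ (smR_xiL hz k),
      dirDeriv_xiL hcov hz]
    push_cast
    simp only [const_neg, const_sum, const_mul, mul_add, Finset.mul_sum, neg_mul, Finset.sum_mul,
      mul_assoc]
    ring
  simp only [h, Finset.sum_add_distrib, Finset.sum_sub_distrib]
  rw [left_eq_add, sub_eq_zero, Finset.sum_comm]

theorem dXi_nab_of_eventually {F : M → Wick m} (hF : SmW z F)
    (h : ∀ᶠ p in 𝓝 z, S.dXi x₀ p (F p) = 0) (i) : S.dXi x₀ z (nab cov x₀ i F z) = 0 := by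
  rw [dXi_nab hcov hz hF]
  refine (covAt_congr (G := fun _ => (0 : Wick m)) _ _ h).trans ?_
  have := covAt_fixed_mul (coordField x₀ i z) (fun k j => (chr cov x₀ k j i z : ℂ))
    (w := 0) (fun i => by simp) (smW_of_forall_eq (m := m) (z := z) (0 : Wick m))
  simpa using this

/-- By the Jacobi identity for the operators ∇_i, the cyclic sum has zero bracket with every y^a,
hence with every solder element. Being transverse, it then has vanishing y-derivatives. A quadratic
element without y-dependence is zero. No expansion in Christoffel symbols is needed, and the torsion
plays no role. -/
theorem bianchi_RL (i j k) :
    nab cov x₀ i (S.RL cov x₀ j k) z + nab cov x₀ j (S.RL cov x₀ k i) z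
      + nab cov x₀ k (S.RL cov x₀ i j) z = 0 := by
  set X := nab cov x₀ i (S.RL cov x₀ j k) z + nab cov x₀ j (S.RL cov x₀ k i) z
      + nab cov x₀ k (S.RL cov x₀ i j) z with hX
  have hs : ∀ j k, SmW z (S.RL cov x₀ j k) := fun j k => smW_RL hcov.smooth hz j k
  have hq1 : ∀ i j k, IsQuadratic (nab cov x₀ i (S.RL cov x₀ j k) z) := by
    intro i j k
    unfold IsQuadratic nab
    rw [← covAt_yScale _ _ (hs j k)]
    exact covAt_congr _ _ (Filter.Eventually.of_forall fun p => isQuadratic_RL j k)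
  have hq : IsQuadratic X := ((hq1 i j k).add (hq1 j k i)).add (hq1 k i j)
  have hxi1 : ∀ i j k, S.dXi x₀ z (nab cov x₀ i (S.RL cov x₀ j k) z) = 0 := fun i j k =>
    dXi_nab_of_eventually hcov hz (hs j k)
      (by filter_upwards [source_mem_nhds hz] with p hp using dXi_RL hcov hp j k) i
  have hxi : S.dXi x₀ z X = 0 := by rw [hX, dXi_add, dXi_add, hxi1, hxi1, hxi1, add_zero, add_zero]
  have hbr : ∀ a, br (S.hL x₀ z) X (y a) = 0 := by
    intro a
    set F : M → Wick m := fun _ => y a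
    have hF : ∀ w, SmW w F := fun w => smW_of_forall_eq _
    have hnF : ∀ {w : M} (_ : w ∈ (chartAt (Model m) x₀).source) (i : Fin (2 * m + 1)),
        SmW w (nab cov x₀ i F) := fun hw i => SmW.nab hw hcov.smooth (hF _) i
    -- That is, [∇_i R_{jk}, ·] acts as the operator commutator [∇_i, [∇_j, ∇_k]]; the cyclic sum of
    -- these is zero.
    have h1 : ∀ i j k, br (S.hL x₀ z) (nab cov x₀ i (S.RL cov x₀ j k) z) (y a) =
        nab cov x₀ i (nab cov x₀ j (nab cov x₀ k F)) z - nab cov x₀ i (nab cov x₀ k (nab cov x₀ j F)) z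
        - (nab cov x₀ j (nab cov x₀ k (nab cov x₀ i F)) z
          - nab cov x₀ k (nab cov x₀ j (nab cov x₀ i F)) z) := by
      intro i j k
      have e1 := covAt_br (coordField x₀ i z) (fun k j => (chr cov x₀ k j i z : ℂ))
        (fun a b => smC_hL hz a b) (parallel_hL hz hcov i) (hs j k) (hF z)
      have e2 : covAt z (coordField x₀ i z) (fun k j => (chr cov x₀ k j i z : ℂ))
          (fun p => br (S.hL x₀ p) (S.RL cov x₀ j k p) (F p)) =
          nab cov x₀ i (nab cov x₀ j (nab cov x₀ k F)) z
            - nab cov x₀ i (nab cov x₀ k (nab cov x₀ j F)) z := by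
        refine Eq.trans (covAt_congr _ _ ?_) (covAt_sub _ _
          (SmW.nab hz hcov.smooth (hnF hz k) j) (SmW.nab hz hcov.smooth (hnF hz j) k))
        filter_upwards [source_mem_nhds hz] with p hp
        exact (nab_comm_eq_br hcov hp (hF p) j k).symm
      have e3 := nab_comm_eq_br hcov hz (hnF hz i) j k
      rw [e2] at e1
      rw [e3, e1]
      exact (add_sub_cancel_right _ _).symm
    rw [hX, br_add_left, br_add_left, h1, h1, h1]
    ring
  refine hq.eq_zero fun b => ?_
  have h2 : ∑ a, const (S.omL x₀ a b z : ℂ) * br (S.hL x₀ z) X (y a) = 0 :=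
    Finset.sum_eq_zero fun a _ => by rw [hbr, mul_zero]
  have h3 : ∑ a, const (S.omL x₀ a b z : ℂ) * br (S.hL x₀ z) X (y a) =
      br (S.hL x₀ z) (S.sL x₀ b z) X := by
    unfold sL
    rw [br_sum_left]
    refine Finset.sum_congr rfl fun a _ => ?_
    rw [br_mul_left _ (isScalar_const _), br_swap _ X, omL_swap hz]
    push_cast
    rw [const_neg, neg_mul_neg]
  rw [h3, br_sL_of_dXi hz b hxi, neg_eq_zero] at h2
  exact h2

end ContactMetricStructure

namespace ContactMetricStructure

/-! ### The Fedosov connection in a chart -/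

/-- `∇_i + (i/ν) [γ_i, ·]` in the chart at `x₀`. -/
def DL (S : ContactMetricStructure m M) (cov : AffineConnection m M) (x₀ : M)
    (γ : Fin (2 * m + 1) → M → Wick m) (i : Fin (2 * m + 1)) (F : M → Wick m) (p : M) : Wick m :=
  nab cov x₀ i F p + br (S.hL x₀ p) (γ i p) (F p)

/-- The curvature `R + ∇ γ + (i/ν) γ ∘ γ` in the chart at `x₀`. -/
def OmL (S : ContactMetricStructure m M) (cov : AffineConnection m M) (x₀ : M)
    (γ : Fin (2 * m + 1) → M → Wick m) (k l : Fin (2 * m + 1)) (p : M) : Wick m :=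
  S.RL cov x₀ k l p + (nab cov x₀ k (γ l) p - nab cov x₀ l (γ k) p) + br (S.hL x₀ p) (γ k p) (γ l p)

variable {S : ContactMetricStructure m M} {cov : AffineConnection m M} {x₀ z : M}
variable {γ : Fin (2 * m + 1) → M → Wick m} {F G : M → Wick m}
variable [T2Space M]
variable (hcov : IsContactMetricConnection S cov) (hz : z ∈ (chartAt (Model m) x₀).source)
include hcov hz

theorem smW_DL (hγ : ∀ i, SmW z (γ i)) (hF : SmW z F) (i) : SmW z (S.DL cov x₀ γ i F) :=
  (SmW.nab hz hcov.smooth hF i).add (SmW.br (fun a b => smC_hL hz a b) (hγ i) hF)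

theorem smW_OmL (hγ : ∀ i, SmW z (γ i)) (k l) : SmW z (S.OmL cov x₀ γ k l) :=
  ((smW_RL hcov.smooth hz k l).add ((SmW.nab hz hcov.smooth (hγ l) k).sub
    (SmW.nab hz hcov.smooth (hγ k) l))).add (SmW.br (fun a b => smC_hL hz a b) (hγ k) (hγ l))

theorem nab_br (hF : SmW z F) (hG : SmW z G) (i) :
    nab cov x₀ i (fun p => br (S.hL x₀ p) (F p) (G p)) z =
      br (S.hL x₀ z) (nab cov x₀ i F z) (G z) + br (S.hL x₀ z) (F z) (nab cov x₀ i G z) :=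
  covAt_br _ _ (fun a b => smC_hL hz a b) (parallel_hL hz hcov i) hF hG

theorem DL_circ (hF : SmW z F) (hG : SmW z G) (i) :
    S.DL cov x₀ γ i (fun p => Wick.circ (S.hL x₀ p) (F p) (G p)) z =
      Wick.circ (S.hL x₀ z) (S.DL cov x₀ γ i F z) (G z)
        + Wick.circ (S.hL x₀ z) (F z) (S.DL cov x₀ γ i G z) := by
  have h : nab cov x₀ i (fun p => Wick.circ (S.hL x₀ p) (F p) (G p)) z =
      Wick.circ (S.hL x₀ z) (nab cov x₀ i F z) (G z)
        + Wick.circ (S.hL x₀ z) (F z) (nab cov x₀ i G z) :=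
    covAt_circ _ _ (fun a b => smC_hL hz a b) (parallel_hL hz hcov i) hF hG
  unfold DL
  rw [h, br_circ, circ_add_left, circ_add_right]
  ring

/-- The commutator of the ∇ parts is the bracket with R, the mixed terms give ∇γ because ∇ is a
derivation of the bracket, and the Jacobi identity collects the remainder into the bracket of γ with
itself. -/
theorem DL_comm (hγ : ∀ i, SmW z (γ i)) (hF : SmW z F) (k l) :
    S.DL cov x₀ γ k (S.DL cov x₀ γ l F) z - S.DL cov x₀ γ l (S.DL cov x₀ γ k F) z =
      br (S.hL x₀ z) (S.OmL cov x₀ γ k l z) (F z) := by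
  have h1 : ∀ k l, nab cov x₀ k (S.DL cov x₀ γ l F) z = nab cov x₀ k (nab cov x₀ l F) z +
      (br (S.hL x₀ z) (nab cov x₀ k (γ l) z) (F z) + br (S.hL x₀ z) (γ l z) (nab cov x₀ k F z)) := by
    intro k l
    rw [← nab_br hcov hz (hγ l) hF]
    exact covAt_add _ _ (SmW.nab hz hcov.smooth hF l)
      (SmW.br (fun a b => smC_hL hz a b) (hγ l) hF)
  have h2 := nab_comm_eq_br hcov hz hF k l
  have h3 := br_jacobi (S.hL x₀ z) (γ k z) (γ l z) (F z)
  have hD : ∀ k F, S.DL cov x₀ γ k F z = nab cov x₀ k F z + br (S.hL x₀ z) (γ k z) (F z) :=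
    fun _ _ => rfl
  rw [hD k, hD l (S.DL cov x₀ γ k F), h1, h1, hD, hD, OmL]
  simp only [br_add_left, br_add_right, br_sub_left]
  linear_combination h2 + h3

/-- The cyclic sum splits by type. The terms ∇R vanish by `bianchi_RL`; the terms ∇∇γ antisymmetrise
to brackets of R with γ and cancel those already present; the terms mixing ∇γ and γ cancel in pairs;
the triple brackets vanish by Jacobi. -/
theorem DL_bianchi (hγ : ∀ i, SmW z (γ i)) (i j k) :
    S.DL cov x₀ γ i (S.OmL cov x₀ γ j k) z + S.DL cov x₀ γ j (S.OmL cov x₀ γ k i) z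
      + S.DL cov x₀ γ k (S.OmL cov x₀ γ i j) z = 0 := by
  have h1 : ∀ i j k, nab cov x₀ i (S.OmL cov x₀ γ j k) z = nab cov x₀ i (S.RL cov x₀ j k) z +
      (nab cov x₀ i (nab cov x₀ j (γ k)) z - nab cov x₀ i (nab cov x₀ k (γ j)) z) +
      (br (S.hL x₀ z) (nab cov x₀ i (γ j) z) (γ k z)
        + br (S.hL x₀ z) (γ j z) (nab cov x₀ i (γ k) z)) := by
    intro i j k
    have hn := fun j k => SmW.nab hz hcov.smooth (hγ k) j
    rw [← nab_br hcov hz (hγ j) (hγ k)]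
    refine (covAt_add _ _ ((smW_RL hcov.smooth hz j k).add ((hn j k).sub (hn k j)))
      (SmW.br (fun a b => smC_hL hz a b) (hγ j) (hγ k))).trans ?_
    refine congrArg (· + _) ?_
    refine (covAt_add _ _ (smW_RL hcov.smooth hz j k) ((hn j k).sub (hn k j))).trans ?_
    exact congrArg (_ + ·) (covAt_sub _ _ (hn j k) (hn k j))
  have h2 := bianchi_RL hcov hz i j k
  have h3 := nab_comm_eq_br hcov hz (hγ k) i j
  have h4 := nab_comm_eq_br hcov hz (hγ i) j k
  have h5 := nab_comm_eq_br hcov hz (hγ j) k i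
  have h6 := br_jacobi (S.hL x₀ z) (γ i z) (γ j z) (γ k z)
  rw [br_swap _ (br _ _ _) (γ k z), br_swap _ (γ i z) (γ k z), br_neg_right] at h6
  rw [DL, DL, DL, h1, h1, h1, OmL, OmL, OmL]
  simp only [br_add_right, br_sub_right]
  rw [br_swap _ (γ i z) (S.RL _ _ _ _ _), br_swap _ (γ j z) (S.RL _ _ _ _ _),
    br_swap _ (γ k z) (S.RL _ _ _ _ _), br_swap _ (nab cov x₀ i (γ j) z),
    br_swap _ (nab cov x₀ j (γ k) z), br_swap _ (nab cov x₀ k (γ i) z)]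
  linear_combination h2 + h3 + h4 + h5 + h6

theorem dXi_DL (hγ : ∀ i, S.dXi x₀ z (γ i z) = 0) (hF : SmW z F)
    (h : ∀ᶠ p in 𝓝 z, S.dXi x₀ p (F p) = 0) (i) : S.dXi x₀ z (S.DL cov x₀ γ i F z) = 0 := by
  rw [DL, dXi_add, dXi_br, dXi_nab_of_eventually hcov hz hF h, hγ, h.self_of_nhds, br_zero_left,
    br_zero_right, add_zero, add_zero]

theorem dXi_OmL (hγ : ∀ i, SmW z (γ i)) (h : ∀ᶠ p in 𝓝 z, ∀ i, S.dXi x₀ p (γ i p) = 0) (k l) :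
    S.dXi x₀ z (S.OmL cov x₀ γ k l z) = 0 := by
  have h1 := fun k l => dXi_nab_of_eventually hcov hz (hγ l) (h.mono fun p hp => hp l) k
  rw [OmL, dXi_add, dXi_add, dXi_sub, dXi_br, h1, h1, dXi_RL hcov hz, h.self_of_nhds, h.self_of_nhds,
    br_zero_left, br_zero_right]
  simp

/-! ### The solder form -/

/-- As ω is parallel, ∇ acts on s_j only through its free index. Antisymmetrising in the two form
indices leaves the torsion. -/
theorem nab_sL (i j) : nab cov x₀ i (S.sL x₀ j) z =
    ∑ n, const (chr cov x₀ n j i z : ℂ) * S.sL x₀ n z := by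
  unfold nab
  have hs : ∀ k, SmW z (fun p => (const (S.omL x₀ j k p : ℂ) : Wick m)) := fun k =>
    SmC.const (smR_omL hz j k).ofReal
  refine (covAt_sum (F := fun k p => const (S.omL x₀ j k p : ℂ) * (y k : Wick m)) _ _
    fun k _ => (hs k).mul (smW_of_forall_eq _)).trans ?_
  have h : ∀ k, covAt z (coordField x₀ i z) (fun k j => (chr cov x₀ k j i z : ℂ))
      (fun p => const (S.omL x₀ j k p : ℂ) * (y k : Wick m)) =
      ∑ n, const (chr cov x₀ n j i z : ℂ) * const (S.omL x₀ n k z : ℂ) * y k +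
      ((∑ n, const (chr cov x₀ n k i z : ℂ) * const (S.omL x₀ j n z : ℂ) * y k) -
        ∑ n, const (chr cov x₀ k n i z : ℂ) * const (S.omL x₀ j k z : ℂ) * y n) := by
    intro k
    rw [covAt_mul _ _ (hs k) (smW_of_forall_eq _), covAt_const, covAt_y,
      dC_ofReal _ _ (smR_omL hz j k), dirDeriv_omL hcov hz]
    push_cast
    simp only [const_add, const_sum, const_mul, add_mul, Finset.sum_mul, mul_neg, Finset.mul_sum]
    rw [← sub_eq_add_neg, add_sub_assoc]
    refine congrArg (_ + ·) (congrArg (_ - ·) (Finset.sum_congr rfl fun n _ => by ring))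
  simp only [h, Finset.sum_add_distrib, Finset.sum_sub_distrib]
  have h2 : ∑ k, ∑ n, const (chr cov x₀ n k i z : ℂ) * const (S.omL x₀ j n z : ℂ) * (y k : Wick m) =
      ∑ k, ∑ n, const (chr cov x₀ k n i z : ℂ) * const (S.omL x₀ j k z : ℂ) * y n :=
    Finset.sum_comm
  rw [h2, sub_self, add_zero, Finset.sum_comm]
  refine Finset.sum_congr rfl fun n _ => ?_
  unfold sL
  rw [Finset.mul_sum]
  exact Finset.sum_congr rfl fun k _ => by ring

end ContactMetricStructure

/-! ### Smooth transverse sections and forms, and the Weyl curvature as the curvature of D. -/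

theorem SmAt1.add {z : M} {a b : WForm1 m M} (ha : SmAt1 z a) (hb : SmAt1 z b) : SmAt1 z (a + b) :=
  fun j => ((ha j).add (hb j)).congr (Filter.Eventually.of_forall fun p => inChart1_add z a b p j)

theorem SmAt.add {z : M} {a b : WSec m M} (ha : SmAt z a) (hb : SmAt z b) : SmAt z (a + b) :=
  (SmW.add ha hb).congr (Filter.Eventually.of_forall fun p => inChart_add z a b p)

namespace ContactMetricStructure

variable {S : ContactMetricStructure m M} {cov : AffineConnection m M}

theorem mem_transSec_iff {a : WSec m M} :
    a ∈ S.transSec ↔ (∀ z, SmAt z a) ∧ ∀ x, S.TransAt x (a x) :=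
  and_congr_left' smoothSec_iff

theorem mem_transForm1_iff {b : WForm1 m M} :
    b ∈ S.transForm1 ↔ (∀ z, SmAt1 z b) ∧ ∀ x i, S.TransAt x (b x i) :=
  and_congr_left' smoothForm1_iff

theorem dXi_inChart {a : WSec m M} (ha : a ∈ S.transSec) {x₀ z : M}
    (hz : z ∈ (chartAt (Model m) x₀).source) : S.dXi x₀ z (inChart x₀ a z) = 0 :=
  dXi_inChart_of_transAt hz (ha.2 z)

theorem dXi_inChart1 {b : WForm1 m M} (hb : b ∈ S.transForm1) {x₀ z : M}
    (hz : z ∈ (chartAt (Model m) x₀).source) (j) : S.dXi x₀ z (inChart1 x₀ b z j) = 0 :=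
  dXi_inChart1_of_transAt hz (hb.2 z) j

theorem smW_inChart {a : WSec m M} (ha : a ∈ S.transSec) {x₀ z : M}
    (hz : z ∈ (chartAt (Model m) x₀).source) : SmW z (inChart x₀ a) :=
  ((mem_transSec_iff.mp ha).1 z).inChart hz

theorem smW_inChart1 {b : WForm1 m M} (hb : b ∈ S.transForm1) {x₀ z : M}
    (hz : z ∈ (chartAt (Model m) x₀).source) (j) : SmW z (fun p => inChart1 x₀ b p j) :=
  ((mem_transForm1_iff.mp hb).1 z).inChart1 hz j

/-- Membership in `W^ξ` can be checked in charts. -/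
theorem mem_transSec_of_chart {a : WSec m M} {F : M → M → Wick m}
    (h : ∀ x₀, ∀ p ∈ (chartAt (Model m) x₀).source, inChart x₀ a p = F x₀ p)
    (hs : ∀ x, SmW x (F x)) (ht : ∀ x, S.dXi x x (F x x) = 0) : a ∈ S.transSec := by
  refine mem_transSec_iff.mpr ⟨fun z => (hs z).congr ?_, fun x => ?_⟩
  · filter_upwards [source_mem_nhds (mem_source (m := m) z)] with p hp using h z p hp
  · rw [transAt_iff, ← inChart_self x a, h x x (mem_source x), ht]

theorem mem_transForm1_of_chart {b : WForm1 m M} {F : M → Fin (2 * m + 1) → M → Wick m}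
    (h : ∀ x₀, ∀ p ∈ (chartAt (Model m) x₀).source, ∀ j, inChart1 x₀ b p j = F x₀ j p)
    (hs : ∀ x j, SmW x (F x j)) (ht : ∀ x j, S.dXi x x (F x j x) = 0) : b ∈ S.transForm1 := by
  refine mem_transForm1_iff.mpr ⟨fun z j => (hs z j).congr ?_, fun x i => ?_⟩
  · filter_upwards [source_mem_nhds (mem_source (m := m) z)] with p hp using h z p hp j
  · rw [transAt_iff, ← inChart1_self x b, h x x (mem_source x), ht]

theorem transForm1_add {a b : WForm1 m M} (ha : a ∈ S.transForm1) (hb : b ∈ S.transForm1) :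
    a + b ∈ S.transForm1 := by
  rw [mem_transForm1_iff] at *
  refine ⟨fun z => (ha.1 z).add (hb.1 z), fun x i => ?_⟩
  have h1 := ha.2 x i
  have h2 := hb.2 x i
  rw [transAt_iff] at *
  rw [Pi.add_apply, Pi.add_apply, dXi_add, h1, h2, add_zero]

theorem transSec_add {a b : WSec m M} (ha : a ∈ S.transSec) (hb : b ∈ S.transSec) :
    a + b ∈ S.transSec := by
  rw [mem_transSec_iff] at *
  refine ⟨fun z => (ha.1 z).add (hb.1 z), fun x => ?_⟩
  have h1 := ha.2 x
  have h2 := hb.2 x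
  rw [transAt_iff] at *
  rw [Pi.add_apply, dXi_add, h1, h2, add_zero]

theorem dNabla_add {a b : WSec m M} (ha : ∀ z, SmAt z a) (hb : ∀ z, SmAt z b) :
    dNabla cov (a + b) = dNabla cov a + dNabla cov b := by
  funext x i
  rw [Pi.add_apply, Pi.add_apply, dNabla_apply, dNabla_apply, dNabla_apply]
  exact (covAt_congr _ _ (Filter.Eventually.of_forall fun p => inChart_add x a b p)).trans
    (covAt_add _ _ (ha x) (hb x))

theorem dNabla_sub {a b : WSec m M} (ha : ∀ z, SmAt z a) (hb : ∀ z, SmAt z b) :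
    dNabla cov (a - b) = dNabla cov a - dNabla cov b := by
  funext x i
  rw [Pi.sub_apply, Pi.sub_apply, dNabla_apply, dNabla_apply, dNabla_apply]
  exact (covAt_congr _ _ (Filter.Eventually.of_forall fun p => inChart_sub x a b p)).trans
    (covAt_sub _ _ (ha x) (hb x))

theorem dNabla1_add {a b : WForm1 m M} (ha : ∀ z, SmAt1 z a) (hb : ∀ z, SmAt1 z b) :
    dNabla1 cov (a + b) = dNabla1 cov a + dNabla1 cov b := by
  have h : ∀ x i j, nab cov x i (fun p => inChart1 x (a + b) p j) x =
      nab cov x i (fun p => inChart1 x a p j) x + nab cov x i (fun p => inChart1 x b p j) x :=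
    fun x i j => (covAt_congr _ _ (Filter.Eventually.of_forall fun p => inChart1_add x a b p j)).trans
      (covAt_add _ _ (ha x j) (hb x j))
  funext x i j
  rw [Pi.add_apply, Pi.add_apply, Pi.add_apply, dNabla1_apply, dNabla1_apply, dNabla1_apply, h, h]
  ring

theorem dNabla1_sub {a b : WForm1 m M} (ha : ∀ z, SmAt1 z a) (hb : ∀ z, SmAt1 z b) :
    dNabla1 cov (a - b) = dNabla1 cov a - dNabla1 cov b := by
  have h : ∀ x i j, nab cov x i (fun p => inChart1 x (a - b) p j) x =
      nab cov x i (fun p => inChart1 x a p j) x - nab cov x i (fun p => inChart1 x b p j) x :=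
    fun x i j => (covAt_congr _ _ (Filter.Eventually.of_forall fun p => inChart1_sub x a b p j)).trans
      (covAt_sub _ _ (ha x j) (hb x j))
  funext x i j
  rw [Pi.sub_apply, Pi.sub_apply, Pi.sub_apply, dNabla1_apply, dNabla1_apply, dNabla1_apply, h, h]
  ring

variable [T2Space M]

theorem solder_mem : S.solder ∈ S.transForm1 :=
  mem_transForm1_of_chart (F := fun x₀ j p => S.sL x₀ j p) (fun _ _ _ j => inChart1_solder j)
    (fun x j => smW_sL (mem_source x) j) (fun x j => dXi_sL (mem_source x) j)

theorem ad_eq_br (x : M) (w w' : Wick m) : S.ad x w w' = br (S.hL x x) w w' := by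
  rw [hL_self]; rfl

section

variable (hcov : IsContactMetricConnection S cov)
include hcov

theorem torsionForm_eq : S.torsionForm cov = dNabla1 cov S.solder := by
  funext x i j
  have h1 : ∀ i j, nab cov x i (fun p => inChart1 x S.solder p j) x =
      ∑ n, const (chr cov x n j i x : ℂ) * S.sL x n x := fun i j =>
    (covAt_congr _ _ (Filter.Eventually.of_forall fun p => inChart1_solder j)).trans
      (nab_sL hcov (mem_source x) i j)
  have h2 : ∀ n, torsionComp cov x n i j = chr cov x n i j x - chr cov x n j i x := by
    intro n
    unfold torsionComp
    rw [mlieBracket_coordField (mem_source x), sub_zero, comp_sub, chr_self, chr_self]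
    rfl
  rw [dNabla1_apply, h1, h1]
  unfold torsionForm sL
  simp only [h2, omL_self, Finset.mul_sum]
  rw [Finset.sum_comm, ← Finset.sum_sub_distrib]
  refine Finset.sum_congr rfl fun n _ => ?_
  rw [← Finset.sum_sub_distrib]
  refine Finset.sum_congr rfl fun k _ => ?_
  have h3 := omL_swap (S := S) (mem_source x) k n
  rw [omL_self, omL_self] at h3
  rw [h3]
  push_cast
  simp only [const_mul, const_sub, const_neg]
  ring

variable {r : WForm1 m M} (hr : r ∈ S.transForm1)
include hr

/-- The components of `r + s` in the chart at `x₀`. -/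
theorem smW_gamma {x₀ z : M} (hz : z ∈ (chartAt (Model m) x₀).source) (j) :
    SmW z (fun p => inChart1 x₀ (r + S.solder) p j) :=
  smW_inChart1 (transForm1_add hr solder_mem) hz j

/-- Completing the square. The square of r + s contributes the square of r, the cross term -δr (here
transversality of r is needed) and ω; d_∇ s contributes T. -/
theorem weylCurvature_eq : S.weylCurvature cov r =
    S.curvatureForm cov + dNabla1 cov (r + S.solder) + S.halfSq (r + S.solder) := by
  unfold weylCurvature
  rw [torsionForm_eq hcov, dNabla1_add (mem_transForm1_iff.mp hr).1 (mem_transForm1_iff.mp solder_mem).1]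
  funext x i j
  have hs : ∀ i, S.solder x i = S.sL x i x := fun i => solder_apply x i
  have ht : ∀ i, S.dXi x x (r x i) = 0 := fun i => (transAt_iff _).mp (hr.2 x i)
  have h1 : S.halfSq (r + S.solder) x i j = S.halfSq r x i j - (dy i (r x j) - dy j (r x i)) +
      const (S.omComp x i j : ℂ) := by
    change S.ad x (r x i + S.solder x i) (r x j + S.solder x j) = S.ad x (r x i) (r x j) - _ + _
    rw [ad_eq_br, ad_eq_br, hs, hs, br_add_left, br_add_right, br_add_right,
      br_sL_sL (mem_source x), br_sL_of_dXi (mem_source x) _ (ht j), br_swap _ (r x i) (S.sL x j x),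
      br_sL_of_dXi (mem_source x) _ (ht i), omL_self]
    ring
  simp only [Pi.add_apply, Pi.sub_apply]
  rw [h1]
  unfold omForm delta1
  ring

theorem inChart2_weylCurvature {x₀ z : M} (hz : z ∈ (chartAt (Model m) x₀).source) (k l) :
    inChart2 x₀ (S.weylCurvature cov r) z k l =
      S.OmL cov x₀ (fun j p => inChart1 x₀ (r + S.solder) p j) k l z := by
  rw [weylCurvature_eq hcov hr, inChart2_add, inChart2_add, inChart2_curvatureForm hcov.smooth hz,
    inChart_dNabla1 hz ((mem_transForm1_iff.mp (transForm1_add hr solder_mem)).1 z),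
    inChart_halfSq hz]
  rfl

theorem fedosov_eq {a : WSec m M} (ha : ∀ x, S.TransAt x (a x)) :
    S.fedosov cov r a = dNabla cov a + S.adForm (r + S.solder) a := by
  funext x i
  have ht : S.dXi x x (a x) = 0 := (transAt_iff _).mp (ha x)
  have h1 : S.adForm (r + S.solder) a x i = S.adForm r a x i - dy i (a x) := by
    change S.ad x (r x i + S.solder x i) (a x) = S.ad x (r x i) (a x) - _
    rw [ad_eq_br, ad_eq_br, solder_apply, br_add_left, br_sL_of_dXi (mem_source x) _ ht]
    ring
  simp only [fedosov, Pi.add_apply, Pi.sub_apply]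
  rw [h1]
  unfold delta
  ring

theorem fedosov1_eq {b : WForm1 m M} (hb : ∀ x i, S.TransAt x (b x i)) :
    S.fedosov1 cov r b = dNabla1 cov b + S.adForm1 (r + S.solder) b := by
  funext x i j
  have ht : ∀ j, S.dXi x x (b x j) = 0 := fun j => (transAt_iff _).mp (hb x j)
  have h2 : ∀ i j, S.ad x (r x i + S.solder x i) (b x j) = S.ad x (r x i) (b x j) - dy i (b x j) := by
    intro i j
    rw [ad_eq_br, ad_eq_br, solder_apply, br_add_left, br_sL_of_dXi (mem_source x) _ (ht j)]
    ring
  simp only [fedosov1, Pi.add_apply, Pi.sub_apply, adForm1]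
  rw [h2, h2]
  unfold delta1
  ring

theorem inChart1_fedosov {a : WSec m M} (ha : a ∈ S.transSec) {x₀ z : M}
    (hz : z ∈ (chartAt (Model m) x₀).source) (j) : inChart1 x₀ (S.fedosov cov r a) z j =
      S.DL cov x₀ (fun j p => inChart1 x₀ (r + S.solder) p j) j (inChart x₀ a) z := by
  rw [fedosov_eq hcov hr ha.2, inChart1_add, inChart_dNabla hz ((mem_transSec_iff.mp ha).1 z),
    inChart_adForm hz]
  rfl

theorem inChart2_fedosov1 {b : WForm1 m M} (hb : b ∈ S.transForm1) {x₀ z : M}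
    (hz : z ∈ (chartAt (Model m) x₀).source) (k l) : inChart2 x₀ (S.fedosov1 cov r b) z k l =
      S.DL cov x₀ (fun j p => inChart1 x₀ (r + S.solder) p j) k (fun p => inChart1 x₀ b p l) z
      - S.DL cov x₀ (fun j p => inChart1 x₀ (r + S.solder) p j) l (fun p => inChart1 x₀ b p k) z := by
  rw [fedosov1_eq hcov hr hb.2, inChart2_add, inChart_dNabla1 hz ((mem_transForm1_iff.mp hb).1 z),
    inChart_adForm1 hz]
  unfold DL
  ring

theorem fedosov_mem {a : WSec m M} (ha : a ∈ S.transSec) : S.fedosov cov r a ∈ S.transForm1 := by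
  refine mem_transForm1_of_chart
    (F := fun x₀ j => S.DL cov x₀ (fun j p => inChart1 x₀ (r + S.solder) p j) j (inChart x₀ a))
    (fun _ _ hp j => inChart1_fedosov hcov hr ha hp j)
    (fun x j => smW_DL hcov (mem_source x) (smW_gamma hcov hr (mem_source x))
      (smW_inChart ha (mem_source x)) j) (fun x j => ?_)
  have hx := mem_source (m := m) x
  have hγ : ∀ i, S.dXi x x (inChart1 x (r + S.solder) x i) = 0 := fun i =>
    dXi_inChart1 (transForm1_add hr solder_mem) hx i
  have he : ∀ᶠ p in 𝓝 x, S.dXi x p (inChart x a p) = 0 := by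
    filter_upwards [source_mem_nhds hx] with p hp using dXi_inChart ha hp
  exact dXi_DL (γ := fun j p => inChart1 x (r + S.solder) p j) hcov hx hγ
    (smW_inChart ha hx) he j

theorem fedosov1_fedosov {a : WSec m M} (ha : a ∈ S.transSec) (x k l) :
    S.fedosov1 cov r (S.fedosov cov r a) x k l = S.ad x (S.weylCurvature cov r x k l) (a x) := by
  have hx := mem_source (m := m) x
  have h1 := DL_comm hcov hx (smW_gamma hcov hr hx) (smW_inChart ha hx) k l
  rw [ad_eq_br, ← inChart2_self x (S.weylCurvature cov r), inChart2_weylCurvature hcov hr hx,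
    ← inChart_self x a, ← h1, ← inChart2_self x (S.fedosov1 cov r _),
    inChart2_fedosov1 hcov hr (fedosov_mem hcov hr ha) hx]
  refine congrArg₂ (· - ·) ?_ ?_
  -- The outer operator differentiates, so the chart expression of Da is needed on a neighbourhood
  -- of x and not only at x.
  · refine congrArg₂ (· + ·) (covAt_congr _ _ ?_) (congrArg _ (inChart1_fedosov hcov hr ha hx l))
    filter_upwards [source_mem_nhds hx] with p hp using inChart1_fedosov hcov hr ha hp l
  · refine congrArg₂ (· + ·) (covAt_congr _ _ ?_) (congrArg _ (inChart1_fedosov hcov hr ha hx k))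
    filter_upwards [source_mem_nhds hx] with p hp using inChart1_fedosov hcov hr ha hp k

end

end ContactMetricStructure

/-! ### Weights by degree in y, and the Poincaré lemma for δ in the fibres. -/

theorem const_zero : (const 0 : Wick m) = 0 := by simp [const]

/-- Coefficients at `y = 0` vanish. -/
def VanishAtZero (w : Wick m) : Prop := ∀ k, cf k 0 w = 0

theorem vanishAtZero_y_mul (i : Fin (2 * m + 1)) (w : Wick m) : VanishAtZero (y i * w) := fun k => by
  rw [cf_y_mul]; simp

theorem VanishAtZero.sum {ι : Type*} {s : Finset ι} {f : ι → Wick m} (h : ∀ i ∈ s, VanishAtZero (f i)) :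
    VanishAtZero (∑ i ∈ s, f i) := fun k => by
  have := map_sum (cfHom k (0 : Fin (2 * m + 1) →₀ ℕ)) f s
  exact this.trans (Finset.sum_eq_zero fun i hi => h i hi k)

theorem VanishAtZero.const_mul {w : Wick m} (h : VanishAtZero w) (c : ℂ) : VanishAtZero (const c * w) :=
  fun k => by rw [cf_const_mul, h, mul_zero]

theorem degree_ne_zero {d : Fin (2 * m + 1) →₀ ℕ} (h : d ≠ 0) : d.degree ≠ 0 := fun h' =>
  h ((Finsupp.degree_eq_zero_iff d).mp h')

/-- In degree zero the weight is `1 / 0 = 0`, so the inverse loses the value at y = 0; the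
hypothesis says that there is nothing to lose. -/
theorem yScale_inv_mul_euler (w : Wick m) (h : VanishAtZero w) :
    yScale (fun l => 1 / (l : ℂ)) (yScale (fun l => (l : ℂ)) w) = w := by
  refine ext_cf fun k d => ?_
  rw [yScale_yScale, cf_yScale]
  by_cases hd : d = 0
  · subst hd; rw [h k, mul_zero]
  · have : (d.degree : ℂ) ≠ 0 := by exact_mod_cast degree_ne_zero hd
    field_simp

theorem eq_zero_of_yScale_inv (w : Wick m) (h : VanishAtZero w)
    (h' : yScale (fun l => 1 / (l : ℂ)) w = 0) : w = 0 := by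
  refine ext_cf fun k d => ?_
  by_cases hd : d = 0
  · subst hd; rw [h k]; simp
  · have h1 := congrArg (cf k d) h'
    rw [cf_yScale] at h1
    have : (d.degree : ℂ) ≠ 0 := by exact_mod_cast degree_ne_zero hd
    exact (mul_eq_zero.mp (h1.trans (by simp))).resolve_left (one_div_ne_zero this) |>.trans (by simp)

theorem yScale_succ_inv (w : Wick m) :
    yScale (fun l => 1 / ((l : ℂ) + 1)) (yScale (fun l => (l : ℂ)) w + w) = w := by
  refine ext_cf fun k d => ?_
  rw [cf_yScale, cf_add, cf_yScale]
  have : (d.degree : ℂ) + 1 ≠ 0 := Nat.cast_add_one_ne_zero _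
  field_simp

theorem eq_zero_of_yScale_ne {c : ℕ → ℂ} (hc : ∀ l, c l ≠ 0) {w : Wick m} (h : yScale c w = 0) :
    w = 0 := by
  refine ext_cf fun k d => ?_
  have h1 := congrArg (cf k d) h
  rw [cf_yScale] at h1
  exact (mul_eq_zero.mp (h1.trans (by simp))).resolve_left (hc _) |>.trans (by simp)

theorem inFiltration_of_yScale_id {n} {w : Wick m} (h : VanishAtZero w)
    (h' : InFiltration n (yScale (fun l => (l : ℂ)) w)) : InFiltration n w := by
  intro k d hd
  by_cases h0 : d = 0
  · subst h0; exact h k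
  · have h1 := h' k d hd
    rw [cf_yScale] at h1
    exact (mul_eq_zero.mp h1).resolve_left (by exact_mod_cast degree_ne_zero h0)

theorem inFiltration_of_yScale_add_mul {n} {c : ℂ} (hc : ∀ l : ℕ, (l : ℂ) + c ≠ 0) {w : Wick m}
    (h : InFiltration n (yScale (fun l => (l : ℂ)) w + const c * w)) : InFiltration n w := by
  intro k d hd
  have h1 := h k d hd
  rw [cf_add, cf_yScale, cf_const_mul, ← add_mul] at h1
  exact (mul_eq_zero.mp h1).resolve_left (hc _)

namespace ContactMetricStructure

variable {S : ContactMetricStructure m M} {x : M}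

theorem sum_ξComp_lamComp : ∑ k, (S.ξComp x k : ℂ) * (S.lamComp x k : ℂ) = 1 := by
  have h := lamL_xiL (S := S) (mem_source x)
  have h' := congrArg (fun t : ℝ => (t : ℂ)) h
  simp only [lamL_self, xiL_self] at h'
  push_cast at h'
  rw [← h']
  exact Finset.sum_congr rfl fun k _ => mul_comm _ _

theorem dXi_self (w : Wick m) : S.dXi x x w = ∑ k, const (S.ξComp x k : ℂ) * dy k w := by
  unfold dXi; simp only [xiL_self]

theorem sum_yP_mul (j) (w : Wick m) : S.yP x j * w =
    y j * w - const (S.ξComp x j : ℂ) * ∑ i, const (S.lamComp x i : ℂ) * y i * w := by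
  unfold yP projComp
  push_cast
  simp only [const_sub, sub_mul, Finset.sum_sub_distrib, const_mul]
  refine congrArg₂ (· - ·) ?_ ?_
  · rw [Finset.sum_eq_single j]
    · simp [const_one]
    · intro i _ hi; simp [hi.symm, const_zero]
    · simp
  · rw [Finset.sum_mul, Finset.mul_sum]
    exact Finset.sum_congr rfl fun i _ => by ring

/-- The projection P changes the Euler operator by a multiple of the fibre derivative along ξ, which
vanishes on transverse elements. So δ^*δ counts the degree in y. -/
theorem sum_yP_dy {w : Wick m} (hw : S.dXi x x w = 0) :
    ∑ j, S.yP x j * dy j w = yScale (fun l => (l : ℂ)) w := by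
  simp only [sum_yP_mul, Finset.sum_sub_distrib, euler]
  rw [sub_eq_self]
  rw [dXi_self] at hw
  have : ∀ j, const (S.ξComp x j : ℂ) * ∑ i, const (S.lamComp x i : ℂ) * y i * dy j w =
      (∑ i, const (S.lamComp x i : ℂ) * y i) * (const (S.ξComp x j : ℂ) * dy j w) := fun j => by
    rw [Finset.mul_sum, Finset.sum_mul]
    exact Finset.sum_congr rfl fun i _ => by ring
  simp only [this, ← Finset.mul_sum, hw, mul_zero]

theorem dy_yP (i j) : dy i (S.yP x j) = const (S.projComp x j i : ℂ) := by
  unfold yP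
  simp [dy_sum, dy_mul, dy_y]

theorem sum_projComp_mul (i) (f : Fin (2 * m + 1) → Wick m) :
    ∑ j, const (S.projComp x j i : ℂ) * f j =
      f i - const (S.lamComp x i : ℂ) * ∑ j, const (S.ξComp x j : ℂ) * f j := by
  unfold projComp
  push_cast
  simp only [const_sub, sub_mul, Finset.sum_sub_distrib, const_mul]
  refine congrArg₂ (· - ·) ?_ ?_
  · rw [Finset.sum_eq_single i]
    · simp [const_one]
    · intro j _ hj; simp [hj, const_zero]
    · simp
  · rw [Finset.mul_sum]
    exact Finset.sum_congr rfl fun i _ => by ring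

/-- If `∑ y^j P_j f_j = 0` then the contraction of `∂_i f_j` is algebraic. -/
theorem sum_yP_dy_swap (i) (f : Fin (2 * m + 1) → Wick m) :
    ∑ j, S.yP x j * dy i (f j) = dy i (∑ j, S.yP x j * f j) -
      (f i - const (S.lamComp x i : ℂ) * ∑ j, const (S.ξComp x j : ℂ) * f j) := by
  rw [← sum_projComp_mul, dy_sum, ← Finset.sum_sub_distrib]
  refine Finset.sum_congr rfl fun j _ => ?_
  rw [dy_mul, dy_yP]
  ring

theorem sum_const_ξComp_lamComp :
    ∑ k, (const (S.ξComp x k : ℂ) * const (S.lamComp x k : ℂ) : Wick m) = 1 := by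
  simp only [← const_mul, ← const_sum, sum_ξComp_lamComp, const_one]

theorem sum_yP_mul_lamComp : ∑ j, S.yP x j * const (S.lamComp x j : ℂ) = 0 := by
  unfold yP
  simp only [Finset.sum_mul]
  rw [Finset.sum_comm]
  refine Finset.sum_eq_zero fun i _ => ?_
  have h := sum_projComp_mul (S := S) (x := x) i (fun j => const (S.lamComp x j : ℂ))
  rw [sum_const_ξComp_lamComp, mul_one, sub_self] at h
  rw [← mul_zero (y i), ← h, Finset.mul_sum]
  exact Finset.sum_congr rfl fun j _ => by ring

theorem dXi_yP (j) : S.dXi x x (S.yP x j) = 0 := by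
  rw [dXi_self]
  simp only [dy_yP]
  have h : ∀ k, const (S.ξComp x k : ℂ) * const (S.projComp x j k : ℂ) =
      (if j = k then const (S.ξComp x k : ℂ) else 0) -
        const (S.ξComp x j : ℂ) * (const (S.ξComp x k : ℂ) * const (S.lamComp x k : ℂ) : Wick m) := by
    intro k
    unfold projComp
    push_cast
    rw [const_sub, const_mul]
    split_ifs with hjk
    · rw [Complex.ofReal_one, const_one]; ring
    · rw [Complex.ofReal_zero, const_zero]; ring
  simp only [h, Finset.sum_sub_distrib, ← Finset.mul_sum, sum_const_ξComp_lamComp]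
  simp

theorem vanishAtZero_yP_mul (j) (w : Wick m) : VanishAtZero (S.yP x j * w) := by
  unfold yP
  rw [Finset.sum_mul]
  refine VanishAtZero.sum fun i _ => ?_
  rw [mul_assoc]
  exact (vanishAtZero_y_mul i w).const_mul _

theorem inFiltration_yP_mul {n} (j) {w : Wick m} (h : InFiltration n w) :
    InFiltration (n + 1) (S.yP x j * w) := by
  unfold yP
  rw [Finset.sum_mul]
  refine InFiltration.sum fun i _ => ?_
  rw [mul_assoc]
  exact (h.y_mul i).const_mul _

theorem yP_mul_yScale (c : ℕ → ℂ) (j) (w : Wick m) :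
    S.yP x j * yScale (fun l => c (l + 1)) w = yScale c (S.yP x j * w) := by
  unfold yP
  rw [Finset.sum_mul, Finset.sum_mul, yScale_sum]
  refine Finset.sum_congr rfl fun i _ => ?_
  rw [mul_assoc, mul_assoc, y_mul_yScale, yScale_const_mul]

/-! ### The homotopy operators -/

/-- On transverse sections δ^{-1}δ = 1 - Π. In degree zero the convention `1 / 0 = 0` agrees with
this. -/
theorem deltaInv_delta {a : WSec m M} (ha : S.TransAt x (a x)) (k d) :
    cf k d (S.deltaInv (delta a) x) = if d = 0 then 0 else cf k d (a x) := by
  unfold deltaInv deltaStar delta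
  rw [sum_yP_dy ((transAt_iff _).mp ha), yScale_yScale, cf_yScale]
  split_ifs with h
  · subst h; simp
  · have : (d.degree : ℂ) ≠ 0 := by exact_mod_cast degree_ne_zero h
    field_simp

variable (S) in
/-- The homotopy operator on `2`-forms. -/
def homot (B : WForm2 m M) : WForm1 m M := fun x k =>
  yScale (fun l => 1 / ((l : ℂ) + 1))
      (S.deltaStar2 B x k - const (S.lamComp x k : ℂ) * S.iξ (S.deltaStar2 B) x)
    + const (S.lamComp x k : ℂ) * yScale (fun l => 1 / (l : ℂ)) (S.iξ (S.deltaStar2 B) x)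

theorem homot_add (A B : WForm2 m M) : S.homot (A + B) = S.homot A + S.homot B := by
  funext x k
  simp only [homot, iξ, deltaStar2, Pi.add_apply, mul_add, Finset.sum_add_distrib, yScale_add,
    yScale_sub]
  ring

theorem homot_neg (A : WForm2 m M) : S.homot (-A) = -S.homot A := by
  rw [eq_neg_iff_add_eq_zero, ← homot_add, neg_add_cancel]
  have := homot_add (S := S) 0 0
  rwa [add_zero, left_eq_add] at this

theorem homot_sub (A B : WForm2 m M) : S.homot (A - B) = S.homot A - S.homot B := by
  rw [sub_eq_add_neg, homot_add, homot_neg, ← sub_eq_add_neg]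

theorem inFiltration_homot {n} {B : WForm2 m M} (h : ∀ i j, InFiltration n (B x i j)) (k) :
    InFiltration (n + 1) (S.homot B x k) := by
  have h1 : ∀ k, InFiltration (n + 1) (S.deltaStar2 B x k) := fun k =>
    InFiltration.sum fun j _ => inFiltration_yP_mul j (h j k)
  have h2 : InFiltration (n + 1) (S.iξ (S.deltaStar2 B) x) :=
    InFiltration.sum fun j _ => (h1 j).const_mul _
  exact (((h1 k).sub (h2.const_mul _)).yScale _).add ((h2.yScale _).const_mul _)

theorem iξ_homot (B : WForm2 m M) (x : M) :
    S.iξ (S.homot B) x = yScale (fun l => 1 / (l : ℂ)) (S.iξ (S.deltaStar2 B) x) := by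
  change ∑ k, const (S.ξComp x k : ℂ) * (yScale _ _ + _) = _
  simp only [mul_add, Finset.sum_add_distrib, ← yScale_const_mul, ← yScale_sum, mul_sub,
    Finset.sum_sub_distrib]
  simp only [← mul_assoc, ← const_mul, ← Finset.sum_mul, ← const_sum, sum_ξComp_lamComp]
  have : ∑ k, const (S.ξComp x k : ℂ) * S.deltaStar2 B x k = S.iξ (S.deltaStar2 B) x := rfl
  rw [this, const_one, one_mul, sub_self]
  simp

/-- (δ^*)² = 0: the contracting factors commute while the form is alternating, so the sum equals its
negative. -/
theorem sum_yP_deltaStar2 {B : WForm2 m M} (hB : ∀ i j, B x i j = -B x j i) :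
    ∑ k, S.yP x k * S.deltaStar2 B x k = 0 := by
  unfold deltaStar2
  simp only [Finset.mul_sum]
  have h : ∑ k, ∑ j, S.yP x k * (S.yP x j * B x j k) = -∑ k, ∑ j, S.yP x k * (S.yP x j * B x j k) := by
    conv_lhs => rw [Finset.sum_comm]
    rw [← Finset.sum_neg_distrib]
    refine Finset.sum_congr rfl fun j _ => ?_
    rw [← Finset.sum_neg_distrib]
    refine Finset.sum_congr rfl fun k _ => ?_
    rw [hB j k]; ring
  have h2 : (2 : Wick m) * ∑ k, ∑ j, S.yP x k * (S.yP x j * B x j k) = 0 := by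
    rw [two_mul]
    nth_rewrite 1 [h]
    rw [neg_add_cancel]
  rw [← const_two] at h2
  refine ext_cf fun k d => ?_
  have := congrArg (cf k d) h2
  rw [cf_const_mul] at this
  simpa using this

/-- The contraction vector y^iP^j_i is annihilated by λ, so the λ-part does not contribute; what
remains is a weighted (δ^*)² = 0. This gives fixed points in the image of `homot` the normalisation
δ^{-1} r = 0. -/
theorem deltaStar_homot {B : WForm2 m M} (hB : ∀ i j, B x i j = -B x j i) :
    S.deltaStar (S.homot B) x = 0 := by
  change ∑ k, S.yP x k * (yScale _ _ + const (S.lamComp x k : ℂ) * _) = _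
  have e1 : ∀ w : Wick m, ∑ k, S.yP x k * (const (S.lamComp x k : ℂ) * w) = 0 := fun w => by
    simp only [← mul_assoc, ← Finset.sum_mul, sum_yP_mul_lamComp, zero_mul]
  simp only [mul_add, Finset.sum_add_distrib, e1, add_zero]
  have e2 : ∀ k (w : Wick m), S.yP x k * yScale (fun l => 1 / ((l : ℂ) + 1)) w =
      yScale (fun l => 1 / (l : ℂ)) (S.yP x k * w) := fun k w => by
    rw [← yP_mul_yScale]; simp
  simp only [e2, ← yScale_sum, mul_sub, Finset.sum_sub_distrib, e1, sub_zero, sum_yP_deltaStar2 hB]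
  simp

theorem embed_proj (a : WSec m M) (x : M) (k d) :
    cf k d (embed (m := m) (proj a) x) = if d = 0 then cf k 0 (a x) else 0 := by
  unfold embed proj cf
  rw [PowerSeries.coeff_mk, PowerSeries.coeff_mk, MvPowerSeries.coeff_C]
  simp

theorem proj1_eq_zero_iff {b : WForm1 m M} : S.proj1 b = 0 ↔ ∀ x, VanishAtZero (S.iξ b x) := by
  constructor
  · intro h x k
    have h1 : ∑ i, const (S.ξComp x i : ℂ) * S.proj1 b x i = embed (m := m) (proj (S.iξ b)) x := by
      unfold proj1
      simp only [← mul_assoc, ← const_mul, ← Finset.sum_mul, ← const_sum, sum_ξComp_lamComp]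
      rw [const_one, one_mul]
    rw [h] at h1
    have h2 := congrArg (cf k 0) h1
    rw [embed_proj, if_pos rfl] at h2
    rw [← h2]
    simp
  · intro h
    funext x i
    unfold proj1
    have : embed (m := m) (proj (S.iξ b)) x = 0 := ext_cf fun k d => by
      rw [embed_proj, h x k]; simp
    rw [this, mul_zero]
    rfl

/-- The ξ-component of the image carries the weight 1/l, which is `1 / 0 = 0` at y = 0; it contains
a factor y besides. -/
theorem proj1_homot (B : WForm2 m M) : S.proj1 (S.homot B) = 0 :=
  proj1_eq_zero_iff.mpr fun x k => by
    rw [iξ_homot, cf_yScale]; simp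

theorem deltaStar_eq_zero_of_deltaInv {b : WForm1 m M} (h : S.deltaInv b = 0) (x : M) :
    S.deltaStar b x = 0 :=
  eq_zero_of_yScale_inv _ (VanishAtZero.sum fun j _ => vanishAtZero_yP_mul j _) (congrFun h x)

theorem deltaInv_eq_zero_of_deltaStar {b : WForm1 m M} (h : ∀ x, S.deltaStar b x = 0) :
    S.deltaInv b = 0 := by
  funext x
  unfold deltaInv
  rw [h]
  simp

/-- When δ^* r = 0, Cartan's formula shows that δ^*δ multiplies the ξ-free part of r by l + 1 and
its λ-part by l, where l is the degree in y. These are the weights divided out in `homot`. The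
weight l vanishes in degree zero, and Π r = 0 excludes exactly that part. -/
theorem homot_delta1 {r : WForm1 m M} (ht : ∀ x i, S.TransAt x (r x i))
    (h1 : ∀ x, S.deltaStar r x = 0) (h2 : S.proj1 r = 0) : S.homot (delta1 r) = r := by
  have hC : ∀ x k, S.deltaStar2 (delta1 r) x k = yScale (fun l => (l : ℂ)) (r x k) + r x k -
      const (S.lamComp x k : ℂ) * S.iξ r x := by
    intro x k
    unfold deltaStar2 delta1
    simp only [mul_sub, Finset.sum_sub_distrib]
    rw [sum_yP_dy ((transAt_iff _).mp (ht x k)), sum_yP_dy_swap, show ∑ j, S.yP x j * r x j = 0 from h1 x]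
    unfold iξ
    simp
    ring
  have hc : ∀ x, S.iξ (S.deltaStar2 (delta1 r)) x = yScale (fun l => (l : ℂ)) (S.iξ r x) := by
    intro x
    change ∑ k, const (S.ξComp x k : ℂ) * S.deltaStar2 (delta1 r) x k = _
    simp only [hC, mul_sub, mul_add, Finset.sum_sub_distrib, Finset.sum_add_distrib,
      ← yScale_const_mul, ← yScale_sum]
    simp only [← mul_assoc, ← const_mul, ← Finset.sum_mul, ← const_sum, sum_ξComp_lamComp]
    rw [const_one, one_mul]
    unfold iξ
    ring
  funext x k
  unfold homot
  rw [hC, hc, yScale_inv_mul_euler _ (proj1_eq_zero_iff.mp h2 x)]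
  have : yScale (fun l => (l : ℂ)) (r x k) + r x k - const (S.lamComp x k : ℂ) * S.iξ r x -
      const (S.lamComp x k : ℂ) * yScale (fun l => (l : ℂ)) (S.iξ r x) =
      (yScale (fun l => (l : ℂ)) (r x k) + r x k) - const (S.lamComp x k : ℂ) *
        (yScale (fun l => (l : ℂ)) (S.iξ r x) + S.iξ r x) := by ring
  rw [this, yScale_sub, yScale_const_mul, yScale_succ_inv, yScale_succ_inv]
  ring

/-- The weights in `homot` are invertible on elements vanishing at y = 0, as everything in the image
of δ^* does. The λ-part is removed by contraction with ξ, then the rest. -/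
theorem deltaStar2_eq_zero_of_homot {A : WForm2 m M} (h : S.homot A = 0) (x k) :
    S.deltaStar2 A x k = 0 := by
  have hv : ∀ k, VanishAtZero (S.deltaStar2 A x k) := fun k =>
    VanishAtZero.sum fun j _ => vanishAtZero_yP_mul j _
  have hc : S.iξ (S.deltaStar2 A) x = 0 := by
    refine eq_zero_of_yScale_inv _ (VanishAtZero.sum fun j _ => (hv j).const_mul _) ?_
    rw [← iξ_homot, h]
    simp [iξ]
  have h1 := congrFun (congrFun h x) k
  unfold homot at h1
  rw [hc] at h1
  simp only [mul_zero, sub_zero] at h1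
  refine eq_zero_of_yScale_ne (c := fun l => 1 / ((l : ℂ) + 1))
    (fun l => one_div_ne_zero (Nat.cast_add_one_ne_zero _)) ?_
  simpa using h1

/-- Fibrewise step of the vanishing argument for closed `2`-forms. -/
theorem inFiltration_of_closed2 {n} {A : Fin (2 * m + 1) → Fin (2 * m + 1) → Wick m}
    (ht : ∀ i j, S.dXi x x (A i j) = 0) (ha : ∀ i j, A i j = -A j i)
    (hs : ∀ k, ∑ j, S.yP x j * A j k = 0)
    (hd : ∀ i j k, InFiltration n (dy i (A j k) + dy j (A k i) + dy k (A i j))) (j k) :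
    InFiltration (n + 1) (A j k) := by
  set c : Fin (2 * m + 1) → Wick m := fun k => ∑ i, const (S.ξComp x i : ℂ) * A i k with hc
  have hc' : ∀ k, ∑ i, const (S.ξComp x i : ℂ) * A k i = -c k := fun k => by
    rw [hc, ← Finset.sum_neg_distrib]
    exact Finset.sum_congr rfl fun i _ => by rw [ha k i, mul_neg]
  have hs' : ∀ k, ∑ i, S.yP x i * A k i = 0 := fun k => by
    rw [← neg_eq_zero, ← Finset.sum_neg_distrib, ← hs k]
    exact Finset.sum_congr rfl fun i _ => by rw [ha k i, mul_neg, neg_neg]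
  -- Contract the cyclic derivative with y^iP^j_i. Since δ^* A = 0, Cartan's formula leaves the
  -- degree plus two, with corrections by the ξ-component `c`.
  have h1 : ∀ j k, InFiltration (n + 1) (yScale (fun l => (l : ℂ)) (A j k) + const 2 * A j k
      - const (S.lamComp x j : ℂ) * c k + const (S.lamComp x k : ℂ) * c j) := by
    intro j k
    have e : ∑ i, S.yP x i * (dy i (A j k) + dy j (A k i) + dy k (A i j)) =
        yScale (fun l => (l : ℂ)) (A j k) + const 2 * A j k
      - const (S.lamComp x j : ℂ) * c k + const (S.lamComp x k : ℂ) * c j := by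
      simp only [mul_add, Finset.sum_add_distrib]
      rw [sum_yP_dy (ht j k), sum_yP_dy_swap j (fun i => A k i), sum_yP_dy_swap k (fun i => A i j),
        hs, hs', hc', ha k j, const_two]
      have : ∑ i, const (S.ξComp x i : ℂ) * A i j = c j := rfl
      rw [this]
      simp
      ring
    rw [← e]
    exact InFiltration.sum fun i _ => inFiltration_yP_mul i (hd i j k)
  have h2 : ∑ j, const (S.ξComp x j : ℂ) * c j = 0 := by
    have e : ∑ j, const (S.ξComp x j : ℂ) * c j = -∑ j, const (S.ξComp x j : ℂ) * c j := by
      rw [← Finset.sum_neg_distrib]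
      simp only [hc, Finset.mul_sum]
      rw [Finset.sum_comm]
      refine Finset.sum_congr rfl fun i _ => ?_
      rw [← Finset.sum_neg_distrib]
      exact Finset.sum_congr rfl fun j _ => by rw [ha i j]; ring
    refine ext_cf fun k d => ?_
    have := congrArg (cf k d) e
    rw [cf_neg, eq_neg_iff_add_eq_zero, ← two_mul] at this
    simpa using this
  -- A further contraction with ξ isolates `c`. One of the two units is used up by λ(ξ) = 1, so the
  -- weight is l + 1, still invertible.
  have h3 : ∀ k, InFiltration (n + 1) (c k) := by
    intro k
    have e : ∑ j, const (S.ξComp x j : ℂ) * (yScale (fun l => (l : ℂ)) (A j k) + const 2 * A j k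
      - const (S.lamComp x j : ℂ) * c k + const (S.lamComp x k : ℂ) * c j) =
      yScale (fun l => (l : ℂ)) (c k) + const 1 * c k := by
      simp only [mul_add, mul_sub, Finset.sum_add_distrib, Finset.sum_sub_distrib,
        ← yScale_const_mul, ← yScale_sum]
      have e1 : ∑ j, const (S.ξComp x j : ℂ) * (const (S.lamComp x j : ℂ) * c k) = c k := by
        simp only [← mul_assoc, ← const_mul, ← Finset.sum_mul, ← const_sum, sum_ξComp_lamComp]
        rw [const_one, one_mul]
      have e2 : ∑ j, const (S.ξComp x j : ℂ) * (const (S.lamComp x k : ℂ) * c j) = 0 := by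
        rw [← mul_zero (const (S.lamComp x k : ℂ)), ← h2, Finset.mul_sum]
        exact Finset.sum_congr rfl fun j _ => by ring
      have e3 : ∑ j, const (S.ξComp x j : ℂ) * (const 2 * A j k) = const 2 * c k := by
        rw [hc, Finset.mul_sum]
        exact Finset.sum_congr rfl fun j _ => by ring
      rw [e1, e2, e3, const_two, const_one]
      ring
    refine inFiltration_of_yScale_add_mul (c := 1) (fun l => Nat.cast_add_one_ne_zero _) ?_
    rw [← e]
    exact InFiltration.sum fun j _ => (h1 j k).const_mul _
  refine inFiltration_of_yScale_add_mul (c := 2) (fun l => by exact_mod_cast (by omega : l + 2 ≠ 0)) ?_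
  have e : yScale (fun l => (l : ℂ)) (A j k) + const 2 * A j k =
      (yScale (fun l => (l : ℂ)) (A j k) + const 2 * A j k
      - const (S.lamComp x j : ℂ) * c k + const (S.lamComp x k : ℂ) * c j) +
      (const (S.lamComp x j : ℂ) * c k - const (S.lamComp x k : ℂ) * c j) := by ring
  rw [e]
  exact (h1 j k).add (((h3 k).const_mul _).sub ((h3 j).const_mul _))

/-- Fibrewise step of the vanishing argument for closed `1`-forms. -/
theorem inFiltration_of_closed1 {n} {b : Fin (2 * m + 1) → Wick m}
    (ht : ∀ i, S.dXi x x (b i) = 0) (hs : ∑ j, S.yP x j * b j = 0)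
    (hv : VanishAtZero (∑ j, const (S.ξComp x j : ℂ) * b j))
    (hd : ∀ i j, InFiltration n (dy i (b j) - dy j (b i))) (k) : InFiltration (n + 1) (b k) := by
  set c : Wick m := ∑ j, const (S.ξComp x j : ℂ) * b j with hc
  have h1 : ∀ k, InFiltration (n + 1) (yScale (fun l => (l : ℂ)) (b k) + const 1 * b k
      - const (S.lamComp x k : ℂ) * c) := by
    intro k
    have e : ∑ i, S.yP x i * (dy i (b k) - dy k (b i)) =
        yScale (fun l => (l : ℂ)) (b k) + const 1 * b k - const (S.lamComp x k : ℂ) * c := by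
      simp only [mul_sub, Finset.sum_sub_distrib]
      rw [sum_yP_dy (ht k), sum_yP_dy_swap k b, hs, ← hc, const_one]
      simp
      ring
    rw [← e]
    exact InFiltration.sum fun i _ => inFiltration_yP_mul i (hd i k)
  -- For the ξ-component of a 1-form the weight is l itself, which vanishes at y = 0. This is why
  -- `hv` is required, and why Δ is the only obstruction to flatness of a lift.
  have h3 : InFiltration (n + 1) c := by
    refine inFiltration_of_yScale_id hv ?_
    have e : ∑ j, const (S.ξComp x j : ℂ) * (yScale (fun l => (l : ℂ)) (b j) + const 1 * b j
      - const (S.lamComp x j : ℂ) * c) = yScale (fun l => (l : ℂ)) c := by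
      simp only [mul_add, mul_sub, Finset.sum_add_distrib, Finset.sum_sub_distrib,
        ← yScale_const_mul, ← yScale_sum, const_one, one_mul]
      have e1 : ∑ j, const (S.ξComp x j : ℂ) * (const (S.lamComp x j : ℂ) * c) = c := by
        simp only [← mul_assoc, ← const_mul, ← Finset.sum_mul, ← const_sum, sum_ξComp_lamComp]
        rw [const_one, one_mul]
      rw [e1, ← hc]
      ring
    rw [← e]
    exact InFiltration.sum fun j _ => (h1 j).const_mul _
  refine inFiltration_of_yScale_add_mul (c := 1) (fun l => Nat.cast_add_one_ne_zero _) ?_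
  have e : yScale (fun l => (l : ℂ)) (b k) + const 1 * b k =
      (yScale (fun l => (l : ℂ)) (b k) + const 1 * b k - const (S.lamComp x k : ℂ) * c) +
      const (S.lamComp x k : ℂ) * c := by ring
  rw [e]
  exact (h1 k).add (h3.const_mul _)

end ContactMetricStructure

/-- Alternating `2`-forms. -/
def IsAlt (B : WForm2 m M) : Prop := ∀ x i j, B x i j = -B x j i

theorem IsAlt.add {A B : WForm2 m M} (hA : IsAlt A) (hB : IsAlt B) : IsAlt (A + B) := fun x i j => by
  simp only [Pi.add_apply]
  rw [hA, hB]
  ring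

theorem IsAlt.sub {A B : WForm2 m M} (hA : IsAlt A) (hB : IsAlt B) : IsAlt (A - B) := fun x i j => by
  simp only [Pi.sub_apply]
  rw [hA, hB]
  ring

theorem isAlt_delta1 (b : WForm1 m M) : IsAlt (delta1 b) := fun _ _ _ => (neg_sub _ _).symm

theorem isAlt_dNabla1 (cov : AffineConnection m M) (b : WForm1 m M) : IsAlt (dNabla1 cov b) :=
  fun _ _ _ => (neg_sub _ _).symm

theorem inFiltration_dNabla {cov : AffineConnection m M} {n} {a : WSec m M}
    (h : ∀ x, InFiltration n (a x)) (x i) : InFiltration n (dNabla cov a x i) := by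
  rw [dNabla_apply]
  exact Wick.InFiltration.covAt _ _ (Filter.Eventually.of_forall fun p => (h p).linSubst _)

theorem inFiltration_inChart1 {n} {b : WForm1 m M} (h : ∀ x i, InFiltration n (b x i)) (x₀ p : M)
    (j : Fin (2 * m + 1)) : InFiltration n (inChart1 x₀ b p j) :=
  InFiltration.sum fun i _ => ((h p i).linSubst _).const_mul _

theorem inFiltration_dNabla1 {cov : AffineConnection m M} {n} {b : WForm1 m M}
    (h : ∀ x i, InFiltration n (b x i)) (x i j) : InFiltration n (dNabla1 cov b x i j) := by
  rw [dNabla1_apply]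
  exact (Wick.InFiltration.covAt _ _ (Filter.Eventually.of_forall fun p =>
    inFiltration_inChart1 h x p j)).sub (Wick.InFiltration.covAt _ _
      (Filter.Eventually.of_forall fun p => inFiltration_inChart1 h x p i))

/-! ### Smooth transverse 2-forms, and the vanishing of Ω - ω. -/

namespace ContactMetricStructure

variable {S : ContactMetricStructure m M} {cov : AffineConnection m M} [T2Space M]

variable (S) in
/-- Smooth transverse `2`-forms. -/
def transForm2 : Set (WForm2 m M) :=
  {B | (∀ z, SmAt2 z B) ∧ ∀ x i j, S.dXi x x (B x i j) = 0}

theorem transForm2_add {A B : WForm2 m M} (hA : A ∈ S.transForm2) (hB : B ∈ S.transForm2) :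
    A + B ∈ S.transForm2 :=
  ⟨fun z k l => ((hA.1 z k l).add (hB.1 z k l)).congr
      (Filter.Eventually.of_forall fun p => inChart2_add z A B p k l),
    fun x i j => (dXi_add _ _).trans (by rw [hA.2, hB.2, add_zero])⟩

theorem transForm2_sub {A B : WForm2 m M} (hA : A ∈ S.transForm2) (hB : B ∈ S.transForm2) :
    A - B ∈ S.transForm2 :=
  ⟨fun z k l => ((hA.1 z k l).sub (hB.1 z k l)).congr
      (Filter.Eventually.of_forall fun p => inChart2_sub z A B p k l),
    fun x i j => (dXi_sub _ _).trans (by rw [hA.2, hB.2, sub_zero])⟩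

theorem mem_transForm2_of_chart {B : WForm2 m M} {F : M → Fin (2 * m + 1) → Fin (2 * m + 1) → M → Wick m}
    (h : ∀ x₀, ∀ p ∈ (chartAt (Model m) x₀).source, ∀ i j, inChart2 x₀ B p i j = F x₀ i j p)
    (hs : ∀ x i j, SmW x (F x i j)) (ht : ∀ x i j, S.dXi x x (F x i j x) = 0) : B ∈ S.transForm2 := by
  refine ⟨fun z i j => (hs z i j).congr ?_, fun x i j => ?_⟩
  · filter_upwards [source_mem_nhds (mem_source (m := m) z)] with p hp using h z p hp i j
  · rw [← inChart2_self x B, h x x (mem_source x), ht]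

theorem omForm_mem : S.omForm ∈ S.transForm2 :=
  mem_transForm2_of_chart (F := fun x₀ i j p => const (S.omL x₀ i j p : ℂ))
    (fun _ _ _ i j => inChart2_omForm i j)
    (fun x i j => SmC.const (smR_omL (mem_source x) i j).ofReal)
    fun _ _ _ => dXi_of_isScalar (isScalar_const _)

theorem delta1_mem {b : WForm1 m M} (hb : b ∈ S.transForm1) : delta1 b ∈ S.transForm2 :=
  mem_transForm2_of_chart
    (F := fun x₀ i j p => dy i (inChart1 x₀ b p j) - dy j (inChart1 x₀ b p i))
    (fun x₀ p _ i j => inChart_delta1 x₀ b p i j)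
    (fun x i j => ((smW_inChart1 hb (mem_source x) j).dy i).sub
      ((smW_inChart1 hb (mem_source x) i).dy j))
    fun x i j => by
      rw [dXi_sub, dXi_dy, dXi_dy, dXi_inChart1 hb (mem_source x), dXi_inChart1 hb (mem_source x),
        dy_zero, dy_zero, sub_zero]

theorem isAlt_halfSq (r : WForm1 m M) : IsAlt (S.halfSq r) := fun x i j => by
  unfold halfSq
  rw [ad_eq_br, ad_eq_br, br_swap]

theorem isAlt_omForm : IsAlt S.omForm := fun x i j => by
  have h := omL_swap (S := S) (mem_source (m := m) x) i j
  rw [omL_self, omL_self] at h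
  unfold omForm
  rw [h]
  push_cast
  exact const_neg _

/-- dω = ddλ = 0: in the cyclic sum the second derivatives of λ cancel pairwise. -/
theorem pd_omL_cyclic (x : M) (i j k : Fin (2 * m + 1)) : pd x i (fun p => (S.omL x j k p : ℂ)) x
    + pd x j (fun p => (S.omL x k i p : ℂ)) x + pd x k (fun p => (S.omL x i j p : ℂ)) x = 0 := by
  have hx := mem_source (m := m) x
  have hs := fun i : Fin (2 * m + 1) => SmR.ofReal (m := m) (smR_lamL (S := S) hx i)
  have h : ∀ i j k : Fin (2 * m + 1), pd x i (fun p => (S.omL x j k p : ℂ)) x =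
      pd x i (pd x j (fun p => (S.lamL x k p : ℂ))) x
        - pd x i (pd x k (fun p => (S.lamL x j p : ℂ))) x := by
    intro i j k
    refine Eq.trans (dC_congr _ _ ?_)
      (dC_sub _ _ (SmC.pd hx (hs k) j) (SmC.pd hx (hs j) k))
    filter_upwards [source_mem_nhds hx] with p hp
    have h1 := fun i j : Fin (2 * m + 1) => dC_ofReal p (coordField x j p) (smR_lamL (S := S) hp i)
    rw [pd, pd, h1, h1, omL_eq_dlam hp, Complex.ofReal_sub]
  rw [h, h, h, pd_comm hx (hs k) i j, pd_comm hx (hs i) j k, pd_comm hx (hs j) k i]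
  ring

section

variable (hcov : IsContactMetricConnection S cov)
include hcov

theorem isAlt_curvatureForm : IsAlt (S.curvatureForm cov) := fun x k l => by
  unfold curvatureForm
  have : ∀ n j, curvatureComp cov x n j k l = -curvatureComp cov x n j l k := fun n j => by
    rw [curvatureComp_eq hcov.smooth, curvatureComp_eq hcov.smooth, curvL, curvL, neg_add, neg_sub,
      ← Finset.sum_neg_distrib]
    simp only [neg_sub]
  simp only [this, mul_neg, ← Finset.sum_neg_distrib]
  push_cast
  simp only [const_neg, neg_mul]

variable {r : WForm1 m M} (hr : r ∈ S.transForm1)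
include hr

theorem isAlt_weylCurvature : IsAlt (S.weylCurvature cov r) := by
  rw [weylCurvature_eq hcov hr]
  exact ((isAlt_curvatureForm hcov).add (isAlt_dNabla1 _ _)).add (isAlt_halfSq _)

theorem weylCurvature_mem : S.weylCurvature cov r ∈ S.transForm2 :=
  mem_transForm2_of_chart
    (F := fun x₀ => S.OmL cov x₀ (fun j p => inChart1 x₀ (r + S.solder) p j))
    (fun _ _ hp k l => inChart2_weylCurvature hcov hr hp k l)
    (fun x k l => smW_OmL hcov (mem_source x) (smW_gamma hcov hr (mem_source x)) k l)
    fun x k l => by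
      refine dXi_OmL (γ := fun j p => inChart1 x (r + S.solder) p j) hcov (mem_source x)
        (smW_gamma hcov hr (mem_source x)) ?_ k l
      filter_upwards [source_mem_nhds (mem_source (m := m) x)] with p hp i
      exact dXi_inChart1 (transForm1_add hr solder_mem) hp i

/-- If `δ^*` kills `Ω - ω`, then the Bianchi identity forces `Ω = ω`. -/
theorem weylCurvature_eq_omForm (h2 : ∀ x i, InFiltration 2 (r x i))
    (hd : ∀ x k, S.deltaStar2 (S.weylCurvature cov r - S.omForm) x k = 0) :
    S.weylCurvature cov r = S.omForm := by
  set A := S.weylCurvature cov r - S.omForm with hA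
  have hAc : ∀ x₀ : M, ∀ p ∈ (chartAt (Model m) x₀).source, ∀ k l, inChart2 x₀ A p k l =
      S.OmL cov x₀ (fun j p => inChart1 x₀ (r + S.solder) p j) k l p - const (S.omL x₀ k l p : ℂ) :=
    fun x₀ p hp k l => by
      rw [hA, inChart2_sub, inChart2_weylCurvature hcov hr hp, inChart2_omForm]
  have ht := (transForm2_sub (weylCurvature_mem hcov hr) (omForm_mem (S := S))).2
  rw [← hA] at ht
  -- Since dω = 0 and ω is central, the Bianchi identity for Ω = ω + A reads δA = d_∇ A + (i/ν)[r,
  -- A]. If A ∈ F^n, then the right side is in F^n, and with δ^* A = 0 the Poincaré lemma puts A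
  -- into F^(n+1).
  have key : ∀ n, ∀ x i j, InFiltration n (A x i j) := by
    intro n
    induction n with
    | zero => exact fun x i j => inFiltration_zero_left _
    | succ n ih =>
      intro x
      have hx := mem_source (m := m) x
      refine inFiltration_of_closed2 (ht x)
        ((isAlt_weylCurvature hcov hr).sub isAlt_omForm x) (hd x) fun i j k => ?_
      set γ : Fin (2 * m + 1) → M → Wick m := fun j p => inChart1 x (r + S.solder) p j with hγ
      have hγs : ∀ i, SmW x (γ i) := smW_gamma hcov hr hx
      have hnA : ∀ i j k, InFiltration n (nab cov x i (fun p => inChart2 x A p j k) x) := fun i j k =>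
        Wick.InFiltration.covAt _ _ (Filter.Eventually.of_forall fun p =>
          InFiltration.sum fun a _ => InFiltration.sum fun b _ =>
            ((ih p a b).linSubst _).const_mul _)
      have hbr : ∀ i j k, InFiltration n (br (S.hL x x) (r x i) (A x j k)) := fun i j k =>
        InFiltration.br _ (h2 x i) (ih x j k) (by omega)
      have hD : ∀ i j k, S.DL cov x γ i (S.OmL cov x γ j k) x =
          nab cov x i (fun p => inChart2 x A p j k) x + br (S.hL x x) (r x i) (A x j k)
            - dy i (A x j k) + const (pd x i (fun p => (S.omL x j k p : ℂ)) x) := by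
        intro i j k
        have e1 : S.OmL cov x γ j k x = A x j k + const (S.omL x j k x : ℂ) := by
          rw [← inChart2_self x A, hAc x x hx]; ring
        have e2 : nab cov x i (S.OmL cov x γ j k) x = nab cov x i (fun p => inChart2 x A p j k) x
            + const (pd x i (fun p => (S.omL x j k p : ℂ)) x) := by
          have hc : SmW x (fun p => (const (S.omL x j k p : ℂ) : Wick m)) :=
            SmC.const (smR_omL hx j k).ofReal
          have hs := smW_OmL hcov hx hγs j k
          refine eq_add_of_sub_eq ?_
          rw [show const (pd x i (fun p => (S.omL x j k p : ℂ)) x) = nab cov x i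
            (fun p => (const (S.omL x j k p : ℂ) : Wick m)) x from (covAt_const _ _ _).symm]
          refine (covAt_sub _ _ hs hc).symm.trans (covAt_congr _ _ ?_)
          filter_upwards [source_mem_nhds hx] with p hp using (hAc x p hp j k).symm
        have e3 : γ i x = r x i + S.sL x i x := by
          rw [hγ]
          change inChart1 x (r + S.solder) x i = _
          rw [inChart1_self, ← solder_apply]; rfl
        rw [DL, e1, e2, e3, br_add_right, br_scalar_right _ (isScalar_const _), br_add_left,
          br_sL_of_dXi hx _ (ht x j k)]
        ring
      have hB := DL_bianchi hcov hx hγs i j k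
      rw [hD, hD, hD] at hB
      have hω := congrArg (const (m := m)) (pd_omL_cyclic (S := S) x i j k)
      rw [const_add, const_add, const_zero] at hω
      have e : dy i (A x j k) + dy j (A x k i) + dy k (A x i j) =
          (nab cov x i (fun p => inChart2 x A p j k) x + br (S.hL x x) (r x i) (A x j k)) +
          (nab cov x j (fun p => inChart2 x A p k i) x + br (S.hL x x) (r x j) (A x k i)) +
          (nab cov x k (fun p => inChart2 x A p i j) x + br (S.hL x x) (r x k) (A x i j)) := by
        linear_combination hω - hB
      rw [e]
      exact (((hnA i j k).add (hbr i j k)).add ((hnA j k i).add (hbr j k i))).add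
        ((hnA k i j).add (hbr k i j))
  refine sub_eq_zero.mp ?_
  funext x i j
  exact eq_zero_of_inFiltration fun n => key n x i j

end

end ContactMetricStructure

/-! ### Contractions for the filtration -/

theorem eq_of_inFiltration_sub {w w' : Wick m} (h : ∀ n, InFiltration n (w - w')) : w = w' :=
  sub_eq_zero.mp (eq_zero_of_inFiltration h)

theorem cf_eq_of_inFiltration {n} {w w' : Wick m} (h : InFiltration n (w - w')) {k d}
    (hd : 2 * k + d.degree < n) : cf k d w = cf k d w' :=
  sub_eq_zero.mp ((cf_sub k d w w').symm.trans (h k d hd))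

/-- Two fixed points agree to one degree more than they agree, hence to all degrees, and the
filtration is separated. -/
theorem unique_fixedPoint {ι : Type*} {Φ : (ι → Wick m) → ι → Wick m} {P : (ι → Wick m) → Prop}
    (hΦ : ∀ f g n, P f → P g → (∀ i, InFiltration n (f i - g i)) →
      ∀ i, InFiltration (n + 1) (Φ f i - Φ g i))
    {f g : ι → Wick m} (hf : P f) (hg : P g) (ef : f = Φ f) (eg : g = Φ g) : f = g := by
  have h : ∀ n i, InFiltration n (f i - g i) := fun n => by
    induction n with
    | zero => exact fun i => inFiltration_zero_left _
    | succ n ih => rw [ef, eg]; exact hΦ f g n hf hg ih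
  exact funext fun i => eq_of_inFiltration_sub fun n => h n i

/-- Banach's fixed point theorem for the filtration. The hypothesis `hc` says that `P` is closed
under limits; for the applications this means that smoothness and transversality pass to the limit.
-/
theorem exists_fixedPoint {ι : Type*} {Φ : (ι → Wick m) → ι → Wick m} {P : (ι → Wick m) → Prop}
    (hΦ : ∀ f g n, P f → P g → (∀ i, InFiltration n (f i - g i)) →
      ∀ i, InFiltration (n + 1) (Φ f i - Φ g i))
    (hP : ∀ f, P f → P (Φ f))
    (hc : ∀ f : ι → Wick m, (∀ n, ∃ g, P g ∧ ∀ i, InFiltration n (f i - g i)) → P f)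
    {f₀ : ι → Wick m} (h₀ : P f₀) : ∃ f, P f ∧ f = Φ f := by
  set u : ℕ → ι → Wick m := fun n => Φ^[n] f₀ with hu
  have hs : ∀ n, u (n + 1) = Φ (u n) := fun n => Function.iterate_succ_apply' Φ n f₀
  have hPu : ∀ n, P (u n) := fun n => by
    induction n with
    | zero => exact h₀
    | succ n ih => rw [hs]; exact hP _ ih
  have h1 : ∀ n k i, InFiltration n (u (n + k) i - u n i) := by
    intro n
    induction n with
    | zero => exact fun k i => inFiltration_zero_left _
    | succ n ih =>
      intro k
      rw [show n + 1 + k = n + k + 1 by omega, hs, hs]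
      exact hΦ _ _ n (hPu _) (hPu _) (ih k)
  -- A coefficient of total degree q = 2k + |d| no longer changes from the iterate q + 1 on, so the
  -- limit takes it from there.
  set f : ι → Wick m := fun i => ofCf fun k d => cf k d (u (2 * k + d.degree + 1) i) with hf
  have h2 : ∀ n i, InFiltration n (f i - u n i) := by
    intro n i k d hd
    obtain ⟨j, rfl⟩ : ∃ j, n = 2 * k + d.degree + 1 + j := ⟨_, (Nat.add_sub_of_le hd).symm⟩
    rw [cf_sub, hf, cf_ofCf, cf_eq_of_inFiltration (h1 (2 * k + d.degree + 1) j i) (by omega), sub_self]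
  have hPf : P f := hc f fun n => ⟨u n, hPu n, h2 n⟩
  refine ⟨f, hPf, funext fun i => eq_of_inFiltration_sub fun n => ?_⟩
  have h3 := hΦ _ _ n hPf (hPu n) (h2 n) i
  rw [← hs] at h3
  have h4 := (h2 (n + 1) i).sub h3
  rw [sub_sub_sub_cancel_right] at h4
  exact h4.mono n.le_succ

/-- Smoothness is imposed on each coefficient separately, and each coefficient coincides with that
of a sufficiently good approximation. -/
theorem smW_of_approx {z : M} {F : M → Wick m}
    (h : ∀ n, ∃ G, SmW z G ∧ ∀ p, InFiltration n (F p - G p)) : SmW z F := fun k d => by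
  obtain ⟨G, hG, e⟩ := h (2 * k + d.degree + 1)
  exact (hG k d).congr_of_eventuallyEq
    (Filter.Eventually.of_forall fun p => cf_eq_of_inFiltration (e p) (Nat.lt_succ_self _))

namespace ContactMetricStructure

variable {S : ContactMetricStructure m M} {cov : AffineConnection m M} {x : M} [T2Space M]

theorem inFiltration_dXi {n} {w : Wick m} (h : InFiltration n w) :
    InFiltration (n - 1) (S.dXi x x w) := InFiltration.sum fun i _ => (h.dy i).const_mul _

theorem dXi_eq_zero_of_approx {w : Wick m}
    (h : ∀ n, ∃ g, S.dXi x x g = 0 ∧ InFiltration n (w - g)) : S.dXi x x w = 0 :=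
  eq_zero_of_inFiltration fun n => by
    obtain ⟨g, hg, e⟩ := h (n + 1)
    have := inFiltration_dXi (S := S) (x := x) e
    rwa [dXi_sub, hg, sub_zero] at this

theorem mem_transSec_of_approx {a : WSec m M}
    (h : ∀ n, ∃ b ∈ S.transSec, ∀ x, InFiltration n (a x - b x)) : a ∈ S.transSec := by
  refine mem_transSec_iff.mpr ⟨fun z => smW_of_approx fun n => ?_, fun x =>
    (transAt_iff _).mpr (dXi_eq_zero_of_approx fun n => ?_)⟩ <;> obtain ⟨b, hb, e⟩ := h n
  · refine ⟨inChart z b, (mem_transSec_iff.mp hb).1 z, fun p => ?_⟩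
    rw [← inChart_sub]
    exact (e p).linSubst _
  · exact ⟨b x, (transAt_iff _).mp (hb.2 x), e x⟩

theorem mem_transForm1_of_approx {a : WForm1 m M}
    (h : ∀ n, ∃ b ∈ S.transForm1, ∀ x i, InFiltration n (a x i - b x i)) : a ∈ S.transForm1 := by
  refine mem_transForm1_iff.mpr ⟨fun z j => smW_of_approx fun n => ?_, fun x i =>
    (transAt_iff _).mpr (dXi_eq_zero_of_approx fun n => ?_)⟩ <;> obtain ⟨b, hb, e⟩ := h n
  · refine ⟨fun p => inChart1 z b p j, (mem_transForm1_iff.mp hb).1 z j, fun p => ?_⟩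
    rw [← inChart1_sub]
    exact inFiltration_inChart1 (b := a - b) e z p j
  · exact ⟨b x i, (transAt_iff _).mp (hb.2 x i), e x i⟩

theorem transForm1_zero : (0 : WForm1 m M) ∈ S.transForm1 :=
  mem_transForm1_of_chart (F := fun _ _ _ => 0)
    (fun x₀ p _ j => by rw [inChart1_eq]; simp [linSubst_zero]) (fun x _ => smW_of_forall_eq 0)
    fun x _ => by simp [dXi]

/-! ### The homotopy operators on smooth transverse forms -/

theorem smW_yPL {x₀ z : M} (hz : z ∈ (chartAt (Model m) x₀).source) (j) :
    SmW z (fun p => S.yPL x₀ p j) :=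
  SmW.sum fun i _ => (SmC.const (SmR.ofReal ((smR_const z _).sub
    ((smR_xiL hz j).mul (smR_lamL hz i))))).mul (smW_of_forall_eq _)

theorem deltaInv_mem {b : WForm1 m M} (hb : b ∈ S.transForm1) : S.deltaInv b ∈ S.transSec := by
  refine mem_transSec_of_chart
    (F := fun x₀ p => yScale (fun l => 1 / (l : ℂ)) (∑ k, S.yPL x₀ p k * inChart1 x₀ b p k))
    (fun x₀ p hp => by rw [← inChart_deltaStar hp]; exact inChart_yScale _ _ _ _)
    (fun x => (SmW.sum fun k _ => (smW_yPL (mem_source x) k).mul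
      (smW_inChart1 hb (mem_source x) k)).yScale _)
    fun x => dXi_yScale_of_eq_zero _ ?_
  rw [dXi_sum]
  refine Finset.sum_eq_zero fun k _ => ?_
  rw [dXi_mul, yPL_self, dXi_yP, dXi_inChart1 hb (mem_source x), zero_mul, mul_zero, add_zero]

theorem inFiltration_deltaInv {n} {b : WForm1 m M} (h : ∀ i, InFiltration n (b x i)) :
    InFiltration (n + 1) (S.deltaInv b x) :=
  (InFiltration.sum fun j _ => inFiltration_yP_mul j (h j)).yScale _

/-- In a chart the operator is assembled from smooth multiples, weights by degree and contractions
with transverse vectors, all of which preserve smoothness and transversality. -/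
theorem homot_mem {B : WForm2 m M} (hB : B ∈ S.transForm2) : S.homot B ∈ S.transForm1 := by
  set C : M → Fin (2 * m + 1) → M → Wick m := fun x₀ k p => ∑ j, S.yPL x₀ p j * inChart2 x₀ B p j k with hC
  set c : M → M → Wick m := fun x₀ p => ∑ k, const (S.xiL x₀ k p : ℂ) * C x₀ k p with hc
  have hCs : ∀ x k, SmW x (C x k) := fun x k =>
    SmW.sum fun j _ => (smW_yPL (mem_source x) j).mul (hB.1 x j k)
  have hcs : ∀ x, SmW x (c x) := fun x =>
    SmW.sum fun k _ => (SmC.const (smR_xiL (mem_source x) k).ofReal).mul (hCs x k)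
  have hls : ∀ x k, SmW x (fun p => (const (S.lamL x k p : ℂ) : Wick m)) := fun x k =>
    SmC.const (smR_lamL (mem_source x) k).ofReal
  have hCt : ∀ x k, S.dXi x x (C x k x) = 0 := fun x k => by
    rw [hC, dXi_sum]
    refine Finset.sum_eq_zero fun j _ => ?_
    rw [dXi_mul, yPL_self, dXi_yP, inChart2_self, hB.2, zero_mul, mul_zero, add_zero]
  have hm : ∀ x (f : ℂ) {w : Wick m}, S.dXi x x w = 0 → S.dXi x x (const f * w) = 0 := fun x f w hw => by
    rw [dXi_mul, dXi_of_isScalar (isScalar_const _), hw, zero_mul, mul_zero, add_zero]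
  have hct : ∀ x, S.dXi x x (c x x) = 0 := fun x => by
    rw [hc, dXi_sum]
    exact Finset.sum_eq_zero fun k _ => hm x _ (hCt x k)
  refine mem_transForm1_of_chart
    (F := fun x₀ k p => yScale (fun l => 1 / ((l : ℂ) + 1)) (C x₀ k p - const (S.lamL x₀ k p : ℂ) * c x₀ p)
      + const (S.lamL x₀ k p : ℂ) * yScale (fun l => 1 / (l : ℂ)) (c x₀ p))
    (fun x₀ p hp k => ?_)
    (fun x k => (((hCs x k).sub ((hls x k).mul (hcs x))).yScale _).add ((hls x k).mul ((hcs x).yScale _)))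
    fun x k => ?_
  · have e1 : ∀ k, inChart1 x₀ (S.deltaStar2 B) p k = C x₀ k p := inChart1_deltaStar2 hp B
    have e2 : inChart x₀ (S.iξ (S.deltaStar2 B)) p = c x₀ p := by
      rw [inChart_iξ hp]
      simp only [e1, hc]
    refine (inChart1_add x₀ (fun x k => yScale (fun l => 1 / ((l : ℂ) + 1))
      (S.deltaStar2 B x k - const (S.lamComp x k : ℂ) * S.iξ (S.deltaStar2 B) x))
      (fun x k => const (S.lamComp x k : ℂ) * yScale (fun l => 1 / (l : ℂ))
        (S.iξ (S.deltaStar2 B) x)) p k).trans (congrArg₂ (· + ·) ?_ ?_)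
    · refine (inChart1_yScale _ _ _ _ _).trans (congrArg _ ?_)
      refine (inChart1_sub _ _ _ _ _).trans (congrArg₂ (· - ·) (e1 k) ?_)
      rw [← e2]
      exact inChart1_lam_mul _ _
    · rw [← e2, ← inChart_yScale]
      exact inChart1_lam_mul _ _
  · rw [dXi_add, dXi_yScale_of_eq_zero _ (by rw [dXi_sub, hCt, hm x _ (hct x), sub_zero]),
      hm x _ (dXi_yScale_of_eq_zero _ (hct x)), add_zero]

theorem inFiltration_ad {p q n} {w w' : Wick m} (h : InFiltration p w) (h' : InFiltration q w')
    (hn : n + 2 ≤ p + q) : InFiltration n (S.ad x w w') := by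
  rw [ad_eq_br]
  exact h.br _ h' hn

theorem halfSq_sub (r r' : WForm1 m M) (i j) : S.halfSq r x i j - S.halfSq r' x i j =
    S.ad x ((r - r') x i) (r x j) + S.ad x (r' x i) ((r - r') x j) := by
  simp only [halfSq, ad_eq_br, Pi.sub_apply, br_sub_left, br_sub_right]
  ring

/-! ### Existence and uniqueness of the Fedosov connection -/

section

variable (hcov : IsContactMetricConnection S cov) {r r' : WForm1 m M}
include hcov

theorem isAbelian_of_weylCurvature (hr : r ∈ S.transForm1) (h2 : ∀ x i, InFiltration 2 (r x i))
    (h : S.weylCurvature cov r = S.omForm) : S.IsAbelian cov r := by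
  refine ⟨hr, h2, fun a ha => ?_⟩
  funext x k l
  rw [fedosov1_fedosov hcov hr ha, h, ad_eq_br]
  exact br_scalar_left _ (isScalar_const _) _

/-- Adding δr removes the only term that lowers the filtration. The lowest remaining one is the
torsion, linear in y; applying `homot` therefore lands in F², as the iteration requires. -/
theorem inFiltration_weylCurvature_sub (h2 : ∀ x i, InFiltration 2 (r x i)) (i j) :
    InFiltration 1 ((S.weylCurvature cov r - S.omForm + delta1 r) x i j) := by
  have e : (S.weylCurvature cov r - S.omForm + delta1 r) x i j = dNabla1 cov S.solder x i j
      + S.RL cov x i j x + dNabla1 cov r x i j + S.halfSq r x i j := by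
    rw [← curvatureForm_apply hcov.smooth, ← torsionForm_eq hcov]
    simp only [weylCurvature, Pi.add_apply, Pi.sub_apply]
    ring
  have hs : ∀ x i, InFiltration 1 (S.solder x i) := fun x i =>
    InFiltration.sum fun k _ => InFiltration.const_mul (by
      simpa using InFiltration.y_mul (inFiltration_zero_left (1 : Wick m)) k) _
  rw [e]
  exact (((inFiltration_dNabla1 hs x i j).add ((isQuadratic_RL i j).inFiltration.mono (by omega))).add
    ((inFiltration_dNabla1 h2 x i j).mono (by omega))).add
      (inFiltration_ad (h2 x i) (h2 x j) (by omega))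

/-- After ω and δr cancel, r enters only through d_∇ r and the square of r. Both preserve the order
of agreement because r and r' lie in F²; `homot` then adds one. -/
theorem homot_weylCurvature_sub (hr : r ∈ S.transForm1) (h2 : ∀ x i, InFiltration 2 (r x i))
    (hr' : r' ∈ S.transForm1) (h2' : ∀ x i, InFiltration 2 (r' x i)) {n}
    (h : ∀ x i, InFiltration n (r x i - r' x i)) (x i) :
    InFiltration (n + 1) (S.homot (S.weylCurvature cov r - S.omForm + delta1 r) x i -
      S.homot (S.weylCurvature cov r' - S.omForm + delta1 r') x i) := by
  change InFiltration _ ((S.homot _ - S.homot _) x i)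
  rw [← homot_sub]
  refine inFiltration_homot (fun i j => ?_) i
  have e : (S.weylCurvature cov r - S.omForm + delta1 r -
      (S.weylCurvature cov r' - S.omForm + delta1 r')) x i j =
      dNabla1 cov (r - r') x i j + (S.halfSq r x i j - S.halfSq r' x i j) := by
    rw [dNabla1_sub (mem_transForm1_iff.mp hr).1 (mem_transForm1_iff.mp hr').1]
    simp only [weylCurvature, Pi.add_apply, Pi.sub_apply]
    ring
  rw [e, halfSq_sub]
  exact (inFiltration_dNabla1 h x i j).add ((inFiltration_ad (h x i) (h2 x j) le_rfl).add
    (inFiltration_ad (h2' x i) (h x j) (by omega)))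

/-- The map r ↦ `homot` (Ω - ω + δr) is a contraction on transverse forms in F². A fixed point is
normalised automatically and Bianchi forces Ω = ω. Conversely, for a normalised r with Ω = ω the
fixed point equation reduces to `homot_delta1`. -/
theorem existsUnique_connection : ∃! r : WForm1 m M, S.IsAbelian cov r ∧
    S.weylCurvature cov r = S.omForm ∧ S.deltaInv r = 0 ∧ S.proj1 r = 0 := by
  set c : (M × Fin (2 * m + 1) → Wick m) → WForm1 m M := fun f x i => f (x, i) with hcd
  set Φ : (M × Fin (2 * m + 1) → Wick m) → M × Fin (2 * m + 1) → Wick m := fun f p =>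
    S.homot (S.weylCurvature cov (c f) - S.omForm + delta1 (c f)) p.1 p.2 with hΦd
  set P : (M × Fin (2 * m + 1) → Wick m) → Prop := fun f =>
    c f ∈ S.transForm1 ∧ ∀ x i, InFiltration 2 (c f x i) with hPd
  have hΦ : ∀ f g n, P f → P g → (∀ i, InFiltration n (f i - g i)) →
      ∀ i, InFiltration (n + 1) (Φ f i - Φ g i) := fun f g n hf hg h p =>
    homot_weylCurvature_sub hcov hf.1 hf.2 hg.1 hg.2 (fun x i => h (x, i)) p.1 p.2
  have hc : ∀ f, (∀ n, ∃ g, P g ∧ ∀ i, InFiltration n (f i - g i)) → P f := by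
    refine fun f h => ⟨mem_transForm1_of_approx fun n => ?_, fun x i => ?_⟩
    · obtain ⟨g, hg, e⟩ := h n
      exact ⟨c g, hg.1, fun x i => e (x, i)⟩
    · obtain ⟨g, hg, e⟩ := h 2
      have := (e (x, i)).add (hg.2 x i)
      rwa [hcd, sub_add_cancel] at this
  obtain ⟨f, hf, ef⟩ := exists_fixedPoint hΦ
    (fun f hf => ⟨homot_mem (transForm2_add (transForm2_sub (weylCurvature_mem hcov hf.1) omForm_mem)
      (delta1_mem hf.1)), fun x => inFiltration_homot (inFiltration_weylCurvature_sub hcov hf.2)⟩) hc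
    (f₀ := 0) ⟨transForm1_zero, fun x i => inFiltration_zero _⟩
  have hsol : ∀ f, P f → f = Φ f → S.deltaInv (c f) = 0 ∧ S.proj1 (c f) = 0 := by
    intro f hf ef
    have e : c f = S.homot (S.weylCurvature cov (c f) - S.omForm + delta1 (c f)) := by
      conv_lhs => rw [ef]
    rw [e]
    exact ⟨deltaInv_eq_zero_of_deltaStar fun x => deltaStar_homot
      ((((isAlt_weylCurvature hcov hf.1).sub isAlt_omForm).add (isAlt_delta1 _)) x), proj1_homot _⟩
  refine ⟨c f, ?_, fun r ⟨⟨hr, h2, _⟩, hw, hd, hp⟩ => ?_⟩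
  · obtain ⟨hd, hp⟩ := hsol f hf ef
    have hw : S.weylCurvature cov (c f) = S.omForm := by
      -- The normalisation gives `homot` (δr) = r, so the fixed point equation collapses to `homot`
      -- (Ω - ω) = 0, which is the hypothesis δ^*(Ω - ω) = 0 of the Bianchi argument.
      refine weylCurvature_eq_omForm hcov hf.1 hf.2 (deltaStar2_eq_zero_of_homot ?_)
      have e : c f = S.homot (S.weylCurvature cov (c f) - S.omForm + delta1 (c f)) := by
        conv_lhs => rw [ef]
      rw [homot_add, homot_delta1 hf.1.2 (deltaStar_eq_zero_of_deltaInv hd) hp] at e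
      exact right_eq_add.mp e
    exact ⟨isAbelian_of_weylCurvature hcov hf.1 hf.2 hw, hw, hd, hp⟩
  · have e : (fun p => r p.1 p.2 : M × Fin (2 * m + 1) → Wick m) = f := by
      refine unique_fixedPoint hΦ ⟨hr, h2⟩ hf (funext fun p => ?_) ef
      change r p.1 p.2 = S.homot (S.weylCurvature cov r - S.omForm + delta1 r) p.1 p.2
      rw [hw, sub_self, zero_add, homot_delta1 hr.2 (deltaStar_eq_zero_of_deltaInv hd) hp]
    rw [← e]

end

end ContactMetricStructure

/-! ### Elements without dependence on `y` -/

theorem Wick.IsScalar.cf_eq_zero {c : Wick m} (hc : IsScalar c) (k) {d : Fin (2 * m + 1) →₀ ℕ}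
    (hd : d ≠ 0) : cf k d c = 0 := by
  obtain ⟨i, hi⟩ := Finsupp.ne_iff.mp hd
  rw [Finsupp.zero_apply] at hi
  have h := congrArg (cf k (d - Finsupp.single i 1)) (hc i)
  rw [cf_dy, sub_add_single hi] at h
  exact (mul_eq_zero.mp (h.trans (by simp))).resolve_right (Nat.cast_add_one_ne_zero _)

theorem isScalar_of_cf {c : Wick m} (h : ∀ k d, d ≠ 0 → cf k d c = 0) : IsScalar c := fun i =>
  ext_cf fun k d => by
    rw [cf_dy, h k _ (fun e => by simpa using DFunLike.congr_fun e i), zero_mul]; simp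

theorem cf_zero_linSubst (L : Model m →L[ℝ] Model m) (k) (w : Wick m) :
    cf k 0 (linSubst L w) = cf k 0 w := by
  rw [cf_linSubst, Finset.sum_eq_single 0]
  · simp
  · intro e he h0
    exact absurd ((Finsupp.degree_eq_zero_iff e).mp (mem_multiIdx.mp he)) h0
  · exact fun h => absurd (mem_multiIdx.mpr rfl) h

theorem linSubst_of_isScalar (L : Model m →L[ℝ] Model m) {c : Wick m} (hc : IsScalar c) :
    linSubst L c = c := ext_cf fun k d => by
  by_cases hd : d = 0
  · subst hd; exact cf_zero_linSubst L k c
  · rw [(hc.linSubst L).cf_eq_zero k hd, hc.cf_eq_zero k hd]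

theorem cf_isScalar_mul {c : Wick m} (hc : IsScalar c) (k d) (w : Wick m) :
    cf k d (c * w) = ∑ p ∈ Finset.HasAntidiagonal.antidiagonal k, cf p.1 0 c * cf p.2 d w := by
  rw [cf_mul]
  refine Finset.sum_congr rfl fun p _ => ?_
  rw [Finset.sum_eq_single (0, d)]
  · intro q hq h0
    rw [hc.cf_eq_zero _ (fun h => h0 ?_), zero_mul]
    have := Finset.HasAntidiagonal.mem_antidiagonal.mp hq
    rw [h, zero_add] at this
    exact Prod.ext h this
  · exact fun h => absurd (by simp) h

theorem yScale_isScalar_mul (f) {c : Wick m} (hc : IsScalar c) (w : Wick m) :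
    yScale f (c * w) = c * yScale f w := ext_cf fun k d => by
  rw [cf_yScale, cf_isScalar_mul hc, cf_isScalar_mul hc, Finset.mul_sum]
  exact Finset.sum_congr rfl fun p _ => by rw [cf_yScale]; ring

theorem cf_embed (a : FormalFun M) (x : M) (k d) :
    cf k d (embed (m := m) a x) = if d = 0 then PowerSeries.coeff k a x else 0 := by
  unfold embed cf
  rw [PowerSeries.coeff_mk, MvPowerSeries.coeff_C]

theorem isScalar_embed (a : FormalFun M) (x : M) : IsScalar (embed (m := m) a x) :=
  isScalar_of_cf fun k d hd => by rw [cf_embed, if_neg hd]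

theorem isScalar_map_C (c : PowerSeries ℂ) :
    IsScalar (PowerSeries.map MvPowerSeries.C c : Wick m) :=
  isScalar_of_cf fun k d hd => by
    unfold cf
    rw [PowerSeries.coeff_map, MvPowerSeries.coeff_C, if_neg hd]

theorem coeff_proj (a : WSec m M) (k) (x : M) : PowerSeries.coeff k (proj a) x = cf k 0 (a x) := by
  unfold proj
  rw [PowerSeries.coeff_mk]
  rfl

theorem formal_ext {a b : FormalFun M} (h : ∀ k x, PowerSeries.coeff k a x = PowerSeries.coeff k b x) :
    a = b := PowerSeries.ext fun k => funext (h k)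

theorem proj_embed (a : FormalFun M) : proj (embed (m := m) a) = a := formal_ext fun k x => by
  rw [coeff_proj, cf_embed, if_pos rfl]

theorem embed_add (a b : FormalFun M) : embed (m := m) (a + b) = embed a + embed b := by
  funext x
  exact ext_cf fun k d => by
    rw [Pi.add_apply, cf_add, cf_embed, cf_embed, cf_embed]
    split_ifs <;> simp

theorem proj_add (a b : WSec m M) : proj (a + b) = proj a + proj b := formal_ext fun k x => by
  rw [map_add, Pi.add_apply, coeff_proj, coeff_proj, coeff_proj]
  exact cf_add _ _ _ _

theorem proj_scaleSec (c : PowerSeries ℂ) (a : WSec m M) :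
    proj (scaleSec c a) = scaleFormal c (proj a) := formal_ext fun k x => by
  unfold scaleSec scaleFormal
  rw [coeff_proj, cf_isScalar_mul (isScalar_map_C c), PowerSeries.coeff_mul, Finset.sum_apply]
  refine Finset.sum_congr rfl fun p _ => ?_
  rw [PowerSeries.coeff_map, Pi.mul_apply, coeff_proj]
  unfold cf
  rw [PowerSeries.coeff_map, MvPowerSeries.coeff_C, if_pos rfl]
  rfl

theorem embed_scaleFormal (c : PowerSeries ℂ) (a : FormalFun M) :
    embed (m := m) (scaleFormal c a) = scaleSec c (embed a) := by
  conv_lhs => rw [← proj_embed (m := m) a, ← proj_scaleSec]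
  funext x
  refine ext_cf fun k d => ?_
  rw [ContactMetricStructure.embed_proj]
  split_ifs with h
  · rw [h]
  · exact (((isScalar_map_C c).mul (isScalar_embed a x)).cf_eq_zero k h).symm

theorem smoothFormal_add {a b : FormalFun M} (ha : a ∈ smoothFormal m M) (hb : b ∈ smoothFormal m M) :
    a + b ∈ smoothFormal m M := fun k => (SmoothFun m M).add_mem (ha k) (hb k)

theorem smoothFormal_scale (c : PowerSeries ℂ) {a : FormalFun M} (ha : a ∈ smoothFormal m M) :
    scaleFormal c a ∈ smoothFormal m M := fun k => by
  unfold scaleFormal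
  rw [PowerSeries.coeff_mul]
  exact (SmoothFun m M).sum_mem fun p _ => (SmoothFun m M).mul_mem
    (by rw [PowerSeries.coeff_map]; exact (SmoothFun m M).algebraMap_mem _) (ha p.2)

theorem proj_mem {a : WSec m M} (h : ∀ z, SmAt z a) : proj a ∈ smoothFormal m M := fun k x =>
  SmC.congr (h x k 0) (Filter.Eventually.of_forall fun p => by
    rw [coeff_proj]; exact (cf_zero_linSubst _ _ _).symm)

namespace ContactMetricStructure

variable {S : ContactMetricStructure m M} {cov : AffineConnection m M} [T2Space M]

theorem embed_mem {a : FormalFun M} (ha : a ∈ smoothFormal m M) : embed a ∈ S.transSec :=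
  mem_transSec_of_chart (F := fun _ p => embed a p)
    (fun x₀ p _ => linSubst_of_isScalar _ (isScalar_embed a p))
    (fun x k d => by
      simp only [cf_embed]
      split_ifs
      · exact (ha k).contMDiffAt
      · exact smC_const _ _)
    fun x => dXi_of_isScalar (isScalar_embed a x)

theorem iξ_mem {b : WForm1 m M} (hb : b ∈ S.transForm1) : S.iξ b ∈ S.transSec :=
  mem_transSec_of_chart (F := fun x₀ p => ∑ k, const (S.xiL x₀ k p : ℂ) * inChart1 x₀ b p k)
    (fun x₀ p hp => inChart_iξ hp b)
    (fun x => SmW.sum fun k _ => (SmC.const (smR_xiL (mem_source x) k).ofReal).mul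
      (smW_inChart1 hb (mem_source x) k))
    fun x => by
      rw [dXi_sum]
      refine Finset.sum_eq_zero fun k _ => ?_
      rw [dXi_mul, dXi_of_isScalar (isScalar_const _), dXi_inChart1 hb (mem_source x), zero_mul,
        mul_zero, add_zero]

theorem proj_iξ_proj1 (b : WForm1 m M) : proj (S.iξ (S.proj1 b)) = proj (S.iξ b) := by
  have : S.iξ (S.proj1 b) = embed (proj (S.iξ b)) := funext fun x => by
    unfold iξ proj1
    simp only [← mul_assoc, ← const_mul, ← Finset.sum_mul, ← const_sum, sum_ξComp_lamComp]
    rw [const_one, one_mul]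
    rfl
  rw [this, proj_embed]

theorem circ_mem {a b : WSec m M} (ha : a ∈ S.transSec) (hb : b ∈ S.transSec) :
    S.circ a b ∈ S.transSec :=
  mem_transSec_of_chart (F := fun x₀ p => Wick.circ (S.hL x₀ p) (inChart x₀ a p) (inChart x₀ b p))
    (fun x₀ p hp => inChart_circ hp a b)
    (fun x => SmW.circ (fun i j => smC_hL (mem_source x) i j) (smW_inChart ha (mem_source x))
      (smW_inChart hb (mem_source x)))
    fun x => by
      rw [dXi_circ, dXi_inChart ha (mem_source x), dXi_inChart hb (mem_source x), circ_zero_left,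
        circ_zero_right, add_zero]

theorem inChart_scaleSec (c : PowerSeries ℂ) (a : WSec m M) (x₀ p : M) :
    inChart x₀ (scaleSec c a) p = PowerSeries.map MvPowerSeries.C c * inChart x₀ a p :=
  (linSubst_mul _ _ _).trans (congrArg (· * _) (linSubst_of_isScalar _ (isScalar_map_C c)))

theorem scaleSec_mem (c : PowerSeries ℂ) {a : WSec m M} (ha : a ∈ S.transSec) :
    scaleSec c a ∈ S.transSec :=
  mem_transSec_of_chart (F := fun x₀ p => PowerSeries.map MvPowerSeries.C c * inChart x₀ a p)
    (fun x₀ p _ => inChart_scaleSec c a x₀ p)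
    (fun x => (smW_of_forall_eq _).mul (smW_inChart ha (mem_source x)))
    fun x => by
      rw [dXi_mul, dXi_of_isScalar (isScalar_map_C c), dXi_inChart ha (mem_source x), zero_mul,
        mul_zero, add_zero]

theorem delta_mem {a : WSec m M} (ha : a ∈ S.transSec) : delta a ∈ S.transForm1 :=
  mem_transForm1_of_chart (F := fun x₀ j p => dy j (inChart x₀ a p))
    (fun x₀ p _ j => inChart_delta x₀ a p j) (fun x j => (smW_inChart ha (mem_source x)).dy j)
    fun x j => by rw [dXi_dy, dXi_inChart ha (mem_source x), dy_zero]

theorem deltaInv_add (a b : WForm1 m M) : S.deltaInv (a + b) = S.deltaInv a + S.deltaInv b := by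
  funext x
  simp only [deltaInv, deltaStar, Pi.add_apply, mul_add, Finset.sum_add_distrib, yScale_add]

theorem vanishAtZero_deltaInv (b : WForm1 m M) (x : M) : VanishAtZero (S.deltaInv b x) := fun k => by
  unfold deltaInv
  rw [cf_yScale]; simp

/-! ### The quantum lift -/

variable (hcov : IsContactMetricConnection S cov) {r : WForm1 m M} (hab : S.IsAbelian cov r)

theorem fedosov_add_delta (a : WSec m M) :
    S.fedosov cov r a + delta a = dNabla cov a + S.adForm r a := by
  unfold fedosov
  abel

include hcov hab

theorem fedosov_add {a b : WSec m M} (ha : a ∈ S.transSec) (hb : b ∈ S.transSec) :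
    S.fedosov cov r (a + b) = S.fedosov cov r a + S.fedosov cov r b := by
  unfold fedosov
  rw [dNabla_add (mem_transSec_iff.mp ha).1 (mem_transSec_iff.mp hb).1]
  funext x i
  simp only [Pi.add_apply, Pi.sub_apply, delta, adForm, ad_eq_br, dy_add, br_add_right]
  ring

theorem fedosov_scaleSec (c : PowerSeries ℂ) {a : WSec m M} (ha : a ∈ S.transSec) (x i) :
    S.fedosov cov r (scaleSec c a) x i = PowerSeries.map MvPowerSeries.C c * S.fedosov cov r a x i := by
  have hc := isScalar_map_C (m := m) c
  have e : dNabla cov (scaleSec c a) x i = PowerSeries.map MvPowerSeries.C c * dNabla cov a x i := by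
    rw [dNabla_apply, dNabla_apply]
    exact (covAt_congr _ _ (Filter.Eventually.of_forall fun p => inChart_scaleSec c a x p)).trans
      (covAt_fixed_mul _ _ hc ((mem_transSec_iff.mp ha).1 x))
  simp only [fedosov, Pi.add_apply, Pi.sub_apply, e, delta, adForm, ad_eq_br, scaleSec, dy_mul, hc _,
    br_mul_right _ hc]
  ring

/-- D is a derivation of ∘: d_∇ is one since h is parallel, and on transverse elements the rest of D
is an inner derivation. -/
theorem fedosov_circ {a b : WSec m M} (ha : a ∈ S.transSec) (hb : b ∈ S.transSec) (x i) :
    S.fedosov cov r (S.circ a b) x i = Wick.circ (S.hL x x) (S.fedosov cov r a x i) (b x)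
      + Wick.circ (S.hL x x) (a x) (S.fedosov cov r b x i) := by
  have hx := mem_source (m := m) x
  have h := fun {c : WSec m M} (hc : c ∈ S.transSec) =>
    (inChart1_self x (S.fedosov cov r c) i).symm.trans (inChart1_fedosov hcov hab.1 hc hx i)
  have h2 := DL_circ (γ := fun j p => inChart1 x (r + S.solder) p j) hcov hx (smW_inChart ha hx)
    (smW_inChart hb hx) i
  rw [h ha, h hb, h (circ_mem ha hb)]
  rw [inChart_self, inChart_self] at h2
  refine Eq.trans ?_ h2
  refine congrArg₂ (· + ·) (covAt_congr _ _ ?_) (congrArg _ (inChart_circ hx a b))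
  filter_upwards [source_mem_nhds hx] with p hp using inChart_circ hp a b

/-- The operator D + δ = d_∇ + (i/ν)[r, ·] preserves the filtration since r ∈ F², and δ^{-1} raises
it by one, so the equation is a contraction. -/
theorem existsUnique_isLift {a : WSec m M} (ha : a ∈ S.transSec) : ∃! b, S.IsLift cov r a b := by
  set Φ : WSec m M → WSec m M := fun b => a + S.deltaInv (S.fedosov cov r b + delta b) with hΦd
  have hΦ : ∀ f g : WSec m M, ∀ n, f ∈ S.transSec → g ∈ S.transSec →
      (∀ x, InFiltration n (f x - g x)) → ∀ x, InFiltration (n + 1) (Φ f x - Φ g x) := by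
    intro f g n hf hg h x
    have e : Φ f x - Φ g x = S.deltaInv (dNabla cov (f - g) + S.adForm r (f - g)) x := by
      have e1 : S.fedosov cov r f + delta f =
          (S.fedosov cov r g + delta g) + (dNabla cov (f - g) + S.adForm r (f - g)) := by
        rw [fedosov_add_delta, fedosov_add_delta,
          dNabla_sub (mem_transSec_iff.mp hf).1 (mem_transSec_iff.mp hg).1]
        funext x i
        simp only [Pi.add_apply, Pi.sub_apply, adForm, ad_eq_br, br_sub_right]
        ring
      simp only [hΦd, Pi.add_apply]
      rw [e1, deltaInv_add, Pi.add_apply]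
      ring
    rw [e]
    exact inFiltration_deltaInv fun i => (inFiltration_dNabla h x i).add
      (inFiltration_ad (hab.2.1 x i) (h x) (by omega))
  obtain ⟨b, hb, e⟩ := exists_fixedPoint (P := fun f => f ∈ S.transSec) hΦ
    (fun f hf => transSec_add ha (deltaInv_mem (transForm1_add (fedosov_mem hcov hab.1 hf)
      (delta_mem hf)))) (fun f h => mem_transSec_of_approx h) ha
  exact ⟨b, ⟨hb, e⟩, fun b' h' => unique_fixedPoint (P := fun f => f ∈ S.transSec) hΦ h'.1 hb h'.2 e⟩

theorem isLift_quantumLift {a : FormalFun M} (ha : a ∈ smoothFormal m M) :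
    S.IsLift cov r (embed a) (S.quantumLift cov r a) := by
  have h := (existsUnique_isLift hcov hab (embed_mem ha)).exists
  unfold quantumLift
  rw [dif_pos h]
  exact h.choose_spec

theorem quantumLift_mem {a : FormalFun M} (ha : a ∈ smoothFormal m M) :
    S.quantumLift cov r a ∈ S.transSec := (isLift_quantumLift hcov hab ha).1

theorem eq_quantumLift {a : FormalFun M} (ha : a ∈ smoothFormal m M) {b : WSec m M}
    (h : S.IsLift cov r (embed a) b) : b = S.quantumLift cov r a :=
  (existsUnique_isLift hcov hab (embed_mem ha)).unique h (isLift_quantumLift hcov hab ha)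

/-- The image of δ^{-1} vanishes at y = 0. -/
theorem proj_quantumLift {a : FormalFun M} (ha : a ∈ smoothFormal m M) :
    proj (S.quantumLift cov r a) = a := by
  rw [(isLift_quantumLift hcov hab ha).2, proj_add, proj_embed, add_eq_left]
  exact formal_ext fun k x => by rw [coeff_proj, vanishAtZero_deltaInv]; simp

theorem quantumLift_add {a b : FormalFun M} (ha : a ∈ smoothFormal m M) (hb : b ∈ smoothFormal m M) :
    S.quantumLift cov r (a + b) = S.quantumLift cov r a + S.quantumLift cov r b := by
  have h := isLift_quantumLift hcov hab ha
  have h' := isLift_quantumLift hcov hab hb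
  refine (eq_quantumLift hcov hab (smoothFormal_add ha hb) ⟨transSec_add h.1 h'.1, ?_⟩).symm
  have e : delta (S.quantumLift cov r a + S.quantumLift cov r b) =
      delta (S.quantumLift cov r a) + delta (S.quantumLift cov r b) := by
    funext x i
    exact dy_add _ _ _
  conv_lhs => rw [h.2, h'.2]
  rw [fedosov_add hcov hab h.1 h'.1, e, embed_add, add_add_add_comm (S.fedosov cov r _),
    deltaInv_add (_ + _), add_add_add_comm]

theorem quantumLift_scale (c : PowerSeries ℂ) {a : FormalFun M} (ha : a ∈ smoothFormal m M) :
    S.quantumLift cov r (scaleFormal c a) = scaleSec c (S.quantumLift cov r a) := by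
  have h := isLift_quantumLift hcov hab ha
  have hc := isScalar_map_C (m := m) c
  refine (eq_quantumLift hcov hab (smoothFormal_scale c ha) ⟨scaleSec_mem c h.1, ?_⟩).symm
  conv_lhs => rw [h.2]
  rw [embed_scaleFormal]
  funext x
  have e : ∀ i, delta (scaleSec c (S.quantumLift cov r a)) x i =
      PowerSeries.map MvPowerSeries.C c * delta (S.quantumLift cov r a) x i := fun i => by
    change dy i (_ * _) = _
    rw [dy_mul, hc, zero_mul, zero_add]
    rfl
  change _ * (_ + yScale _ (∑ j, _)) = _ * _ + yScale _ (∑ j, _)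
  rw [mul_add, ← yScale_isScalar_mul _ hc, Finset.mul_sum]
  refine congrArg (_ + ·) (congrArg _ (Finset.sum_congr rfl fun j _ => ?_))
  rw [Pi.add_apply, Pi.add_apply, Pi.add_apply, Pi.add_apply, fedosov_scaleSec hcov hab c h.1, e]
  ring

theorem Delta_eq (a : FormalFun M) :
    S.Delta cov r a = proj (S.iξ (S.fedosov cov r (S.quantumLift cov r a))) := proj_iξ_proj1 _

/-- For Da = 0 the lift equation with Πa as input reads a = Πa + δ^{-1}δa, which holds for every
transverse section; uniqueness of the lift does the rest. -/
theorem quantumLift_proj {a : WSec m M} (ha : a ∈ S.flatSec cov r) :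
    proj a ∈ smoothFormal m M ∧ a = S.quantumLift cov r (proj a) := by
  have hs := proj_mem (mem_transSec_iff.mp ha.1).1
  refine ⟨hs, eq_quantumLift hcov hab hs ⟨ha.1, funext fun x => ext_cf fun k d => ?_⟩⟩
  rw [ha.2, zero_add, Pi.add_apply, cf_add, embed_proj, deltaInv_delta (ha.1.2 x)]
  split_ifs with h
  · rw [h, add_zero]
  · rw [zero_add]

/-- Let e = DQa. The lift equation gives δ^{-1} e = 0, the condition Δa = 0 gives Π e = 0, and D² =
0 gives De = 0. The fibrewise Poincaré lemma then pushes e into every F^n. Only D² = 0 is used, not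
Ω = ω. -/
theorem quantumLift_mem_flatSec {a : FormalFun M} (ha : a ∈ kerOp m (S.Delta cov r)) :
    S.quantumLift cov r a ∈ S.flatSec cov r := by
  have hb := isLift_quantumLift hcov hab ha.1
  have hp := proj_quantumLift hcov hab ha.1
  set b := S.quantumLift cov r a with hbd
  set e := S.fedosov cov r b with hed
  have he : e ∈ S.transForm1 := fedosov_mem hcov hab.1 hb.1
  -- Subtract b = Πb + δ^{-1}δb from the lift equation b = a + δ^{-1}(e + δb), using Πb = a.
  have hs : S.deltaInv e = 0 := funext fun x => ext_cf fun k d => by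
    have h := congrArg (cf k d) (congrFun hb.2 x)
    rw [deltaInv_add, Pi.add_apply, Pi.add_apply, cf_add, cf_add, deltaInv_delta (hb.1.2 x), ← hp,
      embed_proj] at h
    refine Eq.trans ?_ (by simp : (0 : ℂ) = _)
    split_ifs at h with hd
    · rw [hd] at h ⊢; linear_combination -h
    · linear_combination -h
  have hv : ∀ x, VanishAtZero (S.iξ e x) := fun x k => by
    have h := ha.2
    rw [Delta_eq hcov hab] at h
    rw [← coeff_proj, h]
    simp
  have h1 := hab.2.2 b hb.1
  have key : ∀ n x i, InFiltration n (e x i) := by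
    intro n
    induction n with
    | zero => exact fun x i => inFiltration_zero_left _
    | succ n ih =>
      intro x
      refine inFiltration_of_closed1 (fun i => (transAt_iff _).mp (he.2 x i))
        (deltaStar_eq_zero_of_deltaInv hs x) (hv x) fun i j => ?_
      have h2 := congrFun (congrFun (congrFun h1 x) i) j
      -- De = 0 solved for δe; the right side preserves the filtration.
      have e2 : dy i (e x j) - dy j (e x i) = dNabla1 cov e x i j + S.adForm1 r e x i j := by
        simp only [fedosov1, Pi.add_apply, Pi.sub_apply, Pi.zero_apply, delta1] at h2
        linear_combination -h2
      rw [e2]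
      exact (inFiltration_dNabla1 ih x i j).add
        ((inFiltration_ad (hab.2.1 x i) (ih x j) (by omega)).sub
          (inFiltration_ad (hab.2.1 x j) (ih x i) (by omega)))
  refine ⟨hb.1, ?_⟩
  funext x i
  exact eq_zero_of_inFiltration fun n => key n x i

theorem proj_mem_kerOp {a : WSec m M} (ha : a ∈ S.flatSec cov r) :
    proj a ∈ kerOp m (S.Delta cov r) := by
  obtain ⟨hs, e⟩ := quantumLift_proj hcov hab ha
  refine ⟨hs, ?_⟩
  rw [Delta_eq hcov hab, ← e, ha.2]
  exact formal_ext fun k x => by rw [coeff_proj]; simp [iξ]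

theorem bijOn_quantumLift :
    Set.BijOn (S.quantumLift cov r) (kerOp m (S.Delta cov r)) (S.flatSec cov r) :=
  ⟨fun _ ha => quantumLift_mem_flatSec hcov hab ha,
    fun a ha b hb e => by
      rw [← proj_quantumLift hcov hab ha.1, e, proj_quantumLift hcov hab hb.1],
    fun a ha => ⟨proj a, proj_mem_kerOp hcov hab ha, (quantumLift_proj hcov hab ha).2.symm⟩⟩

theorem circ_mem_flatSec {a b : WSec m M} (ha : a ∈ S.flatSec cov r) (hb : b ∈ S.flatSec cov r) :
    S.circ a b ∈ S.flatSec cov r := by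
  refine ⟨circ_mem ha.1 hb.1, ?_⟩
  funext x i
  rw [fedosov_circ hcov hab ha.1 hb.1, ha.2, hb.2]
  exact (congrArg₂ (· + ·) (circ_zero_left _ _) (circ_zero_right _ _)).trans (add_zero _)

/-- The product of the two lifts is again flat, and a flat section is the lift of its projection. -/
theorem quantumLift_star {a b : FormalFun M} (ha : a ∈ kerOp m (S.Delta cov r))
    (hb : b ∈ kerOp m (S.Delta cov r)) : S.quantumLift cov r (S.star cov r a b) =
      S.circ (S.quantumLift cov r a) (S.quantumLift cov r b) :=
  (quantumLift_proj hcov hab (circ_mem_flatSec hcov hab (quantumLift_mem_flatSec hcov hab ha)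
    (quantumLift_mem_flatSec hcov hab hb))).2.symm

theorem star_mem_kerOp {a b : FormalFun M} (ha : a ∈ kerOp m (S.Delta cov r))
    (hb : b ∈ kerOp m (S.Delta cov r)) : S.star cov r a b ∈ kerOp m (S.Delta cov r) :=
  proj_mem_kerOp hcov hab (circ_mem_flatSec hcov hab (quantumLift_mem_flatSec hcov hab ha)
    (quantumLift_mem_flatSec hcov hab hb))

theorem one_mem_flatSec : (fun _ => 1 : WSec m M) ∈ S.flatSec cov r := by
  have h : (fun _ => 1 : WSec m M) = embed 1 := funext fun x => ext_cf fun k d => by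
    rw [cf_embed, ← const_one, cf_const, PowerSeries.coeff_one]
    split_ifs <;> simp_all
  have h1 : (1 : FormalFun M) ∈ smoothFormal m M := fun k => by
    rw [PowerSeries.coeff_one]
    split_ifs
    · exact contMDiff_const
    · exact contMDiff_const
  have hm : (fun _ => 1 : WSec m M) ∈ S.transSec := h ▸ embed_mem h1
  refine ⟨hm, ?_⟩
  funext x i
  have e : dNabla cov (fun _ => 1 : WSec m M) x i = 0 := by
    rw [dNabla_apply]
    refine (covAt_congr _ _ (G := fun _ => const 1) (Filter.Eventually.of_forall fun p =>
      (linSubst_of_isScalar _ isScalar_one).trans const_one.symm)).trans ((covAt_const _ _ _).trans ?_)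
    rw [dC_const, const_zero]
  simp only [fedosov, Pi.add_apply, Pi.sub_apply, e, delta, adForm, ad_eq_br,
    br_scalar_right _ isScalar_one, isScalar_one _, Pi.zero_apply]
  simp

theorem quantumLift_one : (1 : FormalFun M) ∈ kerOp m (S.Delta cov r) ∧
    S.quantumLift cov r 1 = fun _ => 1 := by
  have h1 := one_mem_flatSec hcov hab
  have e : proj (fun _ => 1 : WSec m M) = 1 := formal_ext fun k x => by
    rw [coeff_proj, ← const_one, cf_const, PowerSeries.coeff_one]
    split_ifs <;> simp_all
  have h2 := proj_mem_kerOp hcov hab h1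
  have h3 := (quantumLift_proj hcov hab h1).2
  rw [e] at h2 h3
  exact ⟨h2, h3.symm⟩

theorem star_one {a : FormalFun M} (ha : a ∈ smoothFormal m M) :
    S.star cov r 1 a = a ∧ S.star cov r a 1 = a := by
  unfold star circ
  rw [(quantumLift_one hcov hab).2]
  simp only [circ_one_left, circ_one_right]
  exact ⟨proj_quantumLift hcov hab ha, proj_quantumLift hcov hab ha⟩

theorem star_assoc {a b c : FormalFun M} (ha : a ∈ kerOp m (S.Delta cov r))
    (hb : b ∈ kerOp m (S.Delta cov r)) (hc : c ∈ kerOp m (S.Delta cov r)) :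
    S.star cov r (S.star cov r a b) c = S.star cov r a (S.star cov r b c) := by
  rw [star, quantumLift_star hcov hab ha hb, star, quantumLift_star hcov hab hb hc]
  refine congrArg proj (funext fun x => ?_)
  exact circ_assoc _ _ _ _

end ContactMetricStructure

/-! ### Differential operators with values in sections -/

/-- Modulo `F^n`, the operator `Φ` is a differential operator of order less than `N`. -/
def OrdMod (n : ℕ) : ℕ → (SmoothFun m M → WSec m M) → Prop
  | 0, Φ => ∀ g x, InFiltration n (Φ g x)
  | N + 1, Φ => ∀ f, OrdMod n N fun g x => Φ (f * g) x - const ((f : M → ℂ) x) * Φ g x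

section OrdMod

variable {n n' N : ℕ} {Φ : SmoothFun m M → WSec m M}

/-- Fibrewise operations commute with multiplication by functions, so they leave the order unchanged
and affect only the filtration degree. -/
theorem OrdMod.map (T : M → Wick m → Wick m) (hs : ∀ x w w', T x (w - w') = T x w - T x w')
    (hm : ∀ x z w, T x (const z * w) = const z * T x w)
    (hF : ∀ x w, InFiltration n w → InFiltration n' (T x w)) (h : OrdMod n N Φ) :
    OrdMod n' N fun g x => T x (Φ g x) := by
  induction N generalizing Φ with
  | zero => exact fun g x => hF x _ (h g x)
  | succ N ih =>
    intro f
    have := ih (h f)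
    simp only [hs, hm] at this
    exact this

theorem OrdMod.sum {ι : Type*} {s : Finset ι} {Φ : ι → SmoothFun m M → WSec m M}
    (h : ∀ i ∈ s, OrdMod n N (Φ i)) : OrdMod n N fun g x => ∑ i ∈ s, Φ i g x := by
  induction N generalizing Φ with
  | zero => exact fun g x => InFiltration.sum fun i hi => h i hi g x
  | succ N ih =>
    intro f
    have := ih fun i hi => h i hi f
    simp only [Finset.sum_sub_distrib, ← Finset.mul_sum] at this
    exact this

theorem OrdMod.add {Ψ : SmoothFun m M → WSec m M} (h : OrdMod n N Φ) (h' : OrdMod n N Ψ) :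
    OrdMod n N fun g x => Φ g x + Ψ g x := by
  have := OrdMod.sum (s := Finset.univ) (Φ := fun b : Bool => if b then Φ else Ψ)
    (N := N) (n := n) (fun b _ => by cases b <;> simpa)
  simpa using this

theorem OrdMod.succ (h : OrdMod n N Φ) : OrdMod n (N + 1) Φ := by
  induction N generalizing Φ with
  | zero => exact fun f g x => (h _ x).sub ((h g x).const_mul _)
  | succ N ih => exact fun f => ih (h f)

theorem smC_coe (f : SmoothFun m M) (z : M) : SmC (m := m) z (f : M → ℂ) :=
  (show ContMDiff 𝓘(ℝ, Model m) 𝓘(ℝ, ℂ) ∞ (f : M → ℂ) from f.2).contMDiffAt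

theorem inChart_sub_mul (x₀ : M) (a b : WSec m M) (f : M → ℂ) (p : M) :
    inChart x₀ (fun x => a x - const (f x) * b x) p =
      inChart x₀ a p - const (f p) * inChart x₀ b p := by
  unfold inChart
  rw [linSubst_sub, linSubst_mul, linSubst_const]

theorem SmAt.sub_mul {z : M} {a b : WSec m M} (ha : SmAt z a) (hb : SmAt z b) (f : SmoothFun m M) :
    SmAt z fun x => a x - const ((f : M → ℂ) x) * b x :=
  SmW.congr (SmW.sub ha ((smC_coe f z).const.mul hb))
    (Filter.Eventually.of_forall fun p => inChart_sub_mul z a b f p)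

theorem dNabla_sub_mul {cov : AffineConnection m M} {a b : WSec m M} (ha : ∀ z, SmAt z a)
    (hb : ∀ z, SmAt z b) (f : SmoothFun m M) (x i) :
    dNabla cov (fun x => a x - const ((f : M → ℂ) x) * b x) x i =
      dNabla cov a x i - const ((f : M → ℂ) x) * dNabla cov b x i
        - const (dC (f : M → ℂ) x (frame x i)) * b x := by
  rw [dNabla_apply, dNabla_apply, dNabla_apply, nab, nab, nab]
  refine (covAt_congr _ _ (Filter.Eventually.of_forall fun p => inChart_sub_mul x a b f p)).trans ?_
  refine (covAt_sub _ _ (ha x) ((smC_coe f x).const.mul (hb x))).trans ?_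
  refine (congrArg (_ - ·) (covAt_const_mul _ _ (smC_coe f x) (hb x))).trans ?_
  rw [inChart_self, coordField_self]
  ring

/-- The commutator of ∇_i with multiplication by f is multiplication by ∂_i f, so a covariant
derivative raises the order by one. -/
theorem OrdMod.dNabla (cov : AffineConnection m M) (i : Fin (2 * m + 1)) (hs : ∀ g z, SmAt z (Φ g))
    (h : OrdMod n N Φ) : OrdMod n (N + 1) fun g x => dNabla cov (Φ g) x i := by
  induction N generalizing Φ with
  | zero => exact OrdMod.succ (N := 0) fun g x => inFiltration_dNabla (h g) x i
  | succ N ih =>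
    intro f
    have h1 := ih (fun g z => (hs (f * g) z).sub_mul (hs g z) f) (h f)
    have h2 := OrdMod.map (n' := n) (fun x w => const (dC (f : M → ℂ) x (frame x i)) * w)
      (fun x w w' => mul_sub _ _ _) (fun x z w => by ring) (fun x w hw => hw.const_mul _) h
    refine cast (congrArg (OrdMod n (N + 1)) ?_) (h1.add h2)
    funext g x
    rw [dNabla_sub_mul (hs (f * g)) (hs g) f]
    ring

/-- A coefficient of degree below n is not affected by F^n, so the vanishing of iterated commutators
modulo F^n becomes exact. Order less than N + 1 in `OrdMod` is order at most N in `IsDiffOp`. -/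
theorem OrdMod.isDiffOp {k} {d : Fin (2 * m + 1) →₀ ℕ} (hd : 2 * k + d.degree < n)
    {L : SmoothFun m M →ₗ[ℂ] SmoothFun m M} (hL : ∀ f x, (L f : M → ℂ) x = cf k d (Φ f x))
    (h : OrdMod n (N + 1) Φ) : IsDiffOp N L := by
  have key : ∀ (Φ : SmoothFun m M → WSec m M) (L : SmoothFun m M →ₗ[ℂ] SmoothFun m M),
      (∀ f x, (L f : M → ℂ) x = cf k d (Φ f x)) → ∀ f g x,
      ((L ∘ₗ LinearMap.mulLeft ℂ f - LinearMap.mulLeft ℂ f ∘ₗ L) g : M → ℂ) x =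
      cf k d (Φ (f * g) x - const ((f : M → ℂ) x) * Φ g x) := fun Φ L hL f g x => by
    rw [cf_sub, cf_const_mul, ← hL, ← hL]
    rfl
  induction N generalizing Φ L with
  | zero =>
    refine fun f => LinearMap.ext fun g => Subtype.ext (funext fun x => ?_)
    rw [key Φ L hL]
    exact h f g x k d hd
  | succ N ih => exact fun f => ih (key Φ L hL f) (h f)

end OrdMod

/-! ### Formally linear operators -/

/-- Smooth functions as formal functions. -/
def formalConst (f : SmoothFun m M) : FormalFun M := PowerSeries.C (f : M → ℂ)

theorem formalConst_mem (f : SmoothFun m M) : formalConst f ∈ smoothFormal m M := fun k => by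
  unfold formalConst
  rw [PowerSeries.coeff_C]
  split_ifs
  · exact f.2
  · exact (SmoothFun m M).zero_mem

/-- `ℂ[[ν]]`-linear operators preserving smoothness. -/
structure IsFormalLinear (m : ℕ) {M : Type*} [TopologicalSpace M] [ChartedSpace (Model m) M]
    (Φ : FormalFun M → FormalFun M) : Prop where
  mem : ∀ a ∈ smoothFormal m M, Φ a ∈ smoothFormal m M
  add : ∀ a ∈ smoothFormal m M, ∀ b ∈ smoothFormal m M, Φ (a + b) = Φ a + Φ b
  scale : ∀ (c : PowerSeries ℂ), ∀ a ∈ smoothFormal m M, Φ (scaleFormal c a) = scaleFormal c (Φ a)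

namespace IsFormalLinear

variable {Φ : FormalFun M → FormalFun M} (hΦ : IsFormalLinear m Φ)
include hΦ

/-- The coefficient of `ν^k`. -/
def coeffOp (k : ℕ) : SmoothFun m M →ₗ[ℂ] SmoothFun m M where
  toFun f := ⟨PowerSeries.coeff k (Φ (formalConst f)), hΦ.mem _ (formalConst_mem f) k⟩
  map_add' f g := Subtype.ext <| by
    have h : formalConst (f + g) = formalConst f + formalConst g := map_add PowerSeries.C _ _
    change PowerSeries.coeff k (Φ (formalConst (f + g))) = _
    rw [h, hΦ.add _ (formalConst_mem f) _ (formalConst_mem g), map_add]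
    rfl
  map_smul' c f := Subtype.ext <| by
    have h : formalConst (c • f) = scaleFormal (PowerSeries.C c) (formalConst f) := by
      unfold scaleFormal formalConst
      rw [PowerSeries.map_C, ← map_mul, ← Algebra.smul_def]
      rfl
    change PowerSeries.coeff k (Φ (formalConst (c • f))) = c • PowerSeries.coeff k (Φ (formalConst f))
    rw [h, hΦ.scale _ _ (formalConst_mem f), scaleFormal, PowerSeries.map_C, PowerSeries.coeff_C_mul,
      Algebra.smul_def]

/-- Write a = a₀ + ν a' and recurse. Linearity over ν suffices, since the coefficient of ν^n
involves only n + 1 such steps; no continuity is assumed. -/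
theorem coeff_eq_sum (a : PowerSeries (SmoothFun m M)) (n : ℕ) :
    PowerSeries.coeff n (Φ (toFormal a)) = ∑ p ∈ Finset.HasAntidiagonal.antidiagonal n,
      (hΦ.coeffOp p.1 (PowerSeries.coeff p.2 a) : M → ℂ) := by
  have hm : ∀ a : PowerSeries (SmoothFun m M), toFormal a ∈ smoothFormal m M := fun a k => by
    unfold toFormal
    rw [PowerSeries.coeff_map]
    exact (PowerSeries.coeff k a).2
  have hs : ∀ a : PowerSeries (SmoothFun m M), Φ (toFormal a) = Φ (formalConst (PowerSeries.coeff 0 a))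
      + PowerSeries.X * Φ (toFormal (PowerSeries.mk fun k => PowerSeries.coeff (k + 1) a)) := by
    intro a
    have hX : ∀ b : FormalFun M, scaleFormal PowerSeries.X b = PowerSeries.X * b := fun b => by
      unfold scaleFormal; rw [PowerSeries.map_X]
    rw [← hX, ← hΦ.scale _ _ (hm _), ← hΦ.add _ (formalConst_mem _) _ (smoothFormal_scale _ (hm _)), hX]
    refine congrArg Φ (PowerSeries.ext fun k => ?_)
    unfold toFormal formalConst
    cases k with
    | zero => rw [map_add, PowerSeries.coeff_zero_X_mul, add_zero, PowerSeries.coeff_map,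
        PowerSeries.coeff_zero_C]; rfl
    | succ k => rw [map_add, PowerSeries.coeff_succ_X_mul, PowerSeries.coeff_C, if_neg k.succ_ne_zero,
        zero_add, PowerSeries.coeff_map, PowerSeries.coeff_map, PowerSeries.coeff_mk]
  induction n generalizing a with
  | zero => rw [hs, map_add, PowerSeries.coeff_zero_X_mul, add_zero]; simp [coeffOp]
  | succ n ih =>
    rw [hs, map_add, PowerSeries.coeff_succ_X_mul, ih, Finset.Nat.sum_antidiagonal_succ']
    simp only [PowerSeries.coeff_mk]
    rfl

end IsFormalLinear

/-- Reindexes the double sum that arises from expanding the product first in the left argument and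
then in the right one. -/
theorem sum_antidiagonal_assoc {E : Type*} [AddCommMonoid E] (g : ℕ → ℕ → ℕ → E) (n : ℕ) :
    ∑ p ∈ Finset.HasAntidiagonal.antidiagonal n, ∑ q ∈ Finset.HasAntidiagonal.antidiagonal p.1,
      g q.1 p.2 q.2 =
    ∑ p ∈ Finset.HasAntidiagonal.antidiagonal n, ∑ q ∈ Finset.HasAntidiagonal.antidiagonal p.2,
      g p.1 q.1 q.2 := by
  rw [Finset.sum_sigma', Finset.sum_sigma']
  refine Finset.sum_nbij' (fun s => ⟨(s.2.1, s.1.2 + s.2.2), (s.1.2, s.2.2)⟩)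
    (fun s => ⟨(s.1.1 + s.2.2, s.2.1), (s.1.1, s.2.2)⟩) ?_ ?_ ?_ ?_ ?_
  all_goals
    rintro ⟨⟨a, b⟩, ⟨c, d⟩⟩ h
    simp only [Finset.mem_sigma, Finset.HasAntidiagonal.mem_antidiagonal] at h ⊢
  · exact ⟨by omega, trivial⟩
  · exact ⟨by omega, trivial⟩
  · obtain ⟨_, rfl⟩ := h; rfl
  · obtain ⟨_, rfl⟩ := h; rfl

namespace ContactMetricStructure

variable {S : ContactMetricStructure m M} {cov : AffineConnection m M} [T2Space M]
  {r : WForm1 m M} {n : ℕ}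

theorem iξ_fedosov {a : WSec m M} {x : M} (ha : S.TransAt x (a x)) : S.iξ (S.fedosov cov r a) x =
    ∑ j, const (S.ξComp x j : ℂ) * (dNabla cov a x j + S.ad x (r x j) (a x)) := by
  have h : ∑ j, const (S.ξComp x j : ℂ) * dy j (a x) = 0 := ha
  rw [← sub_zero (∑ j, const (S.ξComp x j : ℂ) * (dNabla cov a x j + S.ad x (r x j) (a x))), ← h,
    ← Finset.sum_sub_distrib]
  refine Finset.sum_congr rfl fun j _ => ?_
  simp only [fedosov, Pi.add_apply, Pi.sub_apply, delta, adForm]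
  ring

theorem sum_ξComp_dC (f : M → ℂ) (x : M) :
    ∑ j, (S.ξComp x j : ℂ) * dC (m := m) f x (frame x j) = dC f x (S.ξ x) := by
  conv_rhs => rw [ξ_eq_sum (S := S) (mem_source x)]
  refine Eq.symm ((map_sum (dC f x) _ _).trans (Finset.sum_congr rfl fun j _ => ?_))
  rw [xiL_self, coordField_self]
  exact ((dC f x).map_smul _ _).trans (Complex.real_smul)

variable (hcov : IsContactMetricConnection S cov) (hab : S.IsAbelian cov r)
include hcov hab

/-! ### Linearity -/

theorem isFormalLinear_Delta : IsFormalLinear m (S.Delta cov r) where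
  mem a ha := by
    rw [Delta_eq hcov hab]
    exact proj_mem (mem_transSec_iff.mp (iξ_mem (fedosov_mem hcov hab.1
      (quantumLift_mem hcov hab ha)))).1
  add a ha b hb := by
    rw [Delta_eq hcov hab, Delta_eq hcov hab, Delta_eq hcov hab, quantumLift_add hcov hab ha hb,
      fedosov_add hcov hab (quantumLift_mem hcov hab ha) (quantumLift_mem hcov hab hb), ← proj_add]
    refine congrArg proj (funext fun x => ?_)
    simp only [iξ, Pi.add_apply, mul_add, Finset.sum_add_distrib]
  scale c a ha := by
    rw [Delta_eq hcov hab, Delta_eq hcov hab, quantumLift_scale hcov hab c ha, ← proj_scaleSec]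
    refine congrArg proj (funext fun x => ?_)
    simp only [iξ, fedosov_scaleSec hcov hab c (quantumLift_mem hcov hab ha), scaleSec, Finset.mul_sum]
    exact Finset.sum_congr rfl fun j _ => mul_left_comm _ _ _

theorem isFormalLinear_star_left {b : FormalFun M} (hb : b ∈ smoothFormal m M) :
    IsFormalLinear m fun a => S.star cov r a b where
  mem a ha := proj_mem (mem_transSec_iff.mp (circ_mem (quantumLift_mem hcov hab ha)
    (quantumLift_mem hcov hab hb))).1
  add a ha a' ha' := by
    rw [star, star, star, quantumLift_add hcov hab ha ha', ← proj_add]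
    exact congrArg proj (funext fun x => circ_add_left _ _ _ _)
  scale c a ha := by
    rw [star, star, quantumLift_scale hcov hab c ha, ← proj_scaleSec]
    exact congrArg proj (funext fun x => circ_mul_left _ (isScalar_map_C c) _ _)

theorem isFormalLinear_star_right {a : FormalFun M} (ha : a ∈ smoothFormal m M) :
    IsFormalLinear m fun b => S.star cov r a b where
  mem b hb := proj_mem (mem_transSec_iff.mp (circ_mem (quantumLift_mem hcov hab ha)
    (quantumLift_mem hcov hab hb))).1
  add b hb b' hb' := by
    rw [star, star, star, quantumLift_add hcov hab hb hb', ← proj_add]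
    exact congrArg proj (funext fun x => circ_add_right _ _ _ _)
  scale c b hb := by
    rw [star, star, quantumLift_scale hcov hab c hb, ← proj_scaleSec]
    exact congrArg proj (funext fun x => circ_mul_right _ (isScalar_map_C c) _ _)

/-- The coefficients of the star product. -/
def starOp (k : ℕ) : SmoothFun m M →ₗ[ℂ] SmoothFun m M →ₗ[ℂ] SmoothFun m M :=
  LinearMap.mk₂ ℂ
    (fun f g => (isFormalLinear_star_right hcov hab (formalConst_mem f)).coeffOp k g)
    (fun f f' g => ((isFormalLinear_star_left hcov hab (formalConst_mem g)).coeffOp k).map_add f f')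
    (fun c f g => ((isFormalLinear_star_left hcov hab (formalConst_mem g)).coeffOp k).map_smul c f)
    (fun f g g' => ((isFormalLinear_star_right hcov hab (formalConst_mem f)).coeffOp k).map_add g g')
    (fun c f g => ((isFormalLinear_star_right hcov hab (formalConst_mem f)).coeffOp k).map_smul c g)

/-! ### The order of the coefficients -/

theorem smAt_quantumLift (g : SmoothFun m M) (z : M) : SmAt z (S.quantumLift cov r (formalConst g)) :=
  (mem_transSec_iff.mp (quantumLift_mem hcov hab (formalConst_mem g))).1 z

theorem OrdMod_connection {N} (h : OrdMod n N fun g => S.quantumLift cov r (formalConst g)) (j) :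
    OrdMod n (N + 1) fun g x => dNabla cov (S.quantumLift cov r (formalConst g)) x j
      + S.ad x (r x j) (S.quantumLift cov r (formalConst g) x) := by
  refine OrdMod.add (h.dNabla cov j (smAt_quantumLift hcov hab)) (OrdMod.succ ?_)
  refine h.map (fun x w => S.ad x (r x j) w) (fun x w w' => ?_) (fun x z w => ?_)
    fun x w hw => inFiltration_ad (hab.2.1 x j) hw (by omega)
  · rw [ad_eq_br, ad_eq_br, ad_eq_br, br_sub_right]
  · rw [ad_eq_br, ad_eq_br, br_mul_right _ (isScalar_const z)]

/-- In the lift equation D + δ raises the order by one while δ^{-1} gains one filtration degree, so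
order and degree grow together. The starting term f is of order zero. -/
theorem OrdMod_quantumLift (n : ℕ) :
    OrdMod n n fun g => S.quantumLift cov r (formalConst g) := by
  induction n with
  | zero => exact fun g x => inFiltration_zero_left _
  | succ n ih =>
    have h1 : OrdMod (n + 1) (n + 1) fun (g : SmoothFun m M) (x : M) => embed (m := m) (formalConst g) x := by
      have h0 : OrdMod (n + 1) 1 fun (g : SmoothFun m M) (x : M) => embed (m := m) (formalConst g) x := by
        intro f g x k d _
        rw [cf_sub, cf_const_mul, cf_embed, cf_embed, formalConst, formalConst, PowerSeries.coeff_C,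
          PowerSeries.coeff_C]
        split_ifs <;> simp
      have h : ∀ N, OrdMod (n + 1) (N + 1) fun (g : SmoothFun m M) (x : M) =>
          embed (m := m) (formalConst g) x := fun N => Nat.rec h0 (fun _ h => h.succ) N
      exact h n
    have h2 : OrdMod (n + 1) (n + 1) fun (g : SmoothFun m M) (x : M) => ∑ j,
        yScale (fun l => 1 / (l : ℂ)) (S.yP x j *
          (dNabla cov (S.quantumLift cov r (formalConst g)) x j
            + S.ad x (r x j) (S.quantumLift cov r (formalConst g) x))) :=
      OrdMod.sum fun j _ => (OrdMod_connection hcov hab ih j).map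
        (fun x w => yScale (fun l => 1 / (l : ℂ)) (S.yP x j * w))
        (fun x w w' => by rw [mul_sub, yScale_sub])
        (fun x z w => by rw [mul_left_comm, yScale_const_mul])
        fun x w hw => (inFiltration_yP_mul j hw).yScale _
    refine cast (congrArg (OrdMod (n + 1) (n + 1)) ?_) (h1.add h2)
    funext g x
    have h := congrFun (isLift_quantumLift hcov hab (formalConst_mem g)).2 x
    rw [fedosov_add_delta, Pi.add_apply, deltaInv, deltaStar, yScale_sum] at h
    exact h.symm

/-- The coefficient of ν^k at y = 0 has filtration degree 2k, so Q is needed only modulo F^(2k+1);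
the connection applied to Q adds one more derivative. -/
theorem isDiffOp_Delta (k : ℕ) :
    IsDiffOp (2 * k + 1) ((isFormalLinear_Delta hcov hab).coeffOp k) := by
  refine OrdMod.isDiffOp (n := 2 * k + 1) (k := k) (d := 0)
    (Φ := fun g x => ∑ j, const (S.ξComp x j : ℂ) *
      (dNabla cov (S.quantumLift cov r (formalConst g)) x j
        + S.ad x (r x j) (S.quantumLift cov r (formalConst g) x))) (by simp) (fun f x => ?_)
    (OrdMod.sum fun j _ => (OrdMod_connection hcov hab (OrdMod_quantumLift hcov hab (2 * k + 1)) j).map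
      (fun x w => const (S.ξComp x j : ℂ) * w) (fun x w w' => mul_sub _ _ _)
      (fun x z w => mul_left_comm _ _ _) fun x w hw => hw.const_mul _)
  rw [← iξ_fedosov ((quantumLift_mem hcov hab (formalConst_mem f)).2 x), ← coeff_proj,
    ← Delta_eq hcov hab]
  rfl

theorem isBiDiffOp_starOp (k : ℕ) : IsBiDiffOp (starOp hcov hab k) := by
  have h := (OrdMod_quantumLift hcov hab (2 * k + 1)).succ
  refine ⟨2 * k + 1, fun f => ?_, fun g => ?_⟩
  · exact OrdMod.isDiffOp (n := 2 * k + 1) (k := k) (d := 0) (by simp) (fun g x => coeff_proj _ _ _)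
      (h.map (fun x w => Wick.circ (S.wickTensor x) (S.quantumLift cov r (formalConst f) x) w)
        (fun x w w' => circ_sub_right _ _ _ _) (fun x z w => circ_mul_right _ (isScalar_const z) _ _)
        fun x w hw => by simpa using (inFiltration_zero_left _).circ _ hw)
  · exact OrdMod.isDiffOp (n := 2 * k + 1) (k := k) (d := 0) (by simp) (fun f x => coeff_proj _ _ _)
      (h.map (fun x w => Wick.circ (S.wickTensor x) w (S.quantumLift cov r (formalConst g) x))
        (fun x w w' => circ_sub_left _ _ _ _) (fun x z w => circ_mul_left _ (isScalar_const z) _ _)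
        fun x w hw => by simpa using hw.circ _ (inFiltration_zero_left _))

/-! ### The leading terms -/

theorem dNabla_formalConst (f : SmoothFun m M) (x : M) (j) :
    dNabla cov (embed (formalConst f)) x j = const (dC (f : M → ℂ) x (frame x j)) := by
  have h : ∀ p, embed (m := m) (formalConst f) p = const ((f : M → ℂ) p) := fun p =>
    ext_cf fun k d => by
      rw [cf_embed, cf_const, formalConst, PowerSeries.coeff_C]
      split_ifs <;> simp_all
  rw [dNabla_apply, ← coordField_self]
  exact (covAt_congr _ _ (Filter.Eventually.of_forall fun p =>
    (linSubst_of_isScalar _ (isScalar_embed _ p)).trans (h p))).trans (covAt_const _ _ _)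

/-- Qf - f lies in F¹, being in the image of δ^{-1}; d_∇ and (i/ν)[r, ·] preserve F¹, and the
bracket with f vanishes. -/
theorem inFiltration_connection (f : SmoothFun m M) (x : M) (j) : InFiltration 1
    (dNabla cov (S.quantumLift cov r (formalConst f)) x j
      + S.ad x (r x j) (S.quantumLift cov r (formalConst f) x)
      - const (dC (f : M → ℂ) x (frame x j))) := by
  set b := S.quantumLift cov r (formalConst f) with hb
  have hl := isLift_quantumLift hcov hab (formalConst_mem f)
  set c : WSec m M := b - embed (formalConst f) with hc
  have hd : ∀ x, InFiltration 1 (c x) := fun x => by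
    have : c x = S.deltaInv (S.fedosov cov r b + delta b) x := by
      exact sub_eq_of_eq_add' (congrFun hl.2 x)
    rw [this]
    exact inFiltration_deltaInv fun i => inFiltration_zero_left _
  have e : dNabla cov b x j + S.ad x (r x j) (b x) - const (dC (f : M → ℂ) x (frame x j)) =
      dNabla cov c x j + S.ad x (r x j) (c x) := by
    rw [hc, dNabla_sub (mem_transSec_iff.mp hl.1).1
      (mem_transSec_iff.mp (embed_mem (S := S) (formalConst_mem f))).1]
    simp only [Pi.sub_apply, ad_eq_br, br_sub_right, br_scalar_right _ (isScalar_embed _ x),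
      dNabla_formalConst hcov hab]
    ring
  rw [e]
  exact (inFiltration_dNabla hd x j).add (inFiltration_ad (hab.2.1 x j) (hd x) (by omega))

theorem Delta_zero (f : SmoothFun m M) (x : M) :
    ((isFormalLinear_Delta hcov hab).coeffOp 0 f : M → ℂ) x = dC (f : M → ℂ) x (S.ξ x) := by
  change PowerSeries.coeff 0 (S.Delta cov r (formalConst f)) x = _
  rw [Delta_eq hcov hab, coeff_proj, iξ_fedosov ((quantumLift_mem hcov hab (formalConst_mem f)).2 x),
    ← sum_ξComp_dC, cf_sum]
  refine Finset.sum_congr rfl fun j _ => ?_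
  rw [cf_const_mul, cf_eq_of_inFiltration (inFiltration_connection hcov hab f x j) (by simp), cf_const]
  simp

/-- The linear term of Qf at ν = 0 is y^iP^j_i ∂_j f. The projection P is the reason why the
first-order term of ∗ contains the transverse parts of the differentials. -/
theorem dy_quantumLift (f : SmoothFun m M) (x : M) (i) :
    cf 0 0 (dy i (S.quantumLift cov r (formalConst f) x)) =
      S.transCov x (dC (f : M → ℂ) x) (frame x i) := by
  have h := congrFun (isLift_quantumLift hcov hab (formalConst_mem f)).2 x
  have e : ∀ j, cf 0 0 (dy i (S.yP x j * (dNabla cov (S.quantumLift cov r (formalConst f)) x j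
      + S.ad x (r x j) (S.quantumLift cov r (formalConst f) x)))) =
      (S.projComp x j i : ℂ) * dC (f : M → ℂ) x (frame x j) := fun j => by
    rw [dy_mul, cf_add, dy_yP, cf_const_mul, vanishAtZero_yP_mul, add_zero,
      cf_eq_of_inFiltration (inFiltration_connection hcov hab f x j) (by simp), cf_const]
    simp
  rw [h, fedosov_add_delta, Pi.add_apply, dy_add, isScalar_embed, zero_add, deltaInv, dy_yScale,
    cf_yScale, deltaStar, dy_sum, cf_sum]
  refine (congrArg _ (Finset.sum_congr rfl fun j _ => e j)).trans ?_
  have e2 : S.transCov x (dC (f : M → ℂ) x) (frame x i) = dC (f : M → ℂ) x (frame x i)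
      - (S.lamComp x i : ℂ) * dC (f : M → ℂ) x (S.ξ x) := by
    change _ - (S.lam x (frame x i)) • (dC (f : M → ℂ) x (S.ξ x)) = _
    rw [Complex.real_smul]
    rfl
  rw [e2, ← sum_ξComp_dC]
  simp only [projComp, Complex.ofReal_sub, Complex.ofReal_mul, sub_mul, Finset.sum_sub_distrib,
    Finset.mul_sum]
  have e3 : ∑ j, (((if j = i then 1 else 0 : ℝ)) : ℂ) * dC (f : M → ℂ) x (frame x j) =
      dC (f : M → ℂ) x (frame x i) := by
    rw [Finset.sum_eq_single i]
    · simp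
    · intro j _ hj; simp [hj]
    · simp
  rw [e3, map_zero, zero_add, Nat.cast_one, div_one, one_mul]
  exact congrArg (_ - ·) (Finset.sum_congr rfl fun j _ => by ring)

theorem cf_quantumLift (f : SmoothFun m M) (x : M) (k) :
    cf k 0 (S.quantumLift cov r (formalConst f) x) = if k = 0 then (f : M → ℂ) x else 0 := by
  rw [← coeff_proj, proj_quantumLift hcov hab (formalConst_mem f), formalConst, PowerSeries.coeff_C]
  split_ifs <;> rfl

theorem starOp_zero (f g : SmoothFun m M) : starOp hcov hab 0 f g = f * g :=
  Subtype.ext <| funext fun x => by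
    change PowerSeries.coeff 0 (S.star cov r (formalConst f) (formalConst g)) x = (f : M → ℂ) x * (g : M → ℂ) x
    rw [star, coeff_proj, circ, cf_circ_zero, cf_mul]
    simp [cf_quantumLift hcov hab]

theorem starOp_one (f g : SmoothFun m M) (x : M) : (starOp hcov hab 1 f g : M → ℂ) x =
    (1 / 2 : ℂ) * S.hForm x (S.transCov x (dC (f : M → ℂ) x)) (S.transCov x (dC (g : M → ℂ) x)) := by
  change PowerSeries.coeff 1 (S.star cov r (formalConst f) (formalConst g)) x = _
  rw [star, coeff_proj, circ, cf_circ, Finset.Nat.antidiagonal_succ]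
  -- At y = 0 the lift of f is f without higher powers of ν, so the pointwise product contributes
  -- nothing in order ν.
  have h0 : cf 1 0 (contr (S.wickTensor x) 0 (S.quantumLift cov r (formalConst f) x)
      (S.quantumLift cov r (formalConst g) x)) = 0 := by
    rw [contr_zero, cf_mul, Finset.Nat.antidiagonal_succ]
    simp [cf_quantumLift hcov hab]
  have h1 : cf 0 0 (contr (S.wickTensor x) 1 (S.quantumLift cov r (formalConst f) x)
      (S.quantumLift cov r (formalConst g) x)) =
      S.hForm x (S.transCov x (dC (f : M → ℂ) x)) (S.transCov x (dC (g : M → ℂ) x)) := by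
    unfold contr hForm
    rw [cf_sum]
    refine Finset.sum_congr rfl fun i _ => ?_
    rw [cf_sum]
    refine Finset.sum_congr rfl fun j _ => ?_
    rw [cf_const_mul, contr_zero, cf_mul]
    simp [dy_quantumLift hcov hab, mul_assoc]
  simp [h0, h1, expCf]

theorem isWickDeformationQuantization :
    IsWickDeformationQuantization S (S.star cov r) (S.Delta cov r) where
  star_expansion := ⟨starOp hcov hab, isBiDiffOp_starOp hcov hab, starOp_zero hcov hab,
    starOp_one hcov hab, fun a b n => by
      have hm : ∀ a : PowerSeries (SmoothFun m M), toFormal a ∈ smoothFormal m M := fun a k => by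
        unfold toFormal
        rw [PowerSeries.coeff_map]
        exact (PowerSeries.coeff k a).2
      rw [← sum_antidiagonal_assoc fun k i j => (starOp hcov hab k (PowerSeries.coeff i a)
        (PowerSeries.coeff j b) : M → ℂ),
        (isFormalLinear_star_left hcov hab (hm b)).coeff_eq_sum a n]
      exact Finset.sum_congr rfl fun p _ =>
        (isFormalLinear_star_right hcov hab (formalConst_mem _)).coeff_eq_sum b p.1⟩
  delta_expansion := ⟨(isFormalLinear_Delta hcov hab).coeffOp, fun k => ⟨_, isDiffOp_Delta hcov hab k⟩,
    Delta_zero hcov hab, (isFormalLinear_Delta hcov hab).coeff_eq_sum⟩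
  closed a ha b hb := (star_mem_kerOp hcov hab ha hb).2
  assoc a ha b hb c hc := star_assoc hcov hab ha hb hc

theorem coeff_one_star {a b : FormalFun M} (ha : a ∈ kerOp m (S.Delta cov r))
    (hb : b ∈ kerOp m (S.Delta cov r)) (x : M) : PowerSeries.coeff 1 (S.star cov r a b) x =
      PowerSeries.coeff 1 (a * b) x + (1 / 2 : ℂ) * S.hForm x (dC (PowerSeries.coeff 0 a) x)
        (dC (PowerSeries.coeff 0 b) x) := by
  obtain ⟨⟨C, _, hC0, hC1, hC⟩, ⟨L, _, hL0, hL⟩, _, _⟩ := isWickDeformationQuantization hcov hab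
  have hlift : ∀ a ∈ smoothFormal m M, ∃ a' : PowerSeries (SmoothFun m M), toFormal a' = a :=
    fun a ha => ⟨PowerSeries.mk fun k => ⟨PowerSeries.coeff k a, ha k⟩, PowerSeries.ext fun k => by
      unfold toFormal
      rw [PowerSeries.coeff_map, PowerSeries.coeff_mk]
      rfl⟩
  have hc : ∀ (a : PowerSeries (SmoothFun m M)) k, PowerSeries.coeff k (toFormal a) =
      ((PowerSeries.coeff k a : SmoothFun m M) : M → ℂ) := fun a k => by
    unfold toFormal
    rw [PowerSeries.coeff_map]
    rfl
  -- The ν⁰-coefficient of Δa = 0 is ξ a₀ = 0, so the transverse part of da₀ is da₀ itself.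
  have ht : ∀ a : PowerSeries (SmoothFun m M), S.Delta cov r (toFormal a) = 0 →
      S.transCov x (dC ((PowerSeries.coeff 0 a : SmoothFun m M) : M → ℂ) x) =
        dC ((PowerSeries.coeff 0 a : SmoothFun m M) : M → ℂ) x := by
    intro a h
    have h0 := congrFun (hL a 0) x
    rw [h] at h0
    simp only [Finset.Nat.antidiagonal_zero, Finset.sum_singleton, hL0, map_zero, Pi.zero_apply] at h0
    unfold transCov
    rw [← h0]
    ext v
    simp
  obtain ⟨a, rfl⟩ := hlift a ha.1
  obtain ⟨b, rfl⟩ := hlift b hb.1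
  rw [hC, hc, hc, ← ht a ha.2, ← ht b hb.2, ← hC1]
  rw [PowerSeries.coeff_mul, Finset.Nat.sum_antidiagonal_succ]
  simp only [Finset.Nat.antidiagonal_succ, Finset.Nat.antidiagonal_zero]
  simp [hC0, hc]

end ContactMetricStructure

end

end WickContact

/-! ### Assembly of the theorem. -/

open WickContact in
theorem theorem3p5 (m : ℕ) (M : Type*) [TopologicalSpace M] [T2Space M]
    [SecondCountableTopology M] [ChartedSpace (Model m) M] [IsManifold 𝓘(ℝ, Model m) ∞ M]
    (S : ContactMetricStructure m M) (cov : AffineConnection m M)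
    (hcov : IsContactMetricConnection S cov) :
    (∃! r : WForm1 m M, S.IsAbelian cov r ∧ S.weylCurvature cov r = S.omForm ∧
      S.deltaInv r = 0 ∧ S.proj1 r = 0) ∧
    ∀ r : WForm1 m M, S.IsAbelian cov r →
      (∀ a ∈ S.transSec, ∃! b, S.IsLift cov r a b) ∧
      (∀ a ∈ smoothFormal m M, S.IsLift cov r (embed a) (S.quantumLift cov r a)) ∧
      (∀ a ∈ S.flatSec cov r, proj a ∈ smoothFormal m M ∧ a = S.quantumLift cov r (proj a)) ∧
      (∀ a₀ ∈ smoothFormal m M,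
        (∃ a ∈ S.flatSec cov r, proj a = a₀) ↔ S.Delta cov r a₀ = 0) ∧
      Set.BijOn (S.quantumLift cov r) (kerOp m (S.Delta cov r)) (S.flatSec cov r) ∧
      (∀ a ∈ smoothFormal m M, ∀ b ∈ smoothFormal m M,
        S.quantumLift cov r (a + b) = S.quantumLift cov r a + S.quantumLift cov r b) ∧
      (∀ (c : PowerSeries ℂ), ∀ a ∈ smoothFormal m M,
        S.quantumLift cov r (scaleFormal c a) = scaleSec c (S.quantumLift cov r a)) ∧
      (∀ a ∈ S.flatSec cov r, ∀ b ∈ S.flatSec cov r, S.circ a b ∈ S.flatSec cov r) ∧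
      (∀ a ∈ kerOp m (S.Delta cov r), ∀ b ∈ kerOp m (S.Delta cov r),
        S.quantumLift cov r (S.star cov r a b)
          = S.circ (S.quantumLift cov r a) (S.quantumLift cov r b)) ∧
      (1 : FormalFun M) ∈ kerOp m (S.Delta cov r) ∧
      (∀ a ∈ kerOp m (S.Delta cov r), S.star cov r 1 a = a ∧ S.star cov r a 1 = a) ∧
      IsWickDeformationQuantization S (S.star cov r) (S.Delta cov r) ∧
      (∀ a ∈ kerOp m (S.Delta cov r), ∀ b ∈ kerOp m (S.Delta cov r), ∀ x,
        PowerSeries.coeff 1 (S.star cov r a b) x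
          = PowerSeries.coeff 1 (a * b) x
            + (1 / 2 : ℂ) * S.hForm x (dC (PowerSeries.coeff 0 a) x)
                (dC (PowerSeries.coeff 0 b) x)) := by
  open ContactMetricStructure in
  refine ⟨existsUnique_connection hcov, fun r hab => ⟨fun a ha => existsUnique_isLift hcov hab ha,
    fun a ha => isLift_quantumLift hcov hab ha, fun a ha => quantumLift_proj hcov hab ha,
    fun a₀ h₀ => ⟨?_, fun h => ⟨_, quantumLift_mem_flatSec hcov hab ⟨h₀, h⟩,
      proj_quantumLift hcov hab h₀⟩⟩,
    bijOn_quantumLift hcov hab, fun a ha b hb => quantumLift_add hcov hab ha hb,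
    fun c a ha => quantumLift_scale hcov hab c ha, fun a ha b hb => circ_mem_flatSec hcov hab ha hb,
    fun a ha b hb => quantumLift_star hcov hab ha hb, (quantumLift_one hcov hab).1,
    fun a ha => star_one hcov hab ha.1, isWickDeformationQuantization hcov hab,
    fun a ha b hb x => coeff_one_star hcov hab ha hb x⟩⟩
  rintro ⟨a, ha, rfl⟩
  exact (ContactMetricStructure.proj_mem_kerOp hcov hab ha).2
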